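/- **Conventions.** All spaces are complex. A closed operator $A$ on a Banach space $X$ has $L^p$-maximal regularity ($L^p$-m.r.) on $(0,\tau)$, $\tau\in(0,\infty]$, if for every $f\in L^p(0,\tau;X)$ there is a unique strong solution $u\in W^{1,1}_{loc}([0,\tau);X)$ of $u'+Au=f$ a.e. on $(0,\tau)$, $u(0)=0$, such that $u',Au\in L^p(0,\tau;X)$. A semigroup on $X$ is a strongly continuous family $(T(t))_{t>0}$ of bounded operators with $T(t+s)=T(t)T(s)$ and $\sup_{0<t<1}\|T(t)\|<\infty$, such that $T(t)x=0$ for all $t>0$ implies $x=0$; its generator is the operator $-A$ with $(\lambda+A)^{-1}=\int_0^\infty e^{-\lambda t}T(t)\,dt$ for all large $\lambda$. The semigroup is bounded holomorphic if it extends to a bounded holomorphic function on some sector $\{z\ne 0: |\arg z|<\delta\}$, $\delta\in(0,\pi/2]$. A Banach couple $(X_0,X_1)$ consists of two Banach spaces continuously embedded in a Hausdorff topological vector space. An interpolation functor $F$ assigns to every Banach couple a Banach space $F(X_0,X_1)$ with $X_0\cap X_1\hookrightarrow F(X_0,X_1)\hookrightarrow X_0+X_1$, such that every linear $S:X_0+X_1\to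 Y_0+Y_1$ which restricts to bounded operators $X_j\to Y_j$ ($j=0,1$) restricts to a bounded operator $F(X_0,X_1)\to F(Y_0,Y_1)$. The part of $A$ in $X$ is the restriction of $A$ to $\{x\in D(A)\cap X: Ax\in X\}$. $D_{\mathcal A}$ denotes $D(\mathcal A)$ with the graph norm. **Theorem 4.2.** Let $p\in[1,\infty)$ and $\tau\in(0,\infty]$. Let $(X_0,X_1)$ be a Banach couple, and let $-A_0$, $-A_1$ be the generators of bounded holomorphic semigroups $T_0$ on $X_0$ and $T_1$ on $X_1$ such that $T_0(t)x=T_1(t)x$ for all $x\in X_0\cap X_1$, $t>0$, and $A_0x=A_1x$ for all $x\in D(A_0)\cap D(A_1)$. Suppose that $A_0$ and $A_1$ have $L^p$-m.r. on $(0,\tau)$. Let $A_0+A_1$ be the operator on $X_0+X_1$ with domain $D(A_0)+D(A_1)$ given by $(A_0+A_1)(x_0+x_1)=A_0x_0+A_1x_1$ for $x_j\in D(A_j)$. Then for every interpolation functor $F$ with $$F(\ell^p(X_0),\ell^p(X_1))=\ell^p(F(X_0,X_1))\quad\text{(up to equivalence of norms)},$$ the part of $A_0+A_1$ in $F(X_0,X_1)$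 has $L^p$-m.r. on $(0,\tau)$. Consequently (Corollary 4.3), let $p\in[1,\infty)$ and let $\mathcal A$ be a closed operator on a Banach space $\mathcal X$ with $L^p$-m.r. on $\mathbb R_+=(0,\infty)$. Then the part of $\mathcal A$ in each of the following spaces has $L^p$-m.r. on $\mathbb R_+$: 1. $F(\mathcal X,D_{\mathcal A})$, for every interpolation functor $F$ with $F(\ell^p(\mathcal X),\ell^p(D_{\mathcal A}))=\ell^p(F(\mathcal X,D_{\mathcal A}))$ up to equivalence of norms; 2. the complex interpolation space $[\mathcal X,D_{\mathcal A}]_\theta$, for every $\theta\in(0,1)$; 3. if $p>1$, the real interpolation space $(\mathcal X,D_{\mathcal A})_{\theta,q}$, for all $\theta\in(0,1)$ and $q\in(1,\infty)$. -/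

import Mathlib

open MeasureTheory Set
open scoped ENNReal ZeroAtInfty

universe u v

noncomputable section

namespace MaxReg

/-! ## Unbounded operators and maximal regularity -/

section Operators

variable {E : Type v} [NormedAddCommGroup E] [NormedSpace ℂ E]

/-- The interval `(0, τ)`, where `τ ∈ [0, ∞]`. -/
def timeInterval (τ : ℝ≥0∞) : Set ℝ := {t | 0 < t ∧ ENNReal.ofReal t < τ}

/-- The interval `[0, τ)` (for `τ > 0`). -/
def timeIntervalZero (τ : ℝ≥0∞) : Set ℝ := {t | 0 ≤ t ∧ ENNReal.ofReal t < τ}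

/-- Lebesgue measure on `(0, τ)`. -/
def timeMeasure (τ : ℝ≥0∞) : Measure ℝ := volume.restrict (timeInterval τ)

/-- `u ∈ W^{1,1}_loc([0,τ); E)`, with weak derivative `u' = du`, is a strong solution of
`u' + A u = f` on `(0,τ)`, `u(0) = x`, and `Au` stands for `t ↦ A (u t)`.
The function `u` is the continuous representative of its class, that is, the primitive of
`du ∈ L^1_loc([0,τ); E)` which takes the value `x` at `0`. -/
structure IsStrongSolution (A : E →ₗ.[ℂ] E) (τ : ℝ≥0∞) (f : ℝ → E) (x : E)
    (u du Au : ℝ → E) : Prop where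
  deriv_integrableOn : ∀ t ∈ timeIntervalZero τ, IntegrableOn du (Ioc 0 t)
  eq_integral : ∀ t ∈ timeIntervalZero τ, u t = x + ∫ s in (0 : ℝ)..t, du s
  graph_mem : ∀ᵐ t ∂(timeMeasure τ), (u t, Au t) ∈ A.graph
  equation : ∀ᵐ t ∂(timeMeasure τ), du t + Au t = f t

/-- `u` is a strong solution of `u' + A u = f`, `u(0) = 0` on `(0,τ)` such that
`u', A u ∈ L^p(0,τ; E)`. -/
def IsLpSolution (A : E →ₗ.[ℂ] E) (p τ : ℝ≥0∞) (f u : ℝ → E) : Prop :=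
  ∃ du Au : ℝ → E, IsStrongSolution A τ f 0 u du Au ∧
    MemLp du p (timeMeasure τ) ∧ MemLp Au p (timeMeasure τ)

/-- The closed operator `A` has `L^p`-maximal regularity on `(0,τ)`: for every
`f ∈ L^p(0,τ; E)` there is a unique strong solution `u` of `u' + A u = f`, `u(0) = 0`, such that
`u', A u ∈ L^p(0,τ; E)`. -/
def HasLpMaxReg (A : E →ₗ.[ℂ] E) (p τ : ℝ≥0∞) : Prop :=
  A.IsClosed ∧ ∀ f : ℝ → E, MemLp f p (timeMeasure τ) →
    ∃ u : ℝ → E, IsLpSolution A p τ f u ∧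
      ∀ w : ℝ → E, IsLpSolution A p τ f w → EqOn w u (timeIntervalZero τ)

/-- A semigroup `(T(t))_{t > 0}` of bounded operators: strongly continuous on `(0,∞)`, bounded
on `(0,1)` and nondegenerate (strong continuity at `0` is not required).
The values of `T` outside `(0,∞)` are irrelevant. -/
structure IsSemigroup (T : ℝ → E →L[ℂ] E) : Prop where
  continuousOn : ∀ x, ContinuousOn (fun t => T t x) (Ioi 0)
  map_add : ∀ s t, 0 < s → 0 < t → T (s + t) = (T s).comp (T t)
  bounded : ∃ M : ℝ, ∀ t ∈ Ioo (0 : ℝ) 1, ‖T t‖ ≤ M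
  nondegenerate : ∀ x, (∀ t, 0 < t → T t x = 0) → x = 0

/-- `-A` is the generator of the semigroup `T`: for all large `lam`, the operator `lam + A` is
a bijection of `D(A)` onto `E`, whose inverse is `y ↦ ∫_0^∞ e^{-lam t} T(t) y dt`. -/
structure IsNegGenerator (A : E →ₗ.[ℂ] E) (T : ℝ → E →L[ℂ] E) : Prop where
  isSemigroup : IsSemigroup T
  resolvent : ∃ ω : ℝ, ∀ lam : ℝ, ω < lam → ∀ y : E,
    IntegrableOn (fun t : ℝ => Real.exp (-(lam * t)) • T t y) (Ioi 0) ∧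
    ∀ x : E, (∃ z, (x, z) ∈ A.graph ∧ lam • x + z = y) ↔
      x = ∫ t in Ioi (0 : ℝ), Real.exp (-(lam * t)) • T t y

/-- The open sector of half-angle `δ` around the positive real axis. -/
def sector (δ : ℝ) : Set ℂ := {z | z ≠ 0 ∧ |z.arg| < δ}

/-- `T` extends to a bounded holomorphic function on some sector. -/
def IsBoundedHolomorphic (T : ℝ → E →L[ℂ] E) : Prop :=
  ∃ δ : ℝ, 0 < δ ∧ δ ≤ Real.pi / 2 ∧ ∃ S : ℂ → E →L[ℂ] E,
    DifferentiableOn ℂ S (sector δ) ∧ (∃ M : ℝ, ∀ z ∈ sector δ, ‖S z‖ ≤ M) ∧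
    ∀ t : ℝ, 0 < t → S (t : ℂ) = T t

end Operators

section Part

variable {E Z : Type*} [AddCommGroup E] [Module ℂ E] [AddCommGroup Z] [Module ℂ Z]

/-- The part of the operator `A` (in `Z`) in a space `E` which is embedded in `Z` through the
injective linear map `ι`: `D = {x ∈ D(A) ∩ E : A x ∈ E}`. -/
def part (A : Z →ₗ.[ℂ] Z) (ι : E →ₗ[ℂ] Z) : E →ₗ.[ℂ] E :=
  (A.graph.comap (ι.prodMap ι)).toLinearPMap

theorem mem_graph_part (A : Z →ₗ.[ℂ] Z) {ι : E →ₗ[ℂ] Z} (hι : Function.Injective ι) (x y : E) :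
    (x, y) ∈ (part A ι).graph ↔ (ι x, ι y) ∈ A.graph := by
  rw [part, Submodule.toLinearPMap_graph_eq]
  · simp [Submodule.mem_comap]
  · rintro ⟨a, b⟩ hab ha
    simp only at ha
    subst ha
    have h : (ι 0, ι b) ∈ A.graph := hab
    rw [map_zero] at h
    have := A.graph_fst_eq_zero_snd h rfl
    exact hι (by simpa using this)

end Part

/-! ## Extended norms and the Banach spaces they define -/

/-- A norm on a vector space which may take the value `∞`. -/
structure ExtNorm (V : Type u) [AddCommGroup V] [Module ℂ V] where
  toFun : V → ℝ≥0∞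
  add_le' : ∀ x y, toFun (x + y) ≤ toFun x + toFun y
  smul_le' : ∀ (c : ℂ) (x : V), toFun (c • x) ≤ ‖c‖ₑ * toFun x
  eq_zero' : ∀ x, toFun x = 0 → x = 0

namespace ExtNorm

variable {V : Type u} [AddCommGroup V] [Module ℂ V] (N : ExtNorm V)

theorem map_zero : N.toFun 0 = 0 := by
  have := N.smul_le' 0 0
  simpa using this

/-- The subspace on which the extended norm is finite. -/
def finite : Submodule ℂ V where
  carrier := {x | N.toFun x < ∞}
  zero_mem' := by simp [N.map_zero]
  add_mem' := fun {x y} hx hy => lt_of_le_of_lt (N.add_le' x y) (ENNReal.add_lt_top.2 ⟨hx, hy⟩)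
  smul_mem' := fun c x hx =>
    lt_of_le_of_lt (N.smul_le' c x) (ENNReal.mul_lt_top (by simp) hx)

/-- The vectors of finite extended norm, normed by it. -/
def Space : Type u := N.finite

instance : AddCommGroup N.Space := inferInstanceAs (AddCommGroup N.finite)
instance : Module ℂ N.Space := inferInstanceAs (Module ℂ N.finite)

/-- The inclusion in the ambient space. -/
def incl : N.Space →ₗ[ℂ] V := N.finite.subtype

theorem incl_injective : Function.Injective N.incl := N.finite.injective_subtype

theorem lt_top (x : N.Space) : N.toFun (N.incl x) < ∞ := x.2

instance : Norm N.Space := ⟨fun x => (N.toFun (N.incl x)).toReal⟩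

theorem norm_def (x : N.Space) : ‖x‖ = (N.toFun (N.incl x)).toReal := rfl

theorem map_smul (c : ℂ) (x : V) : N.toFun (c • x) = ‖c‖ₑ * N.toFun x := by
  rcases eq_or_ne c 0 with rfl | hc
  · simp [N.map_zero]
  refine le_antisymm (N.smul_le' c x) ?_
  have h := N.smul_le' c⁻¹ (c • x)
  rw [inv_smul_smul₀ hc] at h
  calc ‖c‖ₑ * N.toFun x ≤ ‖c‖ₑ * (‖c⁻¹‖ₑ * N.toFun (c • x)) := by gcongr
    _ = N.toFun (c • x) := by
      rw [← mul_assoc, ← enorm_mul, mul_inv_cancel₀ hc]; simp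

theorem core : NormedSpace.Core ℂ N.Space where
  norm_nonneg x := ENNReal.toReal_nonneg
  norm_smul c x := by
    rw [norm_def, norm_def, _root_.map_smul, N.map_smul, ENNReal.toReal_mul]
    simp
  norm_triangle x y := by
    rw [norm_def, norm_def, norm_def, _root_.map_add,
      ← ENNReal.toReal_add (N.lt_top x).ne (N.lt_top y).ne]
    exact ENNReal.toReal_mono (ENNReal.add_lt_top.2 ⟨N.lt_top x, N.lt_top y⟩).ne (N.add_le' _ _)
  norm_eq_zero_iff x := by
    rw [norm_def, ENNReal.toReal_eq_zero_iff]
    constructor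
    · rintro (h | h)
      · exact N.incl_injective (by rw [N.eq_zero' _ h, _root_.map_zero])
      · exact absurd h (N.lt_top x).ne
    · rintro rfl
      left
      rw [_root_.map_zero, N.map_zero]

instance : NormedAddCommGroup N.Space := NormedAddCommGroup.ofCore N.core
instance : NormedSpace ℂ N.Space := NormedSpace.ofCore N.core

end ExtNorm

/-! ## Banach couples -/

/-- A Banach couple: two complex Banach spaces, continuously embedded in a Hausdorff topological
vector space `Z`. -/
structure BanachCouple : Type (u + 1) where
  Z : Type u
  X₀ : Type u
  X₁ : Type u
  [acgZ : AddCommGroup Z]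
  [modZ : Module ℂ Z]
  [topZ : TopologicalSpace Z]
  [tagZ : IsTopologicalAddGroup Z]
  [csmZ : ContinuousSMul ℂ Z]
  [t2Z : T2Space Z]
  [nacg₀ : NormedAddCommGroup X₀]
  [ns₀ : NormedSpace ℂ X₀]
  [cs₀ : CompleteSpace X₀]
  [nacg₁ : NormedAddCommGroup X₁]
  [ns₁ : NormedSpace ℂ X₁]
  [cs₁ : CompleteSpace X₁]
  ι₀ : X₀ →L[ℂ] Z
  ι₁ : X₁ →L[ℂ] Z
  inj₀ : Function.Injective ι₀
  inj₁ : Function.Injective ι₁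

namespace BanachCouple

attribute [instance] acgZ modZ topZ tagZ csmZ t2Z nacg₀ ns₀ cs₀ nacg₁ ns₁ cs₁

variable (C : BanachCouple.{u})

/-- The `K`-functional `K(t,x) = inf {‖a‖ + t ‖b‖ : x = a + b, a ∈ X₀, b ∈ X₁}`;
it is `∞` if `x ∉ X₀ + X₁`. -/
def K (t : ℝ) (x : C.Z) : ℝ≥0∞ :=
  ⨅ (a : C.X₀) (b : C.X₁) (_ : C.ι₀ a + C.ι₁ b = x), ‖a‖ₑ + ENNReal.ofReal t * ‖b‖ₑ

variable {C} in
theorem K_le {t : ℝ} {x : C.Z} (a : C.X₀) (b : C.X₁) (h : C.ι₀ a + C.ι₁ b = x) :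
    C.K t x ≤ ‖a‖ₑ + ENNReal.ofReal t * ‖b‖ₑ :=
  iInf_le_of_le a (iInf_le_of_le b (iInf_le_of_le h le_rfl))

theorem K_add_le (t : ℝ) (x y : C.Z) : C.K t (x + y) ≤ C.K t x + C.K t y := by
  conv_rhs => rw [K, K]
  simp_rw [ENNReal.iInf_add, ENNReal.add_iInf]
  refine le_iInf fun a => le_iInf fun b => le_iInf fun h => le_iInf fun a' => le_iInf fun b' =>
    le_iInf fun h' => ?_
  refine (K_le (a + a') (b + b') ?_).trans ?_
  · rw [← h, ← h', map_add, map_add]; abel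
  · calc ‖a + a'‖ₑ + ENNReal.ofReal t * ‖b + b'‖ₑ
        ≤ (‖a‖ₑ + ‖a'‖ₑ) + ENNReal.ofReal t * (‖b‖ₑ + ‖b'‖ₑ) := by
          gcongr <;> exact enorm_add_le _ _
      _ = _ := by ring

theorem K_smul_le (t : ℝ) (c : ℂ) (x : C.Z) : C.K t (c • x) ≤ ‖c‖ₑ * C.K t x := by
  rcases eq_or_ne c 0 with rfl | hc
  · refine (K_le 0 0 (by simp)).trans (by simp)
  conv_rhs => rw [K]
  have h1 : ‖c‖ₑ ≠ 0 := by simpa using hc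
  have h2 : ‖c‖ₑ ≠ ∞ := by simp
  simp_rw [ENNReal.mul_iInf_of_ne h1 h2]
  refine le_iInf fun a => le_iInf fun b => le_iInf fun h => ?_
  refine (K_le (c • a) (c • b) (by rw [← h]; simp)).trans (le_of_eq ?_)
  rw [enorm_smul, enorm_smul]; ring

theorem K_eq_zero {t : ℝ} (ht : 0 < t) {x : C.Z} (h : C.K t x = 0) : x = 0 := by
  have key : ∀ n : ℕ, ∃ (a : C.X₀) (b : C.X₁), C.ι₀ a + C.ι₁ b = x ∧
      ‖a‖ₑ + ENNReal.ofReal t * ‖b‖ₑ < ((n : ℝ≥0∞) + 1)⁻¹ := by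
    intro n
    have : C.K t x < ((n : ℝ≥0∞) + 1)⁻¹ := by
      rw [h]; exact ENNReal.inv_pos.2 (by finiteness)
    simpa [K, iInf_lt_iff] using this
  choose a b hab hlt using key
  have hn : Filter.Tendsto (fun n : ℕ => ((n : ℝ≥0∞) + 1)⁻¹) Filter.atTop (nhds 0) := by
    have := (ENNReal.tendsto_inv_nat_nhds_zero).comp (Filter.tendsto_add_atTop_nat 1)
    simpa [Function.comp_def] using this
  have ha : Filter.Tendsto a Filter.atTop (nhds 0) := by
    rw [tendsto_zero_iff_enorm_tendsto_zero]
    exact tendsto_of_tendsto_of_tendsto_of_le_of_le tendsto_const_nhds hn (fun _ => zero_le)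
      fun n => le_self_add.trans (hlt n).le
  have hb : Filter.Tendsto b Filter.atTop (nhds 0) := by
    rw [tendsto_zero_iff_enorm_tendsto_zero]
    have ht0 : ENNReal.ofReal t ≠ 0 := by simpa using ht
    have hn' : Filter.Tendsto (fun n : ℕ => (ENNReal.ofReal t)⁻¹ * ((n : ℝ≥0∞) + 1)⁻¹)
        Filter.atTop (nhds 0) := by
      have := ENNReal.Tendsto.const_mul hn (a := (ENNReal.ofReal t)⁻¹)
        (Or.inr (ENNReal.inv_ne_top.2 ht0))
      simpa using this
    refine tendsto_of_tendsto_of_tendsto_of_le_of_le tendsto_const_nhds hn' (fun _ => zero_le)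
      fun n => ?_
    have h3 : ENNReal.ofReal t * ‖b n‖ₑ ≤ ((n : ℝ≥0∞) + 1)⁻¹ := le_add_self.trans (hlt n).le
    calc ‖b n‖ₑ = (ENNReal.ofReal t)⁻¹ * (ENNReal.ofReal t * ‖b n‖ₑ) := by
          rw [← mul_assoc, ENNReal.inv_mul_cancel ht0 (by simp), one_mul]
      _ ≤ _ := by gcongr
  have hlim : Filter.Tendsto (fun n => C.ι₀ (a n) + C.ι₁ (b n)) Filter.atTop (nhds (0 + 0)) := by
    refine Filter.Tendsto.add ?_ ?_
    · simpa [Function.comp_def] using (C.ι₀.continuous.tendsto 0).comp ha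
    · simpa [Function.comp_def] using (C.ι₁.continuous.tendsto 0).comp hb
  simp only [hab, add_zero] at hlim
  exact tendsto_nhds_unique tendsto_const_nhds hlim

theorem K_mono (x : C.Z) : Monotone fun t => C.K t x := by
  intro s t hst
  refine le_iInf fun a => le_iInf fun b => le_iInf fun h => (K_le a b h).trans ?_
  gcongr

/-- The norm `K(1, ·)` of `X₀ + X₁`. -/
def sumNorm : ExtNorm C.Z where
  toFun := C.K 1
  add_le' := C.K_add_le 1
  smul_le' := C.K_smul_le 1
  eq_zero' := fun _ => C.K_eq_zero one_pos

/-- The space `X₀ + X₁` with the norm `‖x‖ = inf {‖a‖ + ‖b‖ : x = a + b}`. -/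
abbrev Sum : Type u := C.sumNorm.Space

/-- The inclusion of `X₀ + X₁` in the ambient space. -/
def sumIncl : C.Sum →ₗ[ℂ] C.Z := C.sumNorm.incl

/-- The couple `(ℓ^p(X₀), ℓ^p(X₁))`, embedded in the space of all sequences in `Z`. -/
def lpCouple (p : ℝ≥0∞) [Fact (1 ≤ p)] : BanachCouple.{u} where
  Z := ℕ → C.Z
  X₀ := lp (fun _ : ℕ => C.X₀) p
  X₁ := lp (fun _ : ℕ => C.X₁) p
  ι₀ := ContinuousLinearMap.pi fun n => C.ι₀.comp (lp.evalCLM ℂ (fun _ : ℕ => C.X₀) p n)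
  ι₁ := ContinuousLinearMap.pi fun n => C.ι₁.comp (lp.evalCLM ℂ (fun _ : ℕ => C.X₁) p n)
  inj₀ := fun x y h => by
    ext n; exact C.inj₀ (congrFun h n)
  inj₁ := fun x y h => by
    ext n; exact C.inj₁ (congrFun h n)

/-- The operator `A₀ + A₁`, with domain `D(A₀) + D(A₁)` and `(A₀ + A₁)(x₀ + x₁) = A₀ x₀ + A₁ x₁`,
for `A₀` and `A₁` which agree on `D(A₀) ∩ D(A₁)`. -/
def sumOp (A₀ : C.X₀ →ₗ.[ℂ] C.X₀) (A₁ : C.X₁ →ₗ.[ℂ] C.X₁) : C.Z →ₗ.[ℂ] C.Z :=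
  (A₀.graph.map ((C.ι₀ : C.X₀ →ₗ[ℂ] C.Z).prodMap (C.ι₀ : C.X₀ →ₗ[ℂ] C.Z)) ⊔
    A₁.graph.map ((C.ι₁ : C.X₁ →ₗ[ℂ] C.Z).prodMap (C.ι₁ : C.X₁ →ₗ[ℂ] C.Z))).toLinearPMap

/-- `A₀ x = A₁ x` for all `x ∈ D(A₀) ∩ D(A₁)`. -/
def ConsistentOps (A₀ : C.X₀ →ₗ.[ℂ] C.X₀) (A₁ : C.X₁ →ₗ.[ℂ] C.X₁) : Prop :=
  ∀ x₀ y₀ x₁ y₁, (x₀, y₀) ∈ A₀.graph → (x₁, y₁) ∈ A₁.graph → C.ι₀ x₀ = C.ι₁ x₁ →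
    C.ι₀ y₀ = C.ι₁ y₁

theorem mem_graph_sumOp {A₀ : C.X₀ →ₗ.[ℂ] C.X₀} {A₁ : C.X₁ →ₗ.[ℂ] C.X₁}
    (h : C.ConsistentOps A₀ A₁) (x y : C.Z) :
    (x, y) ∈ (C.sumOp A₀ A₁).graph ↔ ∃ x₀ y₀ x₁ y₁, (x₀, y₀) ∈ A₀.graph ∧ (x₁, y₁) ∈ A₁.graph ∧
      x = C.ι₀ x₀ + C.ι₁ x₁ ∧ y = C.ι₀ y₀ + C.ι₁ y₁ := by
  have key : ∀ x y : C.Z,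
      (x, y) ∈ (A₀.graph.map ((C.ι₀ : C.X₀ →ₗ[ℂ] C.Z).prodMap (C.ι₀ : C.X₀ →ₗ[ℂ] C.Z)) ⊔
        A₁.graph.map ((C.ι₁ : C.X₁ →ₗ[ℂ] C.Z).prodMap (C.ι₁ : C.X₁ →ₗ[ℂ] C.Z))) ↔
      ∃ x₀ y₀ x₁ y₁, (x₀, y₀) ∈ A₀.graph ∧ (x₁, y₁) ∈ A₁.graph ∧
        x = C.ι₀ x₀ + C.ι₁ x₁ ∧ y = C.ι₀ y₀ + C.ι₁ y₁ := by
    intro x y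
    rw [Submodule.mem_sup]
    constructor
    · rintro ⟨_, ⟨⟨x₀, y₀⟩, h₀, rfl⟩, _, ⟨⟨x₁, y₁⟩, h₁, rfl⟩, he⟩
      obtain ⟨e1, e2⟩ := Prod.ext_iff.1 he
      exact ⟨x₀, y₀, x₁, y₁, h₀, h₁, e1.symm, e2.symm⟩
    · rintro ⟨x₀, y₀, x₁, y₁, h₀, h₁, rfl, rfl⟩
      exact ⟨_, ⟨(x₀, y₀), h₀, rfl⟩, _, ⟨(x₁, y₁), h₁, rfl⟩, rfl⟩
  rw [sumOp, Submodule.toLinearPMap_graph_eq, key]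
  rintro ⟨x, y⟩ hxy hx
  obtain ⟨x₀, y₀, x₁, y₁, h₀, h₁, hx', hy'⟩ := (key x y).1 hxy
  simp only at hx
  have h₁' : (-x₁, -y₁) ∈ A₁.graph := A₁.graph.neg_mem h₁
  have e : C.ι₀ x₀ = C.ι₁ (-x₁) := by
    rw [map_neg, eq_neg_iff_add_eq_zero, ← hx', hx]
  have := h _ _ _ _ h₀ h₁' e
  rw [map_neg, eq_neg_iff_add_eq_zero] at this
  exact hy'.trans this

end BanachCouple

/-! ## Interpolation functors -/

/-- A morphism of Banach couples: bounded operators `X₀ → Y₀` and `X₁ → Y₁` which agree on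
`X₀ ∩ X₁`, in other words the restrictions of a linear operator `X₀ + X₁ → Y₀ + Y₁`. -/
structure CoupleHom (C D : BanachCouple.{u}) where
  T₀ : C.X₀ →L[ℂ] D.X₀
  T₁ : C.X₁ →L[ℂ] D.X₁
  consistent : ∀ a b, C.ι₀ a = C.ι₁ b → D.ι₀ (T₀ a) = D.ι₁ (T₁ b)

/-- An interpolation functor: it assigns to every Banach couple `(X₀, X₁)` a Banach space `F`
with continuous inclusions `X₀ ∩ X₁ ⊆ F ⊆ X₀ + X₁`, in such a way that every morphism of couples
restricts to a bounded operator between the assigned spaces. -/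
structure InterpolationFunctor : Type (u + 1) where
  space : BanachCouple.{u} → Type u
  [nacg : ∀ C, NormedAddCommGroup (space C)]
  [ns : ∀ C, NormedSpace ℂ (space C)]
  [cs : ∀ C, CompleteSpace (space C)]
  incl : ∀ C, space C →L[ℂ] C.Sum
  incl_injective : ∀ C, Function.Injective (incl C)
  inter_le : ∀ C : BanachCouple.{u}, ∃ c : ℝ, ∀ a b, C.ι₀ a = C.ι₁ b →
    ∃ y : space C, C.sumIncl (incl C y) = C.ι₀ a ∧ ‖y‖ ≤ c * max ‖a‖ ‖b‖
  map_bounded : ∀ (C D : BanachCouple.{u}) (T : CoupleHom C D), ∃ S : space C →L[ℂ] space D,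
    ∀ x a b, C.sumIncl (incl C x) = C.ι₀ a + C.ι₁ b →
      D.sumIncl (incl D (S x)) = D.ι₀ (T.T₀ a) + D.ι₁ (T.T₁ b)

namespace InterpolationFunctor

attribute [instance] nacg ns cs

variable (F : InterpolationFunctor.{u})

/-- The inclusion of `F(X₀, X₁)` in the ambient space of the couple. -/
def inclZ (C : BanachCouple.{u}) : F.space C →ₗ[ℂ] C.Z :=
  C.sumIncl ∘ₗ (F.incl C : F.space C →ₗ[ℂ] C.Sum)

/-- `F(ℓ^p(X₀), ℓ^p(X₁)) = ℓ^p(F(X₀, X₁))`, as spaces of sequences, up to equivalence of norms. -/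
def SplitsLp (p : ℝ≥0∞) [Fact (1 ≤ p)] (C : BanachCouple.{u}) : Prop :=
  ∃ Φ : F.space (C.lpCouple p) ≃L[ℂ] lp (fun _ : ℕ => F.space C) p,
    ∀ (x : F.space (C.lpCouple p)) (n : ℕ),
      F.inclZ C ((Φ x : ∀ _ : ℕ, F.space C) n) = (F.inclZ (C.lpCouple p) x : ℕ → C.Z) n

end InterpolationFunctor

/-! ## The couple `(X, D_A)` -/

section DomainCouple

variable {X : Type u} [NormedAddCommGroup X] [NormedSpace ℂ X]

/-- The domain `D_A` of `A` with the graph norm `‖x‖ + ‖A x‖`, realized as the graph of `A` in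
the `ℓ^1`-direct sum `X ⊕ X`. -/
def graphSpace (A : X →ₗ.[ℂ] X) : Submodule ℂ (WithLp 1 (X × X)) :=
  A.graph.comap (WithLp.linearEquiv 1 ℂ (X × X) : WithLp 1 (X × X) →ₗ[ℂ] X × X)

theorem graphSpace_norm (A : X →ₗ.[ℂ] X) (x : graphSpace A) :
    ‖x‖ = ‖(x : WithLp 1 (X × X)).fst‖ + ‖(x : WithLp 1 (X × X)).snd‖ := by
  have := WithLp.prod_norm_eq_add (p := 1) (by simp) (x : WithLp 1 (X × X))
  simpa using this

theorem graphSpace_complete [CompleteSpace X] (A : X →ₗ.[ℂ] X) (hA : A.IsClosed) :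
    CompleteSpace (graphSpace A) := by
  have : IsClosed (graphSpace A : Set (WithLp 1 (X × X))) := by
    have h : Continuous (WithLp.ofLp : WithLp 1 (X × X) → X × X) :=
      WithLp.prod_continuous_ofLp 1 X X
    exact IsClosed.preimage h hA
  exact this.completeSpace_coe

/-- The Banach couple `(X, D_A)` of a closed operator `A` on the Banach space `X`. -/
@[reducible]
def domainCouple [CompleteSpace X] (A : X →ₗ.[ℂ] X) (hA : A.IsClosed) : BanachCouple.{u} where
  Z := X
  X₀ := X
  X₁ := graphSpace A
  cs₁ := graphSpace_complete A hA
  ι₀ := ContinuousLinearMap.id ℂ X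
  ι₁ := (ContinuousLinearMap.fst ℂ X X).comp
    ((WithLp.prodContinuousLinearEquiv 1 ℂ X X : WithLp 1 (X × X) →L[ℂ] X × X).comp
      (graphSpace A).subtypeL)
  inj₀ := Function.injective_id
  inj₁ := by
    rintro ⟨x, hx⟩ ⟨y, hy⟩ h
    have hx' : (x.fst, x.snd) ∈ A.graph := hx
    have hy' : (y.fst, y.snd) ∈ A.graph := hy
    have h1 : x.fst = y.fst := h
    have h2 : x.snd = y.snd := A.mem_graph_snd_inj hx' hy' h1
    apply Subtype.ext
    apply (WithLp.linearEquiv 1 ℂ (X × X)).injective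
    exact Prod.ext h1 h2

end DomainCouple

/-! ## The real and the complex interpolation spaces -/

namespace BanachCouple

variable (C : BanachCouple.{u})

/-- The measure `dt / t` on `(0, ∞)`. -/
def haarMeasure : Measure ℝ :=
  (volume.restrict (Ioi 0)).withDensity fun t => ENNReal.ofReal t⁻¹

/-- The norm `(∫_0^∞ (t^{-θ} K(t,x))^q dt/t)^{1/q}` of the real method. -/
def realNorm (θ q : ℝ) (hq : 1 ≤ q) : ExtNorm C.Z where
  toFun x := (∫⁻ t, (ENNReal.ofReal (t ^ (-θ)) * C.K t x) ^ q ∂haarMeasure) ^ (1 / q)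
  add_le' x y := by
    have hm : ∀ x : C.Z, Measurable fun t : ℝ => ENNReal.ofReal (t ^ (-θ)) * C.K t x := fun x =>
      ((measurable_id.pow_const (-θ)).ennreal_ofReal).mul (C.K_mono x).measurable
    refine le_trans ?_ (ENNReal.lintegral_Lp_add_le (hm x).aemeasurable (hm y).aemeasurable hq)
    gcongr with t
    simp only [Pi.add_apply]
    rw [← mul_add]
    gcongr
    exact C.K_add_le t x y
  smul_le' c x := by
    have hq0 : 0 < q := by linarith
    calc (∫⁻ t, (ENNReal.ofReal (t ^ (-θ)) * C.K t (c • x)) ^ q ∂haarMeasure) ^ (1 / q)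
        ≤ (∫⁻ t, ‖c‖ₑ ^ q * (ENNReal.ofReal (t ^ (-θ)) * C.K t x) ^ q ∂haarMeasure) ^ (1 / q) := by
          refine ENNReal.rpow_le_rpow (lintegral_mono fun t => ?_) (by positivity)
          rw [← ENNReal.mul_rpow_of_nonneg _ _ hq0.le]
          refine ENNReal.rpow_le_rpow ?_ hq0.le
          calc ENNReal.ofReal (t ^ (-θ)) * C.K t (c • x)
              ≤ ENNReal.ofReal (t ^ (-θ)) * (‖c‖ₑ * C.K t x) := by
                gcongr; exact C.K_smul_le t c x
            _ = ‖c‖ₑ * (ENNReal.ofReal (t ^ (-θ)) * C.K t x) := by ring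
      _ = _ := by
          rw [lintegral_const_mul' _ _ (ENNReal.rpow_ne_top_of_nonneg hq0.le (by simp)),
            ENNReal.mul_rpow_of_nonneg _ _ (by positivity), ← ENNReal.rpow_mul,
            mul_one_div_cancel hq0.ne', ENNReal.rpow_one]
  eq_zero' x h := by
    have hq0 : 0 < q := by linarith
    have hm : Measurable fun t : ℝ => (ENNReal.ofReal (t ^ (-θ)) * C.K t x) ^ q :=
      (((measurable_id.pow_const (-θ)).ennreal_ofReal).mul (C.K_mono x).measurable).pow_const q
    have h1 : ∫⁻ t, (ENNReal.ofReal (t ^ (-θ)) * C.K t x) ^ q ∂haarMeasure = 0 := by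
      rcases ENNReal.rpow_eq_zero_iff.1 h with h | h
      · exact h.1
      · exact absurd h.2 (not_lt.2 (by positivity))
    rw [lintegral_eq_zero_iff hm, Filter.EventuallyEq, haarMeasure,
      ae_withDensity_iff (by fun_prop)] at h1
    have h2 : ∃ᵐ t : ℝ ∂(volume.restrict (Ioi 0)), True := by
      rw [Filter.frequently_true_iff_neBot, ae_neBot]
      intro h0
      have := congrArg (fun μ : Measure ℝ => μ univ) h0
      simp at this
    have h3 := (h2.and_eventually (h1.and (ae_restrict_mem measurableSet_Ioi))).exists
    obtain ⟨t, -, ht, ht0⟩ := h3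
    have ht0' : (0 : ℝ) < t := ht0
    have h4 := ht (by simpa using ht0')
    have h5 : ENNReal.ofReal (t ^ (-θ)) * C.K t x = 0 := by
      rcases ENNReal.rpow_eq_zero_iff.1 h4 with h | h
      · exact h.1
      · exact absurd h.2 (not_lt.2 hq0.le)
    rcases mul_eq_zero.1 h5 with h | h
    · exact absurd h (by simpa using Real.rpow_pos_of_pos ht0' _)
    · exact C.K_eq_zero ht0' h

/-- The real interpolation space `(X₀, X₁)_{θ,q}` for `1 ≤ q < ∞`. -/
abbrev RealSpace (θ q : ℝ) (hq : 1 ≤ q) : Type u := (C.realNorm θ q hq).Space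

/-- The functions admissible for the complex method: bounded and continuous functions
`f : {0 ≤ Re z ≤ 1} → X₀ + X₁`, holomorphic on `{0 < Re z < 1}`, such that `t ↦ f (j + i t)` is
a continuous function to `X_j` which vanishes at infinity (`j = 0, 1`). The values of `f` outside
the closed strip are irrelevant. -/
structure CalderonFun where
  f : ℂ → C.Sum
  f₀ : C₀(ℝ, C.X₀)
  f₁ : C₀(ℝ, C.X₁)
  diffContOnCl : DiffContOnCl ℂ f (Complex.re ⁻¹' Ioo 0 1)
  bounded : ∃ M : ℝ, ∀ z : ℂ, 0 ≤ z.re → z.re ≤ 1 → ‖f z‖ ≤ M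
  boundary₀ : ∀ t : ℝ, C.sumIncl (f (t * Complex.I)) = C.ι₀ (f₀ t)
  boundary₁ : ∀ t : ℝ, C.sumIncl (f (1 + t * Complex.I)) = C.ι₁ (f₁ t)

variable {C}

/-- The norm `max (sup_t ‖f(it)‖_{X₀}, sup_t ‖f(1+it)‖_{X₁})`. -/
def CalderonFun.norm (g : C.CalderonFun) : ℝ := max ‖g.f₀‖ ‖g.f₁‖

theorem CalderonFun.norm_apply_le (g : C.CalderonFun) {z : ℂ} (h0 : 0 ≤ z.re) (h1 : z.re ≤ 1) :
    ‖g.f z‖ ≤ g.norm := by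
  have b0 : ∀ t : ℝ, ‖g.f (t * Complex.I)‖ ≤ g.norm := by
    intro t
    refine le_trans ?_ ((g.f₀.toBCF.norm_coe_le_norm t).trans (le_max_left _ _))
    refine ENNReal.toReal_le_of_le_ofReal (norm_nonneg _) ?_
    refine (K_le (g.f₀ t) 0 ?_).trans (by simp)
    rw [map_zero, add_zero]
    exact (g.boundary₀ t).symm
  have b1 : ∀ t : ℝ, ‖g.f (1 + t * Complex.I)‖ ≤ g.norm := by
    intro t
    refine le_trans ?_ ((g.f₁.toBCF.norm_coe_le_norm t).trans (le_max_right _ _))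
    refine ENNReal.toReal_le_of_le_ofReal (norm_nonneg _) ?_
    refine (K_le 0 (g.f₁ t) ?_).trans (by simp)
    rw [map_zero, zero_add]
    exact (g.boundary₁ t).symm
  obtain ⟨M, hM⟩ := g.bounded
  refine PhragmenLindelof.vertical_strip g.diffContOnCl ⟨0, by simp [Real.pi_pos], 0, ?_⟩
    ?_ ?_ h0 h1
  · refine Asymptotics.IsBigO.of_bound M ?_
    refine Filter.mem_inf_of_right (Filter.mem_principal.2 fun z hz => ?_)
    have hz' : 0 < z.re ∧ z.re < 1 := hz
    simpa using hM z hz'.1.le hz'.2.le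
  · intro z hz
    have : z = (z.im : ℂ) * Complex.I := by apply Complex.ext <;> simp [hz]
    rw [this]; exact b0 _
  · intro z hz
    have : z = 1 + (z.im : ℂ) * Complex.I := by apply Complex.ext <;> simp [hz]
    rw [this]; exact b1 _

/-- Sum of two admissible functions. -/
def CalderonFun.add (g h : C.CalderonFun) : C.CalderonFun where
  f := g.f + h.f
  f₀ := g.f₀ + h.f₀
  f₁ := g.f₁ + h.f₁
  diffContOnCl := g.diffContOnCl.add h.diffContOnCl
  bounded := ⟨g.norm + h.norm, fun z h0 h1 =>
    (norm_add_le _ _).trans (add_le_add (g.norm_apply_le h0 h1) (h.norm_apply_le h0 h1))⟩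
  boundary₀ t := by simp [g.boundary₀, h.boundary₀]
  boundary₁ t := by simp [g.boundary₁, h.boundary₁]

/-- Scalar multiple of an admissible function. -/
def CalderonFun.smul (c : ℂ) (g : C.CalderonFun) : C.CalderonFun where
  f := c • g.f
  f₀ := c • g.f₀
  f₁ := c • g.f₁
  diffContOnCl := g.diffContOnCl.const_smul c
  bounded := ⟨‖c‖ * g.norm, fun z h0 h1 => by
    rw [Pi.smul_apply, norm_smul]
    exact mul_le_mul_of_nonneg_left (g.norm_apply_le h0 h1) (norm_nonneg _)⟩
  boundary₀ t := by simp [g.boundary₀]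
  boundary₁ t := by simp [g.boundary₁]

variable (C)

/-- The norm `inf {‖f‖ : f admissible, f(θ) = x}` of the complex method. -/
def complexNorm (θ : ℝ) (hθ : θ ∈ Ioo (0 : ℝ) 1) : ExtNorm C.Z where
  toFun x := ⨅ (g : C.CalderonFun) (_ : C.sumIncl (g.f θ) = x), ENNReal.ofReal g.norm
  add_le' x y := by
    simp_rw [ENNReal.iInf_add, ENNReal.add_iInf]
    refine le_iInf fun g => le_iInf fun hg => le_iInf fun h => le_iInf fun hh => ?_
    refine iInf_le_of_le (g.add h) (iInf_le_of_le ?_ ?_)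
    · rw [← hg, ← hh, ← map_add]; rfl
    · have hpos : ∀ k : C.CalderonFun, 0 ≤ k.norm := fun k =>
        le_max_of_le_left (norm_nonneg _)
      rw [← ENNReal.ofReal_add (hpos g) (hpos h)]
      refine ENNReal.ofReal_le_ofReal (max_le ?_ ?_)
      · exact (norm_add_le _ _).trans (add_le_add (le_max_left _ _) (le_max_left _ _))
      · exact (norm_add_le _ _).trans (add_le_add (le_max_right _ _) (le_max_right _ _))
  smul_le' c x := by
    have key : ∀ g : C.CalderonFun, (CalderonFun.smul c g).norm = ‖c‖ * g.norm := by
      intro g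
      rw [CalderonFun.norm, CalderonFun.norm, mul_max_of_nonneg _ _ (norm_nonneg c),
        ← norm_smul, ← norm_smul]
      rfl
    rcases eq_or_ne c 0 with rfl | hc
    · let g0 : C.CalderonFun :=
        { f := 0, f₀ := 0, f₁ := 0
          diffContOnCl := diffContOnCl_const
          bounded := ⟨0, by simp⟩
          boundary₀ := by simp
          boundary₁ := by simp }
      refine iInf_le_of_le g0 (iInf_le_of_le ?_ ?_)
      · simp [g0]
      · simp [g0, CalderonFun.norm]
    have h1 : ‖c‖ₑ ≠ 0 := by simpa using hc
    have h2 : ‖c‖ₑ ≠ ∞ := by simp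
    simp_rw [ENNReal.mul_iInf_of_ne h1 h2]
    refine le_iInf fun g => le_iInf fun hg => ?_
    refine iInf_le_of_le (CalderonFun.smul c g) (iInf_le_of_le ?_ ?_)
    · rw [← hg, ← map_smul]; rfl
    · rw [key, ENNReal.ofReal_mul (norm_nonneg c), ofReal_norm]
  eq_zero' x h := by
    have hle : C.K 1 x ≤ 0 := by
      rw [← h]
      refine le_iInf fun g => le_iInf fun hg => ?_
      rw [← hg]
      have h1 := g.norm_apply_le (z := (θ : ℂ)) (by simpa using hθ.1.le) (by simpa using hθ.2.le)
      rw [ExtNorm.norm_def] at h1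
      exact (ENNReal.le_ofReal_iff_toReal_le (ExtNorm.lt_top _ _).ne
        (le_max_of_le_left (norm_nonneg _))).2 h1
    exact C.K_eq_zero one_pos (le_antisymm hle zero_le)

/-- The complex interpolation space `[X₀, X₁]_θ`. -/
abbrev ComplexSpace (θ : ℝ) (hθ : θ ∈ Ioo (0 : ℝ) 1) : Type u := (C.complexNorm θ hθ).Space

end BanachCouple

end MaxReg

end

/-!
# Maximal regularity in interpolation spaces

Maximal regularity of `A` on `L^p(0,τ;X)` amounts to boundedness of the operator `K : f ↦ A u` on
`L^p(0,τ;X)`, `u` the solution of `u' + A u = f`, `u(0) = 0` (`HasLpMaxReg.exists_clm`, by the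
closed graph theorem). Conversely, let `B` be a closed operator with unique strong solutions and a
family `T` for which `t ↦ ∫_0^t T(s) x ds` solves `u' + B u = x`. Then for step functions `f` the
function `B u` is given explicitly by `T` (`dyResp`), and an `L^p`-bound for it on step functions
implies maximal regularity (`hasLpMaxReg_of_bound`), since step functions are dense and limits of
strong solutions are strong solutions.

**Transference.** Applying `K` to step functions of mesh `h` and averaging over the cells of the
mesh gives operators on `ℓ^p(X)` whose norms do not exceed that of `K`. For two consistent
operators these discretizations are a morphism of the couple `(ℓ^p(X₀), ℓ^p(X₁))`. If
`F(ℓ^p(X₀), ℓ^p(X₁)) = ℓ^p(F(X₀, X₁))`, they act on `ℓ^p(F(X₀, X₁))` with norms bounded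
independently of `h`; there they are the discretizations of the response of the interpolated
semigroup, and the mesh tends to `0` (`exists_dyResp_bound`, with Fatou's lemma). Only this
interpolation property for sequences, `LpStable`, is used. The bound is uniform because a functor
acts boundedly on the space of all couple morphisms, again by the closed graph theorem. By the same
argument the interpolated semigroup is continuous in norm, and the interpolated resolvents describe
the graph of the part of `A₀ + A₁`. Uniqueness of strong solutions follows from the semigroup
(`strongUnique_of_family`), and `hasLpMaxReg_part_sumOp` results.

**The half-line.** If `A` has maximal regularity on `(0,∞)`, solutions are causal and unique on every
interval, and `-A` generates a bounded analytic semigroup: if `u' + A u = x` and `v' + A v = u'`, then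
`v(t) = t u'(t)`, so that `T(t) x = u'(t)` is bounded and `A T(t)` is `O(1/t)`
(`HasLpMaxReg.exists_orbit`, `HasLpMaxReg.exists_analyticPair`). Since `T` commutes with `A`, the
estimate for responses on `L^p(X)` yields the one on `L^p(D_A)`. Transference then applies to the
couple `(X, D_A)` and every intermediate space which is `LpStable`
(`HasLpMaxReg.part_of_lpStable`).

**The complex method.** The spaces `[X₀, X₁]_θ` are `LpStable` (`lpStable_complexIncl`): the `p`-th
power of the norm of a value `g(θ)` is at most a mean of the `p`-th powers of the norms of the
boundary values (`norm_eval_rpow_le`), by division by an outer function and Jensen's inequality.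
Applied to each term of a sequence this estimate can be summed.

**The real method.** For `q ≠ p` the space `(X, D_A)_{θ,q}` does not behave well with respect to
`ℓ^p`, and the response `g(t) = ∫ A T(s) f(t - s) ds` is estimated directly. Splitting the integral at
`s = 2^j` bounds the `K`-functional of `g(t)` at `2^j` by that of `f(t - s)` at all scales `s`
(`IsAnalyticPair.domK_integral_le`); thus the weighted sequence `K(2^j, g(t))` is dominated by a
discrete convolution of averages of `K(2^i, f)` over windows of length comparable to `2^i`, up to a
term with the norm of `g(t)` in `X`, for which maximal regularity in `X` is available
(`IsAnalyticPair.dyWeight_mul_domK_le`). Young's inequality removes the convolution. The averages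
are bounded in `L^p(ℓ^q)` for `1 < p, q < ∞` (`exists_tsum_winAvg_bound`): for `q ≤ p` because the
scales are increasing in the index, for `p < q` by duality. Only here is `p > 1` needed.
-/

noncomputable section

namespace MaxReg

set_option linter.unusedSectionVars false

/-! ### Strong solutions -/

section StrongSolutions

open Filter Topology

variable {E : Type v} [NormedAddCommGroup E] [NormedSpace ℂ E]

theorem measurableSet_timeInterval (τ : ℝ≥0∞) : MeasurableSet (timeInterval τ) :=
  measurableSet_Ioi.inter (measurableSet_lt ENNReal.measurable_ofReal measurable_const)

theorem timeInterval_subset_zero (τ : ℝ≥0∞) : timeInterval τ ⊆ timeIntervalZero τ :=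
  fun _ h => ⟨h.1.le, h.2⟩

theorem timeInterval_subset_Ioi (τ : ℝ≥0∞) : timeInterval τ ⊆ Ioi 0 := fun _ h => h.1

theorem Ioc_subset_timeInterval {τ : ℝ≥0∞} {t : ℝ} (ht : t ∈ timeIntervalZero τ) :
    Ioc 0 t ⊆ timeInterval τ :=
  fun _ hs => ⟨hs.1, (ENNReal.ofReal_le_ofReal hs.2).trans_lt ht.2⟩

theorem timeIntervalZero_of_le {τ : ℝ≥0∞} {s t : ℝ} (ht : t ∈ timeIntervalZero τ) (h0 : 0 ≤ s)
    (hst : s ≤ t) : s ∈ timeIntervalZero τ :=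
  ⟨h0, (ENNReal.ofReal_le_ofReal hst).trans_lt ht.2⟩

theorem restrict_Ioc_le_timeMeasure {τ : ℝ≥0∞} {t : ℝ} (ht : t ∈ timeIntervalZero τ) :
    volume.restrict (Ioc 0 t) ≤ timeMeasure τ :=
  Measure.restrict_mono (Ioc_subset_timeInterval ht) le_rfl

theorem timeMeasure_top : timeMeasure ∞ = volume.restrict (Ioi 0) := by
  have : timeInterval ∞ = Ioi 0 := by
    ext t
    simp [timeInterval]
  rw [timeMeasure, this]

theorem timeMeasure_le (τ : ℝ≥0∞) : timeMeasure τ ≤ volume.restrict (Ioi 0) :=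
  Measure.restrict_mono (timeInterval_subset_Ioi τ) le_rfl

theorem ae_timeMeasure_of_mem {τ : ℝ≥0∞} {P : ℝ → Prop} (h : ∀ t ∈ timeInterval τ, P t) :
    ∀ᵐ t ∂(timeMeasure τ), P t :=
  (ae_restrict_mem (measurableSet_timeInterval τ)).mono h

theorem integrableOn_Ioc_of_memLp {τ p : ℝ≥0∞} (hp : 1 ≤ p) {f : ℝ → E}
    (hf : MemLp f p (timeMeasure τ)) {t : ℝ} (ht : t ∈ timeIntervalZero τ) :
    IntegrableOn f (Ioc 0 t) :=
  (hf.mono_measure (restrict_Ioc_le_timeMeasure ht)).integrable hp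

namespace IsStrongSolution

variable {A : E →ₗ.[ℂ] E} {τ : ℝ≥0∞} {f g u w du dw Au Aw : ℝ → E} {x y : E}

theorem add (h : IsStrongSolution A τ f x u du Au) (k : IsStrongSolution A τ g y w dw Aw) :
    IsStrongSolution A τ (f + g) (x + y) (u + w) (du + dw) (Au + Aw) where
  deriv_integrableOn t ht := (h.deriv_integrableOn t ht).add (k.deriv_integrableOn t ht)
  eq_integral t ht := by
    have h1 := h.deriv_integrableOn t ht
    have k1 := k.deriv_integrableOn t ht
    simp only [Pi.add_apply, h.eq_integral t ht, k.eq_integral t ht,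
      intervalIntegral.integral_of_le ht.1]
    rw [integral_add h1 k1]
    abel
  graph_mem := by
    filter_upwards [h.graph_mem, k.graph_mem] with t h1 h2 using A.graph.add_mem h1 h2
  equation := by
    filter_upwards [h.equation, k.equation] with t h1 h2
    simp only [Pi.add_apply, ← h1, ← h2]
    abel

theorem smul (c : ℂ) (h : IsStrongSolution A τ f x u du Au) :
    IsStrongSolution A τ (c • f) (c • x) (c • u) (c • du) (c • Au) where
  deriv_integrableOn t ht := (h.deriv_integrableOn t ht).smul c
  eq_integral t ht := by
    simp only [Pi.smul_apply, h.eq_integral t ht, smul_add, intervalIntegral.integral_smul]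
  graph_mem := by
    filter_upwards [h.graph_mem] with t h1 using A.graph.smul_mem c h1
  equation := by
    filter_upwards [h.equation] with t h1
    simp only [Pi.smul_apply, ← h1, smul_add]

theorem neg (h : IsStrongSolution A τ f x u du Au) :
    IsStrongSolution A τ (-f) (-x) (-u) (-du) (-Au) := by
  simpa using h.smul (-1)

theorem sub (h : IsStrongSolution A τ f x u du Au) (k : IsStrongSolution A τ g y w dw Aw) :
    IsStrongSolution A τ (f - g) (x - y) (u - w) (du - dw) (Au - Aw) := by
  simpa [sub_eq_add_neg] using h.add k.neg

theorem zero : IsStrongSolution A τ 0 0 0 0 0 where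
  deriv_integrableOn t ht := integrableOn_zero
  eq_integral t ht := by simp
  graph_mem := .of_forall fun t => A.graph.zero_mem
  equation := .of_forall fun t => by simp

theorem congr (h : IsStrongSolution A τ f x u du Au) (hf : f =ᵐ[timeMeasure τ] g)
    (hu : EqOn u w (timeIntervalZero τ)) (hdu : du =ᵐ[timeMeasure τ] dw)
    (hAu : Au =ᵐ[timeMeasure τ] Aw) : IsStrongSolution A τ g x w dw Aw where
  deriv_integrableOn t ht := (h.deriv_integrableOn t ht).congr
    (ae_mono (restrict_Ioc_le_timeMeasure ht) hdu)
  eq_integral t ht := by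
    rw [← hu ht, h.eq_integral t ht, intervalIntegral.integral_of_le ht.1,
      intervalIntegral.integral_of_le ht.1]
    congr 1
    exact integral_congr_ae (ae_mono (restrict_Ioc_le_timeMeasure ht) hdu)
  graph_mem := by
    filter_upwards [h.graph_mem, hAu, ae_timeMeasure_of_mem (τ := τ) fun t ht => ht]
      with t h1 h2 h3
    rwa [← h2, ← hu (timeInterval_subset_zero τ h3)]
  equation := by
    filter_upwards [h.equation, hdu, hAu, hf] with t h1 h2 h3 h4
    rw [← h2, ← h3, ← h4, h1]

theorem mono (h : IsStrongSolution A τ f x u du Au) {σ : ℝ≥0∞} (hσ : σ ≤ τ) :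
    IsStrongSolution A σ f x u du Au := by
  have hi : timeInterval σ ⊆ timeInterval τ := fun t ht => ⟨ht.1, ht.2.trans_le hσ⟩
  have hμ : timeMeasure σ ≤ timeMeasure τ := Measure.restrict_mono hi le_rfl
  exact ⟨fun t ht => h.deriv_integrableOn t ⟨ht.1, ht.2.trans_le hσ⟩,
    fun t ht => h.eq_integral t ⟨ht.1, ht.2.trans_le hσ⟩, ae_mono hμ h.graph_mem,
    ae_mono hμ h.equation⟩

/-- The `A`-part of a strong solution is determined by the solution. -/
theorem ae_eq_of_eqOn (h : IsStrongSolution A τ f x u du Au)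
    (k : IsStrongSolution A τ g y w dw Aw) (huw : EqOn u w (timeIntervalZero τ)) :
    Au =ᵐ[timeMeasure τ] Aw := by
  filter_upwards [h.graph_mem, k.graph_mem, ae_timeMeasure_of_mem (τ := τ) fun t ht => ht]
    with t h1 h2 h3
  rw [← huw (timeInterval_subset_zero τ h3)] at h2
  exact A.mem_graph_snd_inj h1 h2 rfl

theorem map {D : Type*} [NormedAddCommGroup D] [NormedSpace ℂ D] [CompleteSpace D]
    [CompleteSpace E] {B : D →ₗ.[ℂ] D} (L : E →L[ℂ] D)
    (hL : ∀ a b, (a, b) ∈ A.graph → (L a, L b) ∈ B.graph)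
    (h : IsStrongSolution A τ f x u du Au) :
    IsStrongSolution B τ (fun t => L (f t)) (L x) (fun t => L (u t)) (fun t => L (du t))
      (fun t => L (Au t)) where
  deriv_integrableOn t ht := L.integrable_comp (h.deriv_integrableOn t ht)
  eq_integral t ht := by
    rw [h.eq_integral t ht, map_add, intervalIntegral.integral_of_le ht.1,
      intervalIntegral.integral_of_le ht.1, L.integral_comp_comm (h.deriv_integrableOn t ht)]
  graph_mem := h.graph_mem.mono fun t ht => hL _ _ ht
  equation := h.equation.mono fun t ht => by rw [← ht, map_add]

end IsStrongSolution

theorem IsStrongSolution.isLpSolution {A : E →ₗ.[ℂ] E} {p τ : ℝ≥0∞} {f u du Au : ℝ → E}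
    (h : IsStrongSolution A τ f 0 u du Au) (hf : MemLp f p (timeMeasure τ))
    (hA : MemLp Au p (timeMeasure τ)) : IsLpSolution A p τ f u :=
  ⟨du, Au, h, (hf.sub hA).ae_eq (h.equation.mono fun t ht => by simp [← ht]), hA⟩

theorem tendsto_setIntegral_of_tendsto_eLpNorm {p : ℝ≥0∞} (hp : 1 ≤ p) {ν : Measure ℝ}
    [IsFiniteMeasure ν] {f : ℕ → ℝ → E} {g : ℝ → E} (hf : ∀ n, MemLp (f n) p ν) (hg : MemLp g p ν)
    (h : Tendsto (fun n => eLpNorm (f n - g) p ν) atTop (𝓝 0)) :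
    Tendsto (fun n => ∫ t, f n t ∂ν) atTop (𝓝 (∫ t, g t ∂ν)) := by
  refine tendsto_integral_of_L1' g hg.1
    (.of_forall fun n => (hf n).integrable hp) ?_
  have hb : ∀ n, eLpNorm (f n - g) 1 ν ≤
      eLpNorm (f n - g) p ν * ν univ ^ (1 / (1 : ℝ≥0∞).toReal - 1 / p.toReal) := fun n =>
    eLpNorm_le_eLpNorm_mul_rpow_measure_univ hp ((hf n).sub hg).1
  refine tendsto_of_tendsto_of_tendsto_of_le_of_le tendsto_const_nhds ?_ (fun _ => zero_le) hb
  have hfin : ν univ ^ (1 / (1 : ℝ≥0∞).toReal - 1 / p.toReal) ≠ ∞ := by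
    refine ENNReal.rpow_ne_top_of_nonneg ?_ (measure_ne_top ν _)
    have : p.toReal⁻¹ ≤ 1 := by
      rcases eq_or_ne p ∞ with rfl | hp'
      · simp
      · exact inv_le_one_of_one_le₀ (by
          rw [← ENNReal.toReal_one]; exact ENNReal.toReal_mono hp' hp)
    simpa using this
  simpa using ENNReal.Tendsto.mul_const h (Or.inr hfin)

variable [CompleteSpace E]

/-- `L^p`-limits of strong solutions are strong solutions, as `A` is closed. -/
theorem isStrongSolution_of_tendsto {A : E →ₗ.[ℂ] E} (hA : A.IsClosed) {p τ : ℝ≥0∞} (hp : 1 ≤ p)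
    {f u du Au : ℕ → ℝ → E} {g G : ℝ → E}
    (h : ∀ n, IsStrongSolution A τ (f n) 0 (u n) (du n) (Au n))
    (hf : ∀ n, MemLp (f n) p (timeMeasure τ)) (hAu : ∀ n, MemLp (Au n) p (timeMeasure τ))
    (hg : MemLp g p (timeMeasure τ)) (hG : MemLp G p (timeMeasure τ))
    (hfg : Tendsto (fun n => eLpNorm (f n - g) p (timeMeasure τ)) atTop (𝓝 0))
    (hAG : Tendsto (fun n => eLpNorm (Au n - G) p (timeMeasure τ)) atTop (𝓝 0)) :
    IsStrongSolution A τ g 0 (fun t => ∫ s in (0 : ℝ)..t, (g - G) s) (g - G) G := by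
  have hdu : ∀ n, du n =ᵐ[timeMeasure τ] f n - Au n := fun n =>
    (h n).equation.mono fun t ht => by simp [← ht]
  have hd : Tendsto (fun n => eLpNorm (du n - (g - G)) p (timeMeasure τ)) atTop (𝓝 0) := by
    have hb : ∀ n, eLpNorm (du n - (g - G)) p (timeMeasure τ) ≤
        eLpNorm (f n - g) p (timeMeasure τ) + eLpNorm (Au n - G) p (timeMeasure τ) := by
      intro n
      have : du n - (g - G) =ᵐ[timeMeasure τ] (f n - g) - (Au n - G) := by
        filter_upwards [hdu n] with t ht
        simp only [Pi.sub_apply, ht]; abel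
      rw [eLpNorm_congr_ae this]
      exact eLpNorm_sub_le ((hf n).sub hg).1 ((hAu n).sub hG).1 hp
    refine tendsto_of_tendsto_of_tendsto_of_le_of_le tendsto_const_nhds ?_ (fun _ => zero_le) hb
    simpa using hfg.add hAG
  have hdLp : ∀ n, MemLp (du n) p (timeMeasure τ) := fun n =>
    ((hf n).sub (hAu n)).ae_eq (hdu n).symm
  have hlim : ∀ t ∈ timeIntervalZero τ,
      Tendsto (fun n => u n t) atTop (𝓝 (∫ s in (0 : ℝ)..t, (g - G) s)) := by
    intro t ht
    have h1 : ∀ n, u n t = ∫ s in Ioc 0 t, du n s := fun n => by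
      rw [(h n).eq_integral t ht, zero_add, intervalIntegral.integral_of_le ht.1]
    simp only [h1, intervalIntegral.integral_of_le ht.1]
    have hle := restrict_Ioc_le_timeMeasure ht
    refine tendsto_setIntegral_of_tendsto_eLpNorm hp (fun n => (hdLp n).mono_measure hle)
      ((hg.sub hG).mono_measure hle) ?_
    exact tendsto_of_tendsto_of_tendsto_of_le_of_le tendsto_const_nhds hd (fun _ => zero_le)
      fun n => eLpNorm_mono_measure _ hle
  refine ⟨fun t ht => integrableOn_Ioc_of_memLp hp (hg.sub hG) ht, fun t ht => by rw [zero_add],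
    ?_, .of_forall fun t => by simp⟩
  obtain ⟨ns, hns, hsub⟩ := (tendstoInMeasure_of_tendsto_eLpNorm (zero_lt_one.trans_le hp).ne'
    (fun n => (hAu n).1) hG.1 hAG).exists_seq_tendsto_ae
  filter_upwards [ae_all_iff.2 fun n => (h n).graph_mem, hsub,
    ae_timeMeasure_of_mem (τ := τ) fun t ht => ht] with t h1 h2 h3
  have h4 := (hlim t (timeInterval_subset_zero τ h3)).comp hns.tendsto_atTop
  exact hA.mem_of_tendsto (h4.prodMk_nhds h2) (.of_forall fun n => h1 (ns n))

/-- Maximal regularity means that `f ↦ A u` is a bounded operator on `L^p`, by the closed graph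
theorem. -/
theorem HasLpMaxReg.exists_clm {A : E →ₗ.[ℂ] E} {p τ : ℝ≥0∞} [Fact (1 ≤ p)]
    (h : HasLpMaxReg A p τ) : ∃ K : Lp E p (timeMeasure τ) →L[ℂ] Lp E p (timeMeasure τ),
      ∀ (f : Lp E p (timeMeasure τ)) (u du Au : ℝ → E), IsStrongSolution A τ f 0 u du Au →
        MemLp Au p (timeMeasure τ) → Au =ᵐ[timeMeasure τ] K f := by
  have hp : 1 ≤ p := Fact.out
  have hex : ∀ f : Lp E p (timeMeasure τ), ∃ g : Lp E p (timeMeasure τ),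
      ∀ (f' u du Au : ℝ → E), f' =ᵐ[timeMeasure τ] f → IsStrongSolution A τ f' 0 u du Au →
        MemLp Au p (timeMeasure τ) → Au =ᵐ[timeMeasure τ] g := by
    intro f
    obtain ⟨w, ⟨dw, Aw, hw, -, hAw⟩, huniq⟩ := h.2 f (Lp.memLp f)
    refine ⟨hAw.toLp _, fun f' u du Au hf' hu hAu => ?_⟩
    have hu' : IsStrongSolution A τ f 0 u du Au :=
      hu.congr hf' (fun _ _ => rfl) (ae_eq_refl _) (ae_eq_refl _)
    exact (hu'.ae_eq_of_eqOn hw (huniq u (hu'.isLpSolution (Lp.memLp f) hAu))).trans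
      hAw.coeFn_toLp.symm
  have hsol : ∀ f : Lp E p (timeMeasure τ), ∃ u du Au : ℝ → E,
      IsStrongSolution A τ f 0 u du Au ∧ MemLp Au p (timeMeasure τ) := by
    intro f
    obtain ⟨w, ⟨dw, Aw, hw, -, hAw⟩, -⟩ := h.2 f (Lp.memLp f)
    exact ⟨w, dw, Aw, hw, hAw⟩
  choose K hK using hex
  choose U dU AU hU hAU using hsol
  let K' : Lp E p (timeMeasure τ) →ₗ[ℂ] Lp E p (timeMeasure τ) :=
    { toFun := K
      map_add' := fun f g => by
        have e := hK (f + g) (f + g) _ _ _ (Lp.coeFn_add f g).symm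
          (by simpa using (hU f).add (hU g)) ((hAU f).add (hAU g))
        refine Lp.ext ?_
        filter_upwards [e, Lp.coeFn_add (K f) (K g), hK f f _ _ _ (ae_eq_refl _) (hU f) (hAU f),
          hK g g _ _ _ (ae_eq_refl _) (hU g) (hAU g)] with t h1 h2 h3 h4
        rw [← h1, h2, Pi.add_apply, Pi.add_apply, h3, h4]
      map_smul' := fun c f => by
        have e := hK (c • f) (c • f) _ _ _ (Lp.coeFn_smul c f).symm
          (by simpa using (hU f).smul c) ((hAU f).const_smul c)
        refine Lp.ext ?_
        filter_upwards [e, Lp.coeFn_smul c (K f), hK f f _ _ _ (ae_eq_refl _) (hU f) (hAU f)]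
          with t h1 h2 h3
        rw [← h1, RingHom.id_apply, h2, Pi.smul_apply, Pi.smul_apply, h3] }
  refine ⟨⟨K', ?_⟩, fun f u du Au hu hAu => hK f f u du Au (ae_eq_refl _) hu hAu⟩
  -- The graph is closed because limits of strong solutions are strong solutions.
  refine K'.continuous_of_seq_closed_graph fun f g G hfg hKG => ?_
  have hKn : ∀ n, AU (f n) =ᵐ[timeMeasure τ] K (f n) := fun n =>
    hK _ _ _ _ _ (ae_eq_refl _) (hU (f n)) (hAU (f n))
  have key := isStrongSolution_of_tendsto h.1 hp (fun n => hU (f n)) (fun n => Lp.memLp (f n))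
    (fun n => hAU (f n)) (Lp.memLp g) (Lp.memLp G)
    ((Lp.tendsto_Lp_iff_tendsto_eLpNorm' f g).1 hfg) (by
      have h1 := (Lp.tendsto_Lp_iff_tendsto_eLpNorm' _ _).1 hKG
      refine h1.congr fun n => eLpNorm_congr_ae ?_
      filter_upwards [hKn n] with t ht
      simp [Pi.sub_apply, ht, K'])
  exact Lp.ext (hK g g _ _ _ (ae_eq_refl _) key (Lp.memLp G))

end StrongSolutions

/-! ### Step functions, averages, and sequence spaces -/

section Steps

open Filter Topology

variable {E : Type v} [NormedAddCommGroup E] [NormedSpace ℂ E]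

/-- The cell `(k h, (k + 1) h]` of the grid of mesh `h`. -/
def cell (h : ℝ) (k : ℕ) : Set ℝ := Ioc (k * h) ((k + 1) * h)

/-- The index of the cell which contains `t > 0`. -/
def cellIndex (h t : ℝ) : ℕ := ⌈t / h⌉₊ - 1

/-- The step function on `(0, ∞)` with value `x k` on the cell `(k h, (k + 1) h]`. -/
def stepFun (h : ℝ) (x : ℕ → E) (t : ℝ) : E := if 0 < t then x (cellIndex h t) else 0

theorem mem_cell_iff {h : ℝ} (hh : 0 < h) {k : ℕ} {t : ℝ} :
    t ∈ cell h k ↔ 0 < t ∧ cellIndex h t = k := by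
  have h1 : t ∈ cell h k ↔ ⌈t / h⌉₊ = k + 1 := by
    rw [Nat.ceil_eq_iff (Nat.succ_ne_zero k), cell, mem_Ioc, lt_div_iff₀ hh, div_le_iff₀ hh]
    simp
  rw [h1, cellIndex]
  constructor
  · intro e
    refine ⟨?_, by omega⟩
    have : 0 < ⌈t / h⌉₊ := by omega
    rw [Nat.ceil_pos] at this
    exact (div_pos_iff_of_pos_right hh).1 this
  · rintro ⟨h0, rfl⟩
    have : 0 < ⌈t / h⌉₊ := Nat.ceil_pos.2 (div_pos h0 hh)
    omega

theorem mem_cell_cellIndex {h : ℝ} (hh : 0 < h) {t : ℝ} (ht : 0 < t) :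
    t ∈ cell h (cellIndex h t) := (mem_cell_iff hh).2 ⟨ht, rfl⟩

theorem measurableSet_cell (h : ℝ) (k : ℕ) : MeasurableSet (cell h k) := measurableSet_Ioc

theorem volume_cell (h : ℝ) (k : ℕ) : volume (cell h k) = ENNReal.ofReal h := by
  rw [cell, Real.volume_Ioc]; congr 1; ring

theorem iUnion_cell {h : ℝ} (hh : 0 < h) : ⋃ k, cell h k = Ioi 0 := by
  ext t
  simp [mem_cell_iff hh]

theorem pairwise_disjoint_cell {h : ℝ} (hh : 0 < h) :
    Pairwise (Function.onFun Disjoint (cell h)) := by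
  intro i j hij
  refine Set.disjoint_left.2 fun t hi hj => hij ?_
  rw [mem_cell_iff hh] at hi hj
  exact hi.2.symm.trans hj.2

theorem stepFun_of_mem {h : ℝ} (hh : 0 < h) {k : ℕ} {t : ℝ} (ht : t ∈ cell h k) (x : ℕ → E) :
    stepFun h x t = x k := by
  obtain ⟨h0, h1⟩ := (mem_cell_iff hh).1 ht
  rw [stepFun, if_pos h0, h1]

theorem stronglyMeasurable_stepFun (h : ℝ) (x : ℕ → E) : StronglyMeasurable (stepFun h x) := by
  refine StronglyMeasurable.ite measurableSet_Ioi ?_ stronglyMeasurable_const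
  have h1 : Measurable (cellIndex h) :=
    (measurable_from_top (f := fun n : ℕ => n - 1)).comp
      (Nat.measurable_ceil.comp (measurable_id.div_const h))
  exact (StronglyMeasurable.of_discrete (f := x)).comp_measurable h1

theorem lintegral_stepFun {h : ℝ} (hh : 0 < h) (x : ℕ → E) (r : ℝ) :
    ∫⁻ t in Ioi 0, ‖stepFun h x t‖ₑ ^ r = ENNReal.ofReal h * ∑' k, ‖x k‖ₑ ^ r := by
  rw [← iUnion_cell hh, lintegral_iUnion (measurableSet_cell h) (pairwise_disjoint_cell hh),
    ← ENNReal.tsum_mul_left]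
  refine tsum_congr fun k => ?_
  rw [setLIntegral_congr_fun (g := fun _ => ‖x k‖ₑ ^ r) (measurableSet_cell h k)
    (fun t ht => by rw [stepFun_of_mem hh ht]), setLIntegral_const, volume_cell, mul_comm]

section Lp

variable {p : ℝ≥0∞}

theorem one_le_toReal_of_fact [hp1 : Fact (1 ≤ p)] (hp : p ≠ ∞) : 1 ≤ p.toReal := by
  rw [← ENNReal.toReal_one]; exact ENNReal.toReal_mono hp hp1.out

theorem enorm_lp_rpow (hp : 0 < p.toReal) [Fact (1 ≤ p)] (x : lp (fun _ : ℕ => E) p) :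
    ‖x‖ₑ ^ p.toReal = ∑' k, ‖x k‖ₑ ^ p.toReal := by
  have h := lp.hasSum_norm hp x
  have h2 := ENNReal.ofReal_tsum_of_nonneg (fun n => by positivity) h.summable
  rw [h.tsum_eq, ENNReal.ofReal_rpow_of_nonneg (norm_nonneg _) hp.le |>.symm, ofReal_norm] at h2
  rw [h2]
  refine tsum_congr fun k => ?_
  rw [← ENNReal.ofReal_rpow_of_nonneg (norm_nonneg _) hp.le, ofReal_norm]

theorem memℓp_of_tsum_ne_top {x : ℕ → E} (hx : ∑' k, ‖x k‖ₑ ^ p.toReal ≠ ∞) : Memℓp x p := by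
  refine memℓp_gen ?_
  have := ENNReal.summable_toReal hx
  refine this.congr fun k => ?_
  rw [← ENNReal.toReal_rpow, toReal_enorm]

theorem memℓp_of_finite_support [Fact (1 ≤ p)] (hp : p ≠ ∞) {x : ℕ → E}
    (hx : (Function.support x).Finite) : Memℓp x p := by
  refine memℓp_gen (summable_of_hasFiniteSupport (hx.subset ?_))
  intro k hk hk'
  have : 0 < p.toReal := zero_lt_one.trans_le (one_le_toReal_of_fact hp)
  exact hk (by simp [hk', this.ne'])

theorem eLpNorm_stepFun [Fact (1 ≤ p)] (hp : p ≠ ∞) {h : ℝ} (hh : 0 < h)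
    (x : lp (fun _ : ℕ => E) p) :
    eLpNorm (stepFun h x) p (volume.restrict (Ioi 0)) =
      ENNReal.ofReal (h ^ (1 / p.toReal)) * ‖x‖ₑ := by
  have hp0 : 0 < p.toReal := zero_lt_one.trans_le (one_le_toReal_of_fact hp)
  have hp1 : p ≠ 0 := fun e => by simp [e] at hp0
  rw [eLpNorm_eq_lintegral_rpow_enorm_toReal hp1 hp, lintegral_stepFun hh, ← enorm_lp_rpow hp0,
    ENNReal.mul_rpow_of_nonneg _ _ (by positivity), ENNReal.ofReal_rpow_of_pos hh,
    ← ENNReal.rpow_mul, mul_one_div_cancel hp0.ne', ENNReal.rpow_one]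

theorem memLp_stepFun [Fact (1 ≤ p)] (hp : p ≠ ∞) {h : ℝ} (hh : 0 < h)
    (x : lp (fun _ : ℕ => E) p) (τ : ℝ≥0∞) : MemLp (stepFun h x) p (timeMeasure τ) :=
  MemLp.mono_measure (timeMeasure_le τ)
    ⟨(stronglyMeasurable_stepFun h x).aestronglyMeasurable, by
      rw [eLpNorm_stepFun hp hh]; exact ENNReal.mul_lt_top (by simp) (by simp)⟩

/-- The map which sends a sequence to the step function of mesh `h` with these values. -/
def stepLp [Fact (1 ≤ p)] (hp : p ≠ ∞) {h : ℝ} (hh : 0 < h) (τ : ℝ≥0∞) :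
    lp (fun _ : ℕ => E) p →L[ℂ] Lp E p (timeMeasure τ) :=
  LinearMap.mkContinuous (σ := RingHom.id ℂ)
    { toFun := fun x => (memLp_stepFun hp hh x τ).toLp _
      map_add' := fun x y => by
        rw [← MemLp.toLp_add]
        congr 1
        ext t
        simp only [stepFun, Pi.add_apply]
        split_ifs <;> simp
      map_smul' := fun c x => by
        rw [RingHom.id_apply, ← MemLp.toLp_const_smul]
        congr 1
        ext t
        simp only [stepFun, Pi.smul_apply]
        split_ifs <;> simp }
    (h ^ (1 / p.toReal)) fun x => by
      simp only [LinearMap.coe_mk, AddHom.coe_mk, Lp.norm_toLp]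
      refine ENNReal.toReal_le_of_le_ofReal (by positivity) ?_
      rw [ENNReal.ofReal_mul (by positivity), ofReal_norm, ← eLpNorm_stepFun hp hh]
      exact eLpNorm_mono_measure _ (timeMeasure_le τ)

theorem stepLp_coe [Fact (1 ≤ p)] (hp : p ≠ ∞) {h : ℝ} (hh : 0 < h) (τ : ℝ≥0∞)
    (x : lp (fun _ : ℕ => E) p) : stepLp hp hh τ x =ᵐ[timeMeasure τ] stepFun h x :=
  MemLp.coeFn_toLp (memLp_stepFun hp hh x τ)

theorem norm_stepLp_le [Fact (1 ≤ p)] (hp : p ≠ ∞) {h : ℝ} (hh : 0 < h) (τ : ℝ≥0∞) :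
    ‖(stepLp hp hh τ : lp (fun _ : ℕ => E) p →L[ℂ] _)‖ ≤ h ^ (1 / p.toReal) :=
  LinearMap.mkContinuous_norm_le _ (by positivity) _

/-- The average of `g` over the part of a cell which lies in `(0, τ)`. -/
def cellAvg (τ : ℝ≥0∞) (h : ℝ) (g : ℝ → E) (k : ℕ) : E :=
  h⁻¹ • ∫ t in cell h k, g t ∂(timeMeasure τ)

theorem cellAvg_congr {τ : ℝ≥0∞} {h : ℝ} {g g' : ℝ → E} (hg : g =ᵐ[timeMeasure τ] g') (k : ℕ) :
    cellAvg τ h g k = cellAvg τ h g' k := by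
  rw [cellAvg, cellAvg, integral_congr_ae (ae_restrict_of_ae hg)]

theorem timeMeasure_cell_le (τ : ℝ≥0∞) (h : ℝ) (k : ℕ) :
    (timeMeasure τ).restrict (cell h k) univ ≤ ENNReal.ofReal h := by
  rw [Measure.restrict_apply_univ, ← volume_cell h k]
  exact Measure.restrict_le_self _

theorem isFiniteMeasure_cell (τ : ℝ≥0∞) (h : ℝ) (k : ℕ) :
    IsFiniteMeasure ((timeMeasure τ).restrict (cell h k)) :=
  ⟨(timeMeasure_cell_le τ h k).trans_lt ENNReal.ofReal_lt_top⟩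

theorem integrable_cell [hp1 : Fact (1 ≤ p)] {τ : ℝ≥0∞} {g : ℝ → E}
    (hg : MemLp g p (timeMeasure τ)) (h : ℝ) (k : ℕ) :
    Integrable g ((timeMeasure τ).restrict (cell h k)) := by
  have := isFiniteMeasure_cell τ h k
  exact (hg.restrict _).integrable hp1.out

theorem enorm_cellAvg_le [hp1 : Fact (1 ≤ p)] (hp : p ≠ ∞) {h : ℝ} (hh : 0 < h) {τ : ℝ≥0∞}
    {g : ℝ → E} (hg : MemLp g p (timeMeasure τ)) (k : ℕ) :
    ‖cellAvg τ h g k‖ₑ ^ p.toReal ≤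
      ENNReal.ofReal h⁻¹ * ∫⁻ t in cell h k, ‖g t‖ₑ ^ p.toReal ∂(timeMeasure τ) := by
  have hp0 : 1 ≤ p.toReal := one_le_toReal_of_fact hp
  have hp2 : p ≠ 0 := (zero_lt_one.trans_le hp1.out).ne'
  set ν := (timeMeasure τ).restrict (cell h k) with hν
  have h1 : ‖cellAvg τ h g k‖ₑ ≤ ENNReal.ofReal h⁻¹ *
      ((∫⁻ t, ‖g t‖ₑ ^ p.toReal ∂ν) ^ (1 / p.toReal) *
        ENNReal.ofReal h ^ (1 - 1 / p.toReal)) := by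
    rw [cellAvg, enorm_smul, Real.enorm_of_nonneg (by positivity)]
    gcongr
    calc ‖∫ t, g t ∂ν‖ₑ ≤ eLpNorm g 1 ν := by
          rw [eLpNorm_one_eq_lintegral_enorm]; exact enorm_integral_le_lintegral_enorm _
      _ ≤ eLpNorm g p ν * ν univ ^ (1 / (1 : ℝ≥0∞).toReal - 1 / p.toReal) :=
          eLpNorm_le_eLpNorm_mul_rpow_measure_univ hp1.out (hg.restrict _).1
      _ ≤ _ := by
          rw [eLpNorm_eq_lintegral_rpow_enorm_toReal hp2 hp, ENNReal.toReal_one, div_one]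
          gcongr
          · have : 1 / p.toReal ≤ 1 := by rw [div_le_one (by linarith)]; exact hp0
            linarith
          · exact timeMeasure_cell_le τ h k
  calc ‖cellAvg τ h g k‖ₑ ^ p.toReal ≤ _ := ENNReal.rpow_le_rpow h1 (by linarith)
    _ = _ := by
      have hp3 : p.toReal ≠ 0 := by linarith
      rw [ENNReal.mul_rpow_of_nonneg _ _ (by linarith), ENNReal.mul_rpow_of_nonneg _ _ (by linarith),
        ← ENNReal.rpow_mul, ← ENNReal.rpow_mul, one_div_mul_cancel hp3, ENNReal.rpow_one, sub_mul,
        one_div_mul_cancel hp3, one_mul, ENNReal.ofReal_rpow_of_pos (by positivity),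
        ENNReal.ofReal_rpow_of_pos hh, mul_comm (∫⁻ t, ‖g t‖ₑ ^ p.toReal ∂ν), ← mul_assoc,
        ← ENNReal.ofReal_mul (by positivity)]
      congr 2
      rw [Real.rpow_sub_one hh.ne', Real.inv_rpow hh.le]
      field_simp

theorem tsum_cellAvg_le [hp1 : Fact (1 ≤ p)] (hp : p ≠ ∞) {h : ℝ} (hh : 0 < h) {τ : ℝ≥0∞}
    {g : ℝ → E} (hg : MemLp g p (timeMeasure τ)) :
    ∑' k, ‖cellAvg τ h g k‖ₑ ^ p.toReal ≤
      (ENNReal.ofReal (h⁻¹ ^ (1 / p.toReal)) * eLpNorm g p (timeMeasure τ)) ^ p.toReal := by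
  have hp0 : 1 ≤ p.toReal := one_le_toReal_of_fact hp
  have hp2 : p ≠ 0 := (zero_lt_one.trans_le hp1.out).ne'
  have hp3 : p.toReal ≠ 0 := by linarith
  refine (ENNReal.tsum_le_tsum (enorm_cellAvg_le hp hh hg)).trans ?_
  rw [ENNReal.tsum_mul_left, ← lintegral_iUnion (measurableSet_cell h) (pairwise_disjoint_cell hh),
    ENNReal.mul_rpow_of_nonneg _ _ (by linarith), eLpNorm_eq_lintegral_rpow_enorm_toReal hp2 hp,
    ← ENNReal.rpow_mul, one_div_mul_cancel hp3, ENNReal.rpow_one,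
    ENNReal.ofReal_rpow_of_pos (by positivity), ← Real.rpow_mul (by positivity),
    one_div_mul_cancel hp3, Real.rpow_one]
  gcongr
  exact Measure.restrict_le_self

/-- The map which sends a function to the sequence of its averages over the cells of mesh `h`. -/
def avgLp [Fact (1 ≤ p)] (hp : p ≠ ∞) {h : ℝ} (hh : 0 < h) (τ : ℝ≥0∞) :
    Lp E p (timeMeasure τ) →L[ℂ] lp (fun _ : ℕ => E) p :=
  LinearMap.mkContinuous
    { toFun := fun g => ⟨cellAvg τ h g, memℓp_of_tsum_ne_top (ne_top_of_le_ne_top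
        (ENNReal.rpow_ne_top_of_nonneg (by positivity) (ENNReal.mul_ne_top (by simp)
          (Lp.memLp g).2.ne)) (tsum_cellAvg_le hp hh (Lp.memLp g)))⟩
      map_add' := fun f g => by
        refine lp.ext (funext fun k => ?_)
        change cellAvg τ h (f + g : Lp E p (timeMeasure τ)) k = cellAvg τ h f k + cellAvg τ h g k
        rw [cellAvg_congr (Lp.coeFn_add f g), cellAvg, cellAvg, cellAvg, ← smul_add,
          ← integral_add (integrable_cell (Lp.memLp f) h k) (integrable_cell (Lp.memLp g) h k)]
        rfl
      map_smul' := fun c f => by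
        refine lp.ext (funext fun k => ?_)
        change cellAvg τ h (c • f : Lp E p (timeMeasure τ)) k = c • cellAvg τ h f k
        rw [cellAvg_congr (Lp.coeFn_smul c f), cellAvg, cellAvg, smul_comm, ← integral_smul c]
        rfl }
    (h⁻¹ ^ (1 / p.toReal)) fun g => by
      have hp0 : 0 < p.toReal := zero_lt_one.trans_le (one_le_toReal_of_fact hp)
      rw [← ENNReal.ofReal_le_ofReal_iff (by positivity), ENNReal.ofReal_mul (by positivity),
        ofReal_norm, ofReal_norm, ← ENNReal.rpow_le_rpow_iff hp0, enorm_lp_rpow hp0, Lp.enorm_def]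
      exact tsum_cellAvg_le hp hh (Lp.memLp g)

theorem norm_avgLp_le [Fact (1 ≤ p)] (hp : p ≠ ∞) {h : ℝ} (hh : 0 < h) (τ : ℝ≥0∞) :
    ‖(avgLp hp hh τ : Lp E p (timeMeasure τ) →L[ℂ] _)‖ ≤ h⁻¹ ^ (1 / p.toReal) :=
  LinearMap.mkContinuous_norm_le _ (by positivity) _

/-- The discretization of an operator on `L^p(0,τ;E)`: apply it to step functions of mesh `h` and
average the result over the cells. -/
def discretize [Fact (1 ≤ p)] (hp : p ≠ ∞) {h : ℝ} (hh : 0 < h) {τ : ℝ≥0∞}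
    (K : Lp E p (timeMeasure τ) →L[ℂ] Lp E p (timeMeasure τ)) :
    lp (fun _ : ℕ => E) p →L[ℂ] lp (fun _ : ℕ => E) p :=
  (avgLp hp hh τ).comp (K.comp (stepLp hp hh τ))

/-- The discretizations are bounded uniformly in the mesh. -/
theorem norm_discretize_le [Fact (1 ≤ p)] (hp : p ≠ ∞) {h : ℝ} (hh : 0 < h) {τ : ℝ≥0∞}
    (K : Lp E p (timeMeasure τ) →L[ℂ] Lp E p (timeMeasure τ)) :
    ‖discretize hp hh K‖ ≤ ‖K‖ := by
  calc ‖discretize hp hh K‖ ≤ h⁻¹ ^ (1 / p.toReal) * (‖K‖ * h ^ (1 / p.toReal)) := by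
        refine (ContinuousLinearMap.opNorm_comp_le _ _).trans ?_
        gcongr
        · exact norm_avgLp_le hp hh τ
        · refine (ContinuousLinearMap.opNorm_comp_le _ _).trans ?_
          gcongr
          exact norm_stepLp_le hp hh τ
    _ = ‖K‖ := by
        rw [Real.inv_rpow hh.le]
        have : h ^ (1 / p.toReal) ≠ 0 := (Real.rpow_pos_of_pos hh _).ne'
        field_simp

theorem discretize_apply [Fact (1 ≤ p)] (hp : p ≠ ∞) {h : ℝ} (hh : 0 < h) {τ : ℝ≥0∞}
    (K : Lp E p (timeMeasure τ) →L[ℂ] Lp E p (timeMeasure τ)) (x : lp (fun _ : ℕ => E) p)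
    {g : ℝ → E} (hg : g =ᵐ[timeMeasure τ] K (stepLp hp hh τ x)) (k : ℕ) :
    discretize hp hh K x k = cellAvg τ h g k := by
  rw [cellAvg_congr hg]; rfl

end Lp

/-! ### Dyadic step functions -/

/-- The mesh `2 ^ (-n)`. -/
def dyMesh (n : ℕ) : ℝ := (2 ^ n)⁻¹

theorem dyMesh_pos (n : ℕ) : 0 < dyMesh n := by unfold dyMesh; positivity

theorem tendsto_dyMesh : Tendsto dyMesh atTop (𝓝 0) := by
  have := tendsto_pow_atTop_nhds_zero_of_lt_one (r := (2⁻¹ : ℝ)) (by norm_num) (by norm_num)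
  refine this.congr fun n => ?_
  rw [dyMesh, inv_pow]

/-- The dyadic step function `Σ c (n, i) 1_{(i 2^{-n}, (i+1) 2^{-n}]}`. -/
def dyStep (c : (ℕ × ℕ) →₀ E) (t : ℝ) : E :=
  c.sum fun q x => (cell (dyMesh q.1) q.2).indicator (fun _ => x) t

theorem dyStep_add (c d : (ℕ × ℕ) →₀ E) : dyStep (c + d) = dyStep c + dyStep d := by
  ext t
  simp only [dyStep, Pi.add_apply]
  refine Finsupp.sum_add_index' (fun q => by simp) fun q x y => ?_
  by_cases h : t ∈ cell (dyMesh q.1) q.2 <;> simp [h]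

theorem dyStep_sub (c d : (ℕ × ℕ) →₀ E) : dyStep (c - d) = dyStep c - dyStep d := by
  have := dyStep_add (c - d) d
  rw [sub_add_cancel] at this
  exact eq_sub_of_add_eq this.symm

theorem mem_cell_dyMesh_iff {n m i k : ℕ} (hnm : n ≤ m) {t : ℝ} (ht : t ∈ cell (dyMesh m) k) :
    t ∈ cell (dyMesh n) i ↔ ((k : ℝ) + 1) * dyMesh m ∈ cell (dyMesh n) i := by
  obtain ⟨d, rfl⟩ := Nat.exists_eq_add_of_le hnm
  have hh := dyMesh_pos (n + d)
  have he : dyMesh n = (2 : ℝ) ^ d * dyMesh (n + d) := by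
    simp only [dyMesh, pow_add]; field_simp
  obtain ⟨h1, h2⟩ := ht
  set h := dyMesh (n + d)
  have hc : ∀ j : ℕ, (j : ℝ) * ((2 : ℝ) ^ d * h) = ((j * 2 ^ d : ℕ) : ℝ) * h := fun j => by
    push_cast; ring
  have hc' : ∀ j : ℕ, ((j : ℝ) + 1) * ((2 : ℝ) ^ d * h) = (((j + 1) * 2 ^ d : ℕ) : ℝ) * h :=
    fun j => by push_cast; ring
  have hk : ((k : ℝ) + 1) * h = ((k + 1 : ℕ) : ℝ) * h := by push_cast; ring
  rw [hk] at h2 ⊢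
  simp only [cell, he, hc, hc', mem_Ioc, mul_lt_mul_iff_left₀ hh, mul_le_mul_iff_left₀ hh,
    Nat.cast_lt, Nat.cast_le]
  refine and_congr ⟨fun h3 => ?_, fun h3 => ?_⟩ ⟨fun h3 => ?_, fun h3 => ?_⟩
  · have := lt_of_mul_lt_mul_right (h3.trans_le h2) hh.le
    exact_mod_cast this
  · refine lt_of_le_of_lt ?_ h1
    gcongr
    omega
  · have := lt_of_mul_lt_mul_right (h1.trans_le h3) hh.le
    have : k < (i + 1) * 2 ^ d := by exact_mod_cast this
    omega
  · refine h2.trans ?_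
    gcongr

/-- The values of a dyadic step function at the right end points of the cells of mesh `2^{-m}`. -/
def dySample (c : (ℕ × ℕ) →₀ E) (m k : ℕ) : E := dyStep c (((k : ℝ) + 1) * dyMesh m)

/-- A dyadic step function is a step function of mesh `2^{-m}`, for all large `m`. -/
theorem dyStep_eq_stepFun (c : (ℕ × ℕ) →₀ E) {m : ℕ} (hm : ∀ q ∈ c.support, q.1 ≤ m) :
    dyStep c = stepFun (dyMesh m) (dySample c m) := by
  ext t
  rw [stepFun]
  split_ifs with ht
  · have h1 := mem_cell_cellIndex (dyMesh_pos m) ht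
    rw [dySample, dyStep, dyStep]
    refine Finsupp.sum_congr fun q hq => ?_
    have := mem_cell_dyMesh_iff (i := q.2) (hm q hq) h1
    by_cases h2 : t ∈ cell (dyMesh q.1) q.2
    · rw [indicator_of_mem h2, indicator_of_mem (this.1 h2)]
    · rw [indicator_of_notMem h2, indicator_of_notMem (mt this.2 h2)]
  · refine Finset.sum_eq_zero fun q _ => indicator_of_notMem (fun h => ht ?_) _
    exact ((mem_cell_iff (dyMesh_pos _)).1 h).1

theorem finite_support_dySample (c : (ℕ × ℕ) →₀ E) (m : ℕ) :
    (Function.support (dySample c m)).Finite := by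
  have h1 : Function.support (dySample c m) ⊆ ⋃ q ∈ c.support,
      {k : ℕ | ((k : ℝ) + 1) * dyMesh m ∈ cell (dyMesh q.1) q.2} := by
    intro k hk
    by_contra h
    simp only [mem_iUnion, not_exists] at h
    refine hk (Finset.sum_eq_zero fun q hq => ?_)
    exact indicator_of_notMem (s := cell (dyMesh q.1) q.2) (h q hq) _
  refine (Set.Finite.biUnion (Finset.finite_toSet _) fun q _ => ?_).subset h1
  refine (Set.finite_Iic ⌈((q.2 : ℝ) + 1) * dyMesh q.1 / dyMesh m⌉₊).subset fun k hk => ?_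
  have h2 : ((k : ℝ) + 1) * dyMesh m ≤ ((q.2 : ℝ) + 1) * dyMesh q.1 := hk.2
  rw [← le_div_iff₀ (dyMesh_pos m)] at h2
  have h3 := h2.trans (Nat.le_ceil _)
  have h4 : k + 1 ≤ ⌈((q.2 : ℝ) + 1) * dyMesh q.1 / dyMesh m⌉₊ := by exact_mod_cast h3
  exact mem_Iic.2 (by omega)

theorem exists_level (c : (ℕ × ℕ) →₀ E) : ∃ m₀ : ℕ, ∀ m, m₀ ≤ m → ∀ q ∈ c.support, q.1 ≤ m :=
  ⟨c.support.sup Prod.fst, fun _ hm _ hq => (Finset.le_sup (f := Prod.fst) hq).trans hm⟩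

theorem stronglyMeasurable_dyStep (c : (ℕ × ℕ) →₀ E) : StronglyMeasurable (dyStep c) := by
  obtain ⟨m, hm⟩ := exists_level c
  rw [dyStep_eq_stepFun c (hm m le_rfl)]
  exact stronglyMeasurable_stepFun _ _

variable {p : ℝ≥0∞}

/-- The samples of a dyadic step function as an element of `ℓ^p`. -/
def dySampleLp [Fact (1 ≤ p)] (hp : p ≠ ∞) (c : (ℕ × ℕ) →₀ E) (m : ℕ) :
    lp (fun _ : ℕ => E) p :=
  ⟨dySample c m, memℓp_of_finite_support hp (finite_support_dySample c m)⟩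

theorem eLpNorm_dyStep [Fact (1 ≤ p)] (hp : p ≠ ∞) (c : (ℕ × ℕ) →₀ E) {m : ℕ}
    (hm : ∀ q ∈ c.support, q.1 ≤ m) :
    eLpNorm (dyStep c) p (volume.restrict (Ioi 0)) =
      ENNReal.ofReal (dyMesh m ^ (1 / p.toReal)) * ‖dySampleLp hp c m‖ₑ := by
  rw [dyStep_eq_stepFun c hm]
  exact eLpNorm_stepFun hp (dyMesh_pos m) (dySampleLp hp c m)

theorem memLp_dyStep [Fact (1 ≤ p)] (hp : p ≠ ∞) (c : (ℕ × ℕ) →₀ E) :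
    MemLp (dyStep c) p (volume.restrict (Ioi 0)) := by
  obtain ⟨m, hm⟩ := exists_level c
  refine ⟨(stronglyMeasurable_dyStep c).aestronglyMeasurable, ?_⟩
  rw [eLpNorm_dyStep hp c (hm m le_rfl)]
  exact ENNReal.mul_lt_top (by simp) (by simp)

theorem stepLp_dySampleLp [Fact (1 ≤ p)] (hp : p ≠ ∞) (τ : ℝ≥0∞) (c : (ℕ × ℕ) →₀ E) {m : ℕ}
    (hm : ∀ q ∈ c.support, q.1 ≤ m) :
    stepLp hp (dyMesh_pos m) τ (dySampleLp hp c m) =ᵐ[timeMeasure τ] dyStep c := by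
  rw [dyStep_eq_stepFun c hm]
  exact stepLp_coe hp (dyMesh_pos m) τ (dySampleLp hp c m)

theorem exists_dyStep_close_of_continuous {g : ℝ → E} (hg : Continuous g)
    (hs : HasCompactSupport g) : ∃ R : ℝ, 0 < R ∧ ∀ ε : ℝ, 0 < ε → ∃ c : (ℕ × ℕ) →₀ E,
      ∀ t, 0 < t → ‖g t - dyStep c t‖ ≤ (Ioc 0 R).indicator (fun _ => ε) t := by
  obtain ⟨R₀, hR₀⟩ := hs.isCompact.isBounded.subset_closedBall 0
  obtain ⟨R, hR⟩ := exists_nat_gt (max R₀ 0)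
  have hR0 : (0 : ℝ) < R := (le_max_right _ _).trans_lt hR
  refine ⟨R, hR0, fun ε hε => ?_⟩
  have hu := hs.uniformContinuous_of_continuous hg
  obtain ⟨δ, hδ, hδ'⟩ := Metric.uniformContinuous_iff.1 hu ε hε
  obtain ⟨n, hn⟩ := (tendsto_dyMesh.eventually (gt_mem_nhds hδ)).exists
  have hh := dyMesh_pos n
  refine ⟨∑ k ∈ Finset.range (R * 2 ^ n), Finsupp.single (n, k) (g (((k : ℝ) + 1) * dyMesh n)),
    fun t ht => ?_⟩
  set k := cellIndex (dyMesh n) t with hk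
  have hmem : t ∈ cell (dyMesh n) k := mem_cell_cellIndex hh ht
  have hval : dyStep (∑ k ∈ Finset.range (R * 2 ^ n),
      Finsupp.single (n, k) (g (((k : ℝ) + 1) * dyMesh n))) t =
      if k < R * 2 ^ n then g (((k : ℝ) + 1) * dyMesh n) else 0 := by
    rw [dyStep, ← Finsupp.sum_finsetSum_index (fun q => by simp) fun q x y => by
      by_cases h : t ∈ cell (dyMesh q.1) q.2 <;> simp [h]]
    have : ∀ j ∈ Finset.range (R * 2 ^ n),
        ((Finsupp.single (n, j) (g (((j : ℝ) + 1) * dyMesh n))).sum fun q x =>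
          (cell (dyMesh q.1) q.2).indicator (fun _ => x) t) =
        if k = j then g (((j : ℝ) + 1) * dyMesh n) else 0 := by
      intro j _
      rw [Finsupp.sum_single_index (by simp)]
      by_cases hj : k = j
      · rw [if_pos hj, ← hj, indicator_of_mem hmem]
      · rw [if_neg hj, indicator_of_notMem]
        exact fun h => hj (((mem_cell_iff hh).1 h).2)
    rw [Finset.sum_congr rfl this, Finset.sum_ite_eq]
    simp
  rw [hval]
  have hRe : ((R * 2 ^ n : ℕ) : ℝ) * dyMesh n = R := by
    simp only [dyMesh]; push_cast; field_simp
  by_cases hkR : k < R * 2 ^ n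
  · have htR : t ≤ R := by
      rw [← hRe]
      refine hmem.2.trans ?_
      gcongr
      exact_mod_cast hkR
    rw [if_pos hkR, indicator_of_mem (show t ∈ Ioc 0 (R : ℝ) from ⟨ht, htR⟩), ← dist_eq_norm]
    refine (hδ' ?_).le
    rw [Real.dist_eq, abs_sub_comm, abs_of_nonneg (by linarith [hmem.2])]
    have := hmem.1
    linarith
  · have htR : (R : ℝ) < t := by
      rw [← hRe]
      refine lt_of_le_of_lt ?_ hmem.1
      gcongr
      omega
    have hz : g t = 0 := by
      by_contra h
      have := hR₀ (subset_tsupport g h)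
      rw [mem_closedBall_zero_iff, Real.norm_eq_abs, abs_of_pos ht] at this
      linarith [le_max_left R₀ 0]
    rw [if_neg hkR, hz, sub_zero, norm_zero]
    exact indicator_nonneg (fun _ _ => hε.le) _

/-- The dyadic step functions are dense in `L^p(0, ∞; E)`. -/
theorem exists_dyStep_close [hp1 : Fact (1 ≤ p)] (hp : p ≠ ∞) {f : ℝ → E}
    (hf : MemLp f p (volume.restrict (Ioi 0))) {ε : ℝ≥0∞} (hε : ε ≠ 0) :
    ∃ c : (ℕ × ℕ) →₀ E, eLpNorm (f - dyStep c) p (volume.restrict (Ioi 0)) ≤ ε := by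
  have hp0 : 1 ≤ p.toReal := one_le_toReal_of_fact hp
  have hε2 : ε / 2 ≠ 0 := by simp [hε]
  have hf' : MemLp ((Ioi 0).indicator f) p volume := (memLp_indicator_iff_restrict
    measurableSet_Ioi).2 hf
  obtain ⟨g, hgs, hg1, hgc, hgm⟩ := hf'.exists_hasCompactSupport_eLpNorm_sub_le hp hε2
  obtain ⟨R, hR, hc⟩ := exists_dyStep_close_of_continuous hgc hgs
  obtain ⟨η, hη, hη2⟩ : ∃ η : ℝ, 0 < η ∧
      ENNReal.ofReal η * ENNReal.ofReal R ^ (1 / p.toReal) ≤ ε / 2 := by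
    have ht : Tendsto (fun η : ℝ => ENNReal.ofReal η * ENNReal.ofReal R ^ (1 / p.toReal))
        (𝓝[>] 0) (𝓝 0) := by
      have h1 : Tendsto (fun η : ℝ => ENNReal.ofReal η) (𝓝[>] 0) (𝓝 0) := by
        have := (ENNReal.continuous_ofReal.tendsto 0).mono_left
          (nhdsWithin_le_nhds (s := Ioi (0 : ℝ)))
        simpa using this
      have := ENNReal.Tendsto.mul_const h1 (b := ENNReal.ofReal R ^ (1 / p.toReal))
        (Or.inr (ENNReal.rpow_ne_top_of_nonneg (by positivity) (by simp)))
      simpa using this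
    have h2 := (ht.eventually (gt_mem_nhds (pos_iff_ne_zero.2 hε2))).and self_mem_nhdsWithin
    obtain ⟨η, h3, h4⟩ := h2.exists
    exact ⟨η, h4, h3.le⟩
  obtain ⟨c, hcc⟩ := hc η hη
  refine ⟨c, ?_⟩
  have h1 : eLpNorm (f - g) p (volume.restrict (Ioi 0)) ≤ ε / 2 := by
    refine le_trans (le_of_eq ?_) ((eLpNorm_mono_measure _
      (Measure.restrict_le_self (s := Ioi 0))).trans hg1)
    refine eLpNorm_congr_ae ((ae_restrict_mem measurableSet_Ioi).mono fun t ht => ?_)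
    simp [indicator_of_mem ht]
  have h2 : eLpNorm (g - dyStep c) p (volume.restrict (Ioi 0)) ≤ ε / 2 := by
    calc eLpNorm (g - dyStep c) p (volume.restrict (Ioi 0))
        ≤ eLpNorm ((Ioc 0 R).indicator fun _ => η) p (volume.restrict (Ioi 0)) := by
          refine eLpNorm_mono_ae_real ((ae_restrict_mem measurableSet_Ioi).mono fun t ht => ?_)
          exact hcc t ht
      _ ≤ ‖η‖ₑ * (volume.restrict (Ioi 0)) (Ioc 0 R) ^ (1 / p.toReal) :=
          eLpNorm_indicator_const_le _ _
      _ ≤ ENNReal.ofReal η * ENNReal.ofReal R ^ (1 / p.toReal) := by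
          rw [Real.enorm_of_nonneg hη.le]
          gcongr
          refine (Measure.restrict_le_self _).trans ?_
          simp
      _ ≤ ε / 2 := hη2
  calc eLpNorm (f - dyStep c) p (volume.restrict (Ioi 0))
      = eLpNorm ((f - g) + (g - dyStep c)) p (volume.restrict (Ioi 0)) := by
        rw [sub_add_sub_cancel]
    _ ≤ _ := eLpNorm_add_le (hf.1.sub hgc.aestronglyMeasurable)
        (hgc.aestronglyMeasurable.sub (stronglyMeasurable_dyStep c).aestronglyMeasurable) hp1.out
    _ ≤ ε / 2 + ε / 2 := add_le_add h1 h2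
    _ = ε := ENNReal.add_halves ε

end Steps

/-! ### Solution families and their step responses -/

section SolutionFamilies

open Filter Topology

variable {E : Type v} [NormedAddCommGroup E] [NormedSpace ℂ E]

/-- A family `(T(t))_{t>0}` of linear maps such that `t ↦ ∫_0^t T(s) x ds` is a strong solution of
`u' + B u = x`, `u(0) = 0`; this is what the theory needs to know about a semigroup with generator
`-B`. -/
structure IsSolFamily (B : E →ₗ.[ℂ] E) (T : ℝ → E →ₗ[ℂ] E) : Prop where
  continuousOn : ∀ x, ContinuousOn (fun t => T t x) (Ioi 0)
  integrableOn : ∀ x t, IntegrableOn (fun s => T s x) (Ioc 0 t)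
  graph_mem : ∀ x t, 0 < t → (∫ s in Ioc 0 t, T s x, x - T t x) ∈ B.graph

/-- The `A`-part `x - T(t) x`, `t > 0`, of the solution of `u' + A u = x`, `u(0) = 0`. -/
def stepResp (T : ℝ → E →ₗ[ℂ] E) (x : E) (t : ℝ) : E := if 0 < t then x - T t x else 0

/-- The `A`-part of the solution of `u' + A u = f`, `u(0) = 0`, for the dyadic step function
`f = dyStep c`. -/
def dyResp (T : ℝ → E →ₗ[ℂ] E) (c : (ℕ × ℕ) →₀ E) (t : ℝ) : E :=
  c.sum fun q x => stepResp T x (t - q.2 * dyMesh q.1) - stepResp T x (t - (q.2 + 1) * dyMesh q.1)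

theorem stepResp_add (T : ℝ → E →ₗ[ℂ] E) (x y : E) (t : ℝ) :
    stepResp T (x + y) t = stepResp T x t + stepResp T y t := by
  simp only [stepResp]
  split_ifs
  · rw [map_add]; abel
  · simp

theorem stepResp_zero (T : ℝ → E →ₗ[ℂ] E) (t : ℝ) : stepResp T 0 t = 0 := by
  simp [stepResp]

theorem dyResp_add (T : ℝ → E →ₗ[ℂ] E) (c d : (ℕ × ℕ) →₀ E) :
    dyResp T (c + d) = dyResp T c + dyResp T d := by
  ext t
  simp only [dyResp, Pi.add_apply]
  refine Finsupp.sum_add_index' (fun q => by simp [stepResp_zero]) fun q x y => ?_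
  rw [stepResp_add, stepResp_add]; abel

theorem dyResp_sub (T : ℝ → E →ₗ[ℂ] E) (c d : (ℕ × ℕ) →₀ E) :
    dyResp T (c - d) = dyResp T c - dyResp T d := by
  have := dyResp_add T (c - d) d
  rw [sub_add_cancel] at this
  exact eq_sub_of_add_eq this.symm

theorem dyStep_single (n i : ℕ) (x : E) (t : ℝ) :
    dyStep (Finsupp.single (n, i) x) t = (cell (dyMesh n) i).indicator (fun _ => x) t :=
  Finsupp.sum_single_index (by simp)

theorem dyResp_single (T : ℝ → E →ₗ[ℂ] E) (n i : ℕ) (x : E) (t : ℝ) :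
    dyResp T (Finsupp.single (n, i) x) t =
      stepResp T x (t - i * dyMesh n) - stepResp T x (t - (i + 1) * dyMesh n) :=
  Finsupp.sum_single_index (by simp [stepResp_zero])

theorem continuousAt_stepResp {T : ℝ → E →ₗ[ℂ] E} {x : E}
    (hT : ContinuousOn (fun t => T t x) (Ioi 0)) {t : ℝ} (ht : t ≠ 0) :
    ContinuousAt (stepResp T x) t := by
  rcases lt_or_gt_of_ne ht with h | h
  · refine (continuousAt_const (y := (0 : E))).congr ?_
    filter_upwards [Iio_mem_nhds h] with s hs
    rw [stepResp, if_neg (not_lt.2 (le_of_lt hs))]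
  · refine ((continuousAt_const (y := x)).sub (hT.continuousAt (Ioi_mem_nhds h))).congr ?_
    filter_upwards [Ioi_mem_nhds h] with s hs
    rw [stepResp, if_pos (show 0 < s from hs)]; rfl

/-- The end points of the cells on which `c` is supported. -/
def nodes (c : (ℕ × ℕ) →₀ E) : Finset ℝ :=
  c.support.image (fun q => (q.2 : ℝ) * dyMesh q.1) ∪
    c.support.image fun q => ((q.2 : ℝ) + 1) * dyMesh q.1

theorem continuousAt_dyResp {T : ℝ → E →ₗ[ℂ] E}
    (hT : ∀ x, ContinuousOn (fun t => T t x) (Ioi 0)) (c : (ℕ × ℕ) →₀ E) {t : ℝ}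
    (ht : t ∉ nodes c) : ContinuousAt (dyResp T c) t := by
  refine tendsto_finsetSum _ fun q hq => ?_
  have h1 : t - q.2 * dyMesh q.1 ≠ 0 := fun h => ht (by
    rw [sub_eq_zero] at h
    exact Finset.mem_union_left _ (Finset.mem_image.2 ⟨q, hq, h.symm⟩))
  have h2 : t - (q.2 + 1) * dyMesh q.1 ≠ 0 := fun h => ht (by
    rw [sub_eq_zero] at h
    exact Finset.mem_union_right _ (Finset.mem_image.2 ⟨q, hq, h.symm⟩))
  have e1 := ContinuousAt.comp (f := fun s : ℝ => s - q.2 * dyMesh q.1)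
    (continuousAt_stepResp (hT (c q)) h1) (by fun_prop)
  have e2 := ContinuousAt.comp (f := fun s : ℝ => s - (q.2 + 1) * dyMesh q.1)
    (continuousAt_stepResp (hT (c q)) h2) (by fun_prop)
  exact e1.sub e2

theorem ae_notMem_nodes (c : (ℕ × ℕ) →₀ E) (τ : ℝ≥0∞) : ∀ᵐ t ∂(timeMeasure τ), t ∉ nodes c :=
  ae_restrict_of_ae ((nodes c).finite_toSet.countable.ae_notMem volume)

theorem aestronglyMeasurable_dyResp {T : ℝ → E →ₗ[ℂ] E}
    (hT : ∀ x, ContinuousOn (fun t => T t x) (Ioi 0)) (c : (ℕ × ℕ) →₀ E) (τ : ℝ≥0∞) :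
    AEStronglyMeasurable (dyResp T c) (timeMeasure τ) := by
  have h1 : ContinuousOn (dyResp T c) {t | t ∉ nodes c} := fun t ht =>
    (continuousAt_dyResp hT c ht).continuousWithinAt
  have hm : MeasurableSet {t : ℝ | t ∉ nodes c} := (nodes c).finite_toSet.measurableSet.compl
  have h2 := h1.aestronglyMeasurable (μ := timeMeasure τ) hm
  have h3 : (timeMeasure τ).restrict {t | t ∉ nodes c} = timeMeasure τ :=
    Measure.restrict_eq_self_of_ae_mem (ae_notMem_nodes c τ)
  rwa [h3] at h2

namespace IsSolFamily

variable {B : E →ₗ.[ℂ] E} {T : ℝ → E →ₗ[ℂ] E}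

theorem isStrongSolution_heaviside (hT : IsSolFamily B T) (τ : ℝ≥0∞) (x : E) {r : ℝ}
    (hr : 0 ≤ r) :
    IsStrongSolution B τ ((Ioi r).indicator fun _ => x) 0 (fun t => ∫ s in Ioc 0 (t - r), T s x)
      ((Ioi r).indicator fun t => T (t - r) x) (fun t => stepResp T x (t - r)) where
  deriv_integrableOn t ht := by
    rw [IntegrableOn, integrable_indicator_iff measurableSet_Ioi, IntegrableOn,
      Measure.restrict_restrict measurableSet_Ioi]
    rcases le_or_gt t r with h | h
    · have : Ioi r ∩ Ioc 0 t = ∅ := by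
        ext s; simp only [mem_inter_iff, mem_Ioi, mem_Ioc, mem_empty_iff_false, iff_false]
        intro hs; linarith [hs.1, hs.2.2]
      simp [this]
    · have h1 : IntervalIntegrable (fun s => T s x) volume 0 (t - r) :=
        (intervalIntegrable_iff_integrableOn_Ioc_of_le (by linarith)).2 (hT.integrableOn x _)
      have h2 := h1.comp_sub_right r
      rw [intervalIntegrable_iff_integrableOn_Ioc_of_le (by linarith)] at h2
      refine h2.mono_set fun s hs => ?_
      simp only [mem_inter_iff, mem_Ioi, mem_Ioc] at hs ⊢
      constructor <;> linarith [hs.1, hs.2.2]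
  eq_integral t ht := by
    rw [zero_add, intervalIntegral.integral_of_le ht.1, setIntegral_indicator measurableSet_Ioi]
    rcases le_or_gt t r with h | h
    · have : Ioc 0 t ∩ Ioi r = ∅ := by
        ext s; simp only [mem_inter_iff, mem_Ioi, mem_Ioc, mem_empty_iff_false, iff_false]
        intro hs; linarith [hs.1, hs.2, hs.1.2]
      rw [this, Ioc_eq_empty (by linarith)]
      simp
    · have : Ioc 0 t ∩ Ioi r = Ioc r t := by
        ext s; simp only [mem_inter_iff, mem_Ioi, mem_Ioc]
        constructor
        · intro hs; exact ⟨hs.2, hs.1.2⟩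
        · intro hs; exact ⟨⟨by linarith [hs.1], hs.2⟩, hs.1⟩
      rw [this, ← intervalIntegral.integral_of_le (by linarith),
        ← intervalIntegral.integral_of_le h.le,
        intervalIntegral.integral_comp_sub_right (fun s => T s x), sub_self]
  graph_mem := .of_forall fun t => by
    by_cases h : 0 < t - r
    · simp only [stepResp, if_pos h]
      exact hT.graph_mem x _ h
    · simp only [stepResp, if_neg h, Ioc_eq_empty h, Measure.restrict_empty,
        integral_zero_measure]
      exact B.graph.zero_mem
  equation := .of_forall fun t => by
    by_cases h : r < t
    · simp [stepResp, h]
    · simp [stepResp, h]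

theorem exists_isStrongSolution_dyResp (hT : IsSolFamily B T) (τ : ℝ≥0∞) (c : (ℕ × ℕ) →₀ E) :
    ∃ u du, IsStrongSolution B τ (dyStep c) 0 u du (dyResp T c) := by
  induction c using Finsupp.induction_linear with
  | zero =>
    refine ⟨0, 0, ?_⟩
    have h1 : dyStep (0 : (ℕ × ℕ) →₀ E) = 0 := by ext t; simp [dyStep]
    have h2 : dyResp T (0 : (ℕ × ℕ) →₀ E) = 0 := by ext t; simp [dyResp]
    rw [h1, h2]
    exact IsStrongSolution.zero
  | add c d hc hd =>
    obtain ⟨u, du, h1⟩ := hc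
    obtain ⟨w, dw, h2⟩ := hd
    refine ⟨u + w, du + dw, ?_⟩
    rw [dyStep_add, dyResp_add]
    simpa using h1.add h2
  | single q x =>
    obtain ⟨n, i⟩ := q
    have hh := dyMesh_pos n
    have h := (hT.isStrongSolution_heaviside τ x (r := i * dyMesh n) (by positivity)).sub
      (hT.isStrongSolution_heaviside τ x (r := (i + 1) * dyMesh n) (by positivity))
    have h1 : dyStep (Finsupp.single (n, i) x) = ((Ioi (i * dyMesh n)).indicator fun _ => x) -
        (Ioi ((i + 1) * dyMesh n)).indicator fun _ => x := by
      ext t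
      rw [dyStep_single, Pi.sub_apply, cell]
      by_cases h1 : (i : ℝ) * dyMesh n < t
      · by_cases h2 : ((i : ℝ) + 1) * dyMesh n < t
        · rw [indicator_of_notMem (fun h => absurd h.2 (not_le.2 h2)),
            indicator_of_mem (show t ∈ Ioi _ from h1), indicator_of_mem (show t ∈ Ioi _ from h2),
            sub_self]
        · rw [indicator_of_mem (show t ∈ Ioc _ _ from ⟨h1, not_lt.1 h2⟩),
            indicator_of_mem (show t ∈ Ioi _ from h1),
            indicator_of_notMem (show t ∉ Ioi _ from h2), sub_zero]
      · have h2 : ¬ ((i : ℝ) + 1) * dyMesh n < t := fun h => h1 (by nlinarith)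
        rw [indicator_of_notMem (fun h => absurd h.1 h1),
          indicator_of_notMem (show t ∉ Ioi _ from h1),
          indicator_of_notMem (show t ∉ Ioi _ from h2), sub_zero]
    have h2 : dyResp T (Finsupp.single (n, i) x) = (fun t => stepResp T x (t - i * dyMesh n)) -
        fun t => stepResp T x (t - (i + 1) * dyMesh n) := by
      ext t
      rw [dyResp_single]; rfl
    rw [h1, h2]
    rw [sub_zero] at h
    exact ⟨_, _, h⟩

end IsSolFamily

/-- Strong solutions of `u' + A u = f`, `u(0) = 0`, are unique. -/
def StrongUnique (A : E →ₗ.[ℂ] E) (τ : ℝ≥0∞) : Prop :=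
  ∀ u du Au : ℝ → E, IsStrongSolution A τ 0 0 u du Au → ∀ t ∈ timeIntervalZero τ, u t = 0

theorem StrongUnique.eqOn {A : E →ₗ.[ℂ] E} {τ : ℝ≥0∞} (h : StrongUnique A τ)
    {f u du Au w dw Aw : ℝ → E} (hu : IsStrongSolution A τ f 0 u du Au)
    (hw : IsStrongSolution A τ f 0 w dw Aw) : EqOn u w (timeIntervalZero τ) := fun t ht =>
  sub_eq_zero.1 (h _ _ _ (by simpa using hu.sub hw) t ht)

/-- The operator `K` on `L^p` maps dyadic step functions to their responses. -/
def ExtendsResp {p τ : ℝ≥0∞} [Fact (1 ≤ p)] (T : ℝ → E →ₗ[ℂ] E)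
    (K : Lp E p (timeMeasure τ) →L[ℂ] Lp E p (timeMeasure τ)) : Prop :=
  ∀ (c : (ℕ × ℕ) →₀ E) (f : Lp E p (timeMeasure τ)), f =ᵐ[timeMeasure τ] dyStep c →
    dyResp T c =ᵐ[timeMeasure τ] K f

theorem HasLpMaxReg.exists_extendsResp [CompleteSpace E] {A : E →ₗ.[ℂ] E} {p τ : ℝ≥0∞}
    [Fact (1 ≤ p)] (hA : HasLpMaxReg A p τ) (hu : StrongUnique A τ) {T : ℝ → E →ₗ[ℂ] E}
    (hT : IsSolFamily A T) :
    ∃ K : Lp E p (timeMeasure τ) →L[ℂ] Lp E p (timeMeasure τ), ExtendsResp T K := by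
  obtain ⟨K, hK⟩ := hA.exists_clm
  refine ⟨K, fun c f hf => ?_⟩
  obtain ⟨u, du, h1⟩ := hT.exists_isStrongSolution_dyResp τ c
  have h2 : IsStrongSolution A τ f 0 u du (dyResp T c) :=
    h1.congr hf.symm (fun _ _ => rfl) (ae_eq_refl _) (ae_eq_refl _)
  obtain ⟨w, ⟨dw, Aw, hw, -, hAw⟩, -⟩ := hA.2 f (Lp.memLp f)
  have h3 : dyResp T c =ᵐ[timeMeasure τ] Aw := h2.ae_eq_of_eqOn hw (hu.eqOn h2 hw)
  exact h3.trans (hK f w dw Aw hw hAw)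

theorem ExtendsResp.memLp {p τ : ℝ≥0∞} [Fact (1 ≤ p)] (hp : p ≠ ∞) {T : ℝ → E →ₗ[ℂ] E}
    {K : Lp E p (timeMeasure τ) →L[ℂ] Lp E p (timeMeasure τ)} (hK : ExtendsResp T K)
    (c : (ℕ × ℕ) →₀ E) : MemLp (dyResp T c) p (timeMeasure τ) := by
  have h := (memLp_dyStep hp c).mono_measure (timeMeasure_le τ)
  exact (Lp.memLp _).ae_eq (hK c (h.toLp _) h.coeFn_toLp).symm

theorem ExtendsResp.discretize_apply {p τ : ℝ≥0∞} [Fact (1 ≤ p)] (hp : p ≠ ∞)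
    {T : ℝ → E →ₗ[ℂ] E} {K : Lp E p (timeMeasure τ) →L[ℂ] Lp E p (timeMeasure τ)}
    (hK : ExtendsResp T K) (c : (ℕ × ℕ) →₀ E) {m : ℕ} (hm : ∀ q ∈ c.support, q.1 ≤ m) (k : ℕ) :
    discretize hp (dyMesh_pos m) K (dySampleLp hp c m) k = cellAvg τ (dyMesh m) (dyResp T c) k :=
  MaxReg.discretize_apply hp _ K _ (hK c _ (stepLp_dySampleLp hp τ c hm)) k

theorem dySampleLp_single {p : ℝ≥0∞} [Fact (1 ≤ p)] (hp : p ≠ ∞) (m j : ℕ) (x : E) :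
    dySampleLp hp (Finsupp.single (m, j) x) m = lp.single p j x := by
  refine lp.ext (funext fun k => ?_)
  change dySample (Finsupp.single (m, j) x) m k = _
  have hk : ((k : ℝ) + 1) * dyMesh m ∈ cell (dyMesh m) k :=
    ⟨by nlinarith [dyMesh_pos m], le_rfl⟩
  rw [dySample, dyStep_single]
  by_cases h : k = j
  · subst h
    rw [indicator_of_mem hk, lp.single_apply_self]
  · rw [lp.single_apply_ne _ _ _ h, indicator_of_notMem]
    intro h'
    exact h (((mem_cell_iff (dyMesh_pos m)).1 hk).2.symm.trans
      ((mem_cell_iff (dyMesh_pos m)).1 h').2)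

end SolutionFamilies

/-! ### Transference to interpolation spaces -/

section Transference

open Filter Topology

/-- Integrals of consistent functions are consistent. The target space need not be locally convex,
so that the integral cannot be moved there. -/
theorem map_integral_eq_zero {α : Type*} [MeasurableSpace α] {μ : Measure α} {G Z : Type*}
    [NormedAddCommGroup G] [NormedSpace ℂ G] [CompleteSpace G] [AddCommGroup Z] [Module ℂ Z]
    [TopologicalSpace Z] [T2Space Z] (L : G →L[ℂ] Z) {f : α → G} (hf : Integrable f μ)
    (h : ∀ᵐ t ∂μ, L (f t) = 0) : L (∫ t, f t ∂μ) = 0 := by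
  let N : Submodule ℂ G := LinearMap.ker (L : G →ₗ[ℂ] Z)
  have hN : IsClosed (N : Set G) := L.isClosed_ker
  have : IsClosed (N : Set G) := hN
  let Q : G →L[ℂ] G ⧸ N := N.mkQL
  have h1 : Q (∫ t, f t ∂μ) = 0 := by
    rw [← Q.integral_comp_comm hf]
    refine integral_eq_zero_of_ae (h.mono fun t ht => ?_)
    exact (Submodule.Quotient.mk_eq_zero N).2 ht
  exact (Submodule.Quotient.mk_eq_zero N).1 h1

variable {C : BanachCouple.{u}}

theorem map_integral_eq {α : Type*} [MeasurableSpace α] {μ : Measure α} {f₀ : α → C.X₀}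
    {f₁ : α → C.X₁} (h₀ : Integrable f₀ μ) (h₁ : Integrable f₁ μ)
    (h : ∀ᵐ t ∂μ, C.ι₀ (f₀ t) = C.ι₁ (f₁ t)) :
    C.ι₀ (∫ t, f₀ t ∂μ) = C.ι₁ (∫ t, f₁ t ∂μ) := by
  have := map_integral_eq_zero (C.ι₀.comp (ContinuousLinearMap.fst ℂ C.X₀ C.X₁) -
    C.ι₁.comp (ContinuousLinearMap.snd ℂ C.X₀ C.X₁)) (h₀.prodMk h₁)
    (h.mono fun t ht => by simp [ht])
  rw [← sub_eq_zero]
  simpa [fst_integral (h₀.prodMk h₁), snd_integral (h₀.prodMk h₁)] using this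

variable {E : Type u} [NormedAddCommGroup E] [NormedSpace ℂ E] [CompleteSpace E]

theorem map_integral_eq_add {α : Type*} [MeasurableSpace α] {μ : Measure α} (ι : E →L[ℂ] C.Z)
    {f : α → E} {f₀ : α → C.X₀} {f₁ : α → C.X₁} (hf : Integrable f μ) (h₀ : Integrable f₀ μ)
    (h₁ : Integrable f₁ μ) (h : ∀ᵐ t ∂μ, ι (f t) = C.ι₀ (f₀ t) + C.ι₁ (f₁ t)) :
    ι (∫ t, f t ∂μ) = C.ι₀ (∫ t, f₀ t ∂μ) + C.ι₁ (∫ t, f₁ t ∂μ) := by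
  have hi := hf.prodMk (h₀.prodMk h₁)
  have := map_integral_eq_zero (ι.comp (ContinuousLinearMap.fst ℂ E (C.X₀ × C.X₁)) -
    ((C.ι₀.comp (ContinuousLinearMap.fst ℂ C.X₀ C.X₁) +
    C.ι₁.comp (ContinuousLinearMap.snd ℂ C.X₀ C.X₁)).comp
      (ContinuousLinearMap.snd ℂ E (C.X₀ × C.X₁)))) hi
    (h.mono fun t ht => by simp [ht])
  rw [← sub_eq_zero]
  simpa [fst_integral hi, snd_integral hi, fst_integral (h₀.prodMk h₁),
    snd_integral (h₀.prodMk h₁)] using this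

variable {p : ℝ≥0∞} [Fact (1 ≤ p)]

/-- The space `E`, embedded in the ambient space of the couple, has the interpolation property for
morphisms of the couple `(ℓ^p(X₀), ℓ^p(X₁))` and the space `ℓ^p(E)`, with a uniform bound. It
suffices to consider sequences of finite support. -/
def LpStable (p : ℝ≥0∞) [Fact (1 ≤ p)] (C : BanachCouple.{u}) (ι : E →L[ℂ] C.Z) : Prop :=
  ∃ κ : ℝ, 0 ≤ κ ∧ ∀ (S₀ : lp (fun _ : ℕ => C.X₀) p →L[ℂ] lp (fun _ : ℕ => C.X₀) p)
    (S₁ : lp (fun _ : ℕ => C.X₁) p →L[ℂ] lp (fun _ : ℕ => C.X₁) p),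
    (∀ a b, (∀ n, C.ι₀ (a n) = C.ι₁ (b n)) → ∀ n, C.ι₀ (S₀ a n) = C.ι₁ (S₁ b n)) →
    ∀ (x : lp (fun _ : ℕ => E) p) (a : lp (fun _ : ℕ => C.X₀) p) (b : lp (fun _ : ℕ => C.X₁) p),
      (Function.support (x : ℕ → E)).Finite → (∀ n, ι (x n) = C.ι₀ (a n) + C.ι₁ (b n)) →
      ∃ z : lp (fun _ : ℕ => E) p, ‖z‖ ≤ κ * max ‖S₀‖ ‖S₁‖ * ‖x‖ ∧
        ∀ n, ι (z n) = C.ι₀ (S₀ a n) + C.ι₁ (S₁ b n)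

theorem dyStep_decomp (ι : E →L[ℂ] C.Z) {d₀ : E → C.X₀} {d₁ : E → C.X₁} (z₀ : d₀ 0 = 0)
    (z₁ : d₁ 0 = 0) (hd : ∀ x, ι x = C.ι₀ (d₀ x) + C.ι₁ (d₁ x)) (c : (ℕ × ℕ) →₀ E) (t : ℝ) :
    ι (dyStep c t) = C.ι₀ (dyStep (c.mapRange d₀ z₀) t) + C.ι₁ (dyStep (c.mapRange d₁ z₁) t) := by
  simp only [dyStep]
  rw [Finsupp.sum_mapRange_index (fun q => by simp), Finsupp.sum_mapRange_index (fun q => by simp)]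
  simp only [Finsupp.sum, map_sum]
  rw [← Finset.sum_add_distrib]
  refine Finset.sum_congr rfl fun q _ => ?_
  by_cases h : t ∈ cell (dyMesh q.1) q.2 <;> simp [h, hd, z₀, z₁]

theorem stepResp_decomp (ι : E →L[ℂ] C.Z) {T : ℝ → E →ₗ[ℂ] E} {T₀ : ℝ → C.X₀ →ₗ[ℂ] C.X₀}
    {T₁ : ℝ → C.X₁ →ₗ[ℂ] C.X₁} (hT : ∀ x a b, ι x = C.ι₀ a + C.ι₁ b → ∀ t, 0 < t →
      ι (T t x) = C.ι₀ (T₀ t a) + C.ι₁ (T₁ t b)) {x : E} {a : C.X₀} {b : C.X₁}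
    (h : ι x = C.ι₀ a + C.ι₁ b) (t : ℝ) :
    ι (stepResp T x t) = C.ι₀ (stepResp T₀ a t) + C.ι₁ (stepResp T₁ b t) := by
  simp only [stepResp]
  split_ifs with ht
  · rw [map_sub, map_sub, map_sub, h, hT x a b h t ht]; abel
  · simp

theorem dyResp_decomp (ι : E →L[ℂ] C.Z) {T : ℝ → E →ₗ[ℂ] E} {T₀ : ℝ → C.X₀ →ₗ[ℂ] C.X₀}
    {T₁ : ℝ → C.X₁ →ₗ[ℂ] C.X₁} (hT : ∀ x a b, ι x = C.ι₀ a + C.ι₁ b → ∀ t, 0 < t →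
      ι (T t x) = C.ι₀ (T₀ t a) + C.ι₁ (T₁ t b))
    {d₀ : E → C.X₀} {d₁ : E → C.X₁} (z₀ : d₀ 0 = 0)
    (z₁ : d₁ 0 = 0) (hd : ∀ x, ι x = C.ι₀ (d₀ x) + C.ι₁ (d₁ x)) (c : (ℕ × ℕ) →₀ E) (t : ℝ) :
    ι (dyResp T c t) =
      C.ι₀ (dyResp T₀ (c.mapRange d₀ z₀) t) + C.ι₁ (dyResp T₁ (c.mapRange d₁ z₁) t) := by
  simp only [dyResp]
  rw [Finsupp.sum_mapRange_index (fun q => by simp [stepResp_zero]),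
    Finsupp.sum_mapRange_index (fun q => by simp [stepResp_zero])]
  simp only [Finsupp.sum, map_sum]
  rw [← Finset.sum_add_distrib]
  refine Finset.sum_congr rfl fun q _ => ?_
  simp only [map_sub, stepResp_decomp ι hT (hd (c q))]
  abel

theorem consistent_discretize (hp : p ≠ ∞) {τ : ℝ≥0∞} {T₀ : ℝ → C.X₀ →ₗ[ℂ] C.X₀}
    {T₁ : ℝ → C.X₁ →ₗ[ℂ] C.X₁}
    (hT : ∀ a b, C.ι₀ a = C.ι₁ b → ∀ t, 0 < t → C.ι₀ (T₀ t a) = C.ι₁ (T₁ t b))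
    {K₀ : Lp C.X₀ p (timeMeasure τ) →L[ℂ] Lp C.X₀ p (timeMeasure τ)}
    {K₁ : Lp C.X₁ p (timeMeasure τ) →L[ℂ] Lp C.X₁ p (timeMeasure τ)}
    (hK₀ : ExtendsResp T₀ K₀) (hK₁ : ExtendsResp T₁ K₁) (m : ℕ)
    (a : lp (fun _ : ℕ => C.X₀) p) (b : lp (fun _ : ℕ => C.X₁) p)
    (hab : ∀ n, C.ι₀ (a n) = C.ι₁ (b n)) (n : ℕ) :
    C.ι₀ (discretize hp (dyMesh_pos m) K₀ a n) = C.ι₁ (discretize hp (dyMesh_pos m) K₁ b n) := by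
  have h0 := ((lp.evalCLM ℂ (fun _ : ℕ => C.X₀) p n).hasSum
    ((discretize hp (dyMesh_pos m) K₀).hasSum (lp.hasSum_single hp a)))
  have h1 := ((lp.evalCLM ℂ (fun _ : ℕ => C.X₁) p n).hasSum
    ((discretize hp (dyMesh_pos m) K₁).hasSum (lp.hasSum_single hp b)))
  refine (C.ι₀.hasSum h0).unique ?_
  change HasSum _ (C.ι₁ (lp.evalCLM ℂ (fun _ : ℕ => C.X₁) p n
    (discretize hp (dyMesh_pos m) K₁ b)))
  convert C.ι₁.hasSum h1 using 2 with j
  have hs : ∀ {Y : Type u} [NormedAddCommGroup Y] (y : Y),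
      ∀ q ∈ (Finsupp.single (m, j) y).support, q.1 ≤ m := fun y q hq => by
    have := Finsupp.support_single_subset hq
    rw [Finset.mem_singleton] at this
    simp [this]
  change C.ι₀ (discretize hp (dyMesh_pos m) K₀ (lp.single p j (a j)) n) =
    C.ι₁ (discretize hp (dyMesh_pos m) K₁ (lp.single p j (b j)) n)
  rw [← dySampleLp_single hp, ← dySampleLp_single hp, hK₀.discretize_apply hp _ (hs _),
    hK₁.discretize_apply hp _ (hs _), cellAvg, cellAvg, ← Complex.coe_smul, ← Complex.coe_smul,
    map_smul, map_smul, map_integral_eq (integrable_cell (hK₀.memLp hp _) _ _)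
      (integrable_cell (hK₁.memLp hp _) _ _)]
  refine .of_forall fun t => ?_
  have hr : ∀ t, C.ι₀ (stepResp T₀ (a j) t) = C.ι₁ (stepResp T₁ (b j) t) := fun t => by
    simp only [stepResp]
    split_ifs with ht
    · rw [map_sub, map_sub, hab j, hT _ _ (hab j) t ht]
    · simp
  rw [dyResp_single, dyResp_single, map_sub, map_sub, hr, hr]

/-- The average over a cell is as close to `y` as the function is on the cell. -/
theorem norm_cellAvg_sub_le {F : Type*} [NormedAddCommGroup F] [NormedSpace ℂ F] [CompleteSpace F]
    {τ : ℝ≥0∞} {h : ℝ} (hh : 0 < h) {g : ℝ → F} {k : ℕ}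
    (hτ : cell h k ⊆ timeInterval τ) (hg : IntegrableOn g (cell h k)) {y : F} {ε : ℝ}
    (hε : ∀ s ∈ cell h k, ‖g s - y‖ ≤ ε) : ‖cellAvg τ h g k - y‖ ≤ ε := by
  have h1 : (timeMeasure τ).restrict (cell h k) = volume.restrict (cell h k) := by
    rw [timeMeasure, Measure.restrict_restrict (measurableSet_cell h k),
      inter_eq_self_of_subset_left hτ]
  have hv : volume.real (cell h k) = h := by
    rw [Measure.real, volume_cell, ENNReal.toReal_ofReal hh.le]
  have h2 : cellAvg τ h g k - y = h⁻¹ • ∫ s in cell h k, (g s - y) := by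
    rw [cellAvg, h1, integral_sub hg (integrableOn_const (by rw [volume_cell]; simp)),
      setIntegral_const, hv, smul_sub, smul_smul, inv_mul_cancel₀ hh.ne', one_smul]
  have h3 := norm_setIntegral_le_of_norm_le_const (f := fun s => g s - y) (μ := volume)
    (by rw [volume_cell]; simp) hε
  rw [h2, norm_smul, Real.norm_of_nonneg (by positivity)]
  rw [hv] at h3
  calc h⁻¹ * ‖∫ s in cell h k, (g s - y)‖ ≤ h⁻¹ * (ε * h) := by gcongr
    _ = ε := by field_simp

/-- The `L^p`-estimates for the responses in `X₀` and `X₁` carry over to `E`: the discretizations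
of the solution operators are interpolated, and the mesh tends to `0`. -/
theorem exists_dyResp_bound (hp : p ≠ ∞) {τ : ℝ≥0∞} (ι : E →L[ℂ] C.Z)
    (hι : Function.Injective ι) (hdec : ∀ x, ∃ a b, ι x = C.ι₀ a + C.ι₁ b)
    (hst : LpStable p C ι) {T : ℝ → E →ₗ[ℂ] E} {T₀ : ℝ → C.X₀ →ₗ[ℂ] C.X₀}
    {T₁ : ℝ → C.X₁ →ₗ[ℂ] C.X₁}
    (hT : ∀ x a b, ι x = C.ι₀ a + C.ι₁ b → ∀ t, 0 < t →
      ι (T t x) = C.ι₀ (T₀ t a) + C.ι₁ (T₁ t b))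
    (hT' : ∀ a b, C.ι₀ a = C.ι₁ b → ∀ t, 0 < t → C.ι₀ (T₀ t a) = C.ι₁ (T₁ t b))
    (hcont : ∀ x, ContinuousOn (fun t => T t x) (Ioi 0))
    {K₀ : Lp C.X₀ p (timeMeasure τ) →L[ℂ] Lp C.X₀ p (timeMeasure τ)}
    {K₁ : Lp C.X₁ p (timeMeasure τ) →L[ℂ] Lp C.X₁ p (timeMeasure τ)}
    (hK₀ : ExtendsResp T₀ K₀) (hK₁ : ExtendsResp T₁ K₁) :
    ∃ κ : ℝ, 0 ≤ κ ∧ ∀ c : (ℕ × ℕ) →₀ E, eLpNorm (dyResp T c) p (timeMeasure τ) ≤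
      ENNReal.ofReal κ * eLpNorm (dyStep c) p (volume.restrict (Ioi 0)) := by
  obtain ⟨κ, hκ, hst⟩ := hst
  refine ⟨κ * max ‖K₀‖ ‖K₁‖, by positivity, fun c => ?_⟩
  -- A decomposition which sends `0` to `0`, so that it can be applied to the coefficients of a step
  -- function.
  have hdec' : ∀ x, ∃ ab : C.X₀ × C.X₁, ι x = C.ι₀ ab.1 + C.ι₁ ab.2 ∧ (x = 0 → ab = 0) := by
    intro x
    rcases eq_or_ne x 0 with rfl | hx
    · exact ⟨0, by simp, fun _ => rfl⟩
    · obtain ⟨a, b, hab⟩ := hdec x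
      exact ⟨(a, b), hab, fun h => absurd h hx⟩
  choose d hd hd0 using hdec'
  have z₀ : (d 0).1 = 0 := by rw [hd0 0 rfl]; rfl
  have z₁ : (d 0).2 = 0 := by rw [hd0 0 rfl]; rfl
  set α := c.mapRange (fun x => (d x).1) z₀ with hα
  set β := c.mapRange (fun x => (d x).2) z₁ with hβ
  obtain ⟨m₀, hm₀⟩ := exists_level c
  have hmα : ∀ m, m₀ ≤ m → ∀ q ∈ α.support, q.1 ≤ m := fun m hm q hq =>
    hm₀ m hm q (Finsupp.support_mapRange hq)
  have hmβ : ∀ m, m₀ ≤ m → ∀ q ∈ β.support, q.1 ≤ m := fun m hm q hq =>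
    hm₀ m hm q (Finsupp.support_mapRange hq)
  -- For meshes finer than all cells of the step function, interpolate the discretized operators.
  have hz : ∀ m, ∃ z : lp (fun _ : ℕ => E) p, m₀ ≤ m →
      ‖z‖ ≤ κ * max ‖K₀‖ ‖K₁‖ * ‖dySampleLp hp c m‖ ∧
      ∀ n, ι (z n) = C.ι₀ (cellAvg τ (dyMesh m) (dyResp T₀ α) n) +
        C.ι₁ (cellAvg τ (dyMesh m) (dyResp T₁ β) n) := by
    intro m
    by_cases hm : m₀ ≤ m
    · obtain ⟨z, hz1, hz2⟩ := hst (discretize hp (dyMesh_pos m) K₀)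
        (discretize hp (dyMesh_pos m) K₁) (consistent_discretize hp hT' hK₀ hK₁ m)
        (dySampleLp hp c m) (dySampleLp hp α m) (dySampleLp hp β m)
        (finite_support_dySample c m) fun n => dyStep_decomp ι z₀ z₁ hd c _
      refine ⟨z, fun _ => ⟨hz1.trans ?_, fun n => ?_⟩⟩
      · gcongr
        · exact norm_discretize_le hp _ K₀
        · exact norm_discretize_le hp _ K₁
      · rw [hz2 n, hK₀.discretize_apply hp α (hmα m hm), hK₁.discretize_apply hp β (hmβ m hm)]
    · exact ⟨0, fun h => absurd h hm⟩
  choose z hz using hz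
  -- Away from the nodes the response is continuous, so its averages over shrinking cells converge.
  have hlim : ∀ᵐ t ∂(timeMeasure τ), Tendsto (fun n => stepFun (dyMesh (n + m₀)) (z (n + m₀)) t)
      atTop (𝓝 (dyResp T c t)) := by
    filter_upwards [ae_notMem_nodes c τ, ae_timeMeasure_of_mem (τ := τ) fun t ht => ht]
      with t ht1 ht2
    have hop : IsOpen ({s | s ∉ nodes c} ∩ timeInterval τ) := by
      refine (nodes c).finite_toSet.isClosed.isOpen_compl.inter ?_
      exact isOpen_Ioi.inter (isOpen_lt ENNReal.continuous_ofReal continuous_const)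
    obtain ⟨δ₁, hδ₁, hball⟩ := Metric.isOpen_iff.1 hop t ⟨ht1, ht2⟩
    rw [Metric.tendsto_atTop]
    intro ε hε
    obtain ⟨δ₂, hδ₂, hclose⟩ := Metric.continuousAt_iff.1 (continuousAt_dyResp hcont c ht1)
      (ε / 2) (half_pos hε)
    obtain ⟨N, hN⟩ := eventually_atTop.1
      (tendsto_dyMesh.eventually (gt_mem_nhds (lt_min hδ₁ hδ₂)))
    refine ⟨N, fun n hn => ?_⟩
    have hh := hN (n + m₀) (by omega)
    have hpos := dyMesh_pos (n + m₀)
    set h := dyMesh (n + m₀) with hdef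
    set k := cellIndex h t with hk
    have htk : t ∈ cell h k := mem_cell_cellIndex hpos ht2.1
    have hIcc : ∀ s ∈ Icc (k * h) ((k + 1) * h), dist s t < min δ₁ δ₂ := fun s hs => by
      refine lt_of_le_of_lt ?_ hh
      rw [Real.dist_eq, abs_le]
      constructor <;> linarith [hs.1, hs.2, htk.1, htk.2]
    have hcell : ∀ s ∈ cell h k, dist s t < min δ₁ δ₂ := fun s hs => hIcc s ⟨hs.1.le, hs.2⟩
    have hint : IntegrableOn (dyResp T c) (cell h k) := by
      refine IntegrableOn.mono_set (ContinuousOn.integrableOn_Icc fun s hs => ?_)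
        Ioc_subset_Icc_self
      refine (continuousAt_dyResp hcont c ?_).continuousWithinAt
      exact (hball (Metric.mem_ball.2 ((hIcc s hs).trans_le (min_le_left _ _)))).1
    have hsub : cell h k ⊆ timeInterval τ := fun s hs =>
      (hball (Metric.mem_ball.2 ((hcell s hs).trans_le (min_le_left _ _)))).2
    have hzk : z (n + m₀) k = cellAvg τ h (dyResp T c) k := by
      apply hι
      have hint' : Integrable (dyResp T c) ((timeMeasure τ).restrict (cell h k)) :=
        IntegrableOn.mono_measure hint Measure.restrict_le_self
      rw [(hz (n + m₀) (by omega)).2 k, cellAvg, cellAvg, cellAvg, ← Complex.coe_smul,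
        ← Complex.coe_smul, ← Complex.coe_smul, map_smul, map_smul, map_smul,
        map_integral_eq_add ι hint' (integrable_cell (hK₀.memLp hp α) _ _)
        (integrable_cell (hK₁.memLp hp β) _ _), smul_add]
      exact .of_forall fun s => dyResp_decomp ι hT z₀ z₁ hd c s
    rw [stepFun_of_mem hpos htk, hzk, dist_eq_norm]
    refine (norm_cellAvg_sub_le hpos hsub hint fun s hs => ?_).trans_lt (half_lt_self hε)
    rw [← dist_eq_norm]
    exact (hclose ((hcell s hs).trans_le (min_le_right _ _))).le
  refine (Lp.eLpNorm_lim_le_liminf_eLpNorm (fun n =>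
    (stronglyMeasurable_stepFun _ _).aestronglyMeasurable) _ hlim).trans ?_
  refine (liminf_le_liminf (v := fun _ => ENNReal.ofReal (κ * max ‖K₀‖ ‖K₁‖) *
    eLpNorm (dyStep c) p (volume.restrict (Ioi 0))) (.of_forall fun n => ?_)).trans
    (le_of_eq (liminf_const _))
  calc eLpNorm (stepFun (dyMesh (n + m₀)) (z (n + m₀))) p (timeMeasure τ)
      ≤ eLpNorm (stepFun (dyMesh (n + m₀)) (z (n + m₀))) p (volume.restrict (Ioi 0)) :=
        eLpNorm_mono_measure _ (timeMeasure_le τ)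
    _ = ENNReal.ofReal (dyMesh (n + m₀) ^ (1 / p.toReal)) * ‖z (n + m₀)‖ₑ :=
        eLpNorm_stepFun hp (dyMesh_pos _) _
    _ ≤ ENNReal.ofReal (dyMesh (n + m₀) ^ (1 / p.toReal)) *
        (ENNReal.ofReal (κ * max ‖K₀‖ ‖K₁‖) * ‖dySampleLp hp c (n + m₀)‖ₑ) := by
        gcongr
        rw [← ofReal_norm, ← ofReal_norm, ← ENNReal.ofReal_mul (by positivity)]
        exact ENNReal.ofReal_le_ofReal (hz (n + m₀) (by omega)).1
    _ = _ := by
        rw [eLpNorm_dyStep hp c (hm₀ (n + m₀) (by omega))]; ring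

end Transference

/-! ### Maximal regularity from estimates for dyadic step functions -/

section Existence

open Filter Topology

variable {E : Type v} [NormedAddCommGroup E] [NormedSpace ℂ E] [CompleteSpace E]
  {B : E →ₗ.[ℂ] E} {T : ℝ → E →ₗ[ℂ] E} {p τ : ℝ≥0∞}

theorem exists_isLpSolution_of_bound [hp1 : Fact (1 ≤ p)] (hp : p ≠ ∞) (hB : B.IsClosed)
    (hT : IsSolFamily B T) {κ : ℝ} (hκ : ∀ c : (ℕ × ℕ) →₀ E,
      eLpNorm (dyResp T c) p (timeMeasure τ) ≤
        ENNReal.ofReal κ * eLpNorm (dyStep c) p (volume.restrict (Ioi 0)))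
    {f : ℝ → E} (hf : MemLp f p (timeMeasure τ)) : ∃ u, IsLpSolution B p τ f u := by
  set f' : ℝ → E := (timeInterval τ).indicator f with hf'
  have hmτ := measurableSet_timeInterval τ
  have hff' : f' =ᵐ[timeMeasure τ] f :=
    ae_timeMeasure_of_mem fun t ht => indicator_of_mem ht f
  have hLp' : MemLp f' p (volume.restrict (Ioi 0)) := by
    refine (memLp_indicator_iff_restrict hmτ).2 ?_
    rwa [Measure.restrict_restrict hmτ, inter_eq_self_of_subset_left (timeInterval_subset_Ioi τ)]
  obtain ⟨ε, hε, hεlim⟩ : ∃ ε : ℕ → ℝ≥0∞, (∀ n, ε n ≠ 0) ∧ Tendsto ε atTop (𝓝 0) :=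
    ⟨fun n => (n : ℝ≥0∞)⁻¹, fun n => by simp, ENNReal.tendsto_inv_nat_nhds_zero⟩
  choose c hc using fun n => exists_dyStep_close hp hLp' (hε n)
  have hstep : ∀ n, MemLp (dyStep (c n)) p (timeMeasure τ) := fun n =>
    (memLp_dyStep hp (c n)).mono_measure (timeMeasure_le τ)
  have hresp : ∀ d : (ℕ × ℕ) →₀ E, MemLp (dyResp T d) p (timeMeasure τ) := fun d =>
    ⟨aestronglyMeasurable_dyResp hT.continuousOn d τ, (hκ d).trans_lt
      (ENNReal.mul_lt_top (by simp) (memLp_dyStep hp d).2)⟩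
  have hdiff : ∀ n m, eLpNorm (dyResp T (c n) - dyResp T (c m)) p (timeMeasure τ) ≤
      ENNReal.ofReal κ * (ε n + ε m) := by
    intro n m
    rw [← dyResp_sub]
    refine (hκ _).trans ?_
    gcongr
    rw [dyStep_sub]
    calc eLpNorm (dyStep (c n) - dyStep (c m)) p (volume.restrict (Ioi 0))
        = eLpNorm ((f' - dyStep (c m)) - (f' - dyStep (c n))) p (volume.restrict (Ioi 0)) := by
          rw [sub_sub_sub_cancel_left]
      _ ≤ _ := eLpNorm_sub_le (hLp'.sub (memLp_dyStep hp _)).1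
          (hLp'.sub (memLp_dyStep hp _)).1 hp1.out
      _ ≤ ε n + ε m := by rw [add_comm]; exact add_le_add (hc n) (hc m)
  have hcau : CauchySeq fun n => (hresp (c n)).toLp := by
    rw [EMetric.cauchySeq_iff]
    intro η hη
    have hlim : Tendsto (fun q : ℕ × ℕ => ENNReal.ofReal κ * (ε q.1 + ε q.2)) atTop (𝓝 0) := by
      rw [← prod_atTop_atTop_eq]
      have := ENNReal.Tendsto.const_mul (a := ENNReal.ofReal κ)
        ((hεlim.comp tendsto_fst).add (hεlim.comp tendsto_snd)) (Or.inr (by simp))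
      simpa using this
    obtain ⟨⟨N, M⟩, hN⟩ := eventually_atTop.1 (hlim.eventually (gt_mem_nhds hη))
    refine ⟨max N M, fun m hm n hn => lt_of_le_of_lt ?_
      (hN (m, n) ⟨(le_max_left _ _).trans hm, (le_max_right _ _).trans hn⟩)⟩
    rw [Lp.edist_toLp_toLp]
    exact hdiff m n
  obtain ⟨G, hG⟩ := cauchySeq_tendsto_of_complete hcau
  choose u du hu using fun n => hT.exists_isStrongSolution_dyResp τ (c n)
  have key := isStrongSolution_of_tendsto hB hp1.out hu hstep (fun n => hresp (c n)) hf
    (Lp.memLp G) (by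
      refine tendsto_of_tendsto_of_tendsto_of_le_of_le tendsto_const_nhds hεlim
        (fun _ => zero_le) fun n => ?_
      calc eLpNorm (dyStep (c n) - f) p (timeMeasure τ)
          = eLpNorm (f' - dyStep (c n)) p (timeMeasure τ) := by
            rw [eLpNorm_sub_comm]
            exact eLpNorm_congr_ae (hff'.symm.sub (ae_eq_refl _))
        _ ≤ _ := eLpNorm_mono_measure _ (timeMeasure_le τ)
        _ ≤ ε n := hc n) (by
      have h1 := (Lp.tendsto_Lp_iff_tendsto_eLpNorm' _ _).1 hG
      refine h1.congr fun n => eLpNorm_congr_ae ?_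
      filter_upwards [(hresp (c n)).coeFn_toLp] with t ht
      simp only [Pi.sub_apply, ht])
  exact ⟨_, key.isLpSolution hf (Lp.memLp G)⟩

theorem hasLpMaxReg_of_bound [Fact (1 ≤ p)] (hp : p ≠ ∞) (hB : B.IsClosed)
    (hu : StrongUnique B τ) (hT : IsSolFamily B T) {κ : ℝ} (hκ : ∀ c : (ℕ × ℕ) →₀ E,
      eLpNorm (dyResp T c) p (timeMeasure τ) ≤
        ENNReal.ofReal κ * eLpNorm (dyStep c) p (volume.restrict (Ioi 0))) :
    HasLpMaxReg B p τ := by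
  refine ⟨hB, fun f hf => ?_⟩
  obtain ⟨u, du, Au, h1, h2, h3⟩ := exists_isLpSolution_of_bound hp hB hT hκ hf
  refine ⟨u, ⟨du, Au, h1, h2, h3⟩, ?_⟩
  rintro w ⟨dw, Aw, k1, -, -⟩
  exact hu.eqOn k1 h1

end Existence

/-! ### Uniqueness of strong solutions -/

section Uniqueness

open Filter Topology

variable {E : Type v} [NormedAddCommGroup E] [NormedSpace ℂ E] [CompleteSpace E]

theorem hasDerivAt_integral_of_continuousOn {g : ℝ → E} {t T : ℝ} (ht : t ∈ Ioo 0 T)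
    (hi : IntervalIntegrable g volume 0 t) (hg : ContinuousOn g (Ioo 0 T)) :
    HasDerivAt (fun r => ∫ s in (0 : ℝ)..r, g s) (g t) t :=
  intervalIntegral.integral_hasDerivAt_right hi
    (hg.stronglyMeasurableAtFilter isOpen_Ioo t ht)
    (hg.continuousAt (isOpen_Ioo.mem_nhds ht))

theorem eqOn_zero_of_integral_eq_zero {g : ℝ → E} {T : ℝ} (hg : ContinuousOn g (Icc 0 T))
    (h : ∀ t ∈ Icc 0 T, ∫ s in (0 : ℝ)..t, g s = 0) : ∀ t ∈ Ioo 0 T, g t = 0 := by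
  intro t ht
  have hi : IntervalIntegrable g volume 0 t :=
    (hg.mono (by rw [uIcc_of_le ht.1.le]; exact Icc_subset_Icc_right ht.2.le)).intervalIntegrable
  have h1 := hasDerivAt_integral_of_continuousOn ht hi (hg.mono Ioo_subset_Icc_self)
  have h2 : HasDerivAt (fun r => ∫ s in (0 : ℝ)..r, g s) 0 t := by
    refine (hasDerivAt_const t (0 : E)).congr_of_eventuallyEq ?_
    filter_upwards [isOpen_Ioo.mem_nhds ht] with r hr using h r (Ioo_subset_Icc_self hr)
  exact h1.unique h2

theorem integral_mem_graph {α : Type*} [MeasurableSpace α] {μ : Measure α} {A : E →ₗ.[ℂ] E}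
    (hA : A.IsClosed) {f g : α → E} (hf : Integrable f μ) (hg : Integrable g μ)
    (h : ∀ᵐ t ∂μ, (f t, g t) ∈ A.graph) : (∫ t, f t ∂μ, ∫ t, g t ∂μ) ∈ A.graph := by
  have : IsClosed (A.graph : Set (E × E)) := hA
  have h1 := map_integral_eq_zero A.graph.mkQL (hf.prodMk hg)
    (h.mono fun t ht => (Submodule.Quotient.mk_eq_zero _).2 ht)
  have h2 := (Submodule.Quotient.mk_eq_zero A.graph).1 h1
  rwa [integral_pair hf hg] at h2

variable {B : E →ₗ.[ℂ] E} {τ : ℝ≥0∞} {f u du Bu : ℝ → E} {x : E}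

theorem IsStrongSolution.intervalIntegrable (h : IsStrongSolution B τ f x u du Bu) {t : ℝ}
    (ht : t ∈ timeIntervalZero τ) : IntervalIntegrable du volume 0 t :=
  (intervalIntegrable_iff_integrableOn_Ioc_of_le ht.1).2 (h.deriv_integrableOn t ht)

theorem IsStrongSolution.continuousOn (h : IsStrongSolution B τ f x u du Bu) {t : ℝ}
    (ht : t ∈ timeIntervalZero τ) : ContinuousOn u (Icc 0 t) := by
  have h1 : ContinuousOn (fun r => x + ∫ s in (0 : ℝ)..r, du s) (Icc 0 t) := by
    have := intervalIntegral.continuousOn_primitive_interval (a := 0) (b := t) (f := du)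
      (μ := volume) (by rw [uIcc_of_le ht.1, integrableOn_Icc_iff_integrableOn_Ioc]
                        exact h.deriv_integrableOn t ht)
    rw [uIcc_of_le ht.1] at this
    exact continuousOn_const.add this
  exact h1.congr fun s hs => h.eq_integral s (timeIntervalZero_of_le ht hs.1 hs.2)

theorem IsStrongSolution.apply_zero (h : IsStrongSolution B τ f x u du Bu) (hτ : 0 < τ) :
    u 0 = x := by
  rw [h.eq_integral 0 ⟨le_rfl, by simpa using hτ⟩]; simp

/-- The primitive of a strong solution of the homogeneous equation is a classical solution. -/
theorem IsStrongSolution.primitive_mem_graph (hB : B.IsClosed)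
    (h : IsStrongSolution B τ 0 0 u du Bu) {t : ℝ} (ht : t ∈ timeIntervalZero τ) :
    (∫ s in (0 : ℝ)..t, u s, -u t) ∈ B.graph := by
  have hu : IntegrableOn u (Ioc 0 t) :=
    (h.continuousOn ht).integrableOn_Icc.mono_set Ioc_subset_Icc_self
  have hB' : Bu =ᵐ[volume.restrict (Ioc 0 t)] fun s => -du s :=
    ae_mono (restrict_Ioc_le_timeMeasure ht) (h.equation.mono fun s hs => by
      rw [eq_neg_iff_add_eq_zero, add_comm]; exact hs)
  have h1 := integral_mem_graph hB hu ((h.deriv_integrableOn t ht).neg.congr hB'.symm)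
    (ae_mono (restrict_Ioc_le_timeMeasure ht) h.graph_mem)
  rw [integral_congr_ae hB', integral_neg] at h1
  rw [h.eq_integral t ht, zero_add, intervalIntegral.integral_of_le ht.1,
    intervalIntegral.integral_of_le ht.1]
  exact h1

theorem exists_gt_of_mem_timeIntervalZero {t : ℝ} (ht : t ∈ timeIntervalZero τ) :
    ∃ t' ∈ timeIntervalZero τ, t < t' := by
  have hop : IsOpen {s : ℝ | ENNReal.ofReal s < τ} :=
    isOpen_lt ENNReal.continuous_ofReal continuous_const
  obtain ⟨ε, hε, h⟩ := Metric.isOpen_iff.1 hop t ht.2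
  refine ⟨t + ε / 2, ⟨by linarith [ht.1], h ?_⟩, by linarith⟩
  rw [Metric.mem_ball, Real.dist_eq, add_sub_cancel_left, abs_of_pos (by linarith)]
  linarith

/-- If every classical solution of the homogeneous equation vanishes, then every strong one
does. -/
theorem strongUnique_of_primitive (hB : B.IsClosed)
    (h : ∀ (v : ℝ → E) (T : ℝ), ENNReal.ofReal T < τ → ContinuousOn v (Icc 0 T) →
      (∀ t ∈ Icc 0 T, (∫ s in (0 : ℝ)..t, v s, -v t) ∈ B.graph) →
      ∀ t ∈ Ioo 0 T, ∫ s in (0 : ℝ)..t, v s = 0) : StrongUnique B τ := by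
  intro u du Bu hu t ht
  obtain ⟨T, hT, htT⟩ := exists_gt_of_mem_timeIntervalZero ht
  obtain ⟨T', hT', hTT'⟩ := exists_gt_of_mem_timeIntervalZero hT
  rcases ht.1.eq_or_lt with rfl | ht0
  · exact hu.apply_zero (pos_of_gt ht.2)
  have h1 := h u T' hT'.2 (hu.continuousOn hT') fun s hs =>
    hu.primitive_mem_graph hB (timeIntervalZero_of_le hT' hs.1 hs.2)
  refine eqOn_zero_of_integral_eq_zero (hu.continuousOn hT) (fun s hs => ?_) t ⟨ht0, htT⟩
  rcases hs.1.eq_or_lt with rfl | hs0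
  · simp
  · exact h1 s ⟨hs0, hs.2.trans_lt hTT'⟩

/-- Uniqueness of strong solutions for an operator with a solution family which is continuous and
bounded in norm: for a classical solution `v` of the homogeneous equation, the derivative of
`Φ(t - s) v(s)`, `Φ(t) = ∫_0^t T`, is `-v(s)`. -/
theorem strongUnique_of_family (hB : B.IsClosed) {T : ℝ → E →L[ℂ] E}
    (hT : ContinuousOn T (Ioi 0)) (hTi : ∀ t, IntegrableOn T (Ioc 0 t))
    (hcomm : ∀ x y, (x, y) ∈ B.graph → ∀ t, 0 < t → ∫ s in Ioc 0 t, T s y = x - T t x) :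
    StrongUnique B τ := by
  refine strongUnique_of_primitive hB fun v b _ hv hgr => ?_
  set V : ℝ → E := fun t => ∫ s in (0 : ℝ)..t, v s with hV
  set Φ : ℝ → E →L[ℂ] E := fun t => ∫ s in (0 : ℝ)..t, T s with hΦ
  have hTii : ∀ t, 0 ≤ t → IntervalIntegrable T volume 0 t := fun t ht =>
    (intervalIntegrable_iff_integrableOn_Ioc_of_le ht).2 (hTi t)
  have hΦd : ∀ t, 0 < t → HasDerivAt Φ (T t) t := fun t ht =>
    hasDerivAt_integral_of_continuousOn (T := t + 1) ⟨ht, by linarith⟩ (hTii t ht.le)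
      (hT.mono fun s hs => hs.1)
  have hΦc : ∀ t, 0 ≤ t → ContinuousOn Φ (Icc 0 t) := by
    intro t ht
    have := intervalIntegral.continuousOn_primitive_interval (a := 0) (b := t) (f := T)
      (μ := volume) (by rw [uIcc_of_le ht, integrableOn_Icc_iff_integrableOn_Ioc]; exact hTi t)
    rwa [uIcc_of_le ht] at this
  have hΦa : ∀ x y, (x, y) ∈ B.graph → ∀ t, 0 < t → Φ t y = x - T t x := by
    intro x y hxy t ht
    rw [← hcomm x y hxy t ht, hΦ]
    simp only
    rw [ContinuousLinearMap.intervalIntegral_apply (hTii t ht.le),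
      intervalIntegral.integral_of_le ht.le]
  have hvi : ∀ t ∈ Icc 0 b, IntervalIntegrable v volume 0 t := fun t ht =>
    (hv.mono (by rw [uIcc_of_le ht.1]; exact Icc_subset_Icc_right ht.2)).intervalIntegrable
  have hVd : ∀ t ∈ Ioo 0 b, HasDerivAt V (v t) t := fun t ht =>
    hasDerivAt_integral_of_continuousOn ht (hvi t (Ioo_subset_Icc_self ht))
      (hv.mono Ioo_subset_Icc_self)
  have hVc : 0 ≤ b → ContinuousOn V (Icc 0 b) := fun hb => by
    have := intervalIntegral.continuousOn_primitive_interval (a := 0) (b := b) (f := v)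
      (μ := volume) (by rw [uIcc_of_le hb]; exact hv.integrableOn_Icc)
    rwa [uIcc_of_le hb] at this
  have hV0 : V 0 = 0 := by simp [hV]
  have hΦ0 : Φ 0 = 0 := by simp [hΦ]
  intro t ht
  have hb : 0 ≤ b := (ht.1.trans ht.2).le
  refine eqOn_zero_of_integral_eq_zero (hVc hb) (fun t ht => ?_) t ht
  have hsub : Icc 0 t ⊆ Icc 0 b := Icc_subset_Icc_right ht.2
  let ρ := ContinuousLinearMap.restrictScalarsL ℂ E E ℝ ℝ
  -- `V` solves the homogeneous equation `V' = -B V` with `V 0 = 0`; by `hΦa` the two terms with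
  -- `T (t - s) (V s)` in the derivative cancel.
  have hW : ∀ s ∈ Ioo 0 t, HasDerivAt (fun s => Φ (t - s) (V s)) (-V s) s := by
    intro s hs
    have h1 : HasDerivAt (fun s => Φ (t - s)) (-T (t - s)) s := by
      have := (hΦd (t - s) (by linarith [hs.2])).scomp s ((hasDerivAt_id s).const_sub t)
      simpa [Function.comp_def] using this
    have h2 : HasDerivAt (fun s => ρ (Φ (t - s))) (ρ (-T (t - s))) s :=
      ρ.hasFDerivAt.comp_hasDerivAt s h1
    have h3 := h2.clm_apply (hVd s ⟨hs.1, hs.2.trans_le ht.2⟩)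
    have h4 := hΦa _ _ (hgr s ⟨hs.1.le, hs.2.le.trans ht.2⟩) (t - s) (by linarith [hs.2])
    have h3' : HasDerivAt (fun s => Φ (t - s) (V s)) (-(T (t - s) (V s)) + Φ (t - s) (v s)) s := h3
    rw [map_neg] at h4
    convert h3' using 1
    rw [← neg_neg (Φ (t - s) (v s)), h4]
    simp only [hV]
    abel
  have hWc : ContinuousOn (fun s => Φ (t - s) (V s)) (Icc 0 t) := by
    refine ContinuousOn.clm_apply ?_ ((hVc hb).mono hsub)
    exact (hΦc t ht.1).comp (by fun_prop) fun s hs => ⟨by linarith [hs.2], by linarith [hs.1]⟩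
  have := intervalIntegral.integral_eq_sub_of_hasDerivAt_of_le ht.1 hWc hW
    (((hVc hb).mono (by rw [uIcc_of_le ht.1]; exact hsub)).intervalIntegrable.neg)
  simpa [hV0, hΦ0] using this

end Uniqueness

/-! ### Semigroups and their generators -/

section Semigroups

open Filter Topology

/-- A family of operators on `(0,∞)` which is continuous in the operator norm and bounded by `M`. -/
structure IsBoundedFamily {E : Type v} [NormedAddCommGroup E] [NormedSpace ℂ E]
    (T : ℝ → E →L[ℂ] E) (M : ℝ) : Prop where
  continuousOn : ContinuousOn T (Ioi 0)
  bound : ∀ t, 0 < t → ‖T t‖ ≤ M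

variable {𝔸 : Type v} [NormedRing 𝔸] [NormedAlgebra ℝ 𝔸] [CompleteSpace 𝔸] {T : ℝ → 𝔸} {M : ℝ}

theorem integrableOn_Ioc_of_bound {E : Type*} [NormedAddCommGroup E] {T : ℝ → E} {M : ℝ}
    (hc : ContinuousOn T (Ioi 0)) (hM : ∀ t, 0 < t → ‖T t‖ ≤ M) (t : ℝ) :
    IntegrableOn T (Ioc 0 t) := by
  refine Integrable.mono' (integrableOn_const (C := M) (by simp))
    ((hc.mono Ioc_subset_Ioi_self).aestronglyMeasurable measurableSet_Ioc) ?_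
  exact (ae_restrict_mem measurableSet_Ioc).mono fun s hs => hM s hs.1

theorem integrableOn_laplace {E : Type*} [NormedAddCommGroup E] [NormedSpace ℝ E] {T : ℝ → E}
    {M : ℝ} (hc : ContinuousOn T (Ioi 0)) (hM : ∀ t, 0 < t → ‖T t‖ ≤ M) {lam : ℝ}
    (hl : 0 < lam) : IntegrableOn (fun t => Real.exp (-(lam * t)) • T t) (Ioi 0) := by
  have h1 : IntegrableOn (fun t => Real.exp (-lam * t) * M) (Ioi 0) :=
    (exp_neg_integrableOn_Ioi 0 hl).mul_const M
  refine Integrable.mono' h1 (ContinuousOn.aestronglyMeasurable ?_ measurableSet_Ioi) ?_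
  · exact ContinuousOn.smul (by fun_prop) hc
  · refine (ae_restrict_mem measurableSet_Ioi).mono fun t ht => ?_
    rw [norm_smul, Real.norm_of_nonneg (Real.exp_pos _).le, neg_mul]
    gcongr
    exact hM t ht

/-- The Laplace transform of a bounded semigroup, and the identity
`Φ(t) = λ R Φ(t) + R - R T(t)`, `Φ(t) = ∫_0^t T`, which expresses that `Φ(t)` maps into the range
of the resolvent `R`. -/
theorem laplace_identities (hc : ContinuousOn T (Ioi 0)) (hM : ∀ t, 0 < t → ‖T t‖ ≤ M)
    (hadd : ∀ s t, 0 < s → 0 < t → T (s + t) = T s * T t) {lam : ℝ} (hl : 0 < lam) {t : ℝ}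
    (ht : 0 < t) :
    let R := ∫ s in Ioi (0 : ℝ), Real.exp (-(lam * s)) • T s
    let Φ := ∫ s in Ioc 0 t, T s
    T t * R = R * T t ∧ Φ * R = R * Φ ∧ Φ = lam • (R * Φ) + R - R * T t := by
  intro R Φ
  set h : ℝ → 𝔸 := fun s => Real.exp (-(lam * s)) • T s with hh
  have hi : IntegrableOn h (Ioi 0) := integrableOn_laplace hc hM hl
  have hcommT : ∀ r, 0 < r → T r * R = R * T r := by
    intro r hr
    rw [← integral_mul_const_of_integrable hi, ← integral_const_mul_of_integrable hi]
    refine setIntegral_congr_fun measurableSet_Ioi fun s hs => ?_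
    simp only [hh, mul_smul_comm, smul_mul_assoc, ← hadd r s hr hs, ← hadd s r hs hr, add_comm]
  have hTi : IntegrableOn T (Ioc 0 t) := integrableOn_Ioc_of_bound hc hM t
  have hcommΦ : Φ * R = R * Φ := by
    rw [← integral_mul_const_of_integrable hTi, ← integral_const_mul_of_integrable hTi]
    exact setIntegral_congr_fun measurableSet_Ioc fun s hs => hcommT s hs.1
  refine ⟨hcommT t ht, hcommΦ, ?_⟩
  set J : ℝ → 𝔸 := fun r => ∫ s in (0 : ℝ)..r, h s with hJ
  -- The semigroup property turns `R T(r)` into a tail of the Laplace integral.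
  have hRT : ∀ r, 0 < r → R * T r = Real.exp (lam * r) • (R - J r) := by
    intro r hr
    have e1 : J r + ∫ s in Ioi r, h s = R :=
      intervalIntegral.integral_interval_add_Ioi hi (hi.mono_set (Ioi_subset_Ioi hr.le))
    rw [← integral_mul_const_of_integrable hi, ← e1, add_sub_cancel_left, ← integral_smul]
    have e2 := (measurePreserving_add_right (volume : Measure ℝ) r).setIntegral_preimage_emb
      (measurableEmbedding_addRight r) (fun s => Real.exp (lam * r) • h s) (Ioi r)
    have e3 : (fun x => x + r) ⁻¹' Ioi r = Ioi (0 : ℝ) := by ext s; simp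
    rw [e3] at e2
    rw [← e2]
    refine setIntegral_congr_fun measurableSet_Ioi fun s hs => ?_
    simp only [hh, smul_mul_assoc, ← hadd s r hs hr, smul_smul, ← Real.exp_add]
    congr 2; ring
  set g : ℝ → 𝔸 := fun r => Real.exp (lam * r) • (R - J r) with hg
  have hhi : ∀ r, 0 ≤ r → IntervalIntegrable h volume 0 r := fun r hr =>
    (intervalIntegrable_iff_integrableOn_Ioc_of_le hr).2 (hi.mono_set Ioc_subset_Ioi_self)
  have hhc : ContinuousOn h (Ioi 0) := ContinuousOn.smul (by fun_prop) hc
  have hJd : ∀ r, 0 < r → HasDerivAt J (h r) r := fun r hr =>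
    intervalIntegral.integral_hasDerivAt_right (hhi r hr.le)
      (hhc.stronglyMeasurableAtFilter isOpen_Ioi r hr) (hhc.continuousAt (Ioi_mem_nhds hr))
  have hJc : ContinuousOn J (Icc 0 t) := by
    have := intervalIntegral.continuousOn_primitive_interval (a := 0) (b := t) (f := h)
      (μ := volume) (by
        rw [uIcc_of_le ht.le, integrableOn_Icc_iff_integrableOn_Ioc]
        exact hi.mono_set Ioc_subset_Ioi_self)
    rwa [uIcc_of_le ht.le] at this
  have hgc : ContinuousOn g (Icc 0 t) := ContinuousOn.smul (by fun_prop)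
    (continuousOn_const.sub hJc)
  -- `g(r) = R T(r)` solves `g' = λ g - T`; integration over `[0,t]` gives the last identity.
  have hgd : ∀ r ∈ Ioo 0 t, HasDerivAt g (lam • g r - T r) r := by
    intro r hr
    have d1 : HasDerivAt (fun r => Real.exp (lam * r)) (Real.exp (lam * r) * lam) r := by
      simpa using ((hasDerivAt_id r).const_mul lam).exp
    have d2 : HasDerivAt g (Real.exp (lam * r) • (-h r) +
        (Real.exp (lam * r) * lam) • (R - J r)) r := d1.smul ((hJd r hr.1).const_sub R)
    convert d2 using 1
    simp only [hg, hh, smul_smul, smul_neg, ← Real.exp_add]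
    rw [add_neg_cancel, Real.exp_zero, one_smul, mul_comm lam]
    abel
  have hgi : IntervalIntegrable g volume 0 t :=
    (hgc.mono (by rw [uIcc_of_le ht.le])).intervalIntegrable
  have hTii : IntervalIntegrable T volume 0 t :=
    (intervalIntegrable_iff_integrableOn_Ioc_of_le ht.le).2 hTi
  have hgl : IntervalIntegrable (fun r => lam • g r) volume 0 t := hgi.smul lam
  have key := intervalIntegral.integral_eq_sub_of_hasDerivAt_of_le ht.le hgc hgd (hgl.sub hTii)
  rw [intervalIntegral.integral_sub hgl hTii, intervalIntegral.integral_smul] at key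
  have hRΦ : R * Φ = ∫ r in (0 : ℝ)..t, g r := by
    rw [← integral_const_mul_of_integrable hTi, intervalIntegral.integral_of_le ht.le]
    exact setIntegral_congr_fun measurableSet_Ioc fun s hs => hRT s hs.1
  have g0 : g 0 = R := by simp [hg, hJ]
  have gt : g t = R * T t := (hRT t ht).symm
  rw [g0, gt, ← hRΦ, intervalIntegral.integral_of_le ht.le] at key
  change lam • (R * Φ) - Φ = R * T t - R at key
  rw [add_sub_assoc, ← neg_sub (R * T t) R, ← key]
  abel

variable {E : Type v} [NormedAddCommGroup E] [NormedSpace ℂ E] [CompleteSpace E]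

theorem IsBoundedHolomorphic.exists_bound {T : ℝ → E →L[ℂ] E} (h : IsBoundedHolomorphic T) :
    ∃ M, IsBoundedFamily T M := by
  obtain ⟨δ, hδ, -, S, hS, ⟨M, hM⟩, hST⟩ := h
  have hmem : ∀ t : ℝ, 0 < t → (t : ℂ) ∈ sector δ := fun t ht =>
    ⟨by exact_mod_cast ht.ne', by rw [Complex.arg_ofReal_of_nonneg ht.le]; simpa using hδ⟩
  refine ⟨M, ?_, fun t ht => by rw [← hST t ht]; exact hM _ (hmem t ht)⟩
  have h1 : ContinuousOn (fun t : ℝ => S (t : ℂ)) (Ioi 0) :=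
    hS.continuousOn.comp (by fun_prop) fun t ht => hmem t ht
  exact h1.congr fun t ht => (hST t ht).symm

namespace IsNegGenerator

variable {A : E →ₗ.[ℂ] E} {T : ℝ → E →L[ℂ] E} {M : ℝ}

/-- The graph of `A` in terms of the resolvent. -/
theorem exists_resolvent (h : IsNegGenerator A T) (hb : IsBoundedFamily T M) (lam₀ : ℝ) :
    ∃ lam₁ : ℝ, lam₀ ≤ lam₁ ∧ ∀ lam, lam₁ < lam → 0 < lam ∧ ∀ x z, (x, z) ∈ A.graph ↔
      x = (∫ t in Ioi (0 : ℝ), Real.exp (-(lam * t)) • T t) (lam • x + z) := by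
  obtain ⟨ω, hω⟩ := h.resolvent
  refine ⟨max lam₀ (max ω 0), le_max_left _ _, fun lam hl => ?_⟩
  have hl0 : 0 < lam := (le_max_of_le_right (le_max_right _ _)).trans_lt hl
  have hlω : ω < lam := (le_max_of_le_right (le_max_left _ _)).trans_lt hl
  refine ⟨hl0, fun x z => ?_⟩
  have h1 := (hω lam hlω (lam • x + z)).2 x
  rw [ContinuousLinearMap.integral_apply (integrableOn_laplace hb.continuousOn hb.bound hl0)]
  refine Iff.trans ?_ h1
  constructor
  · intro hx
    exact ⟨z, hx, rfl⟩
  · rintro ⟨z', hx, he⟩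
    rwa [← add_left_cancel he]

theorem solFamily (h : IsNegGenerator A T) (hb : IsBoundedFamily T M) :
    IsSolFamily A (fun t => (T t : E →ₗ[ℂ] E)) ∧
    ∀ x y, (x, y) ∈ A.graph → ∀ t, 0 < t → ∫ s in Ioc 0 t, T s y = x - T t x := by
  obtain ⟨lam₁, -, hres⟩ := h.exists_resolvent hb 0
  obtain ⟨hl, hgr⟩ := hres (lam₁ + 1) (by linarith)
  set lam := lam₁ + 1
  set R : E →L[ℂ] E := ∫ t in Ioi (0 : ℝ), Real.exp (-(lam * t)) • T t with hR
  have hi : ∀ t, IntegrableOn T (Ioc 0 t) :=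
    integrableOn_Ioc_of_bound hb.continuousOn hb.bound
  have hid : ∀ t, 0 < t → T t * R = R * T t ∧ (∫ s in Ioc 0 t, T s) * R = R * ∫ s in Ioc 0 t, T s
      ∧ ∫ s in Ioc 0 t, T s = lam • (R * ∫ s in Ioc 0 t, T s) + R - R * T t := fun t ht =>
    laplace_identities hb.continuousOn hb.bound h.isSemigroup.map_add hl ht
  have happ : ∀ t x, ∫ s in Ioc 0 t, T s x = (∫ s in Ioc 0 t, T s) x := fun t x =>
    (ContinuousLinearMap.integral_apply (hi t) x).symm
  constructor
  · refine ⟨fun x => hb.continuousOn.clm_apply continuousOn_const, fun x t =>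
      (ContinuousLinearMap.apply ℂ E x).integrable_comp (hi t), fun x t ht => ?_⟩
    simp only [ContinuousLinearMap.coe_coe]
    rw [happ, hgr]
    obtain ⟨-, -, h3⟩ := hid t ht
    have h4 := congrArg (fun L : E →L[ℂ] E => L x) h3
    simp only [add_apply, sub_apply, smul_apply] at h4
    rw [map_add, map_sub, ← Complex.coe_smul, map_smul, Complex.coe_smul, ← add_sub_assoc]
    exact h4
  · intro x y hxy t ht
    rw [happ]
    obtain ⟨h1, h2, h3⟩ := hid t ht
    have hx := (hgr x y).1 hxy
    set w := lam • x + y with hw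
    have hy : y = w - lam • x := by rw [hw]; abel
    set Φ := ∫ s in Ioc 0 t, T s
    have h4 : Φ w = lam • R (Φ w) + R w - R (T t w) := congrArg (fun L : E →L[ℂ] E => L w) h3
    have h1' : T t (R w) = R (T t w) := congrArg (fun L : E →L[ℂ] E => L w) h1
    have h2' : Φ (R w) = R (Φ w) := congrArg (fun L : E →L[ℂ] E => L w) h2
    rw [← hx] at h4 h1' h2'
    rw [hy, map_sub, ← Complex.coe_smul, map_smul, Complex.coe_smul, h2', h1', sub_eq_iff_eq_add]
    exact h4.trans (by abel)

theorem isClosed (h : IsNegGenerator A T) (hb : IsBoundedFamily T M) : A.IsClosed := by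
  obtain ⟨lam₁, -, hres⟩ := h.exists_resolvent hb 0
  obtain ⟨hl, hgr⟩ := hres (lam₁ + 1) (by linarith)
  have : (A.graph : Set (E × E)) = {q | q.1 = (∫ t in Ioi (0 : ℝ),
      Real.exp (-((lam₁ + 1) * t)) • T t) ((lam₁ + 1) • q.1 + q.2)} := by
    ext ⟨x, z⟩
    exact hgr x z
  rw [LinearPMap.IsClosed, this]
  exact isClosed_eq (by fun_prop) (by fun_prop)

end IsNegGenerator

end Semigroups

/-! ### Interpolation functors on spaces of couple morphisms -/

section Functors

open Filter Topology

namespace BanachCouple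

variable (C : BanachCouple.{u})

theorem exists_decomp (x : C.Sum) {ε : ℝ} (hε : 0 < ε) :
    ∃ (a : C.X₀) (b : C.X₁), C.sumIncl x = C.ι₀ a + C.ι₁ b ∧ ‖a‖ + ‖b‖ < ‖x‖ + ε := by
  have hx : C.K 1 (C.sumIncl x) ≠ ∞ := (C.sumNorm.lt_top x).ne
  have h1 : C.K 1 (C.sumIncl x) < C.K 1 (C.sumIncl x) + ENNReal.ofReal ε :=
    ENNReal.lt_add_right hx (by simpa using hε)
  conv_lhs at h1 => rw [K]
  simp only [iInf_lt_iff] at h1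
  obtain ⟨a, b, hab, h2⟩ := h1
  refine ⟨a, b, hab.symm, ?_⟩
  have h3 : ‖x‖ = (C.K 1 (C.sumIncl x)).toReal := rfl
  rw [ENNReal.ofReal_one, one_mul, ← ENNReal.ofReal_toReal hx, ← h3,
    ← ENNReal.ofReal_add (norm_nonneg _) hε.le, ← ofReal_norm, ← ofReal_norm,
    ← ENNReal.ofReal_add (norm_nonneg _) (norm_nonneg _)] at h2
  exact (ENNReal.ofReal_lt_ofReal_iff (add_pos_of_nonneg_of_pos (norm_nonneg _) hε)).1 h2

theorem continuous_sumIncl : Continuous C.sumIncl := by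
  refine continuous_of_continuousAt_zero C.sumIncl ?_
  rw [ContinuousAt, map_zero, tendsto_nhds_iff_seq_tendsto]
  intro x hx
  choose a b hab hlt using fun n : ℕ => C.exists_decomp (x n) (Nat.one_div_pos_of_nat (n := n))
  have hlim : Tendsto (fun n : ℕ => ‖x n‖ + 1 / ((n : ℝ) + 1)) atTop (𝓝 0) := by
    simpa using (tendsto_norm_zero.comp hx).add tendsto_one_div_add_atTop_nhds_zero_nat
  have ha : Tendsto a atTop (𝓝 0) := squeeze_zero_norm
    (fun n => (le_add_of_nonneg_right (norm_nonneg (b n))).trans (hlt n).le) hlim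
  have hb : Tendsto b atTop (𝓝 0) := squeeze_zero_norm
    (fun n => (le_add_of_nonneg_left (norm_nonneg (a n))).trans (hlt n).le) hlim
  have h := ((C.ι₀.continuous.tendsto 0).comp ha).add ((C.ι₁.continuous.tendsto 0).comp hb)
  simp only [map_zero, add_zero] at h
  exact h.congr fun n => (hab n).symm

end BanachCouple

/-- The space of morphisms of Banach couples, as a subspace of `L(X₀, Y₀) × L(X₁, Y₁)`. -/
def homSpace (C D : BanachCouple.{u}) :
    Submodule ℂ ((C.X₀ →L[ℂ] D.X₀) × (C.X₁ →L[ℂ] D.X₁)) where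
  carrier := {S | ∀ a b, C.ι₀ a = C.ι₁ b → D.ι₀ (S.1 a) = D.ι₁ (S.2 b)}
  zero_mem' := by simp
  add_mem' := fun {S S'} h h' a b hab => by simp [h a b hab, h' a b hab]
  smul_mem' := fun c S h a b hab => by simp [h a b hab]

theorem isClosed_homSpace (C D : BanachCouple.{u}) :
    IsClosed (homSpace C D : Set ((C.X₀ →L[ℂ] D.X₀) × (C.X₁ →L[ℂ] D.X₁))) := by
  have : (homSpace C D : Set ((C.X₀ →L[ℂ] D.X₀) × (C.X₁ →L[ℂ] D.X₁))) =
      ⋂ (a) (b) (_ : C.ι₀ a = C.ι₁ b), {S | D.ι₀ (S.1 a) = D.ι₁ (S.2 b)} := by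
    ext S
    simp only [mem_iInter]
    rfl
  rw [this]
  refine isClosed_iInter fun a => isClosed_iInter fun b => isClosed_iInter fun _ =>
    isClosed_eq ?_ ?_
  · exact D.ι₀.continuous.comp ((ContinuousLinearMap.apply ℂ D.X₀ a).continuous.comp continuous_fst)
  · exact D.ι₁.continuous.comp ((ContinuousLinearMap.apply ℂ D.X₁ b).continuous.comp continuous_snd)

/-- The Banach space of morphisms of Banach couples, with the norm `max ‖S₀‖ ‖S₁‖`. -/
def HomSpace (C D : BanachCouple.{u}) : Type u := homSpace C D

instance (C D : BanachCouple.{u}) : NormedAddCommGroup (HomSpace C D) :=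
  inferInstanceAs (NormedAddCommGroup (homSpace C D))

instance (C D : BanachCouple.{u}) : NormedSpace ℂ (HomSpace C D) :=
  inferInstanceAs (NormedSpace ℂ (homSpace C D))

instance (C D : BanachCouple.{u}) : CompleteSpace (HomSpace C D) :=
  (isClosed_homSpace C D).completeSpace_coe

/-- The two components of a morphism of couples. -/
def HomSpace.coe (C D : BanachCouple.{u}) :
    HomSpace C D →L[ℂ] (C.X₀ →L[ℂ] D.X₀) × (C.X₁ →L[ℂ] D.X₁) :=
  (homSpace C D).subtypeL

namespace InterpolationFunctor

variable (F : InterpolationFunctor.{u}) {C D : BanachCouple.{u}}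

/-- The inclusion of `F(X₀, X₁)` in the ambient space of the couple, as a continuous map. -/
def inclCLM (C : BanachCouple.{u}) : F.space C →L[ℂ] C.Z where
  toLinearMap := F.inclZ C
  cont := C.continuous_sumIncl.comp (F.incl C).continuous

theorem inclZ_injective (C : BanachCouple.{u}) : Function.Injective (F.inclZ C) :=
  C.sumNorm.incl_injective.comp (F.incl_injective C)

theorem exists_decomp (x : F.space C) : ∃ a b, F.inclZ C x = C.ι₀ a + C.ι₁ b := by
  obtain ⟨a, b, h, -⟩ := C.exists_decomp (F.incl C x) one_pos
  exact ⟨a, b, h⟩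

theorem exists_map (C D : BanachCouple.{u}) :
    ∃ m : HomSpace C D →L[ℂ] F.space C →L[ℂ] F.space D,
    ∀ S x a b, F.inclZ C x = C.ι₀ a + C.ι₁ b →
      F.inclZ D (m S x) = D.ι₀ (S.1.1 a) + D.ι₁ (S.1.2 b) := by
  choose m hm using fun S : HomSpace C D => F.map_bounded C D ⟨S.1.1, S.1.2, S.2⟩
  have hm' : ∀ S x a b, F.inclZ C x = C.ι₀ a + C.ι₁ b →
      F.inclZ D (m S x) = D.ι₀ (S.1.1 a) + D.ι₁ (S.1.2 b) := hm
  let L : HomSpace C D →ₗ[ℂ] F.space C →L[ℂ] F.space D :=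
    { toFun := m
      map_add' := fun S S' => by
        have e : (S + S').1 = S.1 + S'.1 := rfl
        ext x
        obtain ⟨a, b, hab⟩ := F.exists_decomp x
        apply F.inclZ_injective D
        rw [add_apply, map_add, hm' _ x a b hab, hm' _ x a b hab, hm' _ x a b hab]
        simp only [e, Prod.fst_add, Prod.snd_add, add_apply, map_add]
        abel
      map_smul' := fun c S => by
        have e : (c • S).1 = c • S.1 := rfl
        ext x
        obtain ⟨a, b, hab⟩ := F.exists_decomp x
        apply F.inclZ_injective D
        simp [hm' _ x a b hab, e] }
  refine ⟨⟨L, ?_⟩, hm'⟩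
  -- The values of `m S x` in the ambient space depend continuously on `S` for fixed `x`.
  refine LinearMap.continuous_of_seq_closed_graph L fun S S' y hS hy => ?_
  ext x
  obtain ⟨a, b, hab⟩ := F.exists_decomp x
  apply F.inclZ_injective D
  have h1 : Tendsto (fun n => F.inclZ D (m (S n) x)) atTop (𝓝 (F.inclZ D (y x))) :=
    ((F.inclCLM D).continuous.tendsto _).comp
      (((ContinuousLinearMap.apply ℂ (F.space D) x).continuous.tendsto y).comp hy)
  refine tendsto_nhds_unique h1 ?_
  change Tendsto _ _ (𝓝 (F.inclZ D (m S' x)))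
  simp only [hm' _ x a b hab]
  have hS1 : Tendsto (fun n => (S n).1.1 a) atTop (𝓝 (S'.1.1 a)) :=
    ((ContinuousLinearMap.apply ℂ D.X₀ a).continuous.comp
      (continuous_fst.comp (HomSpace.coe C D).continuous)).continuousAt.tendsto.comp hS
  have hS2 : Tendsto (fun n => (S n).1.2 b) atTop (𝓝 (S'.1.2 b)) :=
    ((ContinuousLinearMap.apply ℂ D.X₁ b).continuous.comp
      (continuous_snd.comp (HomSpace.coe C D).continuous)).continuousAt.tendsto.comp hS
  exact ((D.ι₀.continuous.tendsto _).comp hS1).add ((D.ι₁.continuous.tendsto _).comp hS2)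

/-- The action of an interpolation functor on the morphisms of Banach couples. It is bounded, by
the closed graph theorem. -/
def map (C D : BanachCouple.{u}) : HomSpace C D →L[ℂ] F.space C →L[ℂ] F.space D :=
  (F.exists_map C D).choose

theorem inclZ_map (S : HomSpace C D) {x : F.space C} {a : C.X₀} {b : C.X₁}
    (h : F.inclZ C x = C.ι₀ a + C.ι₁ b) :
    F.inclZ D (F.map C D S x) = D.ι₀ (S.1.1 a) + D.ι₁ (S.1.2 b) :=
  (F.exists_map C D).choose_spec S x a b h

/-- A functor which commutes with `ℓ^p` has the interpolation property for sequences: operators on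
`ℓ^p(X₀)` and `ℓ^p(X₁)` are interpolated, and the result is transported by the isomorphism. -/
theorem SplitsLp.lpStable {p : ℝ≥0∞} [Fact (1 ≤ p)] {F : InterpolationFunctor.{u}}
    (h : F.SplitsLp p C) : LpStable p C (F.inclCLM C) := by
  obtain ⟨Φ, hΦ⟩ := h
  refine ⟨‖(Φ : F.space (C.lpCouple p) →L[ℂ] lp (fun _ : ℕ => F.space C) p)‖ *
    ‖F.map (C.lpCouple p) (C.lpCouple p)‖ *
    ‖(Φ.symm : lp (fun _ : ℕ => F.space C) p →L[ℂ] F.space (C.lpCouple p))‖, by positivity,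
    fun S₀ S₁ hS x a b _ hx => ?_⟩
  let S : HomSpace (C.lpCouple p) (C.lpCouple p) :=
    ⟨(S₀, S₁), fun a b hab => funext fun n => hS a b (fun n => congrFun hab n) n⟩
  have hy : F.inclZ (C.lpCouple p) (Φ.symm x) = (C.lpCouple p).ι₀ a + (C.lpCouple p).ι₁ b := by
    funext n
    rw [← hΦ, Φ.apply_symm_apply]
    exact hx n
  refine ⟨Φ (F.map _ _ S (Φ.symm x)), ?_, fun n => ?_⟩
  · calc ‖Φ (F.map _ _ S (Φ.symm x))‖
        ≤ ‖(Φ : F.space (C.lpCouple p) →L[ℂ] lp (fun _ : ℕ => F.space C) p)‖ *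
            ‖F.map _ _ S (Φ.symm x)‖ :=
          (Φ : F.space (C.lpCouple p) →L[ℂ] lp (fun _ : ℕ => F.space C) p).le_opNorm _
      _ ≤ ‖(Φ : F.space (C.lpCouple p) →L[ℂ] lp (fun _ : ℕ => F.space C) p)‖ *
          (‖F.map (C.lpCouple p) (C.lpCouple p)‖ * ‖S‖ *
            (‖(Φ.symm : lp (fun _ : ℕ => F.space C) p →L[ℂ] F.space (C.lpCouple p))‖ * ‖x‖)) := by
          gcongr
          refine (ContinuousLinearMap.le_opNorm₂ _ _ _).trans ?_
          gcongr
          exact (Φ.symm : lp (fun _ : ℕ => F.space C) p →L[ℂ] F.space (C.lpCouple p)).le_opNorm x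
      _ = _ := by
          have : ‖S‖ = max ‖S₀‖ ‖S₁‖ := rfl
          rw [this]; ring
  · change F.inclZ C _ = _
    rw [hΦ, F.inclZ_map S hy]
    rfl

end InterpolationFunctor

end Functors

/-! ### Sums of generators in interpolation spaces -/

section SumGenerators

open Filter Topology

variable {C : BanachCouple.{u}} {T₀ : ℝ → C.X₀ →L[ℂ] C.X₀} {T₁ : ℝ → C.X₁ →L[ℂ] C.X₁}

/-- The pair of two consistent semigroups, as a function with values in the couple morphisms. -/
def homFamily (hT : ∀ (a : C.X₀) (b : C.X₁), C.ι₀ a = C.ι₁ b → ∀ t : ℝ, 0 < t →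
    C.ι₀ (T₀ t a) = C.ι₁ (T₁ t b)) (t : ℝ) : HomSpace C C :=
  if ht : 0 < t then ⟨(T₀ t, T₁ t), fun a b hab => hT a b hab t ht⟩ else 0

theorem coe_homFamily (hT : ∀ (a : C.X₀) (b : C.X₁), C.ι₀ a = C.ι₁ b → ∀ t : ℝ, 0 < t →
    C.ι₀ (T₀ t a) = C.ι₁ (T₁ t b)) {t : ℝ} (ht : 0 < t) :
    (homFamily hT t).1 = (T₀ t, T₁ t) := by
  exact congrArg Subtype.val (dif_pos ht)

variable {A₀ : C.X₀ →ₗ.[ℂ] C.X₀} {A₁ : C.X₁ →ₗ.[ℂ] C.X₁}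

/-- Maximal regularity of the sum of two generators in the space of a functor that commutes with
`ℓ^p`. The interpolated semigroup is a norm continuous solution family for the part `B` of
`A₀ + A₁`, and the interpolated resolvents show that `B` is closed. -/
theorem hasLpMaxReg_part_sumOp {p : ℝ≥0∞} [Fact (1 ≤ p)] (hp : p ≠ ∞) (g₀ : IsNegGenerator A₀ T₀)
    (b₀ : IsBoundedHolomorphic T₀) (g₁ : IsNegGenerator A₁ T₁) (b₁ : IsBoundedHolomorphic T₁)
    (hT : ∀ (a : C.X₀) (b : C.X₁), C.ι₀ a = C.ι₁ b →
      ∀ t : ℝ, 0 < t → C.ι₀ (T₀ t a) = C.ι₁ (T₁ t b))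
    (hA : C.ConsistentOps A₀ A₁) {τ : ℝ≥0∞} (m₀ : HasLpMaxReg A₀ p τ) (m₁ : HasLpMaxReg A₁ p τ)
    {F : InterpolationFunctor.{u}} (hF : F.SplitsLp p C) :
    HasLpMaxReg (part (C.sumOp A₀ A₁) (F.inclZ C)) p τ := by
  obtain ⟨M₀, hM₀⟩ := b₀.exists_bound
  obtain ⟨M₁, hM₁⟩ := b₁.exists_bound
  obtain ⟨s₀, c₀⟩ := g₀.solFamily hM₀
  obtain ⟨s₁, c₁⟩ := g₁.solFamily hM₁
  set H := homFamily hT with hH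
  set B := part (C.sumOp A₀ A₁) (F.inclZ C) with hB
  have hgr : ∀ x y, (x, y) ∈ B.graph ↔ ∃ x₀ y₀ x₁ y₁, (x₀, y₀) ∈ A₀.graph ∧ (x₁, y₁) ∈ A₁.graph ∧
      F.inclZ C x = C.ι₀ x₀ + C.ι₁ x₁ ∧ F.inclZ C y = C.ι₀ y₀ + C.ι₁ y₁ := fun x y => by
    exact (mem_graph_part _ (F.inclZ_injective C) x y).trans (C.mem_graph_sumOp hA _ _)
  have hHc : ContinuousOn H (Ioi 0) := by
    refine continuousOn_iff_continuous_domRestrict.2 (Continuous.subtype_mk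
      (f := fun t : Ioi (0 : ℝ) => (H t).1) ?_ fun t => (H t).2)
    refine (continuousOn_iff_continuous_domRestrict.1
      (hM₀.continuousOn.prodMk hM₁.continuousOn)).congr fun t => ?_
    exact (coe_homFamily hT t.2).symm
  have hHb : ∀ t, 0 < t → ‖H t‖ ≤ max M₀ M₁ := fun t ht => by
    have e : ‖H t‖ = ‖(H t).1‖ := rfl
    rw [e, coe_homFamily hT ht]
    exact max_le_max (hM₀.bound t ht) (hM₁.bound t ht)
  set TF : ℝ → F.space C →L[ℂ] F.space C := fun t => F.map C C (H t) with hTF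
  have hTFspec : ∀ x a b, F.inclZ C x = C.ι₀ a + C.ι₁ b → ∀ t, 0 < t →
      F.inclZ C (TF t x) = C.ι₀ (T₀ t a) + C.ι₁ (T₁ t b) := fun x a b hab t ht => by
    rw [hTF, F.inclZ_map (H t) hab, coe_homFamily hT ht]
  have hTFc : ContinuousOn TF (Ioi 0) := (F.map C C).continuous.comp_continuousOn hHc
  have hTFi : ∀ t, IntegrableOn TF (Ioc 0 t) := fun t =>
    (F.map C C).integrable_comp (integrableOn_Ioc_of_bound hHc hHb t)
  have hTFx : ∀ x t, IntegrableOn (fun t => TF t x) (Ioc 0 t) := fun x t =>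
    (ContinuousLinearMap.apply ℂ (F.space C) x).integrable_comp (hTFi t)
  have hint : ∀ x a b, F.inclZ C x = C.ι₀ a + C.ι₁ b → ∀ t, 0 < t →
      F.inclZ C (∫ s in Ioc 0 t, TF s x) =
        C.ι₀ (∫ s in Ioc 0 t, T₀ s a) + C.ι₁ (∫ s in Ioc 0 t, T₁ s b) := fun x a b hab t ht =>
    map_integral_eq_add (F.inclCLM C) (hTFx x t) (s₀.integrableOn a t) (s₁.integrableOn b t)
      ((ae_restrict_mem measurableSet_Ioc).mono fun s hs => hTFspec x a b hab s hs.1)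
  have hclosed : B.IsClosed := by
    obtain ⟨lam₀, -, r₀⟩ := g₀.exists_resolvent hM₀ 0
    obtain ⟨lam₁, hl, r₁⟩ := g₁.exists_resolvent hM₁ lam₀
    obtain ⟨hl0, r₀⟩ := r₀ (lam₁ + 1) (by linarith)
    obtain ⟨-, r₁⟩ := r₁ (lam₁ + 1) (by linarith)
    set lam := lam₁ + 1
    have hi := integrableOn_laplace hHc hHb hl0
    set R : HomSpace C C := ∫ t in Ioi (0 : ℝ), Real.exp (-(lam * t)) • H t with hR
    have e₀ : R.1.1 = ∫ t in Ioi (0 : ℝ), Real.exp (-(lam * t)) • T₀ t := by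
      have := ((ContinuousLinearMap.fst ℂ (C.X₀ →L[ℂ] C.X₀) (C.X₁ →L[ℂ] C.X₁)).comp
        (HomSpace.coe C C)).integral_comp_comm hi
      refine this.symm.trans (setIntegral_congr_fun measurableSet_Ioi fun t ht => ?_)
      change Real.exp (-(lam * t)) • (H t).1.1 = _
      rw [coe_homFamily hT ht]
    have e₁ : R.1.2 = ∫ t in Ioi (0 : ℝ), Real.exp (-(lam * t)) • T₁ t := by
      have := ((ContinuousLinearMap.snd ℂ (C.X₀ →L[ℂ] C.X₀) (C.X₁ →L[ℂ] C.X₁)).comp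
        (HomSpace.coe C C)).integral_comp_comm hi
      refine this.symm.trans (setIntegral_congr_fun measurableSet_Ioi fun t ht => ?_)
      change Real.exp (-(lam * t)) • (H t).1.2 = _
      rw [coe_homFamily hT ht]
    rw [← e₀] at r₀
    rw [← e₁] at r₁
    -- The graph of `B` is the solution set of `x = R (λ x + y)`, `R` the interpolated resolvent.
    have hset : (B.graph : Set (F.space C × F.space C)) =
        {q | q.1 = F.map C C R ((lam : ℂ) • q.1 + q.2)} := by
      ext ⟨x, y⟩
      change (x, y) ∈ B.graph ↔ x = F.map C C R ((lam : ℂ) • x + y)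
      rw [hgr]
      constructor
      · rintro ⟨x₀, y₀, x₁, y₁, h₀, h₁, hx, hy⟩
        apply F.inclZ_injective C
        rw [F.inclZ_map R (a := (lam : ℂ) • x₀ + y₀) (b := (lam : ℂ) • x₁ + y₁), Complex.coe_smul,
          Complex.coe_smul, ← (r₀ _ _).1 h₀, ← (r₁ _ _).1 h₁, hx]
        simp only [map_add, map_smul, hx, hy, smul_add]
        abel
      · intro hx
        obtain ⟨a, b, hab⟩ := F.exists_decomp ((lam : ℂ) • x + y)
        have hx' := congrArg (F.inclZ C) hx
        rw [F.inclZ_map R hab] at hx'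
        refine ⟨R.1.1 a, a - (lam : ℂ) • R.1.1 a, R.1.2 b, b - (lam : ℂ) • R.1.2 b, ?_, ?_, hx', ?_⟩
        · rw [r₀, ← Complex.coe_smul, add_sub_cancel]
        · rw [r₁, ← Complex.coe_smul, add_sub_cancel]
        · have hy : y = ((lam : ℂ) • x + y) - (lam : ℂ) • x := by abel
          rw [hy, map_sub, hab, map_smul, hx']
          simp only [map_sub, map_smul, smul_add]
          abel
    rw [LinearPMap.IsClosed, hset]
    exact isClosed_eq continuous_fst
      ((F.map C C R).continuous.comp ((continuous_fst.const_smul _).add continuous_snd))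
  have hsol : IsSolFamily B (fun t => (TF t : F.space C →ₗ[ℂ] F.space C)) := by
    refine ⟨fun x => hTFc.clm_apply continuousOn_const, fun x t => hTFx x t, fun x t ht => ?_⟩
    obtain ⟨a, b, hab⟩ := F.exists_decomp x
    rw [hgr]
    refine ⟨_, _, _, _, s₀.graph_mem a t ht, s₁.graph_mem b t ht, hint x a b hab t ht, ?_⟩
    rw [map_sub]
    simp only [ContinuousLinearMap.coe_coe]
    rw [hTFspec x a b hab t ht, hab, map_sub, map_sub]
    abel
  have hcomm : ∀ x y, (x, y) ∈ B.graph → ∀ t, 0 < t → ∫ s in Ioc 0 t, TF s y = x - TF t x := by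
    intro x y hxy t ht
    obtain ⟨x₀, y₀, x₁, y₁, h₀, h₁, hx, hy⟩ := (hgr x y).1 hxy
    apply F.inclZ_injective C
    rw [hint _ _ _ hy t ht, c₀ _ _ h₀ t ht, c₁ _ _ h₁ t ht, map_sub (F.inclZ C),
      hTFspec _ _ _ hx t ht, hx, map_sub, map_sub]
    abel
  have hu₀ : StrongUnique A₀ τ := strongUnique_of_family (g₀.isClosed hM₀) hM₀.continuousOn
    (integrableOn_Ioc_of_bound hM₀.continuousOn hM₀.bound) c₀
  have hu₁ : StrongUnique A₁ τ := strongUnique_of_family (g₁.isClosed hM₁) hM₁.continuousOn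
    (integrableOn_Ioc_of_bound hM₁.continuousOn hM₁.bound) c₁
  obtain ⟨K₀, hK₀⟩ := m₀.exists_extendsResp hu₀ s₀
  obtain ⟨K₁, hK₁⟩ := m₁.exists_extendsResp hu₁ s₁
  obtain ⟨κ, -, hκ⟩ := exists_dyResp_bound hp (F.inclCLM C) (F.inclZ_injective C)
    F.exists_decomp hF.lpStable (T := fun t => (TF t : F.space C →ₗ[ℂ] F.space C))
    hTFspec hT hsol.continuousOn hK₀ hK₁
  exact hasLpMaxReg_of_bound hp hclosed (strongUnique_of_family hclosed hTFc hTFi hcomm) hsol hκ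

end SumGenerators

/-! ### Causality and local uniqueness on the half-line -/

section Causality

open Filter Topology

variable {E : Type v} [NormedAddCommGroup E] [NormedSpace ℂ E] [CompleteSpace E]
  {A : E →ₗ.[ℂ] E} {p : ℝ≥0∞} {f u du Au : ℝ → E}

theorem measurePreserving_sub_Ioi (a : ℝ) :
    MeasurePreserving (fun t => t - a) (volume.restrict (Ioi a)) (volume.restrict (Ioi (0 : ℝ))) := by
  have := (measurePreserving_sub_right (volume : Measure ℝ) a).restrict_preimage
    (measurableSet_Ioi (a := (0 : ℝ)))
  simpa using this

theorem measurePreserving_add_Ioi (a : ℝ) :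
    MeasurePreserving (fun t => t + a) (volume.restrict (Ioi (0 : ℝ))) (volume.restrict (Ioi a)) := by
  have := (measurePreserving_add_right (volume : Measure ℝ) a).restrict_preimage
    (measurableSet_Ioi (a := a))
  simpa using this

/-- The translate of a function on `(0,∞)` by `a ≥ 0`, extended by zero. -/
def shift (a : ℝ) (g : ℝ → E) : ℝ → E := (Ioi a).indicator fun t => g (t - a)

theorem shift_of_le {a t : ℝ} (h : t ≤ a) (g : ℝ → E) : shift a g t = 0 :=
  indicator_of_notMem (not_lt.2 h) _

theorem shift_of_lt {a t : ℝ} (h : a < t) (g : ℝ → E) : shift a g t = g (t - a) :=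
  indicator_of_mem (mem_Ioi.2 h) _

theorem memLp_shift {a : ℝ} (ha : 0 ≤ a) {g : ℝ → E} (hg : MemLp g p (volume.restrict (Ioi 0))) :
    MemLp (shift a g) p (volume.restrict (Ioi 0)) := by
  rw [shift, memLp_indicator_iff_restrict measurableSet_Ioi,
    Measure.restrict_restrict measurableSet_Ioi, inter_eq_self_of_subset_left (Ioi_subset_Ioi ha)]
  exact hg.comp_measurePreserving (measurePreserving_sub_Ioi a)

theorem ae_Ioi_of_shift {a : ℝ} {P Q : ℝ → Prop} (h : ∀ᵐ t ∂(volume.restrict (Ioi (0 : ℝ))), P t)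
    (h1 : ∀ t, a < t → P (t - a) → Q t) (h2 : ∀ t, t ≤ a → Q t) :
    ∀ᵐ t ∂(volume.restrict (Ioi (0 : ℝ))), Q t := by
  have h3 := (measurePreserving_sub_Ioi a).quasiMeasurePreserving.ae h
  rw [ae_restrict_iff' measurableSet_Ioi] at h3
  refine ae_restrict_of_ae (h3.mono fun t ht => ?_)
  rcases le_or_gt t a with h | h
  · exact h2 t h
  · exact h1 t h (ht h)

theorem mem_timeIntervalZero_top {t : ℝ} : t ∈ timeIntervalZero ∞ ↔ 0 ≤ t := by
  simp [timeIntervalZero]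

theorem IsStrongSolution.shift (h : IsStrongSolution A ∞ f 0 u du Au) {a : ℝ} (ha : 0 ≤ a) :
    IsStrongSolution A ∞ (shift a f) 0 (shift a u) (shift a du) (shift a Au) := by
  have hI : ∀ t, a ≤ t → IntervalIntegrable (fun s => du (s - a)) volume a t := fun t ht => by
    have := (h.intervalIntegrable (t := t - a)
      (mem_timeIntervalZero_top.2 (by linarith))).comp_sub_right a
    simpa using this
  have hset : ∀ t, Ioi a ∩ Ioc 0 t = Ioc a t := fun t => by
    ext s
    simp only [mem_inter_iff, mem_Ioi, mem_Ioc]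
    constructor
    · rintro ⟨h1, -, h3⟩
      exact ⟨h1, h3⟩
    · rintro ⟨h1, h3⟩
      exact ⟨h1, by linarith, h3⟩
  constructor
  · intro t _
    rw [MaxReg.shift, IntegrableOn, integrable_indicator_iff measurableSet_Ioi, IntegrableOn,
      Measure.restrict_restrict measurableSet_Ioi, hset]
    rcases le_or_gt a t with hat | hat
    · exact (intervalIntegrable_iff_integrableOn_Ioc_of_le hat).1 (hI t hat)
    · rw [Ioc_eq_empty (by linarith)]
      simp
  · intro t ht
    rw [mem_timeIntervalZero_top] at ht
    rw [intervalIntegral.integral_of_le ht, zero_add]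
    conv_rhs => rw [MaxReg.shift]
    rw [setIntegral_indicator measurableSet_Ioi, inter_comm, hset]
    rcases lt_or_ge a t with hat | hat
    · rw [shift_of_lt hat, h.eq_integral _ (mem_timeIntervalZero_top.2 (by linarith)), zero_add,
        ← intervalIntegral.integral_of_le hat.le, intervalIntegral.integral_comp_sub_right, sub_self]
    · rw [shift_of_le hat, Ioc_eq_empty (by linarith)]
      simp
  · have := h.graph_mem
    rw [timeMeasure_top] at this ⊢
    refine ae_Ioi_of_shift (a := a) this (fun t hat ht => ?_) fun t hat => ?_
    · rw [shift_of_lt hat, shift_of_lt hat]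
      exact ht
    · rw [shift_of_le hat, shift_of_le hat]
      exact A.graph.zero_mem
  · have := h.equation
    rw [timeMeasure_top] at this ⊢
    refine ae_Ioi_of_shift (a := a) this (fun t hat ht => ?_) fun t hat => ?_
    · rw [shift_of_lt hat, shift_of_lt hat, shift_of_lt hat]
      exact ht
    · rw [shift_of_le hat, shift_of_le hat, shift_of_le hat, add_zero]

/-- Causality: translations in time preserve the equation, so that the solution vanishes as long
as the right-hand side does. -/
theorem HasLpMaxReg.eq_zero_of_rhs_eq_zero (h : HasLpMaxReg A p ∞)
    (hu : IsStrongSolution A ∞ f 0 u du Au) (hf : MemLp f p (timeMeasure ∞))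
    (hAu : MemLp Au p (timeMeasure ∞)) {a : ℝ} (ha : 0 ≤ a) (hfa : ∀ t ∈ Ioo 0 a, f t = 0) :
    ∀ t ∈ Icc 0 a, u t = 0 := by
  rw [timeMeasure_top] at hf
  have hfs : MemLp (fun t => f (t + a)) p (timeMeasure ∞) := by
    rw [timeMeasure_top]
    exact (hf.mono_measure (Measure.restrict_mono (Ioi_subset_Ioi ha) le_rfl)).comp_measurePreserving
      (measurePreserving_add_Ioi a)
  -- Solve with the right-hand side `f(· + a)` and translate back; by uniqueness, this is `u`.
  obtain ⟨w, ⟨dw, Aw, hw, -, hAw⟩, -⟩ := h.2 _ hfs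
  have hfeq : MaxReg.shift a (fun t => f (t + a)) =ᵐ[timeMeasure ∞] f := by
    have hne : ∀ᵐ t : ℝ ∂(timeMeasure ∞), t ≠ a :=
      ae_restrict_of_ae (by simp [ae_iff])
    filter_upwards [hne, ae_timeMeasure_of_mem (τ := ∞) fun t ht => ht] with t ht1 ht2
    rcases lt_or_gt_of_ne ht1 with hta | hta
    · rw [shift_of_le hta.le, hfa t ⟨ht2.1, hta⟩]
    · rw [shift_of_lt hta, sub_add_cancel]
  have hws := (hw.shift ha).congr hfeq (fun _ _ => rfl) (ae_eq_refl _) (ae_eq_refl _)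
  rw [← timeMeasure_top] at hf
  have hAws : MemLp (MaxReg.shift a Aw) p (timeMeasure ∞) := by
    rw [timeMeasure_top] at hAw ⊢
    exact memLp_shift ha hAw
  obtain ⟨z, -, hz⟩ := h.2 f hf
  intro t ht
  have ht' : t ∈ timeIntervalZero ∞ := mem_timeIntervalZero_top.2 ht.1
  rw [hz u (hu.isLpSolution hf hAu) ht', ← hz _ (hws.isLpSolution hf hAws) ht',
    shift_of_le ht.2]

/-- Uniqueness of strong solutions on every interval `(0,τ)`, by a cutoff argument: for a classical
solution `V` of the homogeneous equation on `[0,b]` and a cutoff function `χ`, the function `χ V`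
solves an equation whose right-hand side `χ' V` vanishes on the set where `χ = 1`. -/
theorem HasLpMaxReg.strongUnique (h : HasLpMaxReg A p ∞) (τ : ℝ≥0∞) :
    StrongUnique A τ := by
  refine strongUnique_of_primitive h.1 fun v b _ hv hgr t ht => ?_
  have hb : 0 < b := ht.1.trans ht.2
  set v' : ℝ → E := IccExtend hb.le ((Icc 0 b).domRestrict v) with hv'
  have hv'c : Continuous v' := (continuousOn_iff_continuous_domRestrict.1 hv).Icc_extend'
  have hv'eq : ∀ s ∈ Icc 0 b, v' s = v s := fun s hs => by
    rw [hv', IccExtend_of_mem _ _ hs]; rfl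
  set V : ℝ → E := fun t => ∫ s in (0 : ℝ)..t, v' s with hV
  have hVeq : ∀ s ∈ Icc 0 b, V s = ∫ r in (0 : ℝ)..s, v r := fun s hs =>
    intervalIntegral.integral_congr fun r hr => by
      rw [uIcc_of_le hs.1] at hr
      exact hv'eq r ⟨hr.1, hr.2.trans hs.2⟩
  have hVd : ∀ s, HasDerivAt V (v' s) s := fun s =>
    intervalIntegral.integral_hasDerivAt_right (hv'c.intervalIntegrable _ _)
      (hv'c.stronglyMeasurableAtFilter _ _) hv'c.continuousAt
  have hVc : Continuous V := continuous_iff_continuousAt.2 fun s => (hVd s).continuousAt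
  -- The cutoff is `1` on `[0,t]` and `0` beyond `b`.
  let χ : ContDiffBump (0 : ℝ) := ⟨t, b, ht.1, ht.2⟩
  have hχd : ∀ s, HasDerivAt (χ : ℝ → ℝ) (deriv χ s) s := fun s =>
    ((χ.contDiff (n := 1)).differentiable (by simp) s).hasDerivAt
  have hχ'c : Continuous (deriv (χ : ℝ → ℝ)) := (χ.contDiff (n := 1)).continuous_deriv le_rfl
  set f : ℝ → E := fun s => deriv χ s • V s with hf
  set g : ℝ → E := fun s => χ s • v' s with hg
  have hfc : Continuous f := hχ'c.smul hVc
  have hgc : Continuous g := χ.continuous.smul hv'c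
  have hfs : MemLp f p (timeMeasure ∞) :=
    (hfc.memLp_of_hasCompactSupport (χ.hasCompactSupport.deriv.smul_right)).restrict _
  have hgs : MemLp g p (timeMeasure ∞) :=
    (hgc.memLp_of_hasCompactSupport (χ.hasCompactSupport.smul_right)).restrict _
  -- The homogeneous equation `V' = -A V` gives `A (χ V) = -χ V' = -g`.
  have hsol : IsStrongSolution A ∞ f 0 (fun s => χ s • V s) (fun s => f s + g s) (-g) := by
    refine ⟨fun s _ => ((hfc.add hgc).integrableOn_Icc).mono_set Ioc_subset_Icc_self,
      fun s hs => ?_, ?_, .of_forall fun s => by simp⟩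
    · have hd : ∀ r ∈ uIcc 0 s, HasDerivAt (fun s => χ s • V s) (f r + g r) r := fun r _ => by
        rw [add_comm]
        exact (hχd r).smul (hVd r)
      rw [intervalIntegral.integral_eq_sub_of_hasDerivAt hd
        ((hfc.add hgc).intervalIntegrable _ _)]
      simp [hV]
    · refine ae_timeMeasure_of_mem fun s hs => ?_
      rcases le_or_gt s b with hsb | hsb
      · have h1 := A.graph.smul_mem (χ s : ℂ) (hgr s ⟨hs.1.le, hsb⟩)
        rw [← hVeq s ⟨hs.1.le, hsb⟩, ← hv'eq s ⟨hs.1.le, hsb⟩, Prod.smul_mk, Complex.coe_smul,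
          Complex.coe_smul, smul_neg] at h1
        exact h1
      · have h1 : χ s = 0 := χ.zero_of_le_dist (by
          rw [Real.dist_eq, sub_zero, abs_of_pos hs.1]; exact hsb.le)
        simp only [hg, Pi.neg_apply, h1, zero_smul, neg_zero]
        exact A.graph.zero_mem
  have h0 := h.eq_zero_of_rhs_eq_zero hsol hfs hgs.neg ht.1.le (fun s hs => ?_) t ⟨ht.1.le, le_rfl⟩
  · have h1 : χ t = 1 := χ.one_of_mem_closedBall (by
      rw [Metric.mem_closedBall, Real.dist_eq, sub_zero, abs_of_pos ht.1])
    rw [← hVeq t (Ioo_subset_Icc_self ht)]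
    simpa [h1] using h0
  · have h1 : (χ : ℝ → ℝ) =ᶠ[𝓝 s] fun _ => 1 := χ.eventuallyEq_one_of_mem_ball (by
      rw [Metric.mem_ball, Real.dist_eq, sub_zero, abs_of_pos hs.1]; exact hs.2)
    simp only [hf]
    rw [h1.deriv_eq, deriv_const, zero_smul]

end Causality

/-! ### Solutions for locally integrable right-hand sides -/

section LocalSolutions

open Filter Topology

variable {E : Type v} [NormedAddCommGroup E] [NormedSpace ℂ E] [CompleteSpace E]
  {A : E →ₗ.[ℂ] E} {p : ℝ≥0∞}

theorem timeMeasure_ofReal {r : ℝ} : timeMeasure (ENNReal.ofReal r) = volume.restrict (Ioc 0 r) := by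
  have : timeInterval (ENNReal.ofReal r) = Ioo 0 r := by
    ext t
    simp only [timeInterval, mem_ofPred_eq, mem_Ioo]
    refine and_congr_right fun ht => ?_
    constructor
    · intro h
      exact (ENNReal.ofReal_lt_ofReal_iff_of_nonneg ht.le).1 h
    · intro h
      exact (ENNReal.ofReal_lt_ofReal_iff_of_nonneg ht.le).2 h
  rw [timeMeasure, this, restrict_Ioo_eq_restrict_Ioc]

theorem mem_timeIntervalZero_ofReal {r t : ℝ} :
    t ∈ timeIntervalZero (ENNReal.ofReal r) ↔ 0 ≤ t ∧ t < r := by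
  refine and_congr_right fun ht => ?_
  exact ENNReal.ofReal_lt_ofReal_iff_of_nonneg ht

theorem ae_timeMeasure_top_of_forall {P : ℝ → Prop}
    (h : ∀ r : ℝ, 0 < r → ∀ᵐ t ∂(volume.restrict (Ioc 0 r)), P t) : ∀ᵐ t ∂(timeMeasure ∞), P t := by
  have hU : Ioi (0 : ℝ) = ⋃ n : ℕ, Ioc 0 ((n : ℝ) + 1) := by
    ext t
    simp only [mem_Ioi, mem_iUnion, mem_Ioc]
    constructor
    · intro ht
      obtain ⟨n, hn⟩ := exists_nat_gt t
      exact ⟨n, ht, by linarith⟩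
    · rintro ⟨n, h, -⟩
      exact h
  rw [timeMeasure_top, hU, ae_restrict_iUnion_iff]
  exact fun n => h _ (by positivity)

theorem isStrongSolution_top {f u du Au : ℝ → E} {x : E}
    (h : ∀ r : ℝ, 0 < r → IsStrongSolution A (ENNReal.ofReal r) f x u du Au) :
    IsStrongSolution A ∞ f x u du Au := by
  have hmem : ∀ t ∈ timeIntervalZero ∞, t ∈ timeIntervalZero (ENNReal.ofReal (t + 1)) :=
    fun t ht => mem_timeIntervalZero_ofReal.2 ⟨ht.1, by linarith⟩
  have hpos : ∀ t ∈ timeIntervalZero ∞, 0 < t + 1 := fun t ht => by linarith [ht.1]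
  refine ⟨fun t ht => (h _ (hpos t ht)).deriv_integrableOn t (hmem t ht),
    fun t ht => (h _ (hpos t ht)).eq_integral t (hmem t ht),
    ae_timeMeasure_top_of_forall fun r hr => ?_, ae_timeMeasure_top_of_forall fun r hr => ?_⟩
  · rw [← timeMeasure_ofReal]
    exact (h r hr).graph_mem
  · rw [← timeMeasure_ofReal]
    exact (h r hr).equation

/-- The norm of `f` in `L^p(0,t)` is at most `m t^{1/p}`, for all `t > 0`. -/
def HasGrowth (p : ℝ≥0∞) (f : ℝ → E) (m : ℝ) : Prop :=
  ∀ t : ℝ, 0 < t → MemLp f p (volume.restrict (Ioc 0 t)) ∧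
    eLpNorm f p (volume.restrict (Ioc 0 t)) ≤
      ENNReal.ofReal m * ENNReal.ofReal t ^ (1 / p.toReal)

theorem hasGrowth_of_bound {f : ℝ → E} {m : ℝ}
    (hf : AEStronglyMeasurable f (volume.restrict (Ioi 0))) (hm : ∀ t, 0 < t → ‖f t‖ ≤ m) :
    HasGrowth p f m := by
  intro t _
  have hf' : AEStronglyMeasurable f (volume.restrict (Ioc 0 t)) :=
    hf.mono_measure (Measure.restrict_mono Ioc_subset_Ioi_self le_rfl)
  have hb : ∀ᵐ s ∂(volume.restrict (Ioc 0 t)), ‖f s‖ ≤ m :=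
    (ae_restrict_mem measurableSet_Ioc).mono fun s hs => hm s hs.1
  refine ⟨MemLp.of_bound hf' m hb, ?_⟩
  refine (eLpNorm_le_of_ae_bound hb).trans ?_
  rw [mul_comm]
  simp

theorem HasGrowth.integral_norm_le [hp1 : Fact (1 ≤ p)] (hp : p ≠ ∞) {f : ℝ → E} {m : ℝ}
    (hm : 0 ≤ m) (h : HasGrowth p f m) {t : ℝ} (ht : 0 < t) :
    IntegrableOn f (Ioc 0 t) ∧ ∫ s in Ioc 0 t, ‖f s‖ ≤ m * t := by
  obtain ⟨h1, h2⟩ := h t ht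
  have hi : IntegrableOn f (Ioc 0 t) := h1.integrable hp1.out
  refine ⟨hi, ?_⟩
  have h3 := eLpNorm_le_eLpNorm_mul_rpow_measure_univ (p := 1) (q := p) hp1.out h1.1
  have hp0 : 1 ≤ p.toReal := one_le_toReal_of_fact hp
  have h4 : eLpNorm f 1 (volume.restrict (Ioc 0 t)) ≤ ENNReal.ofReal (m * t) := by
    refine h3.trans ((mul_le_mul_left h2 _).trans (le_of_eq ?_))
    rw [Measure.restrict_apply_univ, Real.volume_Ioc, sub_zero, ENNReal.ofReal_mul hm, mul_assoc,
      ← ENNReal.rpow_add _ _ (by simpa using ht) (by simp)]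
    simp
  rw [eLpNorm_one_eq_lintegral_enorm] at h4
  rw [integral_norm_eq_lintegral_enorm h1.1]
  exact ENNReal.toReal_le_of_le_ofReal (by positivity) h4

/-- Maximal regularity on `(0,∞)` for right-hand sides which are only locally in `L^p`. -/
theorem HasLpMaxReg.exists_solution_of_growth [hp1 : Fact (1 ≤ p)] (h : HasLpMaxReg A p ∞) :
    ∃ κ : ℝ, 0 ≤ κ ∧ ∀ (f : ℝ → E) (m : ℝ), 0 ≤ m → HasGrowth p f m →
      ∃ u du Au : ℝ → E, IsStrongSolution A ∞ f 0 u du Au ∧ HasGrowth p Au (κ * m) ∧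
        HasGrowth p du ((1 + κ) * m) := by
  obtain ⟨K, hK⟩ := h.exists_clm
  refine ⟨‖K‖, norm_nonneg _, fun f m hm hf => ?_⟩
  -- Solutions for the truncations of `f` to `(0,r]`.
  have hex : ∀ r : ℝ, ∃ u Au : ℝ → E, 0 < r →
      IsStrongSolution A (ENNReal.ofReal r) f 0 u (f - Au) Au ∧
      MemLp Au p (timeMeasure ∞) ∧ eLpNorm Au p (timeMeasure ∞) ≤
        ENNReal.ofReal ‖K‖ * eLpNorm f p (volume.restrict (Ioc 0 r)) := by
    intro r
    rcases le_or_gt r 0 with hr | hr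
    · exact ⟨0, 0, fun h => absurd h (not_lt.2 hr)⟩
    have hmem : MemLp ((Ioc 0 r).indicator f) p (timeMeasure ∞) := by
      rw [timeMeasure_top, memLp_indicator_iff_restrict measurableSet_Ioc,
        Measure.restrict_restrict measurableSet_Ioc,
        inter_eq_self_of_subset_left Ioc_subset_Ioi_self]
      exact (hf r hr).1
    have hnorm : eLpNorm ((Ioc 0 r).indicator f) p (timeMeasure ∞) =
        eLpNorm f p (volume.restrict (Ioc 0 r)) := by
      rw [timeMeasure_top, eLpNorm_indicator_eq_eLpNorm_restrict measurableSet_Ioc,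
        Measure.restrict_restrict measurableSet_Ioc,
        inter_eq_self_of_subset_left Ioc_subset_Ioi_self]
    obtain ⟨u, ⟨du, Au, hu, -, hAu⟩, -⟩ := h.2 (hmem.toLp _) (Lp.memLp _)
    refine ⟨u, Au, fun _ => ⟨?_, hAu, ?_⟩⟩
    · have hfr : hmem.toLp _ =ᵐ[timeMeasure (ENNReal.ofReal r)] f := by
        have h1 := ae_mono (Measure.restrict_mono (μ := volume)
          (s := timeInterval (ENNReal.ofReal r)) (s' := timeInterval ∞)
          (fun t ht => ⟨ht.1, ht.2.trans_le le_top⟩) le_rfl) hmem.coeFn_toLp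
        refine Filter.EventuallyEq.trans h1 ?_
        rw [timeMeasure_ofReal]
        exact indicator_ae_eq_restrict measurableSet_Ioc
      have h2 := hu.mono (σ := ENNReal.ofReal r) le_top
      refine h2.congr hfr (fun _ _ => rfl) ?_ (ae_eq_refl _)
      filter_upwards [h2.equation, hfr] with t h3 h4
      rw [Pi.sub_apply, ← h4, ← h3, add_sub_cancel_right]
    · rw [← hnorm, eLpNorm_congr_ae (hK _ _ _ _ hu hAu), ← Lp.enorm_def, ← Lp.enorm_toLp hmem,
        ← ofReal_norm, ← ofReal_norm, ← ENNReal.ofReal_mul (norm_nonneg _)]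
      exact ENNReal.ofReal_le_ofReal (K.le_opNorm _)
  choose U AU hU using hex
  have hcompat : ∀ r r' : ℝ, 0 < r → 0 < r' →
      (∀ t, 0 ≤ t → t < min r r' → U r t = U r' t) ∧
      ∀ᵐ t ∂(volume.restrict (Ioc 0 (min r r'))), AU r t = AU r' t := by
    intro r r' hr hr'
    have h1 := (hU r hr).1.mono (σ := ENNReal.ofReal (min r r'))
      (ENNReal.ofReal_le_ofReal (min_le_left _ _))
    have h2 := (hU r' hr').1.mono (σ := ENNReal.ofReal (min r r'))
      (ENNReal.ofReal_le_ofReal (min_le_right _ _))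
    have h3 := (h.strongUnique (ENNReal.ofReal (min r r'))).eqOn h1 h2
    have h4 := h1.ae_eq_of_eqOn h2 h3
    rw [timeMeasure_ofReal] at h4
    exact ⟨fun t h0 ht => h3 (mem_timeIntervalZero_ofReal.2 ⟨h0, ht⟩), h4⟩
  -- By uniqueness the solutions agree where both are defined; glue those for integral `r`.
  set n : ℝ → ℝ := fun t => (⌊t⌋₊ : ℝ) + 1 with hn
  have hnt : ∀ t, t < n t := fun t => Nat.lt_floor_add_one t
  have hn0 : ∀ t, 0 < n t := fun t => by positivity
  set u : ℝ → E := fun t => U (n t) t with hu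
  set Au : ℝ → E := fun t => AU (n t) t with hAu
  have hu_eq : ∀ r, 0 < r → EqOn (U r) u (timeIntervalZero (ENNReal.ofReal r)) := fun r hr t ht => by
    obtain ⟨h0, h1⟩ := mem_timeIntervalZero_ofReal.1 ht
    exact (hcompat r (n t) hr (hn0 t)).1 t h0 (lt_min h1 (hnt t))
  have hAu_eq : ∀ r, 0 < r → AU r =ᵐ[volume.restrict (Ioc 0 r)] Au := fun r hr => by
    have h1 : ∀ k : ℕ, ∀ᵐ t : ℝ, t ∈ Ioc 0 (min r ((k : ℝ) + 1)) → AU r t = AU ((k : ℝ) + 1) t :=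
      fun k => (ae_restrict_iff' measurableSet_Ioc).1 (hcompat r _ hr (by positivity)).2
    rw [EventuallyEq, ae_restrict_iff' measurableSet_Ioc]
    filter_upwards [ae_all_iff.2 h1] with t ht ht'
    exact ht _ ⟨ht'.1, le_min ht'.2 (hnt t).le⟩
  have hgA : HasGrowth p Au (‖K‖ * m) := by
    intro t ht
    have hle : volume.restrict (Ioc 0 t) ≤ timeMeasure ∞ := by
      rw [timeMeasure_top]; exact Measure.restrict_mono Ioc_subset_Ioi_self le_rfl
    refine ⟨((hU t ht).2.1.mono_measure hle).ae_eq (hAu_eq t ht), ?_⟩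
    rw [← eLpNorm_congr_ae (hAu_eq t ht), ENNReal.ofReal_mul (norm_nonneg _), mul_assoc]
    refine (eLpNorm_mono_measure _ hle).trans ((hU t ht).2.2.trans ?_)
    gcongr
    exact (hf t ht).2
  refine ⟨u, f - Au, Au, isStrongSolution_top fun r hr => ?_, hgA, fun t ht => ?_⟩
  · have h1 := hAu_eq r hr
    rw [← timeMeasure_ofReal] at h1
    exact (hU r hr).1.congr (ae_eq_refl _) (hu_eq r hr) ((ae_eq_refl f).sub h1) h1
  · refine ⟨(hf t ht).1.sub (hgA t ht).1, (eLpNorm_sub_le (hf t ht).1.1 (hgA t ht).1.1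
      hp1.out).trans ?_⟩
    rw [add_mul, one_mul, ENNReal.ofReal_add hm (by positivity), add_mul]
    exact add_le_add (hf t ht).2 (hgA t ht).2

end LocalSolutions

/-! ### The semigroup of an operator with maximal regularity on the half-line -/

section HalfLine

open Filter Topology

variable {E : Type v} [NormedAddCommGroup E] [NormedSpace ℂ E] [CompleteSpace E]
  {A : E →ₗ.[ℂ] E} {p : ℝ≥0∞}

/-- Fubini's theorem for an iterated primitive. -/
theorem integral_primitive {g : ℝ → E} {t : ℝ} (hg : IntegrableOn g (Ioc 0 t)) :
    ∫ s in Ioc 0 t, ∫ r in Ioc 0 s, g r = ∫ r in Ioc 0 t, (t - r) • g r := by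
  set ν : Measure ℝ := volume.restrict (Ioc 0 t) with hν
  set F : ℝ → ℝ → E := fun s r => {q : ℝ × ℝ | q.2 ≤ q.1}.indicator (fun q => g q.2) (s, r) with hF
  have hFi : Integrable (Function.uncurry F) (ν.prod ν) := by
    have h1 : Integrable (fun q : ℝ × ℝ => g q.2) (ν.prod ν) := Integrable.comp_snd hg ν
    exact h1.indicator (measurableSet_le measurable_snd measurable_fst)
  have h1 : ∀ s ∈ Ioc 0 t, ∫ r, F s r ∂ν = ∫ r in Ioc 0 s, g r := fun s hs => by
    have e : F s = (Iic s).indicator g := by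
      ext r
      simp only [hF, indicator_apply, mem_ofPred_eq, mem_Iic]
    rw [e, integral_indicator measurableSet_Iic, hν, Measure.restrict_restrict measurableSet_Iic]
    congr 2
    ext r
    simp only [mem_inter_iff, mem_Iic, mem_Ioc]
    constructor
    · rintro ⟨a, b, -⟩
      exact ⟨b, a⟩
    · rintro ⟨a, b⟩
      exact ⟨b, a, b.trans hs.2⟩
  have h2 : ∀ r ∈ Ioc 0 t, ∫ s, F s r ∂ν = (t - r) • g r := fun r hr => by
    have e : (fun s => F s r) = (Ici r).indicator fun _ => g r := by
      ext s
      simp only [hF, indicator_apply, mem_ofPred_eq, mem_Ici]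
    rw [e, integral_indicator measurableSet_Ici, hν, Measure.restrict_restrict measurableSet_Ici,
      setIntegral_const]
    have e2 : Ici r ∩ Ioc 0 t = Icc r t := by
      ext s
      simp only [mem_inter_iff, mem_Ici, mem_Ioc, mem_Icc]
      constructor
      · rintro ⟨a, -, c⟩
        exact ⟨a, c⟩
      · rintro ⟨a, c⟩
        exact ⟨a, hr.1.trans_le a, c⟩
    rw [e2, Real.volume_real_Icc_of_le hr.2]
  calc ∫ s in Ioc 0 t, ∫ r in Ioc 0 s, g r = ∫ s, ∫ r, F s r ∂ν ∂ν :=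
        setIntegral_congr_fun measurableSet_Ioc fun s hs => (h1 s hs).symm
    _ = ∫ r, ∫ s, F s r ∂ν ∂ν := integral_integral_swap hFi
    _ = _ := setIntegral_congr_fun measurableSet_Ioc h2

theorem integrableOn_id_smul {g : ℝ → E} {t : ℝ} (hg : IntegrableOn g (Ioc 0 t)) :
    IntegrableOn (fun s => s • g s) (Ioc 0 t) := by
  refine Integrable.mono' (hg.norm.const_mul t) 
    (AEStronglyMeasurable.smul (f := fun s : ℝ => s) continuous_id.aestronglyMeasurable hg.1) ?_
  filter_upwards [ae_restrict_mem measurableSet_Ioc] with s hs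
  rw [norm_smul, Real.norm_of_nonneg hs.1.le]
  gcongr
  exact hs.2

theorem forall_mem_of_ae_mem {Y : Type*} [TopologicalSpace Y] {G : ℝ → Y} {S : Set Y}
    (hS : IsClosed S) (hG : ContinuousOn G (Ioi 0))
    (h : ∀ᵐ t ∂(volume.restrict (Ioi (0 : ℝ))), G t ∈ S) : ∀ t, 0 < t → G t ∈ S := by
  intro t ht
  rw [ae_restrict_iff' measurableSet_Ioi] at h
  have h1 := (Measure.dense_of_ae h).open_subset_closure_inter isOpen_Ioi (mem_Ioi.2 ht)
  have h2 : ContinuousWithinAt G (Ioi 0 ∩ {t | t ∈ Ioi 0 → G t ∈ S}) t :=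
    (hG t ht).mono inter_subset_left
  have h3 := h2.mem_closure (t := S) h1 fun s hs => hs.2 hs.1
  rwa [hS.closure_eq] at h3

theorem IsStrongSolution.eq_integral_Ioc {f u du Au : ℝ → E}
    (h : IsStrongSolution A ∞ f 0 u du Au) {t : ℝ} (ht : 0 ≤ t) :
    u t = ∫ s in Ioc 0 t, du s := by
  rw [h.eq_integral t (mem_timeIntervalZero_top.2 ht), zero_add,
    intervalIntegral.integral_of_le ht]

theorem IsStrongSolution.continuousOn_Ici {f u du Au : ℝ → E}
    (h : IsStrongSolution A ∞ f 0 u du Au) : ContinuousOn u (Ici 0) := by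
  intro t ht
  have h1 := h.continuousOn (t := t + 1) (mem_timeIntervalZero_top.2 (by
    have : (0 : ℝ) ≤ t := ht
    linarith)) t ⟨ht, by linarith⟩
  refine h1.mono_of_mem_nhdsWithin ?_
  rw [← Ici_inter_Iic]
  exact inter_mem_nhdsWithin _ (Iic_mem_nhds (by linarith))

/-- `g` is continuous on `(0,∞)`, integrable near `0`, and its primitive `u` solves `u' + A u = x`,
`u(0) = 0`. -/
structure IsOrbit (A : E →ₗ.[ℂ] E) (x : E) (g : ℝ → E) : Prop where
  continuousOn : ContinuousOn g (Ioi 0)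
  integrableOn : ∀ t, IntegrableOn g (Ioc 0 t)
  graph_mem : ∀ t, 0 < t → (∫ s in Ioc 0 t, g s, x - g t) ∈ A.graph

namespace IsOrbit

variable {x y : E} {g h : ℝ → E}

theorem add (hg : IsOrbit A x g) (hh : IsOrbit A y h) :
    IsOrbit A (x + y) (fun t => g t + h t) where
  continuousOn := hg.continuousOn.add hh.continuousOn
  integrableOn t := (hg.integrableOn t).add (hh.integrableOn t)
  graph_mem t ht := by
    rw [integral_add (hg.integrableOn t) (hh.integrableOn t), add_sub_add_comm]
    exact A.graph.add_mem (hg.graph_mem t ht) (hh.graph_mem t ht)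

theorem smul (c : ℂ) (hg : IsOrbit A x g) : IsOrbit A (c • x) (fun t => c • g t) where
  continuousOn := hg.continuousOn.const_smul c
  integrableOn t := (hg.integrableOn t).smul c
  graph_mem t ht := by
    rw [integral_smul, ← smul_sub]
    exact A.graph.smul_mem c (hg.graph_mem t ht)

theorem eq_zero (hu : StrongUnique A ∞) (hg : IsOrbit A 0 g) {t : ℝ} (ht : 0 < t) : g t = 0 := by
  have hii : ∀ s, 0 ≤ s → IntervalIntegrable g volume 0 s := fun s hs =>
    (intervalIntegrable_iff_integrableOn_Ioc_of_le hs).2 (hg.integrableOn s)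
  have h1 : IsStrongSolution A ∞ 0 0 (fun t => ∫ s in (0 : ℝ)..t, g s) g (-g) := by
    refine ⟨fun t _ => hg.integrableOn t, fun t _ => by rw [zero_add],
      ae_timeMeasure_of_mem fun t ht => ?_, .of_forall fun t => by simp⟩
    have := hg.graph_mem t ht.1
    rw [zero_sub, ← intervalIntegral.integral_of_le ht.1.le] at this
    exact this
  have h2 := hu _ _ _ h1
  have h3 := hasDerivAt_integral_of_continuousOn (T := t + 1) ⟨ht, by linarith⟩ (hii t ht.le)
    (hg.continuousOn.mono fun s hs => hs.1)
  have h4 : HasDerivAt (fun r => ∫ s in (0 : ℝ)..r, g s) 0 t := by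
    refine (hasDerivAt_const t (0 : E)).congr_of_eventuallyEq ?_
    filter_upwards [Ioi_mem_nhds ht] with r hr
      using h2 r (mem_timeIntervalZero_top.2 (le_of_lt hr))
  exact h3.unique h4

theorem unique (hu : StrongUnique A ∞) (hg : IsOrbit A x g) (hh : IsOrbit A x h) {t : ℝ}
    (ht : 0 < t) : g t = h t := by
  have h1 := hg.add (hh.smul (-1))
  rw [neg_one_smul, add_neg_cancel] at h1
  have h2 := h1.eq_zero hu ht
  rwa [neg_one_smul, ← sub_eq_add_neg, sub_eq_zero] at h2

theorem translate (hg : IsOrbit A x g) {r : ℝ} (hr : 0 < r) :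
    IsOrbit A (g r) (fun t => g (t + r)) := by
  have hi : ∀ t, 0 ≤ t → IntervalIntegrable g volume 0 t := fun t ht =>
    (intervalIntegrable_iff_integrableOn_Ioc_of_le ht).2 (hg.integrableOn t)
  have hi' : ∀ t, 0 ≤ t → IntervalIntegrable (fun s => g (s + r)) volume 0 t := fun t ht => by
    have := ((hi r hr.le).symm.trans (hi (t + r) (by linarith))).comp_add_right r
    simpa using this
  refine ⟨hg.continuousOn.comp (by fun_prop) fun t ht => ?_, fun t => ?_, fun t ht => ?_⟩
  · have : (0 : ℝ) < t := ht
    exact mem_Ioi.2 (by linarith)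
  · rcases le_or_gt 0 t with ht | ht
    · exact (intervalIntegrable_iff_integrableOn_Ioc_of_le ht).1 (hi' t ht)
    · rw [Ioc_eq_empty (by linarith)]; simp
  · have h1 := A.graph.sub_mem (hg.graph_mem (t + r) (by linarith)) (hg.graph_mem r hr)
    have h2 : ∫ s in Ioc 0 t, g (s + r) =
        (∫ s in Ioc 0 (t + r), g s) - ∫ s in Ioc 0 r, g s := by
      rw [← intervalIntegral.integral_of_le ht.le, ← intervalIntegral.integral_of_le hr.le,
        ← intervalIntegral.integral_of_le (by linarith), intervalIntegral.integral_comp_add_right,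
        zero_add, intervalIntegral.integral_interval_sub_left (hi (t + r) (by linarith)) (hi r hr.le)]
    rw [h2]
    rw [Prod.mk_sub_mk, sub_sub_sub_cancel_left] at h1
    exact h1

/-- The orbit of an element of the domain. -/
theorem of_mem_graph (hA : A.IsClosed) (hxy : (x, y) ∈ A.graph) (hg : IsOrbit A y g) :
    IsOrbit A x (fun t => x - ∫ s in Ioc 0 t, g s) ∧
      ∀ t, 0 < t → (x - ∫ s in Ioc 0 t, g s, g t) ∈ A.graph := by
  have hgr : ∀ t, 0 < t → (x - ∫ s in Ioc 0 t, g s, g t) ∈ A.graph := fun t ht => by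
    have := A.graph.sub_mem hxy (hg.graph_mem t ht)
    rwa [Prod.mk_sub_mk, sub_sub_cancel] at this
  have hi : ∀ t, 0 ≤ t → IntervalIntegrable g volume 0 t := fun t ht =>
    (intervalIntegrable_iff_integrableOn_Ioc_of_le ht).2 (hg.integrableOn t)
  have hcIcc : ∀ t, ContinuousOn (fun t => x - ∫ s in Ioc 0 t, g s) (Icc 0 t) := fun t =>
    continuousOn_const.sub (intervalIntegral.continuousOn_primitive
      ((integrableOn_Icc_iff_integrableOn_Ioc).2 (hg.integrableOn t)))
  have hint : ∀ t, IntegrableOn (fun t => x - ∫ s in Ioc 0 t, g s) (Ioc 0 t) := fun t =>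
    (hcIcc t).integrableOn_Icc.mono_set Ioc_subset_Icc_self
  refine ⟨⟨fun t ht => ?_, hint, fun t ht => ?_⟩, hgr⟩
  · have ht' : (0 : ℝ) < t := ht
    exact ((hcIcc (t + 1)).continuousAt (Icc_mem_nhds ht' (by linarith))).continuousWithinAt
  · have h1 := integral_mem_graph hA (hint t) (hg.integrableOn t)
      ((ae_restrict_mem measurableSet_Ioc).mono fun s hs => hgr s hs.1)
    rwa [sub_sub_cancel]

end IsOrbit

/-- The orbits of the semigroup: with `u' + A u = x` and `v' + A v = u'`, one has `v(t) = t u'(t)`,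
because `t u - ∫ u` and `∫ v` solve the same equation. In particular, `u'` is continuous and bounded,
and `A u'` is controlled by the maximal regularity of `v`. -/
theorem HasLpMaxReg.exists_orbit [hp1 : Fact (1 ≤ p)] (hp : p ≠ ∞) (hA : HasLpMaxReg A p ∞) :
    ∃ M : ℝ, 0 ≤ M ∧ ∀ x, ∃ g, IsOrbit A x g ∧ (∀ t, 0 < t → ‖g t‖ ≤ M * ‖x‖) ∧
      ∀ t, 0 < t → ∃ s ∈ Ioc (t / 2) t, ∃ y, (g s, y) ∈ A.graph ∧ ‖y‖ ≤ M * ‖x‖ / t := by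
  obtain ⟨κ, hκ, hsol⟩ := hA.exists_solution_of_growth
  have hu := hA.strongUnique ∞
  refine ⟨4 * (1 + κ) * (1 + κ), by positivity, fun x => ?_⟩
  set m := (1 + κ) * ‖x‖ with hm
  have hm0 : 0 ≤ m := by positivity
  obtain ⟨u, du, Au, hu1, huA, hdu⟩ := hsol (fun _ => x) ‖x‖ (norm_nonneg _)
    (hasGrowth_of_bound aestronglyMeasurable_const fun _ _ => le_rfl)
  obtain ⟨v, dv, Av, hv1, hvA, hdv⟩ := hsol du m hm0 hdu
  have hi : ∀ {f : ℝ → E} {c : ℝ}, 0 ≤ c → HasGrowth p f c → ∀ t, IntegrableOn f (Ioc 0 t) := by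
    intro f c hc hf t
    rcases le_or_gt t 0 with ht | ht
    · rw [Ioc_eq_empty (by linarith)]; simp
    · exact (hf.integral_norm_le hp hc ht).1
  have idu := hi hm0 hdu
  have iAu := hi (by positivity) huA
  have iAv := hi (by positivity) hvA
  have iu : ∀ t, 0 ≤ t → IntegrableOn u (Ioc 0 t) := fun t ht =>
    (hu1.continuousOn (mem_timeIntervalZero_top.2 ht)).integrableOn_Icc.mono_set Ioc_subset_Icc_self
  have iv : ∀ t, 0 ≤ t → IntegrableOn v (Ioc 0 t) := fun t ht =>
    (hv1.continuousOn (mem_timeIntervalZero_top.2 ht)).integrableOn_Icc.mono_set Ioc_subset_Icc_self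
  have hIoc : ∀ t : ℝ, volume.restrict (Ioc 0 t) ≤ timeMeasure ∞ := fun t => by
    rw [timeMeasure_top]; exact Measure.restrict_mono Ioc_subset_Ioi_self le_rfl
  have hae : ∀ {P : ℝ → Prop}, (∀ᵐ t ∂(timeMeasure ∞), P t) →
      ∀ t : ℝ, ∀ᵐ s ∂(volume.restrict (Ioc 0 t)), P s := fun h t => ae_mono (hIoc t) h
  have hmem : ∀ᵐ t ∂(timeMeasure ∞), 0 < t := ae_timeMeasure_of_mem fun t ht => ht.1
  -- `Q = t u - ∫ u` and `W = ∫ v` both solve `w' + A w = u`; comparing the derivatives `t u'` and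
  -- `v` gives `v = t u'`.
  have hQ : IsStrongSolution A ∞ u 0 (fun t => t • u t - ∫ s in Ioc 0 t, u s)
      (fun t => t • du t) (fun t => t • Au t - ∫ s in Ioc 0 t, Au s) := by
    refine ⟨fun t _ => integrableOn_id_smul (idu t), fun t ht => ?_, ?_, ?_⟩
    · have ht0 := mem_timeIntervalZero_top.1 ht
      have e1 : ∫ s in Ioc 0 t, u s = ∫ s in Ioc 0 t, ∫ r in Ioc 0 s, du r :=
        setIntegral_congr_fun measurableSet_Ioc fun s hs => hu1.eq_integral_Ioc hs.1.le
      have e2 : ∫ r in Ioc 0 t, (t - r) • du r =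
          t • (∫ r in Ioc 0 t, du r) - ∫ r in Ioc 0 t, r • du r := by
        simp only [sub_smul]
        have i1 : Integrable (fun r => t • du r) (volume.restrict (Ioc 0 t)) := (idu t).smul t
        rw [integral_sub i1 (integrableOn_id_smul (idu t)), integral_smul]
      rw [zero_add, intervalIntegral.integral_of_le ht0, e1, integral_primitive (idu t), e2,
        hu1.eq_integral_Ioc ht0, sub_sub_cancel]
    · filter_upwards [hu1.graph_mem, hmem] with t ht ht0
      have h1 := integral_mem_graph hA.1 (iu t ht0.le) (iAu t) (hae hu1.graph_mem t)
      have h2 := A.graph.smul_mem (t : ℂ) ht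
      rw [Prod.smul_mk, Complex.coe_smul, Complex.coe_smul] at h2
      exact A.graph.sub_mem h2 h1
    · filter_upwards [hu1.equation, hmem] with t ht ht0
      have e : ∫ s in Ioc 0 t, Au s = t • x - u t := by
        have h1 : ∫ s in Ioc 0 t, Au s = ∫ s in Ioc 0 t, (x - du s) :=
          integral_congr_ae ((hae hu1.equation t).mono fun s hs =>
            eq_sub_of_add_eq' hs)
        rw [h1, integral_sub (integrable_const x) (idu t), setIntegral_const,
          Real.volume_real_Ioc_of_le ht0.le, sub_zero, hu1.eq_integral_Ioc ht0.le]
      rw [e, ← ht, smul_add]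
      abel
  have hW : IsStrongSolution A ∞ u 0 (fun t => ∫ s in Ioc 0 t, v s) v
      (fun t => ∫ s in Ioc 0 t, Av s) := by
    refine ⟨fun t ht => iv t (mem_timeIntervalZero_top.1 ht), fun t ht => ?_, ?_, ?_⟩
    · rw [zero_add, intervalIntegral.integral_of_le (mem_timeIntervalZero_top.1 ht)]
    · filter_upwards [hmem] with t ht0
      exact integral_mem_graph hA.1 (iv t ht0.le) (iAv t) (hae hv1.graph_mem t)
    · filter_upwards [hmem] with t ht0
      have h1 : ∫ s in Ioc 0 t, Av s = ∫ s in Ioc 0 t, (du s - dv s) :=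
        integral_congr_ae ((hae hv1.equation t).mono fun s hs =>
          eq_sub_of_add_eq' hs)
      rw [h1, integral_sub (idu t) (hi (by positivity) hdv t), ← hu1.eq_integral_Ioc ht0.le,
        ← hv1.eq_integral_Ioc ht0.le, add_sub_cancel]
  have hdu_eq : ∀ᵐ t ∂(timeMeasure ∞), du t = t⁻¹ • v t := by
    filter_upwards [hQ.ae_eq_of_eqOn hW (hu.eqOn hQ hW), hQ.equation, hW.equation, hmem]
      with t h1 h2 h3 h4
    rw [h1, ← h3] at h2
    rw [← add_right_cancel h2, smul_smul, inv_mul_cancel₀ h4.ne', one_smul]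
  set g : ℝ → E := fun t => t⁻¹ • v t with hg
  have hgc : ContinuousOn g (Ioi 0) :=
    (ContinuousOn.inv₀ continuousOn_id fun t ht => (mem_Ioi.1 ht).ne').smul
      (hv1.continuousOn_Ici.mono Ioi_subset_Ici_self)
  have hug : ∀ t, 0 < t → ∫ s in Ioc 0 t, g s = u t := fun t ht => by
    rw [hu1.eq_integral_Ioc ht.le]
    exact integral_congr_ae ((hae hdu_eq t).mono fun s hs => hs.symm)
  have hgr : ∀ t, 0 < t → (u t, x - g t) ∈ A.graph := by
    refine forall_mem_of_ae_mem (S := (A.graph : Set (E × E))) hA.1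
      ((hu1.continuousOn_Ici.mono Ioi_subset_Ici_self).prodMk (continuousOn_const.sub hgc)) ?_
    rw [← timeMeasure_top]
    filter_upwards [hu1.graph_mem, hu1.equation, hdu_eq] with t h1 h2 h3
    rw [← h2, h3] at *
    simpa [hg] using h1
  refine ⟨g, ⟨hgc, fun t => (idu t).congr (hae hdu_eq t), fun t ht => ?_⟩,
    fun t ht => ?_, fun t ht => ?_⟩
  · rw [hug t ht]
    exact hgr t ht
  · have h1 : ‖v t‖ ≤ (1 + κ) * m * t := by
      rw [hv1.eq_integral_Ioc ht.le]
      exact (norm_integral_le_integral_norm _).trans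
        (hdv.integral_norm_le hp (by positivity) ht).2
    rw [hg, norm_smul, norm_inv, Real.norm_of_nonneg ht.le, inv_mul_le_iff₀ ht]
    refine h1.trans ?_
    rw [hm]
    have : 0 ≤ (1 + κ) * (1 + κ) * ‖x‖ * t := by positivity
    nlinarith
  · have h1 := (hvA.integral_norm_le hp (by positivity) ht).2
    set ν := volume.restrict (Ioc (t / 2) t) with hν
    have hsub : Ioc (t / 2) t ⊆ Ioc 0 t := Ioc_subset_Ioc_left (by linarith)
    have hνi : Integrable (fun s => ‖Av s‖) ν := ((iAv t).mono_set hsub).norm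
    have hgood : ∀ᵐ s ∂ν, s ∈ Ioc (t / 2) t ∧ (v s, Av s) ∈ A.graph :=
      (ae_restrict_mem measurableSet_Ioc).and
        (ae_mono ((Measure.restrict_mono hsub le_rfl).trans (hIoc t)) hv1.graph_mem)
    have hν0 : ν ≠ 0 := by
      rw [hν, Ne, Measure.restrict_eq_zero, Real.volume_Ioc]
      simpa using ht
    -- Some point of `(t/2,t]` at which the graph relation holds does not exceed the average.
    obtain ⟨s, hs1, hs2⟩ := exists_notMem_null_le_average hν0 hνi (ae_iff.1 hgood)
    simp only [mem_ofPred_eq, not_not] at hs1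
    have hs0 : 0 < s := by linarith [hs1.1.1]
    refine ⟨s, hs1.1, s⁻¹ • Av s, ?_, ?_⟩
    · have := A.graph.smul_mem ((s⁻¹ : ℝ) : ℂ) hs1.2
      rwa [Prod.smul_mk, Complex.coe_smul, Complex.coe_smul] at this
    · have hav : ⨍ s, ‖Av s‖ ∂ν ≤ 2 * (κ * m) := by
        rw [average_eq, hν, measureReal_restrict_apply_univ, Real.volume_real_Ioc_of_le (by linarith),
          smul_eq_mul, inv_mul_le_iff₀ (by linarith)]
        refine (setIntegral_mono_set (iAv t).norm (.of_forall fun _ => norm_nonneg _)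
          (.of_forall hsub)).trans (h1.trans (le_of_eq (by ring)))
      have h2 : s⁻¹ ≤ 2 / t := by
        rw [inv_le_comm₀ hs0 (by positivity), inv_div]
        exact hs1.1.1.le
      rw [norm_smul, norm_inv, Real.norm_of_nonneg hs0.le]
      calc s⁻¹ * ‖Av s‖ ≤ 2 / t * (2 * (κ * m)) := by
            gcongr
            exact hs2.trans hav
        _ = 4 * (κ * m) / t := by ring
        _ ≤ 4 * (1 + κ) * (1 + κ) * ‖x‖ / t := by
            refine div_le_div_of_nonneg_right ?_ ht.le
            rw [hm]
            have : 0 ≤ (1 + κ) * ‖x‖ := by positivity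
            nlinarith

/-- A bounded semigroup `T` of solution operators of `u' + A u = 0` such that `S(t) = A T(t)` is
bounded, with norm at most `M / t`. -/
structure IsAnalyticPair (A : E →ₗ.[ℂ] E) (T S : ℝ → E →L[ℂ] E) (M : ℝ) : Prop where
  orbit : ∀ x, IsOrbit A x (fun t => T t x)
  bound : ∀ t, 0 < t → ‖T t‖ ≤ M
  map_add : ∀ s t x, 0 < s → 0 < t → T (s + t) x = T s (T t x)
  graph_mem : ∀ t x, 0 < t → (T t x, S t x) ∈ A.graph
  bound' : ∀ t, 0 < t → ‖S t‖ ≤ M / t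
  continuousOn : ∀ x, ContinuousOn (fun t => S t x) (Ioi 0)
  integral_eq : ∀ x y, (x, y) ∈ A.graph → ∀ t, 0 < t → T t x = x - ∫ s in Ioc 0 t, T s y
  comm : ∀ x y, (x, y) ∈ A.graph → ∀ t, 0 < t → S t x = T t y

/-- Maximal regularity on `(0,∞)` produces a bounded analytic semigroup: the orbits depend linearly
on the initial value, by uniqueness. -/
theorem HasLpMaxReg.exists_analyticPair [hp1 : Fact (1 ≤ p)] (hp : p ≠ ∞)
    (hA : HasLpMaxReg A p ∞) : ∃ T S M, 0 ≤ M ∧ IsAnalyticPair A T S M := by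
  obtain ⟨M, hM, horb⟩ := hA.exists_orbit hp
  have hu := hA.strongUnique ∞
  choose G hG hGb hGA using horb
  let T : ℝ → E →L[ℂ] E := fun t =>
    if ht : 0 < t then LinearMap.mkContinuous
      { toFun := fun x => G x t
        map_add' := fun x y => (hG (x + y)).unique hu ((hG x).add (hG y)) ht
        map_smul' := fun c x => (hG (c • x)).unique hu ((hG x).smul c) ht } M
      fun x => hGb x t ht
    else 0
  have hTG : ∀ t, 0 < t → ∀ x, T t x = G x t := fun t ht x => by
    simp only [T, dif_pos ht]
    rfl
  have orbit : ∀ x, IsOrbit A x (fun t => T t x) := fun x => by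
    have e : ∀ t, EqOn (G x) (fun t => T t x) (Ioc 0 t) := fun t s hs => (hTG s hs.1 x).symm
    refine ⟨(hG x).continuousOn.congr fun t ht => hTG t ht x,
      fun t => ((hG x).integrableOn t).congr_fun (e t) measurableSet_Ioc, fun t ht => ?_⟩
    rw [← setIntegral_congr_fun measurableSet_Ioc (e t), hTG t ht]
    exact (hG x).graph_mem t ht
  have hadd : ∀ s t x, 0 < s → 0 < t → T (s + t) x = T s (T t x) := fun s t x hs ht =>
    ((orbit x).translate ht).unique hu (orbit (T t x)) hs
  have hdom : ∀ x y, (x, y) ∈ A.graph → ∀ t, 0 < t → T t x = x - ∫ s in Ioc 0 t, T s y :=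
    fun x y hxy t ht => (orbit x).unique hu ((orbit y).of_mem_graph hA.1 hxy).1 ht
  have hTgr : ∀ x y, (x, y) ∈ A.graph → ∀ t, 0 < t → (T t x, T t y) ∈ A.graph :=
    fun x y hxy t ht => by
    rw [hdom x y hxy t ht]
    exact ((orbit y).of_mem_graph hA.1 hxy).2 t ht
  have hTb : ∀ t, 0 < t → ∀ x, ‖T t x‖ ≤ M * ‖x‖ := fun t ht x => by
    rw [hTG t ht]
    exact hGb x t ht
  -- for `t > s` one has `A T(t) x = T(t - s) A T(s) x`
  have hlocal : ∀ x t, 0 < t → ∃ s ∈ Ico (t / 4) t, ∃ y, ‖y‖ ≤ 2 * M * ‖x‖ / t ∧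
      ∀ r, s < r → (T r x, T (r - s) y) ∈ A.graph := by
    intro x t ht
    obtain ⟨s, hs, y, hy, hyb⟩ := hGA x (t / 2) (by linarith)
    have hs0 : 0 < s := by linarith [hs.1]
    rw [← hTG s hs0] at hy
    refine ⟨s, ⟨by linarith [hs.1], by linarith [hs.2]⟩, y, hyb.trans (le_of_eq (by field_simp)),
      fun r hr => ?_⟩
    have h1 := hTgr _ _ hy (r - s) (by linarith)
    rwa [← hadd (r - s) s x (by linarith) hs0, sub_add_cancel] at h1
  have hS : ∀ t x, ∃ y, 0 < t → (T t x, y) ∈ A.graph ∧ ‖y‖ ≤ 2 * M * M / t * ‖x‖ := by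
    intro t x
    rcases le_or_gt t 0 with ht | ht
    · exact ⟨0, fun h => absurd h (not_lt.2 ht)⟩
    obtain ⟨s, hs, y, hy, h1⟩ := hlocal x t ht
    refine ⟨T (t - s) y, fun _ => ⟨h1 t hs.2, (hTb _ (by linarith [hs.2]) _).trans ?_⟩⟩
    calc M * ‖y‖ ≤ M * (2 * M * ‖x‖ / t) := by gcongr
      _ = _ := by ring
  choose S hS using hS
  let S' : ℝ → E →L[ℂ] E := fun t =>
    if ht : 0 < t then LinearMap.mkContinuous
      { toFun := S t
        map_add' := fun x y => A.mem_graph_snd_inj (hS t (x + y) ht).1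
          (A.graph.add_mem (hS t x ht).1 (hS t y ht).1) (map_add (T t) x y)
        map_smul' := fun c x => A.mem_graph_snd_inj (hS t (c • x) ht).1
          (A.graph.smul_mem c (hS t x ht).1) (map_smul (T t) c x) } (2 * M * M / t)
      fun x => (hS t x ht).2
    else 0
  have hS' : ∀ t, 0 < t → ∀ x, S' t x = S t x := fun t ht x => by
    simp only [S', dif_pos ht]
    rfl
  have hgr : ∀ t x, 0 < t → (T t x, S' t x) ∈ A.graph := fun t x ht => by
    rw [hS' t ht]
    exact (hS t x ht).1
  refine ⟨T, S', max M (2 * M * M), le_max_of_le_left hM, orbit, fun t ht => ?_, hadd, hgr,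
    fun t ht => ?_, fun x t ht => ?_, hdom, fun x y hxy t ht => ?_⟩
  · refine ContinuousLinearMap.opNorm_le_bound _ (le_max_of_le_left hM) fun x => ?_
    exact (hTb t ht x).trans (by gcongr; exact le_max_left _ _)
  · have : ‖S' t‖ ≤ 2 * M * M / t := by
      refine ContinuousLinearMap.opNorm_le_bound _ (by positivity) fun x => ?_
      rw [hS' t ht]
      exact (hS t x ht).2
    refine this.trans ?_
    gcongr
    exact le_max_right _ _
  · obtain ⟨s, hs, y, hy, h1⟩ := hlocal x t ht
    have hs0 : 0 < s := by
      have : (0 : ℝ) < t := ht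
      linarith [hs.1]
    have h2 : ContinuousAt (fun r => T (r - s) y) t := by
      refine ContinuousAt.comp (g := fun r => T r y) (f := fun r => r - s) ?_ (by fun_prop)
      exact (orbit y).continuousOn.continuousAt (Ioi_mem_nhds (by linarith [hs.2]))
    refine (h2.congr ?_).continuousWithinAt
    filter_upwards [Ioi_mem_nhds hs.2] with r hr
    exact A.mem_graph_snd_inj (h1 r hr) (hgr r x (hs0.trans hr)) rfl
  · exact A.mem_graph_snd_inj (hgr t x ht) (hTgr x y hxy t ht) rfl

end HalfLine

/-! ### The part of an operator in a space between the domain and the ambient space -/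

section Intermediate

open Filter Topology

variable {X : Type u} [NormedAddCommGroup X] [NormedSpace ℂ X] [CompleteSpace X]
  {A : X →ₗ.[ℂ] X} {T S : ℝ → X →L[ℂ] X} {M : ℝ} {p : ℝ≥0∞}

/-- The inclusion of the domain of `A`. -/
def domFst (A : X →ₗ.[ℂ] X) : graphSpace A →L[ℂ] X :=
  (ContinuousLinearMap.fst ℂ X X).comp
    ((WithLp.prodContinuousLinearEquiv 1 ℂ X X : WithLp 1 (X × X) →L[ℂ] X × X).comp
      (graphSpace A).subtypeL)

/-- The operator `A` on its domain with the graph norm. -/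
def domSnd (A : X →ₗ.[ℂ] X) : graphSpace A →L[ℂ] X :=
  (ContinuousLinearMap.snd ℂ X X).comp
    ((WithLp.prodContinuousLinearEquiv 1 ℂ X X : WithLp 1 (X × X) →L[ℂ] X × X).comp
      (graphSpace A).subtypeL)

theorem mem_graph_dom (d : graphSpace A) : (domFst A d, domSnd A d) ∈ A.graph := d.2

theorem norm_dom (d : graphSpace A) : ‖d‖ = ‖domFst A d‖ + ‖domSnd A d‖ := graphSpace_norm A d

theorem norm_domFst_le (d : graphSpace A) : ‖domFst A d‖ ≤ ‖d‖ := by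
  rw [norm_dom]; exact le_add_of_nonneg_right (norm_nonneg _)

theorem norm_domSnd_le (d : graphSpace A) : ‖domSnd A d‖ ≤ ‖d‖ := by
  rw [norm_dom]; exact le_add_of_nonneg_left (norm_nonneg _)

theorem domFst_injective : Function.Injective (domFst A) := by
  intro d d' h
  have h2 : domSnd A d = domSnd A d' := A.mem_graph_snd_inj (mem_graph_dom d) (mem_graph_dom d') h
  rw [← sub_eq_zero, ← norm_eq_zero, norm_dom, map_sub, map_sub, h, h2]
  simp

/-- The element of the space `D_A` given by a point of the graph of `A`. -/
def domMk {x y : X} (h : (x, y) ∈ A.graph) : graphSpace A := ⟨WithLp.toLp 1 (x, y), h⟩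

@[simp] theorem domFst_mk {x y : X} (h : (x, y) ∈ A.graph) : domFst A (domMk h) = x := rfl

@[simp] theorem domSnd_mk {x y : X} (h : (x, y) ∈ A.graph) : domSnd A (domMk h) = y := rfl

namespace IsAnalyticPair

variable (hT : IsAnalyticPair A T S M)

/-- The operators of the semigroup, as operators from `X` to `D_A`. -/
def toDom (t : ℝ) : X →L[ℂ] graphSpace A :=
  if ht : 0 < t then LinearMap.mkContinuous
    { toFun := fun x => domMk (hT.graph_mem t x ht)
      map_add' := fun x y => domFst_injective (by simp)
      map_smul' := fun c x => domFst_injective (by simp) } (‖T t‖ + ‖S t‖)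
    fun x => by
      rw [norm_dom, add_mul]
      exact add_le_add ((T t).le_opNorm x) ((S t).le_opNorm x)
  else 0

theorem toDom_apply {t : ℝ} (ht : 0 < t) (x : X) : hT.toDom t x = domMk (hT.graph_mem t x ht) := by
  simp only [toDom, dif_pos ht]
  rfl

theorem domFst_toDom {t : ℝ} (ht : 0 < t) (x : X) : domFst A (hT.toDom t x) = T t x := by
  rw [toDom_apply hT ht, domFst_mk]

theorem domSnd_toDom {t : ℝ} (ht : 0 < t) (x : X) : domSnd A (hT.toDom t x) = S t x := by
  rw [toDom_apply hT ht, domSnd_mk]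

theorem continuousOn_toDom (x : X) : ContinuousOn (fun t => hT.toDom t x) (Ioi 0) := by
  have h1 : ContinuousOn (fun t => WithLp.toLp 1 (T t x, S t x)) (Ioi (0 : ℝ)) :=
    (WithLp.prod_continuous_toLp 1 X X).comp_continuousOn
      ((hT.orbit x).continuousOn.prodMk (hT.continuousOn x))
  rw [continuousOn_iff_continuous_domRestrict] at h1 ⊢
  refine (Topology.IsInducing.subtypeVal.continuous_iff).2 (h1.congr fun t => ?_)
  simp only [domRestrict_apply, Function.comp_apply]
  rw [toDom_apply hT t.2]
  rfl

theorem norm_toDom_domFst_le {t : ℝ} (ht : 0 < t) (d : graphSpace A) :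
    ‖hT.toDom t (domFst A d)‖ ≤ M * ‖d‖ := by
  rw [norm_dom, domFst_toDom hT ht, domSnd_toDom hT ht, hT.comm _ _ (mem_graph_dom d) t ht,
    norm_dom, mul_add]
  gcongr
  · exact (T t).le_of_opNorm_le (hT.bound t ht) _
  · exact (T t).le_of_opNorm_le (hT.bound t ht) _

end IsAnalyticPair

variable {E : Type u} [NormedAddCommGroup E] [NormedSpace ℂ E] [CompleteSpace E]

theorem isClosed_part (hA : A.IsClosed) {ι : E →L[ℂ] X} (hι : Function.Injective ι) :
    (part A (ι : E →ₗ[ℂ] X)).IsClosed := by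
  have : ((part A (ι : E →ₗ[ℂ] X)).graph : Set (E × E)) =
      (fun q : E × E => (ι q.1, ι q.2)) ⁻¹' A.graph := by
    ext ⟨x, y⟩
    exact mem_graph_part A hι x y
  rw [LinearPMap.IsClosed, this]
  exact IsClosed.preimage (by fun_prop) hA

theorem StrongUnique.part {τ : ℝ≥0∞} (h : StrongUnique A τ) {ι : E →L[ℂ] X}
    (hι : Function.Injective ι) : StrongUnique (part A (ι : E →ₗ[ℂ] X)) τ := by
  intro u du Au hu t ht
  have h1 := hu.map ι (B := A) fun a b hab => (mem_graph_part A hι a b).1 hab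
  simp only [Pi.zero_apply, map_zero] at h1
  exact hι (by rw [h _ _ _ h1 t ht, map_zero])

/-- The semigroup, restricted to a space `E` with `D_A ⊆ E ⊆ X` on which it is bounded. -/
theorem IsAnalyticPair.solFamily (hT : IsAnalyticPair A T S M) {ι : E →L[ℂ] X}
    (hι : Function.Injective ι) (j : graphSpace A →L[ℂ] E) (hj : ∀ d, ι (j d) = domFst A d)
    {M' : ℝ} (hM' : ∀ t, 0 < t → ∀ x, ‖j (hT.toDom t (ι x))‖ ≤ M' * ‖x‖) :
    IsSolFamily (MaxReg.part A (ι : E →ₗ[ℂ] X))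
      (fun t => ((j.comp (hT.toDom t)).comp ι : E →ₗ[ℂ] E)) := by
  have hc : ∀ x, ContinuousOn (fun t => j (hT.toDom t (ι x))) (Ioi 0) := fun x =>
    j.continuous.comp_continuousOn (hT.continuousOn_toDom (ι x))
  have hi : ∀ x t, IntegrableOn (fun t => j (hT.toDom t (ι x))) (Ioc 0 t) := fun x t =>
    integrableOn_Ioc_of_bound (hc x) (fun t ht => hM' t ht x) t
  refine ⟨hc, hi, fun x t ht => ?_⟩
  refine (mem_graph_part A hι _ _).2 ?_
  have h1 : ι (∫ s in Ioc 0 t, j (hT.toDom s (ι x))) = ∫ s in Ioc 0 t, T s (ι x) := by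
    rw [← ι.integral_comp_comm (hi x t)]
    exact setIntegral_congr_fun measurableSet_Ioc fun s hs => by
      simp only [hj, hT.domFst_toDom hs.1]
  have h2 : ι (x - j (hT.toDom t (ι x))) = ι x - T t (ι x) := by
    rw [map_sub, hj, hT.domFst_toDom ht]
  have h3 := (hT.orbit (ι x)).graph_mem t ht
  rw [← h1, ← h2] at h3
  exact h3

theorem map_dyStep {F : Type*} [NormedAddCommGroup F] [NormedSpace ℂ F] (L : E →L[ℂ] F)
    (c : (ℕ × ℕ) →₀ E) (t : ℝ) : dyStep (c.mapRange L (map_zero L)) t = L (dyStep c t) := by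
  simp only [dyStep]
  rw [Finsupp.sum_mapRange_index (fun q => by simp)]
  simp only [Finsupp.sum, map_sum]
  refine Finset.sum_congr rfl fun q _ => ?_
  by_cases h : t ∈ cell (dyMesh q.1) q.2 <;> simp [h]

/-- Linear maps which intertwine two families of operators intertwine the responses -/
theorem map_dyResp {F : Type*} [NormedAddCommGroup F] [NormedSpace ℂ F] (L : E →L[ℂ] F)
    {R : ℝ → E →ₗ[ℂ] E} {R' : ℝ → F →ₗ[ℂ] F} (h : ∀ t, 0 < t → ∀ x, L (R t x) = R' t (L x))
    (c : (ℕ × ℕ) →₀ E) (t : ℝ) :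
    dyResp R' (c.mapRange L (map_zero L)) t = L (dyResp R c t) := by
  have hs : ∀ x t, L (stepResp R x t) = stepResp R' (L x) t := fun x t => by
    simp only [stepResp]
    split_ifs with ht
    · rw [map_sub, h t ht]
    · simp
  simp only [dyResp]
  rw [Finsupp.sum_mapRange_index (fun q => by simp [stepResp_zero])]
  simp only [Finsupp.sum, map_sum, map_sub, hs]

theorem ExtendsResp.eLpNorm_le {τ : ℝ≥0∞} [Fact (1 ≤ p)] (hp : p ≠ ∞) {R : ℝ → E →ₗ[ℂ] E}
    {K : Lp E p (timeMeasure τ) →L[ℂ] Lp E p (timeMeasure τ)} (hK : ExtendsResp R K)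
    (c : (ℕ × ℕ) →₀ E) : eLpNorm (dyResp R c) p (timeMeasure τ) ≤
      ENNReal.ofReal ‖K‖ * eLpNorm (dyStep c) p (volume.restrict (Ioi 0)) := by
  have h := (memLp_dyStep hp c).mono_measure (timeMeasure_le τ)
  rw [eLpNorm_congr_ae (hK c (h.toLp _) h.coeFn_toLp), ← Lp.enorm_def]
  calc ‖K (h.toLp _)‖ₑ ≤ ENNReal.ofReal ‖K‖ * ‖h.toLp _‖ₑ := by
        rw [← ofReal_norm, ← ofReal_norm, ← ENNReal.ofReal_mul (norm_nonneg _)]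
        exact ENNReal.ofReal_le_ofReal (K.le_opNorm _)
    _ ≤ _ := by
        rw [Lp.enorm_toLp h]
        gcongr
        exact timeMeasure_le τ

variable [Fact (1 ≤ p)]

theorem HasLpMaxReg.exists_extendsResp_top (hA : HasLpMaxReg A p ∞)
    (hT : IsAnalyticPair A T S M) : ∃ K : Lp X p (timeMeasure ∞) →L[ℂ] Lp X p (timeMeasure ∞),
      ExtendsResp (fun t => (T t : X →ₗ[ℂ] X)) K :=
  hA.exists_extendsResp (hA.strongUnique ∞) ⟨fun x => (hT.orbit x).continuousOn,
    fun x => (hT.orbit x).integrableOn, fun x => (hT.orbit x).graph_mem⟩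

/-- The solution operator of `A` on `L^p(0,∞; D_A)`: since `A` commutes with the semigroup, the
estimate in `L^p(0,∞; X)` may be applied to both components of the graph norm. -/
theorem HasLpMaxReg.exists_extendsResp_dom (hp : p ≠ ∞) (hA : HasLpMaxReg A p ∞)
    (hT : IsAnalyticPair A T S M) :
    ∃ K : Lp (graphSpace A) p (timeMeasure ∞) →L[ℂ] Lp (graphSpace A) p (timeMeasure ∞),
      ExtendsResp (fun t => ((hT.toDom t).comp (domFst A) : graphSpace A →ₗ[ℂ] graphSpace A)) K := by
  have := graphSpace_complete A hA.1
  obtain ⟨K, hK⟩ := hA.exists_extendsResp_top hT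
  have hsol := hT.solFamily domFst_injective (ContinuousLinearMap.id ℂ (graphSpace A))
    (fun _ => rfl) (fun t ht d => hT.norm_toDom_domFst_le ht d)
  have hu := (hA.strongUnique ∞).part (domFst_injective (A := A))
  set R : ℝ → graphSpace A →ₗ[ℂ] graphSpace A :=
    fun t => ((hT.toDom t).comp (domFst A) : graphSpace A →ₗ[ℂ] graphSpace A) with hR
  have hb : ∀ c : (ℕ × ℕ) →₀ graphSpace A, eLpNorm (dyResp R c) p (timeMeasure ∞) ≤
      ENNReal.ofReal (2 * ‖K‖) * eLpNorm (dyStep c) p (volume.restrict (Ioi 0)) := by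
    intro c
    have e1 : ∀ t, dyResp (fun t => (T t : X →ₗ[ℂ] X))
        (c.mapRange (domFst A) (map_zero (domFst A))) t = domFst A (dyResp R c t) :=
      map_dyResp (domFst A) (fun t ht d => hT.domFst_toDom ht _) c
    have e2 : ∀ t, dyResp (fun t => (T t : X →ₗ[ℂ] X))
        (c.mapRange (domSnd A) (map_zero (domSnd A))) t = domSnd A (dyResp R c t) :=
      map_dyResp (domSnd A) (fun t ht d => (hT.domSnd_toDom ht _).trans
        (hT.comm _ _ (mem_graph_dom d) t ht)) c
    have m1 := hK.memLp hp (c.mapRange (domFst A) (map_zero (domFst A)))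
    have m2 := hK.memLp hp (c.mapRange (domSnd A) (map_zero (domSnd A)))
    have s1 : eLpNorm (dyStep (c.mapRange (domFst A) (map_zero (domFst A)))) p
        (volume.restrict (Ioi 0)) ≤ eLpNorm (dyStep c) p (volume.restrict (Ioi 0)) :=
      eLpNorm_mono fun t => by rw [map_dyStep]; exact norm_domFst_le _
    have s2 : eLpNorm (dyStep (c.mapRange (domSnd A) (map_zero (domSnd A)))) p
        (volume.restrict (Ioi 0)) ≤ eLpNorm (dyStep c) p (volume.restrict (Ioi 0)) :=
      eLpNorm_mono fun t => by rw [map_dyStep]; exact norm_domSnd_le _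
    calc eLpNorm (dyResp R c) p (timeMeasure ∞)
        = eLpNorm (fun t => ‖dyResp (fun t => (T t : X →ₗ[ℂ] X))
            (c.mapRange (domFst A) (map_zero (domFst A))) t‖ +
            ‖dyResp (fun t => (T t : X →ₗ[ℂ] X))
            (c.mapRange (domSnd A) (map_zero (domSnd A))) t‖) p (timeMeasure ∞) := by
          refine eLpNorm_congr_norm_ae (.of_forall fun t => ?_)
          rw [e1, e2, norm_dom, Real.norm_of_nonneg (by positivity)]
      _ ≤ _ := eLpNorm_add_le m1.1.norm m2.1.norm Fact.out
      _ ≤ ENNReal.ofReal ‖K‖ * eLpNorm (dyStep c) p (volume.restrict (Ioi 0)) +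
          ENNReal.ofReal ‖K‖ * eLpNorm (dyStep c) p (volume.restrict (Ioi 0)) := by
          rw [eLpNorm_norm, eLpNorm_norm]
          refine add_le_add ((hK.eLpNorm_le hp _).trans ?_) ((hK.eLpNorm_le hp _).trans ?_)
          · gcongr
          · gcongr
      _ = _ := by
          rw [two_mul, ENNReal.ofReal_add (norm_nonneg _) (norm_nonneg _), add_mul]
  have hm := hasLpMaxReg_of_bound hp (isClosed_part hA.1 domFst_injective) hu hsol hb
  exact hm.exists_extendsResp hu hsol

/-- An operator acts on `ℓ^p` through the coordinate with index `0`. -/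
theorem exists_lp_single_map {Y : Type*} [NormedAddCommGroup Y] [NormedSpace ℂ Y] (L : Y →L[ℂ] Y) :
    ∃ L' : lp (fun _ : ℕ => Y) p →L[ℂ] lp (fun _ : ℕ => Y) p, ‖L'‖ ≤ ‖L‖ ∧
      ∀ a n, L' a n = (if n = 0 then L (a 0) else 0) := by
  have hp1 : (1 : ℝ≥0∞) ≤ p := Fact.out
  have hp0 : 0 < p := zero_lt_one.trans_le hp1
  refine ⟨(lp.singleContinuousLinearMap ℂ (fun _ : ℕ => Y) p 0).comp
    (L.comp (lp.evalCLM ℂ (fun _ : ℕ => Y) p 0)),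
    ContinuousLinearMap.opNorm_le_bound _ (norm_nonneg _) fun a => ?_, fun a n => ?_⟩
  · rw [ContinuousLinearMap.comp_apply, lp.singleContinuousLinearMap_apply]
    refine (lp.norm_single (E := fun _ : ℕ => Y) hp0 0 _).trans_le ?_
    calc ‖L (a 0)‖ ≤ ‖L‖ * ‖a 0‖ := L.le_opNorm _
      _ ≤ ‖L‖ * ‖a‖ :=
        mul_le_mul_of_nonneg_left (lp.norm_apply_le_norm hp0.ne' a 0) (norm_nonneg _)
  · rw [ContinuousLinearMap.comp_apply, lp.singleContinuousLinearMap_apply]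
    have h0 : L.comp (lp.evalCLM ℂ (fun _ : ℕ => Y) p 0) a = L (a 0) := rfl
    rw [h0]
    split_ifs with h
    · rw [h, lp.single_apply_self]
    · rw [lp.single_apply_ne _ _ _ h]

/-- The interpolation property for single operators, from that for sequences supported at `0`. -/
theorem LpStable.exists_map {C : BanachCouple.{u}} {ι : E →L[ℂ] C.Z} (h : LpStable p C ι) :
    ∃ κ : ℝ, 0 ≤ κ ∧ ∀ (T₀ : C.X₀ →L[ℂ] C.X₀) (T₁ : C.X₁ →L[ℂ] C.X₁),
      (∀ a b, C.ι₀ a = C.ι₁ b → C.ι₀ (T₀ a) = C.ι₁ (T₁ b)) → ∀ x a b, ι x = C.ι₀ a + C.ι₁ b →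
        ∃ z, ‖z‖ ≤ κ * max ‖T₀‖ ‖T₁‖ * ‖x‖ ∧ ι z = C.ι₀ (T₀ a) + C.ι₁ (T₁ b) := by
  obtain ⟨κ, hκ, hst⟩ := h
  have hp1 : (1 : ℝ≥0∞) ≤ p := Fact.out
  have hp0 : 0 < p := zero_lt_one.trans_le hp1
  refine ⟨κ, hκ, fun T₀ T₁ hT x a b hab => ?_⟩
  obtain ⟨S₀, n₀, h₀⟩ := exists_lp_single_map (p := p) T₀
  obtain ⟨S₁, n₁, h₁⟩ := exists_lp_single_map (p := p) T₁
  obtain ⟨z, hz1, hz2⟩ := hst S₀ S₁ (fun a b hab n => by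
      rw [h₀, h₁]
      split_ifs
      · exact hT _ _ (hab 0)
      · simp) (lp.single p 0 x) (lp.single p 0 a) (lp.single p 0 b)
    ((finite_singleton 0).subset fun n hn => by
      by_contra h
      exact hn (lp.single_apply_ne _ _ _ h)) fun n => by
      by_cases h : n = 0
      · subst h
        simp only [lp.single_apply_self, hab]
      · rw [lp.single_apply_ne _ _ _ h, lp.single_apply_ne _ _ _ h, lp.single_apply_ne _ _ _ h]
        simp
  refine ⟨z 0, (lp.norm_apply_le_norm hp0.ne' z 0).trans (hz1.trans ?_), ?_⟩
  · rw [lp.norm_single hp0]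
    gcongr
  · rw [hz2 0, h₀, h₁, if_pos rfl, if_pos rfl, lp.single_apply_self, lp.single_apply_self]

/-- Maximal regularity on `(0,∞)` passes to the part of `A` in a space `E` with `D_A ⊆ E ⊆ X` which
has the interpolation property for sequences of operators. -/
theorem HasLpMaxReg.part_of_lpStable (hp : p ≠ ∞) (hA : HasLpMaxReg A p ∞) {ι : E →L[ℂ] X}
    (hι : Function.Injective ι) (j : graphSpace A →L[ℂ] E) (hj : ∀ d, ι (j d) = domFst A d)
    (hst : LpStable p (domainCouple A hA.1) ι) :
    HasLpMaxReg (MaxReg.part A (ι : E →ₗ[ℂ] X)) p ∞ := by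
  have := graphSpace_complete A hA.1
  obtain ⟨T, S, M, hM, hT⟩ := hA.exists_analyticPair hp
  obtain ⟨κ, hκ, hmap⟩ := hst.exists_map
  obtain ⟨K₀, hK₀⟩ := hA.exists_extendsResp_top hT
  obtain ⟨K₁, hK₁⟩ := hA.exists_extendsResp_dom hp hT
  have hcons : ∀ a (b : graphSpace A), a = domFst A b → ∀ t, 0 < t →
      T t a = domFst A (hT.toDom t (domFst A b)) := fun a b hab t ht => by
    rw [hab, hT.domFst_toDom ht]
  have hbound : ∀ t, 0 < t → ∀ x, ‖j (hT.toDom t (ι x))‖ ≤ κ * M * ‖x‖ := by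
    intro t ht x
    obtain ⟨z, hz1, hz2⟩ := hmap (T t) ((hT.toDom t).comp (domFst A))
      (fun a b hab => hcons a b hab t ht) x (ι x) 0 (by simp)
    have : z = j (hT.toDom t (ι x)) := hι (by
      rw [hz2, hj, hT.domFst_toDom ht, map_zero, map_zero, add_zero]
      rfl)
    rw [← this]
    refine hz1.trans ?_
    gcongr
    exact max_le (hT.bound t ht) (ContinuousLinearMap.opNorm_le_bound _ hM fun d =>
      hT.norm_toDom_domFst_le ht d)
  have hsol := hT.solFamily hι j hj hbound
  obtain ⟨κ', -, hκ'⟩ := exists_dyResp_bound (C := domainCouple A hA.1) hp ι hι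
    (fun x => ⟨ι x, 0, by simp⟩) hst
    (T := fun t => ((j.comp (hT.toDom t)).comp ι : E →ₗ[ℂ] E))
    (fun x a b hab t ht => by
      change ι (j (hT.toDom t (ι x))) = T t a + domFst A (hT.toDom t (domFst A b))
      have hab' : ι x = a + domFst A b := hab
      rw [hj, hT.domFst_toDom ht, hT.domFst_toDom ht, hab', map_add])
    (fun a b hab t ht => hcons a b hab t ht) hsol.continuousOn hK₀ hK₁
  exact hasLpMaxReg_of_bound hp (isClosed_part hA.1 hι) ((hA.strongUnique ∞).part hι) hsol hκ'

/-- The inclusion of `D_A` in an interpolation space between `X` and `D_A`. -/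
theorem InterpolationFunctor.exists_inclDom (F : InterpolationFunctor.{u}) (hA : A.IsClosed) :
    ∃ j : graphSpace A →L[ℂ] F.space (domainCouple A hA),
      ∀ d, F.inclCLM (domainCouple A hA) (j d) = domFst A d := by
  obtain ⟨c, hc⟩ := F.inter_le (domainCouple A hA)
  choose j hj hjb using fun d : graphSpace A => hc (domFst A d) d rfl
  have hj' : ∀ d, F.inclCLM (domainCouple A hA) (j d) = domFst A d := hj
  have hinj : Function.Injective (F.inclCLM (domainCouple A hA)) := F.inclZ_injective _
  refine ⟨LinearMap.mkContinuous
    { toFun := j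
      map_add' := fun d d' => hinj (by rw [map_add, hj', hj', hj', map_add])
      map_smul' := fun a d => hinj (by
        rw [map_smul, hj', hj', map_smul, RingHom.id_apply]) } |c| fun d => ?_, hj'⟩
  refine (hjb d).trans ?_
  rw [max_eq_right (norm_domFst_le d)]
  gcongr
  exact le_abs_self c

/-- Maximal regularity on `(0,∞)` passes to the part of `A` in `F(X, D_A)` if `F` commutes with
`ℓ^p`. -/
theorem HasLpMaxReg.part_functor (hp : p ≠ ∞) (hA : HasLpMaxReg A p ∞)
    {F : InterpolationFunctor.{u}} (hF : F.SplitsLp p (domainCouple A hA.1)) :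
    HasLpMaxReg (MaxReg.part A (F.inclZ (domainCouple A hA.1))) p ∞ := by
  obtain ⟨j, hj⟩ := F.exists_inclDom hA.1
  exact hA.part_of_lpStable hp (ι := F.inclCLM (domainCouple A hA.1)) (F.inclZ_injective _) j hj
    hF.lpStable

end Intermediate

/-! ### The sum of a Banach couple -/

section SumSpace

open Filter Topology

namespace BanachCouple

variable (C : BanachCouple.{u})

/-- The map `(a, b) ↦ a + b` from `X₀ × X₁` to `X₀ + X₁`. -/
def sumMk : C.X₀ × C.X₁ →L[ℂ] C.Sum :=
  LinearMap.mkContinuous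
    { toFun := fun q => ⟨C.ι₀ q.1 + C.ι₁ q.2, (K_le q.1 q.2 rfl).trans_lt (by finiteness)⟩
      map_add' := fun q r => C.sumNorm.incl_injective (by
        change C.ι₀ (q.1 + r.1) + C.ι₁ (q.2 + r.2) = C.ι₀ q.1 + C.ι₁ q.2 + (C.ι₀ r.1 + C.ι₁ r.2)
        rw [map_add, map_add]; abel)
      map_smul' := fun c q => C.sumNorm.incl_injective (by
        change C.ι₀ (c • q.1) + C.ι₁ (c • q.2) = c • (C.ι₀ q.1 + C.ι₁ q.2)
        rw [map_smul, map_smul, smul_add]) } 2 fun q => by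
    refine ENNReal.toReal_le_of_le_ofReal (by positivity) ((K_le q.1 q.2 rfl).trans ?_)
    rw [ENNReal.ofReal_one, one_mul, ← ofReal_norm, ← ofReal_norm,
      ← ENNReal.ofReal_add (norm_nonneg _) (norm_nonneg _), two_mul]
    exact ENNReal.ofReal_le_ofReal (add_le_add (norm_fst_le q) (norm_snd_le q))

theorem sumIncl_sumMk (q : C.X₀ × C.X₁) : C.sumIncl (C.sumMk q) = C.ι₀ q.1 + C.ι₁ q.2 := rfl

theorem norm_sumMk_le (q : C.X₀ × C.X₁) : ‖C.sumMk q‖ ≤ ‖q.1‖ + ‖q.2‖ := by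
  refine ENNReal.toReal_le_of_le_ofReal (by positivity) ((K_le q.1 q.2 rfl).trans ?_)
  rw [ENNReal.ofReal_one, one_mul, ENNReal.ofReal_add (norm_nonneg _) (norm_nonneg _),
    ofReal_norm, ofReal_norm]

theorem sumIncl_injective : Function.Injective C.sumIncl := C.sumNorm.incl_injective

theorem exists_sumMk (x : C.Sum) {ε : ℝ} (hε : 0 < ε) :
    ∃ q, C.sumMk q = x ∧ ‖q.1‖ + ‖q.2‖ < ‖x‖ + ε := by
  obtain ⟨a, b, h1, h2⟩ := C.exists_decomp x hε
  exact ⟨(a, b), C.sumIncl_injective h1.symm, h2⟩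

instance : CompleteSpace C.Sum := by
  refine NormedAddCommGroup.completeSpace_of_summable_imp_tendsto fun x hx => ?_
  choose q hq hqn using fun n : ℕ => C.exists_sumMk (x n) (ε := (1 / 2) ^ n) (by positivity)
  have hs : Summable fun n => ‖x n‖ + (1 / 2 : ℝ) ^ n := hx.add summable_geometric_two
  have hqs : Summable q := by
    refine Summable.of_norm_bounded hs fun n => ?_
    refine le_trans ?_ (hqn n).le
    exact max_le (le_add_of_nonneg_right (norm_nonneg _)) (le_add_of_nonneg_left (norm_nonneg _))
  have h := (C.sumMk.hasSum hqs.hasSum).tendsto_sum_nat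
  simp only [hq] at h
  exact ⟨_, h⟩

variable {C} {D : BanachCouple.{u}}

/-- The operator on `X₀ + X₁` given by a morphism of couples. -/
theorem exists_sumMap (S₀ : C.X₀ →L[ℂ] D.X₀) (S₁ : C.X₁ →L[ℂ] D.X₁)
    (h : ∀ a b, C.ι₀ a = C.ι₁ b → D.ι₀ (S₀ a) = D.ι₁ (S₁ b)) :
    ∃ L : C.Sum →L[ℂ] D.Sum, ∀ x a b, C.sumIncl x = C.ι₀ a + C.ι₁ b →
      D.sumIncl (L x) = D.ι₀ (S₀ a) + D.ι₁ (S₁ b) := by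
  choose q hq _ using fun x : C.Sum => C.exists_sumMk x one_pos
  have hwd : ∀ x a b, C.sumIncl x = C.ι₀ a + C.ι₁ b →
      D.sumIncl (D.sumMk (S₀ (q x).1, S₁ (q x).2)) = D.ι₀ (S₀ a) + D.ι₁ (S₁ b) := by
    intro x a b hab
    have h1 : C.ι₀ ((q x).1 - a) = C.ι₁ (b - (q x).2) := by
      have h2 : C.sumIncl x = C.ι₀ (q x).1 + C.ι₁ (q x).2 := by rw [← C.sumIncl_sumMk, hq]
      rw [map_sub, map_sub, sub_eq_sub_iff_add_eq_add, ← h2, hab, add_comm]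
    have h3 := h _ _ h1
    rw [map_sub, map_sub, map_sub, map_sub, sub_eq_sub_iff_add_eq_add] at h3
    rw [D.sumIncl_sumMk, h3, add_comm]
  let L : C.Sum →ₗ[ℂ] D.Sum :=
    { toFun := fun x => D.sumMk (S₀ (q x).1, S₁ (q x).2)
      map_add' := fun x y => D.sumIncl_injective (by
        rw [hwd (x + y) ((q x).1 + (q y).1) ((q x).2 + (q y).2), map_add D.sumIncl,
          sumIncl_sumMk, sumIncl_sumMk]
        · simp only [map_add]; abel
        · have h1 := C.sumIncl_sumMk (q x + q y)
          rw [map_add C.sumMk, hq, hq] at h1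
          exact h1)
      map_smul' := fun c x => D.sumIncl_injective (by
        rw [hwd (c • x) (c • (q x).1) (c • (q x).2), RingHom.id_apply, map_smul D.sumIncl,
          sumIncl_sumMk]
        · simp only [map_smul, smul_add]
        · have h1 := C.sumIncl_sumMk (c • q x)
          rw [map_smul C.sumMk, hq] at h1
          exact h1) }
  refine ⟨L.mkContinuous (max ‖S₀‖ ‖S₁‖) fun x => ?_, hwd⟩
  refine le_of_forall_pos_le_add fun ε hε => ?_
  obtain ⟨r, hr, hrn⟩ := C.exists_sumMk x (ε := ε / (max ‖S₀‖ ‖S₁‖ + 1)) (by positivity)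
  have hL : L x = D.sumMk (S₀ r.1, S₁ r.2) := D.sumIncl_injective (by
    rw [sumIncl_sumMk]
    exact hwd x r.1 r.2 (by rw [← hr, C.sumIncl_sumMk]))
  have hm : 0 ≤ max ‖S₀‖ ‖S₁‖ := le_max_of_le_left (norm_nonneg _)
  calc ‖L x‖ ≤ ‖S₀ r.1‖ + ‖S₁ r.2‖ := by rw [hL]; exact D.norm_sumMk_le _
    _ ≤ max ‖S₀‖ ‖S₁‖ * ‖r.1‖ + max ‖S₀‖ ‖S₁‖ * ‖r.2‖ := add_le_add
        (S₀.le_of_opNorm_le (le_max_left _ _) _) (S₁.le_of_opNorm_le (le_max_right _ _) _)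
    _ = max ‖S₀‖ ‖S₁‖ * (‖r.1‖ + ‖r.2‖) := by ring
    _ ≤ max ‖S₀‖ ‖S₁‖ * (‖x‖ + ε / (max ‖S₀‖ ‖S₁‖ + 1)) := by gcongr
    _ = max ‖S₀‖ ‖S₁‖ * ‖x‖ + ε * (max ‖S₀‖ ‖S₁‖ / (max ‖S₀‖ ‖S₁‖ + 1)) := by ring
    _ ≤ max ‖S₀‖ ‖S₁‖ * ‖x‖ + ε * 1 := by
        gcongr
        rw [div_le_one (by positivity)]
        linarith
    _ = _ := by rw [mul_one]

end BanachCouple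

end SumSpace

/-! ### The complex interpolation space -/

section ComplexMethod

open Filter Topology

namespace BanachCouple

variable {C : BanachCouple.{u}}

theorem closure_strip : closure (Complex.re ⁻¹' Ioo 0 1) = Complex.re ⁻¹' Icc 0 1 := by
  rw [Complex.closure_preimage_re, closure_Ioo zero_ne_one]

namespace CalderonFun

theorem norm_nonneg (g : C.CalderonFun) : 0 ≤ g.norm := le_max_of_le_left (_root_.norm_nonneg _)

/-- Image of an admissible function under a morphism of couples. -/
def map (S₀ : C.X₀ →L[ℂ] C.X₀) (S₁ : C.X₁ →L[ℂ] C.X₁)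
    (h : ∀ a b, C.ι₀ a = C.ι₁ b → C.ι₀ (S₀ a) = C.ι₁ (S₁ b)) (g : C.CalderonFun) :
    C.CalderonFun where
  f z := (exists_sumMap S₀ S₁ h).choose (g.f z)
  f₀ := ⟨⟨fun t => S₀ (g.f₀ t), by fun_prop⟩, by
    have h := (S₀.continuous.tendsto 0).comp (zero_at_infty g.f₀)
    rw [map_zero] at h
    exact h⟩
  f₁ := ⟨⟨fun t => S₁ (g.f₁ t), by fun_prop⟩, by
    have h := (S₁.continuous.tendsto 0).comp (zero_at_infty g.f₁)
    rw [map_zero] at h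
    exact h⟩
  diffContOnCl := (exists_sumMap S₀ S₁ h).choose.differentiable.comp_diffContOnCl g.diffContOnCl
  bounded := ⟨‖(exists_sumMap S₀ S₁ h).choose‖ * g.norm, fun z h0 h1 =>
    (ContinuousLinearMap.le_opNorm _ _).trans (by
      gcongr
      exact g.norm_apply_le h0 h1)⟩
  boundary₀ t := by
    rw [(exists_sumMap S₀ S₁ h).choose_spec _ (g.f₀ t) 0 (by rw [g.boundary₀, map_zero, add_zero])]
    simp
  boundary₁ t := by
    rw [(exists_sumMap S₀ S₁ h).choose_spec _ 0 (g.f₁ t) (by rw [g.boundary₁, map_zero, zero_add])]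
    simp

theorem sumIncl_map {S₀ : C.X₀ →L[ℂ] C.X₀} {S₁ : C.X₁ →L[ℂ] C.X₁}
    (h : ∀ a b, C.ι₀ a = C.ι₁ b → C.ι₀ (S₀ a) = C.ι₁ (S₁ b)) (g : C.CalderonFun) {z : ℂ}
    {a : C.X₀} {b : C.X₁} (hab : C.sumIncl (g.f z) = C.ι₀ a + C.ι₁ b) :
    C.sumIncl ((g.map S₀ S₁ h).f z) = C.ι₀ (S₀ a) + C.ι₁ (S₁ b) :=
  (exists_sumMap S₀ S₁ h).choose_spec _ a b hab

/-- Product of an admissible function and a bounded holomorphic scalar function. -/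
def scale (m : ℂ → ℂ) (hm : DiffContOnCl ℂ m (Complex.re ⁻¹' Ioo 0 1)) {B : ℝ}
    (hB : ∀ z : ℂ, 0 ≤ z.re → z.re ≤ 1 → ‖m z‖ ≤ B) (g : C.CalderonFun) : C.CalderonFun where
  f z := m z • g.f z
  f₀ := ⟨⟨fun t => m (t * Complex.I) • g.f₀ t, by
      refine Continuous.smul ?_ g.f₀.continuous
      refine (hm.continuousOn.comp_continuous (by fun_prop) fun t => ?_)
      rw [closure_strip]
      simp⟩, by
    refine squeeze_zero_norm (a := fun t => B * ‖g.f₀ t‖) (fun t => ?_) ?_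
    · rw [norm_smul]
      gcongr
      exact hB _ (by simp) (by simp)
    · simpa using (tendsto_norm_zero.comp (zero_at_infty g.f₀)).const_mul B⟩
  f₁ := ⟨⟨fun t => m (1 + t * Complex.I) • g.f₁ t, by
      refine Continuous.smul ?_ g.f₁.continuous
      refine (hm.continuousOn.comp_continuous (by fun_prop) fun t => ?_)
      rw [closure_strip]
      simp⟩, by
    refine squeeze_zero_norm (a := fun t => B * ‖g.f₁ t‖) (fun t => ?_) ?_
    · rw [norm_smul]
      gcongr
      exact hB _ (by simp) (by simp)
    · simpa using (tendsto_norm_zero.comp (zero_at_infty g.f₁)).const_mul B⟩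
  diffContOnCl := hm.smul g.diffContOnCl
  bounded := ⟨B * g.norm, fun z h0 h1 => by
    rw [norm_smul]
    have := hB z h0 h1
    exact mul_le_mul this (g.norm_apply_le h0 h1) (_root_.norm_nonneg _)
      ((_root_.norm_nonneg _).trans this)⟩
  boundary₀ t := by
    rw [map_smul, g.boundary₀, ← map_smul]
    rfl
  boundary₁ t := by
    rw [map_smul, g.boundary₁, ← map_smul]
    rfl

/-- Sum of a series of admissible functions. -/
def tsum (g : ℕ → C.CalderonFun) (hg : Summable fun n => (g n).norm) : C.CalderonFun where
  f z := ∑' n, (g n).f z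
  f₀ := ∑' n, (g n).f₀
  f₁ := ∑' n, (g n).f₁
  diffContOnCl := by
    refine ⟨Complex.differentiableOn_tsum_of_summable_norm hg (fun n => (g n).diffContOnCl.differentiableOn)
      (isOpen_Ioo.preimage Complex.continuous_re)
      fun n z hz => (g n).norm_apply_le (le_of_lt hz.1) (le_of_lt hz.2),
      continuousOn_tsum (fun n => (g n).diffContOnCl.continuousOn) hg fun n z hz => ?_⟩
    rw [closure_strip] at hz
    exact (g n).norm_apply_le hz.1 hz.2
  bounded := ⟨∑' n, (g n).norm, fun z h0 h1 =>
    tsum_of_norm_bounded hg.hasSum fun n => (g n).norm_apply_le h0 h1⟩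
  boundary₀ t := by
    have h1 : Summable fun n => (g n).f (t * Complex.I) :=
      Summable.of_norm_bounded hg fun n => (g n).norm_apply_le (by simp) (by simp)
    have h2 : Summable fun n => (g n).f₀ := Summable.of_norm_bounded hg fun n => le_max_left _ _
    let ev : C₀(ℝ, C.X₀) →+ C.X₀ :=
      { toFun := fun f => f t, map_zero' := rfl, map_add' := fun _ _ => rfl }
    have hev : Continuous ev := by
      refine (LipschitzWith.of_dist_le_mul (K := 1) fun f f' => ?_).continuous
      rw [NNReal.coe_one, one_mul]
      exact BoundedContinuousFunction.dist_coe_le_dist (f := f.toBCF) (g := f'.toBCF) t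
    have h3 := h1.hasSum.map C.sumIncl C.continuous_sumIncl
    have h4 := (h2.hasSum.map ev hev).map C.ι₀ C.ι₀.continuous
    refine h3.unique ?_
    have h5 : (C.sumIncl ∘ fun n => (g n).f (t * Complex.I)) = C.ι₀ ∘ (ev ∘ fun n => (g n).f₀) :=
      funext fun n => (g n).boundary₀ t
    rw [h5]
    exact h4
  boundary₁ t := by
    have h1 : Summable fun n => (g n).f (1 + t * Complex.I) :=
      Summable.of_norm_bounded hg fun n => (g n).norm_apply_le (by simp) (by simp)
    have h2 : Summable fun n => (g n).f₁ := Summable.of_norm_bounded hg fun n => le_max_right _ _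
    let ev : C₀(ℝ, C.X₁) →+ C.X₁ :=
      { toFun := fun f => f t, map_zero' := rfl, map_add' := fun _ _ => rfl }
    have hev : Continuous ev := by
      refine (LipschitzWith.of_dist_le_mul (K := 1) fun f f' => ?_).continuous
      rw [NNReal.coe_one, one_mul]
      exact BoundedContinuousFunction.dist_coe_le_dist (f := f.toBCF) (g := f'.toBCF) t
    have h3 := h1.hasSum.map C.sumIncl C.continuous_sumIncl
    have h4 := (h2.hasSum.map ev hev).map C.ι₁ C.ι₁.continuous
    refine h3.unique ?_
    have h5 : (C.sumIncl ∘ fun n => (g n).f (1 + t * Complex.I)) = C.ι₁ ∘ (ev ∘ fun n => (g n).f₁) :=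
      funext fun n => (g n).boundary₁ t
    rw [h5]
    exact h4

theorem norm_tsum_le (g : ℕ → C.CalderonFun) (hg : Summable fun n => (g n).norm) :
    (tsum g hg).norm ≤ ∑' n, (g n).norm :=
  max_le (tsum_of_norm_bounded hg.hasSum fun _ => le_max_left _ _)
    (tsum_of_norm_bounded hg.hasSum fun _ => le_max_right _ _)

/-- The admissible function `z ↦ (1 + z)⁻¹ x`, for `x ∈ X₀ ∩ X₁`. -/
def ofInter (a : C.X₀) (b : C.X₁) (hab : C.ι₀ a = C.ι₁ b) : C.CalderonFun where
  f z := (1 + z)⁻¹ • C.sumMk (a, 0)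
  f₀ := ⟨⟨fun t => (1 + (t : ℂ) * Complex.I)⁻¹ • a, by
      refine Continuous.smul (Continuous.inv₀ (by fun_prop) fun t h => ?_) continuous_const
      simpa using congrArg Complex.re h⟩, by
    refine squeeze_zero_norm (a := fun t : ℝ => ‖1 + (t : ℂ) * Complex.I‖⁻¹ * ‖a‖)
      (fun t => by rw [norm_smul, norm_inv]) ?_
    have h1 : Tendsto (fun t : ℝ => ‖1 + (t : ℂ) * Complex.I‖) (cocompact ℝ) atTop :=
      tendsto_atTop_mono (fun t => by simpa using Complex.abs_im_le_norm (1 + (t : ℂ) * Complex.I))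
        (tendsto_norm_cocompact_atTop (E := ℝ))
    simpa using h1.inv_tendsto_atTop.mul_const ‖a‖⟩
  f₁ := ⟨⟨fun t => (1 + (1 + (t : ℂ) * Complex.I))⁻¹ • b, by
      refine Continuous.smul (Continuous.inv₀ (by fun_prop) fun t h => ?_) continuous_const
      have := congrArg Complex.re h
      norm_num at this⟩, by
    refine squeeze_zero_norm (a := fun t : ℝ => ‖1 + (1 + (t : ℂ) * Complex.I)‖⁻¹ * ‖b‖)
      (fun t => by rw [norm_smul, norm_inv]) ?_
    have h1 : Tendsto (fun t : ℝ => ‖1 + (1 + (t : ℂ) * Complex.I)‖) (cocompact ℝ) atTop :=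
      tendsto_atTop_mono (fun t => by
        simpa using Complex.abs_im_le_norm (1 + (1 + (t : ℂ) * Complex.I)))
        (tendsto_norm_cocompact_atTop (E := ℝ))
    simpa using h1.inv_tendsto_atTop.mul_const ‖b‖⟩
  diffContOnCl := by
    refine DifferentiableOn.diffContOnCl ?_
    rw [closure_strip]
    refine DifferentiableOn.smul_const (DifferentiableOn.inv (by fun_prop) fun z hz h => ?_) _
    have h1 := congrArg Complex.re h
    have h2 : 0 ≤ z.re := hz.1
    simp at h1
    linarith
  bounded := ⟨1 * ‖C.sumMk (a, 0)‖, fun z h0 _ => by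
    rw [norm_smul, norm_inv]
    gcongr
    refine inv_le_one_of_one_le₀ ?_
    refine le_trans ?_ (Complex.re_le_norm (1 + z))
    simpa using h0⟩
  boundary₀ t := by
    rw [map_smul, sumIncl_sumMk, map_zero, add_zero, ← map_smul]
    rfl
  boundary₁ t := by
    rw [map_smul, sumIncl_sumMk, map_zero, add_zero, hab, ← map_smul]
    rfl

theorem norm_ofInter_le (a : C.X₀) (b : C.X₁) (hab : C.ι₀ a = C.ι₁ b) :
    (ofInter a b hab).norm ≤ max ‖a‖ ‖b‖ := by
  have key : ∀ z : ℂ, 0 ≤ z.re → ‖(1 + z)⁻¹‖ ≤ 1 := fun z hz => by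
    rw [norm_inv]
    refine inv_le_one_of_one_le₀ (le_trans ?_ (Complex.re_le_norm (1 + z)))
    simpa using hz
  refine max_le ?_ ?_
  · refine (BoundedContinuousFunction.norm_le (le_max_of_le_left (_root_.norm_nonneg _))).2
      fun t => ?_
    refine le_trans ?_ (le_max_left _ _)
    change ‖(1 + (t : ℂ) * Complex.I)⁻¹ • a‖ ≤ ‖a‖
    rw [norm_smul]
    exact mul_le_of_le_one_left (_root_.norm_nonneg _) (key _ (by simp))
  · refine (BoundedContinuousFunction.norm_le (le_max_of_le_left (_root_.norm_nonneg _))).2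
      fun t => ?_
    refine le_trans ?_ (le_max_right _ _)
    change ‖(1 + (1 + (t : ℂ) * Complex.I))⁻¹ • b‖ ≤ ‖b‖
    rw [norm_smul]
    exact mul_le_of_le_one_left (_root_.norm_nonneg _) (key _ (by simp))

end CalderonFun

variable {θ : ℝ} (hθ : θ ∈ Ioo (0 : ℝ) 1)

theorem complexNorm_lt_iff {x : C.Z} {c : ℝ≥0∞} : (C.complexNorm θ hθ).toFun x < c ↔
    ∃ g : C.CalderonFun, C.sumIncl (g.f θ) = x ∧ ENNReal.ofReal g.norm < c := by
  change (⨅ (g : C.CalderonFun) (_ : C.sumIncl (g.f θ) = x), ENNReal.ofReal g.norm) < c ↔ _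
  simp only [iInf_lt_iff, exists_prop]

theorem complexNorm_le (g : C.CalderonFun) :
    (C.complexNorm θ hθ).toFun (C.sumIncl (g.f θ)) ≤ ENNReal.ofReal g.norm :=
  iInf_le_of_le g (iInf_le_of_le rfl le_rfl)

/-- The element `g(θ)` of the complex interpolation space. -/
def CalderonFun.eval (g : C.CalderonFun) : C.ComplexSpace θ hθ :=
  ⟨C.sumIncl (g.f θ), (complexNorm_le hθ g).trans_lt ENNReal.ofReal_lt_top⟩

theorem CalderonFun.incl_eval (g : C.CalderonFun) :
    (C.complexNorm θ hθ).incl (g.eval hθ) = C.sumIncl (g.f θ) := rfl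

theorem CalderonFun.norm_eval_le (g : C.CalderonFun) : ‖g.eval hθ‖ ≤ g.norm :=
  ENNReal.toReal_le_of_le_ofReal g.norm_nonneg (complexNorm_le hθ g)

theorem exists_eval_eq (x : C.ComplexSpace θ hθ) {ε : ℝ} (hε : 0 < ε) :
    ∃ g : C.CalderonFun, g.eval hθ = x ∧ g.norm < ‖x‖ + ε := by
  have hx : (C.complexNorm θ hθ).toFun ((C.complexNorm θ hθ).incl x) ≠ ∞ :=
    ((C.complexNorm θ hθ).lt_top x).ne
  have h1 : (C.complexNorm θ hθ).toFun ((C.complexNorm θ hθ).incl x) <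
      (C.complexNorm θ hθ).toFun ((C.complexNorm θ hθ).incl x) + ENNReal.ofReal ε :=
    ENNReal.lt_add_right hx (by simpa using hε)
  obtain ⟨g, hg, h2⟩ := (complexNorm_lt_iff hθ).1 h1
  refine ⟨g, (C.complexNorm θ hθ).incl_injective hg, ?_⟩
  rw [← ENNReal.ofReal_toReal hx, ← ExtNorm.norm_def,
    ← ENNReal.ofReal_add (norm_nonneg _) hε.le] at h2
  exact (ENNReal.ofReal_lt_ofReal_iff (add_pos_of_nonneg_of_pos (norm_nonneg _) hε)).1 h2

instance completeSpace_complexSpace : CompleteSpace (C.ComplexSpace θ hθ) := by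
  refine NormedAddCommGroup.completeSpace_of_summable_imp_tendsto fun x hx => ?_
  choose g hg hgn using fun n : ℕ => exists_eval_eq hθ (x n) (ε := (1 / 2) ^ n) (by positivity)
  have hs : Summable fun n => (g n).norm := Summable.of_nonneg_of_le (fun n => (g n).norm_nonneg)
    (fun n => (hgn n).le) (hx.add summable_geometric_two)
  have hs' : ∀ n, Summable fun k => (g (k + n)).norm := fun n => (summable_nat_add_iff n).2 hs
  refine ⟨(CalderonFun.tsum g hs).eval hθ, ?_⟩
  rw [← tendsto_sub_nhds_zero_iff, ← neg_zero]
  have key : ∀ n, ∑ i ∈ Finset.range n, x i - (CalderonFun.tsum g hs).eval hθ =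
      -(CalderonFun.tsum (fun k => g (k + n)) (hs' n)).eval hθ := by
    intro n
    apply (C.complexNorm θ hθ).incl_injective
    have h1 : Summable fun k => (g k).f θ := Summable.of_norm_bounded hs fun k =>
      (g k).norm_apply_le (by simpa using hθ.1.le) (by simpa using hθ.2.le)
    have h2 := h1.sum_add_tsum_nat_add n
    rw [map_sub, map_neg, map_sum, CalderonFun.incl_eval, CalderonFun.incl_eval,
      sub_eq_iff_eq_add, ← sub_eq_neg_add, ← map_sub]
    have h3 : ∀ k, (C.complexNorm θ hθ).incl (x k) = C.sumIncl ((g k).f θ) := fun k => by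
      rw [← hg k]; rfl
    simp only [h3, ← map_sum]
    congr 1
    exact eq_sub_of_add_eq h2
  simp only [key]
  refine Tendsto.neg (squeeze_zero_norm (fun n => ((CalderonFun.norm_eval_le hθ _).trans
    (CalderonFun.norm_tsum_le _ _))) ?_)
  exact tendsto_sum_nat_add fun k => (g k).norm

/-- The inclusion of the complex interpolation space in `X₀ + X₁`. -/
def complexToSum : C.ComplexSpace θ hθ →L[ℂ] C.Sum :=
  LinearMap.mkContinuous
    { toFun := fun x => (exists_eval_eq hθ x one_pos).choose.f θ
      map_add' := fun x y => C.sumIncl_injective (by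
        have h : ∀ x : C.ComplexSpace θ hθ, C.sumIncl ((exists_eval_eq hθ x one_pos).choose.f θ) =
            (C.complexNorm θ hθ).incl x := fun x => by
          conv_rhs => rw [← (exists_eval_eq hθ x one_pos).choose_spec.1]
          rfl
        rw [map_add, h, h, h, map_add])
      map_smul' := fun c x => C.sumIncl_injective (by
        have h : ∀ x : C.ComplexSpace θ hθ, C.sumIncl ((exists_eval_eq hθ x one_pos).choose.f θ) =
            (C.complexNorm θ hθ).incl x := fun x => by
          conv_rhs => rw [← (exists_eval_eq hθ x one_pos).choose_spec.1]
          rfl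
        rw [RingHom.id_apply, map_smul, h, h, map_smul]) } 1 fun x => by
    refine le_of_forall_pos_le_add fun ε hε => ?_
    obtain ⟨g, hg, hgn⟩ := exists_eval_eq hθ x hε
    have h1 : (exists_eval_eq hθ x one_pos).choose.f θ = g.f θ := C.sumIncl_injective (by
      have h2 := congrArg (C.complexNorm θ hθ).incl
        ((exists_eval_eq hθ x one_pos).choose_spec.1.trans hg.symm)
      exact h2)
    change ‖(exists_eval_eq hθ x one_pos).choose.f θ‖ ≤ _
    rw [h1, one_mul]
    exact (g.norm_apply_le (by simpa using hθ.1.le) (by simpa using hθ.2.le)).trans hgn.le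

theorem sumIncl_complexToSum (x : C.ComplexSpace θ hθ) :
    C.sumIncl (complexToSum hθ x) = (C.complexNorm θ hθ).incl x := by
  conv_rhs => rw [← (exists_eval_eq hθ x one_pos).choose_spec.1]
  rfl

/-- The inclusion of the complex interpolation space in the ambient space. -/
def complexIncl : C.ComplexSpace θ hθ →L[ℂ] C.Z where
  toLinearMap := (C.complexNorm θ hθ).incl
  cont := by
    refine (C.continuous_sumIncl.comp (complexToSum hθ).continuous).congr fun x => ?_
    exact sumIncl_complexToSum hθ x

end BanachCouple

end ComplexMethod

/-! ### Jensen's inequality for the complex method -/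

section StripJensen

open Filter Topology Complex

/-- Real continuous functions on the unit circle are uniform limits of real parts of entire
functions. -/
theorem exists_entire_close {h : ℂ → ℝ} (hc : ContinuousOn h (Metric.sphere 0 1)) {ε : ℝ}
    (hε : 0 < ε) : ∃ Q : ℂ → ℂ, Differentiable ℂ Q ∧
      ∀ w ∈ Metric.sphere (0 : ℂ) 1, |(Q w).re - h w| ≤ ε := by
  have : Fact (0 < 2 * Real.pi) := ⟨Real.two_pi_pos⟩
  let H : C(AddCircle (2 * Real.pi), ℂ) :=
    ⟨fun x => (h (AddCircle.toCircle x : ℂ) : ℂ), by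
      refine continuous_ofReal.comp (hc.comp_continuous ?_ fun x => ?_)
      · exact continuous_subtype_val.comp AddCircle.continuous_toCircle
      · rw [mem_sphere_zero_iff_norm, Circle.norm_coe]⟩
  have hmem : H ∈ (Submodule.span ℂ (range <| @fourier (2 * Real.pi))).topologicalClosure := by
    rw [span_fourier_closure_eq_top]; trivial
  obtain ⟨P, hP, hPH⟩ := Metric.mem_closure_iff.1 hmem ε hε
  -- A trigonometric polynomial is `Q + conj R` on the circle, with polynomials `Q` and `R`, and has
  -- the real part of `Q + R` there.
  have key : ∀ P ∈ Submodule.span ℂ (range <| @fourier (2 * Real.pi)),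
      ∃ Q R : ℂ → ℂ, Differentiable ℂ Q ∧ Differentiable ℂ R ∧ ∀ x : AddCircle (2 * Real.pi),
        P x = Q (AddCircle.toCircle x : ℂ) + star (R (AddCircle.toCircle x : ℂ)) := by
    intro P hP
    induction hP using Submodule.span_induction with
    | mem P hP =>
      obtain ⟨n, rfl⟩ := hP
      obtain ⟨k, rfl | rfl⟩ := n.eq_nat_or_neg
      · refine ⟨fun w => w ^ k, 0, by fun_prop, differentiable_const 0, fun x => ?_⟩
        rw [fourier_apply, natCast_zsmul, AddCircle.toCircle_nsmul]
        simp
      · refine ⟨0, fun w => w ^ k, differentiable_const 0, by fun_prop, fun x => ?_⟩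
        rw [fourier_neg, fourier_apply, natCast_zsmul, AddCircle.toCircle_nsmul]
        simp
    | zero => exact ⟨0, 0, differentiable_const 0, differentiable_const 0, fun x => by simp⟩
    | add P P' _ _ h1 h2 =>
      obtain ⟨Q, R, hQ, hR, h1⟩ := h1
      obtain ⟨Q', R', hQ', hR', h2⟩ := h2
      refine ⟨Q + Q', R + R', hQ.add hQ', hR.add hR', fun x => ?_⟩
      rw [ContinuousMap.add_apply, h1, h2, Pi.add_apply, Pi.add_apply, star_add]
      ring
    | smul c P _ h1 =>
      obtain ⟨Q, R, hQ, hR, h1⟩ := h1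
      refine ⟨c • Q, star c • R, hQ.const_smul c, hR.const_smul _, fun x => ?_⟩
      rw [ContinuousMap.smul_apply, h1, Pi.smul_apply, Pi.smul_apply, star_smul, star_star,
        smul_add]
  obtain ⟨Q, R, hQ, hR, hQR⟩ := key P hP
  refine ⟨Q + R, hQ.add hR, fun w hw => ?_⟩
  obtain ⟨x, hx⟩ : ∃ x : AddCircle (2 * Real.pi), (AddCircle.toCircle x : ℂ) = w := by
    obtain ⟨x, hx⟩ := (AddCircle.homeomorphCircle (T := 2 * Real.pi) (by positivity)).surjective
      ⟨w, by simpa [Submonoid.unitSphere] using hw⟩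
    refine ⟨x, ?_⟩
    rw [← AddCircle.homeomorphCircle_apply (T := 2 * Real.pi) (by positivity), hx]
  have h1 : ‖P x - H x‖ ≤ ε := by
    rw [← dist_eq_norm, dist_comm]
    exact (ContinuousMap.dist_apply_le_dist x).trans hPH.le
  have h2 : (Q w + R w).re - h w = (P x - H x).re := by
    rw [hQR, hx]
    change _ = (Q w + star (R w) - (h (AddCircle.toCircle x : ℂ) : ℂ)).re
    rw [hx]
    simp
  rw [Pi.add_apply, h2]
  exact (abs_re_le_norm _).trans h1

/-- If `Q` is entire then `e^{a p} ≤ M`, where `a = Re Q(0)` and `M` is the average over the unit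
circle of an upper bound of `e^{p Re Q}`. -/
theorem exp_le_circleAverage {Q : ℂ → ℂ} (hQ : Differentiable ℂ Q) {p : ℝ} {F : ℂ → ℝ}
    (hF : ContinuousOn F (Metric.sphere 0 1))
    (h : ∀ w ∈ Metric.sphere (0 : ℂ) 1, Real.exp (p * (Q w).re) ≤ F w) :
    Real.exp (p * (Q 0).re) ≤ Real.circleAverage F 0 1 := by
  have h1 : Real.circleAverage Q 0 1 = Q 0 := hQ.diffContOnCl.circleAverage
  have hi : CircleIntegrable Q 0 1 := hQ.continuous.continuousOn.circleIntegrable zero_le_one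
  have h2 : Real.circleAverage (fun w => (Q w).re) 0 1 = (Q 0).re := by
    rw [← h1]
    exact (reCLM.circleAverage_comp_comm hi)
  have hg : CircleIntegrable (fun w => Real.exp (p * (Q 0).re) *
      (1 + p * ((Q w).re - (Q 0).re))) 0 1 := by
    refine ContinuousOn.circleIntegrable zero_le_one (Continuous.continuousOn ?_)
    have := hQ.continuous
    fun_prop
  -- The tangent of `x ↦ e^{p x}` at `x = a` lies below the exponential, and its average is
  -- `e^{p a}` by the mean value property.
  have h3 : Real.circleAverage (fun w => Real.exp (p * (Q 0).re) *
      (1 + p * ((Q w).re - (Q 0).re))) 0 1 = Real.exp (p * (Q 0).re) := by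
    have e1 : (fun w => Real.exp (p * (Q 0).re) * (1 + p * ((Q w).re - (Q 0).re))) =
        fun w => (Real.exp (p * (Q 0).re) * p) • (Q w).re +
          Real.exp (p * (Q 0).re) * (1 - p * (Q 0).re) := by
      ext w; simp only [smul_eq_mul]; ring
    rw [e1, Real.circleAverage_fun_add, Real.circleAverage_fun_smul, h2, Real.circleAverage_const,
      smul_eq_mul]
    · ring
    · refine ContinuousOn.circleIntegrable zero_le_one (Continuous.continuousOn ?_)
      have := hQ.continuous
      fun_prop
    · exact circleIntegrable_const _ _ _
  rw [← h3]
  refine Real.circleAverage_mono hg (hF.circleIntegrable zero_le_one) fun w hw => ?_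
  rw [abs_one] at hw
  refine le_trans ?_ (h w hw)
  have e2 : Real.exp (p * (Q w).re) =
      Real.exp (p * (Q 0).re) * Real.exp (p * ((Q w).re - (Q 0).re)) := by
    rw [← Real.exp_add]; ring_nf
  rw [e2]
  gcongr
  linarith [Real.add_one_le_exp (p * ((Q w).re - (Q 0).re))]

/-- The conformal map of the strip `0 < Re z < 1` onto the unit disc which takes `θ` to `0`. -/
def stripMap (θ : ℝ) (z : ℂ) : ℂ :=
  (exp (Real.pi * I * z) - exp (Real.pi * I * θ)) /
    (exp (Real.pi * I * z) - star (exp (Real.pi * I * θ)))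

theorem im_exp_pi_mul_I (z : ℂ) : (exp (Real.pi * I * z)).im =
    Real.exp (-(Real.pi * z.im)) * Real.sin (Real.pi * z.re) := by
  rw [exp_im]
  congr 2 <;> simp

theorem exp_pi_mul_I_left (t : ℝ) :
    exp (Real.pi * I * (t * I)) = (Real.exp (-(Real.pi * t)) : ℝ) := by
  rw [ofReal_exp]
  congr 1
  push_cast
  linear_combination (Real.pi * t : ℂ) * I_mul_I

theorem exp_pi_mul_I_right (t : ℝ) :
    exp (Real.pi * I * (1 + t * I)) = (-Real.exp (-(Real.pi * t)) : ℝ) := by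
  rw [mul_add, mul_one, exp_add, exp_pi_mul_I, exp_pi_mul_I_left]
  push_cast
  ring

theorem norm_sub_le_norm_sub_star {v ζ : ℂ} (hv : 0 ≤ v.im) (hζ : 0 ≤ ζ.im) :
    ‖v - ζ‖ ≤ ‖v - star ζ‖ := by
  rw [← sq_le_sq₀ (norm_nonneg _) (norm_nonneg _), ← normSq_eq_norm_sq, ← normSq_eq_norm_sq,
    normSq_apply, normSq_apply]
  simp only [sub_re, sub_im, star_def, conj_re, conj_im]
  nlinarith [mul_nonneg hv hζ]

theorem sub_star_ne_zero {v ζ : ℂ} (hv : 0 ≤ v.im) (hζ : 0 < ζ.im) : v - star ζ ≠ 0 := by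
  intro h
  have := congrArg Complex.im h
  simp only [sub_im, star_def, conj_im, zero_im] at this
  linarith

theorem norm_div_sub_star {y : ℝ} {ζ : ℂ} (hζ : 0 < ζ.im) :
    ‖((y : ℂ) - ζ) / (y - star ζ)‖ = 1 := by
  have h1 : (y : ℂ) - star ζ ≠ 0 := sub_star_ne_zero (by simp) hζ
  have h2 : (y : ℂ) - star ζ = star ((y : ℂ) - ζ) := by simp
  rw [norm_div, div_eq_one_iff_eq (norm_ne_zero_iff.2 h1), h2, norm_star]

theorem inverse_div_sub_star {y : ℝ} {ζ : ℂ} (hζ : 0 < ζ.im) :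
    (ζ - star ζ * (((y : ℂ) - ζ) / (y - star ζ))) / (1 - ((y : ℂ) - ζ) / (y - star ζ)) = y := by
  have h1 : (y : ℂ) - star ζ ≠ 0 := sub_star_ne_zero (by simp) hζ
  have h2 : ζ - star ζ ≠ 0 := sub_star_ne_zero hζ.le hζ
  have h3 : 1 - ((y : ℂ) - ζ) / (y - star ζ) = (ζ - star ζ) / (y - star ζ) := by
    rw [eq_div_iff h1, sub_mul, div_mul_cancel₀ _ h1]; ring
  rw [h3, div_eq_iff (div_ne_zero h2 h1)]
  field_simp
  ring

theorem im_exp_pi_pos {θ : ℝ} (hθ : θ ∈ Ioo (0 : ℝ) 1) : 0 < (exp (Real.pi * I * θ)).im := by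
  rw [im_exp_pi_mul_I]
  refine mul_pos (Real.exp_pos _) (Real.sin_pos_of_pos_of_lt_pi ?_ ?_)
  · exact mul_pos Real.pi_pos (by simpa using hθ.1)
  · simpa using mul_lt_mul_of_pos_left hθ.2 Real.pi_pos

theorem stripMap_self (θ : ℝ) : stripMap θ θ = 0 := by simp [stripMap]

theorem im_exp_pi_nonneg {z : ℂ} (hz : z.re ∈ Icc (0 : ℝ) 1) :
    0 ≤ (exp (Real.pi * I * z)).im := by
  rw [im_exp_pi_mul_I]
  refine mul_nonneg (Real.exp_pos _).le (Real.sin_nonneg_of_nonneg_of_le_pi ?_ ?_)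
  · exact mul_nonneg Real.pi_pos.le hz.1
  · simpa using mul_le_mul_of_nonneg_left hz.2 Real.pi_pos.le

section

variable {θ : ℝ} (hθ : θ ∈ Ioo (0 : ℝ) 1)
include hθ

theorem norm_stripMap_le {z : ℂ} (hz : z.re ∈ Icc (0 : ℝ) 1) : ‖stripMap θ z‖ ≤ 1 := by
  rw [stripMap, norm_div]
  exact div_le_one_of_le₀ (norm_sub_le_norm_sub_star (im_exp_pi_nonneg hz) (im_exp_pi_pos hθ).le)
    (norm_nonneg _)

theorem differentiableOn_stripMap :
    DifferentiableOn ℂ (stripMap θ) (Complex.re ⁻¹' Icc (0 : ℝ) 1) := by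
  unfold stripMap
  refine DifferentiableOn.div (by fun_prop) (by fun_prop) fun z hz => ?_
  exact sub_star_ne_zero (im_exp_pi_nonneg hz) (im_exp_pi_pos hθ)

end

namespace BanachCouple.CalderonFun

variable {C : BanachCouple.{u}} (g : C.CalderonFun) {θ : ℝ}

/-- The norm of the boundary values of an admissible function, transplanted from the boundary
of the strip to the real line by `z ↦ e^{iπz}`. -/
def lineSize (y : ℝ) : ℝ :=
  if 0 < y then ‖g.f₀ (-(Real.log y / Real.pi))‖ else
    if y < 0 then ‖g.f₁ (-(Real.log y / Real.pi))‖ else 0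

/-- The norm of the boundary values of an admissible function, transplanted from the boundary
of the strip to the unit circle by `stripMap θ`. The point `1`, which corresponds to infinity,
is sent to `lineSize 0 = 0` by the convention on division by zero. -/
def circleSize (θ : ℝ) (w : ℂ) : ℝ :=
  g.lineSize ((exp (Real.pi * I * θ) - star (exp (Real.pi * I * θ)) * w) / (1 - w)).re

theorem lineSize_nonneg (y : ℝ) : 0 ≤ g.lineSize y := by
  unfold lineSize
  split_ifs <;> positivity

theorem circleSize_nonneg (w : ℂ) : 0 ≤ g.circleSize θ w := g.lineSize_nonneg _

theorem lineSize_exp (t : ℝ) : g.lineSize (Real.exp (-(Real.pi * t))) = ‖g.f₀ t‖ := by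
  rw [lineSize, if_pos (Real.exp_pos _), Real.log_exp, neg_div, neg_neg,
    mul_div_cancel_left₀ _ Real.pi_ne_zero]

theorem lineSize_neg_exp (t : ℝ) : g.lineSize (-Real.exp (-(Real.pi * t))) = ‖g.f₁ t‖ := by
  have h := Real.exp_pos (-(Real.pi * t))
  rw [lineSize, if_neg (by linarith), if_pos (by linarith), Real.log_neg_eq_log, Real.log_exp,
    neg_div, neg_neg, mul_div_cancel_left₀ _ Real.pi_ne_zero]

theorem circleSize_left (hθ : θ ∈ Ioo (0 : ℝ) 1) (t : ℝ) :
    g.circleSize θ (stripMap θ (t * I)) = ‖g.f₀ t‖ := by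
  rw [circleSize, stripMap, exp_pi_mul_I_left, inverse_div_sub_star (im_exp_pi_pos hθ), ofReal_re,
    lineSize_exp]

theorem circleSize_right (hθ : θ ∈ Ioo (0 : ℝ) 1) (t : ℝ) :
    g.circleSize θ (stripMap θ (1 + t * I)) = ‖g.f₁ t‖ := by
  rw [circleSize, stripMap, exp_pi_mul_I_right, inverse_div_sub_star (im_exp_pi_pos hθ), ofReal_re,
    lineSize_neg_exp]

theorem lineSize_le (y : ℝ) : g.lineSize y ≤
    ‖g.f₀ (-(Real.log y / Real.pi))‖ + ‖g.f₁ (-(Real.log y / Real.pi))‖ := by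
  unfold lineSize
  split_ifs
  · simp
  · simp
  · positivity

theorem tendsto_lineSize {l : Filter ℝ}
    (hl : Tendsto (fun y => -(Real.log y / Real.pi)) l (cocompact ℝ)) :
    Tendsto g.lineSize l (𝓝 0) := by
  refine squeeze_zero g.lineSize_nonneg g.lineSize_le ?_
  have h0 := tendsto_norm_zero.comp ((zero_at_infty g.f₀).comp hl)
  have h1 := tendsto_norm_zero.comp ((zero_at_infty g.f₁).comp hl)
  simpa using h0.add h1

theorem tendsto_lineSize_cocompact : Tendsto g.lineSize (cocompact ℝ) (𝓝 0) := by
  refine g.tendsto_lineSize ?_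
  have h1 : Tendsto (fun y : ℝ => Real.log ‖y‖) (cocompact ℝ) atTop :=
    Real.tendsto_log_atTop.comp tendsto_norm_cocompact_atTop
  simp only [Real.norm_eq_abs, Real.log_abs] at h1
  exact (tendsto_neg_atTop_atBot.comp (h1.atTop_div_const Real.pi_pos)).mono_right
    atBot_le_cocompact

theorem continuous_lineSize : Continuous g.lineSize := by
  rw [continuous_iff_continuousAt]
  intro y
  rcases lt_trichotomy y 0 with hy | rfl | hy
  · have h1 : g.lineSize =ᶠ[𝓝 y] fun y => ‖g.f₁ (-(Real.log y / Real.pi))‖ := by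
      filter_upwards [Iio_mem_nhds hy] with s hs
      rw [lineSize, if_neg (not_lt.2 (le_of_lt hs)), if_pos (mem_Iio.1 hs)]
    refine ContinuousAt.congr ?_ h1.symm
    exact (g.f₁.continuous.continuousAt.comp
      ((Real.continuousAt_log hy.ne).div_const _).neg).norm
  · rw [continuousAt_iff_punctured_nhds]
    have h0 : g.lineSize 0 = 0 := by simp [lineSize]
    rw [h0]
    refine g.tendsto_lineSize ?_
    exact (tendsto_neg_atBot_atTop.comp
      (Real.tendsto_log_nhdsNE_zero.atBot_div_const Real.pi_pos)).mono_right atTop_le_cocompact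
  · have h1 : g.lineSize =ᶠ[𝓝 y] fun y => ‖g.f₀ (-(Real.log y / Real.pi))‖ := by
      filter_upwards [Ioi_mem_nhds hy] with s hs
      rw [lineSize, if_pos (mem_Ioi.1 hs)]
    refine ContinuousAt.congr ?_ h1.symm
    exact (g.f₀.continuous.continuousAt.comp
      ((Real.continuousAt_log hy.ne').div_const _).neg).norm

/-- The boundary values, transplanted to the unit circle, have continuous norms. The point `1`
corresponds to the two infinite ends of the strip, where the boundary values vanish. -/
theorem continuousOn_circleSize (hθ : θ ∈ Ioo (0 : ℝ) 1) :
    ContinuousOn (g.circleSize θ) (Metric.sphere 0 1) := by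
  set ζ := exp (Real.pi * I * θ) with hζ
  have hζ0 : ζ - star ζ ≠ 0 := sub_star_ne_zero (im_exp_pi_pos hθ).le (im_exp_pi_pos hθ)
  intro w hw
  by_cases h1 : w = 1
  · subst h1
    rw [← continuousWithinAt_sdiff_self, ContinuousWithinAt]
    have h0 : g.circleSize θ 1 = 0 := by simp [circleSize, lineSize]
    rw [h0]
    refine g.tendsto_lineSize_cocompact.comp (tendsto_cocompact_of_tendsto_dist_comp_atTop 0 ?_)
    have h2 : ∀ᶠ w in 𝓝[Metric.sphere (0 : ℂ) 1 \ {1}] 1, ‖ζ - star ζ * w‖ * ‖1 - w‖⁻¹ =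
        dist ((ζ - star ζ * w) / (1 - w)).re 0 := by
      filter_upwards [self_mem_nhdsWithin] with w hw
      have hw0 : w ≠ 0 := by
        rintro rfl
        simpa using hw.1
      have hw1 : 1 - w ≠ 0 := sub_ne_zero.2 fun h => hw.2 h.symm
      have hcw : star w = w⁻¹ := by
        rw [star_def, inv_def, normSq_eq_norm_sq, mem_sphere_zero_iff_norm.1 hw.1]
        simp
      have hw2 : 1 - w⁻¹ ≠ 0 := fun h => hw1 (by
        rw [sub_eq_zero] at h ⊢
        rw [← inv_one, h, inv_inv])
      have hre : star ((ζ - star ζ * w) / (1 - w)) = (ζ - star ζ * w) / (1 - w) := by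
        rw [star_div₀, star_sub, star_mul', star_star, star_sub, star_one, hcw, div_eq_div_iff hw2
          hw1]
        field_simp
        ring
      rw [← div_eq_mul_inv, ← norm_div, Real.dist_eq, sub_zero]
      rw [star_def, conj_eq_iff_re] at hre
      rw [← Real.norm_eq_abs, ← norm_real]
      exact congrArg _ hre.symm
    refine Tendsto.congr' h2 ?_
    have h3 : Tendsto (fun w : ℂ => ‖ζ - star ζ * w‖) (𝓝[Metric.sphere (0 : ℂ) 1 \ {1}] 1)
        (𝓝 ‖ζ - star ζ‖) := by
      have : Continuous fun w : ℂ => ‖ζ - star ζ * w‖ := by fun_prop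
      have h4 := this.tendsto 1
      rw [mul_one] at h4
      exact h4.mono_left nhdsWithin_le_nhds
    refine h3.pos_mul_atTop (norm_pos_iff.2 hζ0) (Tendsto.inv_tendsto_nhdsGT_zero ?_)
    rw [tendsto_nhdsWithin_iff]
    constructor
    · have : Continuous fun w : ℂ => ‖1 - w‖ := by fun_prop
      have h4 := this.tendsto 1
      rw [sub_self, norm_zero] at h4
      exact h4.mono_left nhdsWithin_le_nhds
    · filter_upwards [self_mem_nhdsWithin] with w hw
      exact norm_pos_iff.2 (sub_ne_zero.2 fun h => hw.2 h.symm)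
  · refine ContinuousAt.continuousWithinAt ?_
    refine g.continuous_lineSize.continuousAt.comp (continuous_re.continuousAt.comp ?_)
    exact ContinuousAt.div (by fun_prop) (by fun_prop) (sub_ne_zero.2 fun h => h1 h.symm)

/-- The norm in the complex interpolation space is at most a mean of the norms of the boundary
values: after division by an outer function of nearly the same modulus on the boundary, the
boundary values have norm at most `1`. -/
theorem norm_eval_rpow_le (hθ : θ ∈ Ioo (0 : ℝ) 1) {p : ℝ} (hp : 0 < p) :
    ‖g.eval hθ‖ ^ p ≤ Real.circleAverage (fun w => g.circleSize θ w ^ p) 0 1 := by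
  set A := Real.circleAverage (fun w => g.circleSize θ w ^ p) 0 1 with hA
  have hN : ContinuousOn (fun w => g.circleSize θ w ^ p) (Metric.sphere 0 1) :=
    (g.continuousOn_circleSize hθ).rpow_const fun _ _ => Or.inr hp.le
  have key : ∀ ε : ℝ, 0 < ε → ‖g.eval hθ‖ ^ p ≤ Real.exp (p * (2 * ε)) * (ε + A) := by
    intro ε hε
    have hpos : ∀ w, 0 < ε + g.circleSize θ w ^ p := fun w =>
      add_pos_of_pos_of_nonneg hε (Real.rpow_nonneg (g.circleSize_nonneg w) _)
    obtain ⟨Q, hQ, hQh⟩ := exists_entire_close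
      (h := fun w => p⁻¹ * Real.log (ε + g.circleSize θ w ^ p))
      (continuousOn_const.mul ((hN.const_add ε).log fun w _ => (hpos w).ne')) hε
    have hexp : ∀ w, Real.exp (p * (p⁻¹ * Real.log (ε + g.circleSize θ w ^ p))) =
        ε + g.circleSize θ w ^ p := fun w => by
      rw [mul_inv_cancel_left₀ hp.ne', Real.exp_log (hpos w)]
    have h1 : Real.exp (p * (Q 0).re) ≤ Real.exp (p * ε) * (ε + A) := by
      have h2 := exp_le_circleAverage hQ (p := p)
        (F := fun w => Real.exp (p * ε) • (ε + g.circleSize θ w ^ p))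
        (hN.const_add ε |>.const_smul (Real.exp (p * ε))) fun w hw => by
          rw [smul_eq_mul, ← hexp, ← Real.exp_add, ← mul_add]
          refine Real.exp_le_exp.2 (mul_le_mul_of_nonneg_left ?_ hp.le)
          linarith [(abs_le.1 (hQh w hw)).2]
      rwa [Real.circleAverage_fun_smul, Real.circleAverage_fun_add
        (circleIntegrable_const _ _ _) (hN.circleIntegrable zero_le_one), Real.circleAverage_const,
        smul_eq_mul] at h2
    -- On the circle `Re Q` is within `ε` of `p⁻¹ log (ε + circleSize ^ p)`, so that the factor
    -- `exp (Q 0 - Q)` makes the boundary values bounded by `exp (Re Q(0) + ε)`. The factor is `1`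
    -- at the point `0`, which corresponds to `θ`.
    have hb : ∀ w ∈ Metric.sphere (0 : ℂ) 1,
        ‖exp (Q 0 - Q w)‖ * g.circleSize θ w ≤ Real.exp ((Q 0).re + ε) := by
      intro w hw
      have h3 : g.circleSize θ w ≤ Real.exp (p⁻¹ * Real.log (ε + g.circleSize θ w ^ p)) := by
        rw [← Real.rpow_le_rpow_iff (g.circleSize_nonneg w) (Real.exp_pos _).le hp,
          ← Real.exp_mul, mul_comm _ p, hexp]
        linarith
      calc ‖exp (Q 0 - Q w)‖ * g.circleSize θ w
          ≤ Real.exp ((Q 0).re - (Q w).re) *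
            Real.exp (p⁻¹ * Real.log (ε + g.circleSize θ w ^ p)) := by
            rw [norm_exp, sub_re]
            gcongr
        _ ≤ _ := by
            rw [← Real.exp_add]
            refine Real.exp_le_exp.2 ?_
            linarith [(abs_le.1 (hQh w hw)).1]
    obtain ⟨B, hB⟩ := (isCompact_closedBall (0 : ℂ) 1).exists_bound_of_continuousOn
      (f := fun w => exp (Q 0 - Q w)) (by have := hQ.continuous; fun_prop)
    have hm : DiffContOnCl ℂ (fun z => exp (Q 0 - Q (stripMap θ z)))
        (Complex.re ⁻¹' Ioo (0 : ℝ) 1) := by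
      refine DifferentiableOn.diffContOnCl ?_
      rw [closure_strip]
      exact ((differentiableOn_const _).sub
        (hQ.comp_differentiableOn (differentiableOn_stripMap hθ))).cexp
    let G := g.scale (fun z => exp (Q 0 - Q (stripMap θ z))) hm (B := B)
      fun z h0 h1 => hB _ (mem_closedBall_zero_iff.2 (norm_stripMap_le hθ ⟨h0, h1⟩))
    have hG : G.norm ≤ Real.exp ((Q 0).re + ε) := by
      refine max_le ?_ ?_
      · refine (BoundedContinuousFunction.norm_le (Real.exp_pos _).le).2 fun t => ?_
        change ‖exp (Q 0 - Q (stripMap θ (t * I))) • g.f₀ t‖ ≤ _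
        rw [norm_smul, ← g.circleSize_left hθ]
        refine hb _ (mem_sphere_zero_iff_norm.2 ?_)
        rw [stripMap, exp_pi_mul_I_left, norm_div_sub_star (im_exp_pi_pos hθ)]
      · refine (BoundedContinuousFunction.norm_le (Real.exp_pos _).le).2 fun t => ?_
        change ‖exp (Q 0 - Q (stripMap θ (1 + t * I))) • g.f₁ t‖ ≤ _
        rw [norm_smul, ← g.circleSize_right hθ]
        refine hb _ (mem_sphere_zero_iff_norm.2 ?_)
        rw [stripMap, exp_pi_mul_I_right, norm_div_sub_star (im_exp_pi_pos hθ)]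
    have hGg : G.eval hθ = g.eval hθ := by
      apply (C.complexNorm θ hθ).incl_injective
      rw [incl_eval, incl_eval]
      change C.sumIncl (exp (Q 0 - Q (stripMap θ θ)) • g.f θ) = _
      rw [stripMap_self, sub_self, exp_zero, one_smul]
    calc ‖g.eval hθ‖ ^ p ≤ Real.exp ((Q 0).re + ε) ^ p := by
          rw [← hGg]
          exact Real.rpow_le_rpow (_root_.norm_nonneg _) ((G.norm_eval_le hθ).trans hG) hp.le
      _ = Real.exp (p * ε) * Real.exp (p * (Q 0).re) := by
          rw [← Real.exp_mul, ← Real.exp_add]; ring_nf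
      _ ≤ Real.exp (p * ε) * (Real.exp (p * ε) * (ε + A)) := by gcongr
      _ = _ := by
          rw [← mul_assoc, ← Real.exp_add]; ring_nf
  have hlim : Tendsto (fun ε : ℝ => Real.exp (p * (2 * ε)) * (ε + A)) (𝓝[>] 0) (𝓝 A) := by
    have : Continuous fun ε : ℝ => Real.exp (p * (2 * ε)) * (ε + A) := by fun_prop
    have h := this.tendsto 0
    simp only [mul_zero, Real.exp_zero, zero_add, one_mul] at h
    exact h.mono_left nhdsWithin_le_nhds
  exact ge_of_tendsto hlim (eventually_nhdsWithin_of_forall fun ε hε => key ε hε)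

end BanachCouple.CalderonFun

end StripJensen

/-! ### Sequences in complex interpolation spaces -/

section ComplexStable

open Filter Topology

variable {C : BanachCouple.{u}}

theorem sum_zeroAtInfty_apply {Y : Type*} [NormedAddCommGroup Y] (s : Finset ℕ) (f : ℕ → C₀(ℝ, Y))
    (t : ℝ) : (∑ k ∈ s, f k) t = ∑ k ∈ s, f k t := by
  let ev : C₀(ℝ, Y) →+ Y := { toFun := fun f => f t, map_zero' := rfl, map_add' := fun _ _ => rfl }
  exact map_sum ev f s

/-- Sum of finitely many admissible functions. -/
def BanachCouple.CalderonFun.sum (s : Finset ℕ) (g : ℕ → C.CalderonFun) : C.CalderonFun where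
  f z := ∑ k ∈ s, (g k).f z
  f₀ := ∑ k ∈ s, (g k).f₀
  f₁ := ∑ k ∈ s, (g k).f₁
  diffContOnCl :=
    ⟨DifferentiableOn.fun_sum fun k _ => (g k).diffContOnCl.differentiableOn,
      continuousOn_finsetSum _ fun k _ => (g k).diffContOnCl.continuousOn⟩
  bounded := ⟨∑ k ∈ s, (g k).norm, fun z h0 h1 =>
    norm_sum_le_of_le _ fun k _ => (g k).norm_apply_le h0 h1⟩
  boundary₀ t := by
    rw [map_sum, sum_zeroAtInfty_apply, map_sum]
    exact Finset.sum_congr rfl fun k _ => (g k).boundary₀ t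
  boundary₁ t := by
    rw [map_sum, sum_zeroAtInfty_apply, map_sum]
    exact Finset.sum_congr rfl fun k _ => (g k).boundary₁ t

variable {p : ℝ≥0∞} [Fact (1 ≤ p)]

/-- The entry with index `(n, k)` of the infinite matrix of an operator in `ℓ^p(Y)`. -/
def lpEntry {Y : Type u} [NormedAddCommGroup Y] [NormedSpace ℂ Y]
    (S : lp (fun _ : ℕ => Y) p →L[ℂ] lp (fun _ : ℕ => Y) p) (n k : ℕ) : Y →L[ℂ] Y :=
  (lp.evalCLM ℂ (fun _ : ℕ => Y) p n).comp
    (S.comp (lp.singleContinuousLinearMap ℂ (fun _ : ℕ => Y) p k))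

theorem sum_lpEntry_apply {Y : Type u} [NormedAddCommGroup Y] [NormedSpace ℂ Y]
    (S : lp (fun _ : ℕ => Y) p →L[ℂ] lp (fun _ : ℕ => Y) p) (n : ℕ) (s : Finset ℕ) (y : ℕ → Y) :
    ∑ k ∈ s, lpEntry S n k (y k) = S (∑ k ∈ s, lp.single p k (y k)) n := by
  rw [map_sum, lp.coeFn_sum, Finset.sum_apply]
  rfl

theorem sum_norm_lpEntry_le {Y : Type u} [NormedAddCommGroup Y] [NormedSpace ℂ Y]
    (hp : 0 < p.toReal) (S : lp (fun _ : ℕ => Y) p →L[ℂ] lp (fun _ : ℕ => Y) p) (F s : Finset ℕ)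
    (y : ℕ → Y) {r : ℕ → ℝ} (hr : ∀ k ∈ s, ‖y k‖ ≤ r k) :
    ∑ n ∈ F, ‖∑ k ∈ s, lpEntry S n k (y k)‖ ^ p.toReal ≤
      ‖S‖ ^ p.toReal * ∑ k ∈ s, r k ^ p.toReal := by
  simp only [sum_lpEntry_apply]
  refine (lp.sum_rpow_le_norm_rpow hp _ F).trans ?_
  calc ‖S (∑ k ∈ s, lp.single p k (y k))‖ ^ p.toReal
      ≤ (‖S‖ * ‖∑ k ∈ s, lp.single p k (y k)‖) ^ p.toReal :=
        Real.rpow_le_rpow (norm_nonneg _) (S.le_opNorm _) hp.le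
    _ = ‖S‖ ^ p.toReal * ∑ k ∈ s, ‖y k‖ ^ p.toReal := by
        rw [Real.mul_rpow (norm_nonneg _) (norm_nonneg _), lp.norm_sum_single hp]
    _ ≤ _ := by
        gcongr with k hk
        exact hr k hk

theorem lpEntry_consistent
    {S₀ : lp (fun _ : ℕ => C.X₀) p →L[ℂ] lp (fun _ : ℕ => C.X₀) p}
    {S₁ : lp (fun _ : ℕ => C.X₁) p →L[ℂ] lp (fun _ : ℕ => C.X₁) p}
    (hS : ∀ a b, (∀ n, C.ι₀ (a n) = C.ι₁ (b n)) → ∀ n, C.ι₀ (S₀ a n) = C.ι₁ (S₁ b n))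
    (n k : ℕ) (a : C.X₀) (b : C.X₁) (h : C.ι₀ a = C.ι₁ b) :
    C.ι₀ (lpEntry S₀ n k a) = C.ι₁ (lpEntry S₁ n k b) := by
  refine hS _ _ (fun m => ?_) n
  change C.ι₀ ((lp.single p k a : lp (fun _ : ℕ => C.X₀) p) m) =
    C.ι₁ ((lp.single p k b : lp (fun _ : ℕ => C.X₁) p) m)
  by_cases hm : m = k
  · subst hm
    rw [lp.single_apply_self, lp.single_apply_self, h]
  · rw [lp.single_apply_ne _ _ _ hm, lp.single_apply_ne _ _ _ hm, map_zero, map_zero]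

/-- On an element `a + b` of `ℓ^p(X₀) + ℓ^p(X₁)` with finitely many nonzero terms, a pair of
consistent operators acts through finitely many matrix entries, even if `a` and `b` have infinitely
many nonzero terms: outside `s`, the sequences `a` and `-b` agree. -/
theorem add_eq_sum_lpEntry
    {S₀ : lp (fun _ : ℕ => C.X₀) p →L[ℂ] lp (fun _ : ℕ => C.X₀) p}
    {S₁ : lp (fun _ : ℕ => C.X₁) p →L[ℂ] lp (fun _ : ℕ => C.X₁) p}
    (hS : ∀ a b, (∀ n, C.ι₀ (a n) = C.ι₁ (b n)) → ∀ n, C.ι₀ (S₀ a n) = C.ι₁ (S₁ b n))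
    {a : lp (fun _ : ℕ => C.X₀) p} {b : lp (fun _ : ℕ => C.X₁) p} {s : Finset ℕ}
    (hs : ∀ n ∉ s, C.ι₀ (a n) + C.ι₁ (b n) = 0) (n : ℕ) :
    C.ι₀ (S₀ a n) + C.ι₁ (S₁ b n) =
      ∑ k ∈ s, (C.ι₀ (lpEntry S₀ n k (a k)) + C.ι₁ (lpEntry S₁ n k (b k))) := by
  have h1 : C.ι₀ (S₀ (a - ∑ k ∈ s, lp.single p k (a k)) n) =
      C.ι₁ (S₁ (∑ k ∈ s, lp.single p k (b k) - b) n) := by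
    refine hS _ _ (fun m => ?_) n
    rw [lp.coeFn_sub, lp.coeFn_sub, Pi.sub_apply, Pi.sub_apply, lp.coeFn_sum, lp.coeFn_sum,
      Finset.sum_apply, Finset.sum_apply]
    simp only [lp.coeFn_single, Finset.sum_pi_single]
    split_ifs with hm
    · simp
    · rw [sub_zero, zero_sub, map_neg, eq_neg_iff_add_eq_zero, hs m hm]
  rw [map_sub, map_sub, lp.coeFn_sub, lp.coeFn_sub, Pi.sub_apply, Pi.sub_apply, map_sub, map_sub,
    sub_eq_sub_iff_add_eq_add, ← sum_lpEntry_apply, ← sum_lpEntry_apply, map_sum, map_sum] at h1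
  rw [Finset.sum_add_distrib, h1, add_comm]

/-- The complex interpolation spaces have the interpolation property for sequences. -/
theorem lpStable_complexIncl (hp : p ≠ ∞) {θ : ℝ} (hθ : θ ∈ Ioo (0 : ℝ) 1) :
    LpStable p C (BanachCouple.complexIncl (C := C) hθ) := by
  have hp1 : (1 : ℝ≥0∞) ≤ p := Fact.out
  have hpr : 0 < p.toReal := ENNReal.toReal_pos (zero_lt_one.trans_le hp1).ne' hp
  refine ⟨2, zero_le_two, fun S₀ S₁ hS x a b hx hab => ?_⟩
  set s := hx.toFinset with hs
  -- Near-optimal functions for the nonzero terms of `x`.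
  have hsx : ∀ k, ∃ g : C.CalderonFun, g.eval hθ = x k ∧ (k ∈ s → g.norm ≤ 2 * ‖x k‖) := by
    intro k
    by_cases hk : x k = 0
    · obtain ⟨g, hg, _⟩ := BanachCouple.exists_eval_eq hθ (x k) one_pos
      exact ⟨g, hg, fun h => absurd hk (by simpa [hs] using h)⟩
    · obtain ⟨g, hg, h⟩ := BanachCouple.exists_eval_eq hθ (x k) (norm_pos_iff.2 hk)
      exact ⟨g, hg, fun _ => by linarith⟩
  choose φ hφ hφn using hsx
  -- The operators act on the boundary values through their matrix entries.
  let ψ : ℕ → C.CalderonFun := fun n => BanachCouple.CalderonFun.sum s fun k =>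
    (φ k).map (lpEntry S₀ n k) (lpEntry S₁ n k) (lpEntry_consistent hS n k)
  have hψ₀ : ∀ n t, (ψ n).f₀ t = ∑ k ∈ s, lpEntry S₀ n k ((φ k).f₀ t) := fun n t => by
    change (∑ k ∈ s, _ : C₀(ℝ, C.X₀)) t = _
    rw [sum_zeroAtInfty_apply]
    rfl
  have hψ₁ : ∀ n t, (ψ n).f₁ t = ∑ k ∈ s, lpEntry S₁ n k ((φ k).f₁ t) := fun n t => by
    change (∑ k ∈ s, _ : C₀(ℝ, C.X₁)) t = _
    rw [sum_zeroAtInfty_apply]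
    rfl
  set M := max ‖S₀‖ ‖S₁‖ with hM
  have hM0 : 0 ≤ M := le_max_of_le_left (norm_nonneg _)
  have hxs : ∑ k ∈ s, (2 * ‖x k‖) ^ p.toReal ≤ (2 * ‖x‖) ^ p.toReal := by
    simp only [Real.mul_rpow zero_le_two (norm_nonneg _), ← Finset.mul_sum]
    gcongr
    exact lp.sum_rpow_le_norm_rpow hpr x s
  -- At each boundary point the sequence of values is bounded in `ℓ^p`; Jensen's inequality, applied
  -- to each term, keeps the sum over `n` inside the average.
  have hbd : ∀ (F : Finset ℕ) (y : ℝ),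
      ∑ n ∈ F, (ψ n).lineSize y ^ p.toReal ≤ (2 * M * ‖x‖) ^ p.toReal := by
    intro F y
    have h2 : (2 * M * ‖x‖) ^ p.toReal = M ^ p.toReal * (2 * ‖x‖) ^ p.toReal := by
      rw [← Real.mul_rpow hM0 (by positivity)]; ring_nf
    unfold BanachCouple.CalderonFun.lineSize
    split_ifs
    · simp only [hψ₀]
      refine (sum_norm_lpEntry_le hpr S₀ F s _ fun k hk =>
        (((φ k).f₀.toBCF.norm_coe_le_norm _).trans (le_max_left _ _)).trans (hφn k hk)).trans ?_
      rw [h2]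
      have := le_max_left ‖S₀‖ ‖S₁‖
      gcongr
    · simp only [hψ₁]
      refine (sum_norm_lpEntry_le hpr S₁ F s _ fun k hk =>
        (((φ k).f₁.toBCF.norm_coe_le_norm _).trans (le_max_right _ _)).trans (hφn k hk)).trans ?_
      rw [h2]
      have := le_max_right ‖S₀‖ ‖S₁‖
      gcongr
    · simp only [Real.zero_rpow hpr.ne', Finset.sum_const_zero]
      positivity
  have hz : ∀ F : Finset ℕ,
      ∑ n ∈ F, ‖(ψ n).eval hθ‖ ^ p.toReal ≤ (2 * M * ‖x‖) ^ p.toReal := by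
    intro F
    have hi : ∀ n, CircleIntegrable (fun w => (ψ n).circleSize θ w ^ p.toReal) 0 1 := fun n =>
      (((ψ n).continuousOn_circleSize hθ).rpow_const fun _ _ =>
        Or.inr hpr.le).circleIntegrable zero_le_one
    refine (Finset.sum_le_sum fun n _ => (ψ n).norm_eval_rpow_le hθ hpr).trans ?_
    rw [← Real.circleAverage_fun_sum fun n _ => hi n]
    exact Real.circleAverage_mono_on_of_le_circle (CircleIntegrable.fun_sum F fun n _ => hi n)
      fun w _ => hbd F _
  let z : lp (fun _ : ℕ => C.ComplexSpace θ hθ) p := ⟨fun n => (ψ n).eval hθ, memℓp_gen' hz⟩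
  refine ⟨z, lp.norm_le_of_forall_sum_le hpr (by positivity) hz, fun n => ?_⟩
  have hab' : ∀ k, C.sumIncl ((φ k).f θ) = C.ι₀ (a k) + C.ι₁ (b k) := fun k => by
    rw [← hab k, ← hφ k]; rfl
  rw [add_eq_sum_lpEntry hS (s := s) fun k hk => ?_]
  · change C.sumIncl (∑ k ∈ s, _) = _
    rw [map_sum]
    exact Finset.sum_congr rfl fun k _ => (φ k).sumIncl_map _ (hab' k)
  · rw [← hab k]
    have : x k = 0 := by simpa [hs] using hk
    rw [this, map_zero]

end ComplexStable

/-! ### Maximal regularity in complex interpolation spaces -/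

section ComplexMaxReg

variable {X : Type u} [NormedAddCommGroup X] [NormedSpace ℂ X] [CompleteSpace X]
  {A : X →ₗ.[ℂ] X} {p : ℝ≥0∞} [Fact (1 ≤ p)]

/-- The inclusion of `D_A` in `[X, D_A]_θ`. -/
theorem exists_domToComplex (hA : A.IsClosed) {θ : ℝ} (hθ : θ ∈ Ioo (0 : ℝ) 1) :
    ∃ j : graphSpace A →L[ℂ] (domainCouple A hA).ComplexSpace θ hθ,
      ∀ d, ((domainCouple A hA).complexNorm θ hθ).incl (j d) = domFst A d := by
  let g : graphSpace A → (domainCouple A hA).CalderonFun := fun d =>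
    BanachCouple.CalderonFun.smul (1 + θ) (BanachCouple.CalderonFun.ofInter
      (C := domainCouple A hA) (domFst A d) d rfl)
  -- The factor `1 + θ` normalizes the value at `θ`: the function `ofInter` has the factor
  -- `(1 + θ)⁻¹` there.
  have h1 : (1 + θ : ℂ) ≠ 0 := fun h => by
    have h2 := congrArg Complex.re h
    simp at h2
    linarith [hθ.1]
  have hg : ∀ d, ((domainCouple A hA).complexNorm θ hθ).incl ((g d).eval hθ) = domFst A d := by
    intro d
    rw [BanachCouple.CalderonFun.incl_eval]
    change (domainCouple A hA).sumIncl ((1 + θ : ℂ) • (1 + θ : ℂ)⁻¹ •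
      (domainCouple A hA).sumMk (domFst A d, 0)) = _
    rw [smul_inv_smul₀ h1, BanachCouple.sumIncl_sumMk, map_zero, add_zero]
    rfl
  have hinj := ((domainCouple A hA).complexNorm θ hθ).incl_injective
  let j : graphSpace A →ₗ[ℂ] (domainCouple A hA).ComplexSpace θ hθ :=
    { toFun := fun d => (g d).eval hθ
      map_add' := fun d d' => hinj (by rw [map_add, hg, hg, hg, map_add])
      map_smul' := fun c d => hinj (by rw [RingHom.id_apply, map_smul, hg, hg, map_smul]) }
  refine ⟨j.mkContinuous ‖(1 + θ : ℂ)‖ fun d => ?_, hg⟩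
  refine ((g d).norm_eval_le hθ).trans ?_
  have h2 := BanachCouple.CalderonFun.norm_ofInter_le (C := domainCouple A hA) (domFst A d) d rfl
  rw [max_eq_right (norm_domFst_le d)] at h2
  refine le_trans (max_le ?_ ?_) (mul_le_mul_of_nonneg_left h2 (norm_nonneg _))
  · refine (norm_smul_le (1 + θ : ℂ) _).trans ?_
    gcongr
    exact le_max_left _ _
  · refine (norm_smul_le (1 + θ : ℂ) _).trans ?_
    gcongr
    exact le_max_right _ _

/-- Maximal regularity on `(0,∞)` passes to the part of `A` in `[X, D_A]_θ`. -/
theorem HasLpMaxReg.part_complex (hp : p ≠ ∞) (hA : HasLpMaxReg A p ∞) {θ : ℝ}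
    (hθ : θ ∈ Ioo (0 : ℝ) 1) :
    HasLpMaxReg (MaxReg.part A ((domainCouple A hA.1).complexNorm θ hθ).incl) p ∞ := by
  obtain ⟨j, hj⟩ := exists_domToComplex hA.1 hθ
  have := BanachCouple.completeSpace_complexSpace (C := domainCouple A hA.1) hθ
  exact hA.part_of_lpStable hp (ι := BanachCouple.complexIncl (C := domainCouple A hA.1) hθ)
    ((domainCouple A hA.1).complexNorm θ hθ).incl_injective j hj (lpStable_complexIncl hp hθ)

end ComplexMaxReg

/-! ### Window averages in mixed-norm spaces -/

section Averages

open Filter Topology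

/-- The mean value (up to a factor `2`) of `φ` over the window `[t - h, t + h]`. -/
def winAvg (h : ℝ) (φ : ℝ → ℝ≥0∞) (t : ℝ) : ℝ≥0∞ :=
  ENNReal.ofReal h⁻¹ * ∫⁻ u in Icc (t - h) (t + h), φ u

variable {h : ℝ} {φ ψ : ℝ → ℝ≥0∞}

theorem winAvg_eq_lintegral (h : ℝ) (φ : ℝ → ℝ≥0∞) (t : ℝ) : winAvg h φ t =
    ENNReal.ofReal h⁻¹ * ∫⁻ u, {q : ℝ × ℝ | |q.1 - q.2| ≤ h}.indicator 1 (t, u) * φ u := by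
  rw [winAvg, ← lintegral_indicator measurableSet_Icc]
  congr 1
  refine lintegral_congr fun u => ?_
  have h1 : (t, u) ∈ {q : ℝ × ℝ | |q.1 - q.2| ≤ h} ↔ u ∈ Icc (t - h) (t + h) := by
    simp only [mem_ofPred_eq, mem_Icc, abs_le]
    constructor <;> rintro ⟨h1, h2⟩ <;> constructor <;> linarith
  by_cases hu : u ∈ Icc (t - h) (t + h)
  · rw [indicator_of_mem hu, indicator_of_mem (h1.2 hu), Pi.one_apply, one_mul]
  · rw [indicator_of_notMem hu, indicator_of_notMem (fun h => hu (h1.1 h)), zero_mul]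

theorem measurable_window (h : ℝ) :
    Measurable ({q : ℝ × ℝ | |q.1 - q.2| ≤ h}.indicator (1 : ℝ × ℝ → ℝ≥0∞)) := by
  refine measurable_one.indicator (measurableSet_le (by fun_prop) measurable_const)

theorem measurable_winAvg (hφ : Measurable φ) : Measurable (winAvg h φ) := by
  rw [show winAvg h φ = _ from funext fun t => winAvg_eq_lintegral h φ t]
  refine Measurable.const_mul (Measurable.lintegral_prod_right' (f := fun q : ℝ × ℝ =>
    {q : ℝ × ℝ | |q.1 - q.2| ≤ h}.indicator 1 (q.1, q.2) * φ q.2) ?_) _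
  exact (measurable_window h).mul (hφ.comp measurable_snd)

/-- The averages are symmetric operators. -/
theorem lintegral_winAvg_mul (hφ : Measurable φ) (hψ : Measurable ψ) :
    ∫⁻ t, winAvg h φ t * ψ t = ∫⁻ t, φ t * winAvg h ψ t := by
  have hm : Measurable fun q : ℝ × ℝ =>
      {q : ℝ × ℝ | |q.1 - q.2| ≤ h}.indicator (1 : ℝ × ℝ → ℝ≥0∞) q * φ q.2 * ψ q.1 :=
    ((measurable_window h).mul (hφ.comp measurable_snd)).mul (hψ.comp measurable_fst)
  have e1 : ∀ t, winAvg h φ t * ψ t = ENNReal.ofReal h⁻¹ *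
      ∫⁻ u, {q : ℝ × ℝ | |q.1 - q.2| ≤ h}.indicator 1 (t, u) * φ u * ψ t := fun t => by
    rw [winAvg_eq_lintegral, mul_assoc, lintegral_mul_const]
    exact ((measurable_window h).comp (by fun_prop)).mul hφ
  have e2 : ∀ u, φ u * winAvg h ψ u = ENNReal.ofReal h⁻¹ *
      ∫⁻ t, {q : ℝ × ℝ | |q.1 - q.2| ≤ h}.indicator 1 (t, u) * φ u * ψ t := fun u => by
    rw [winAvg_eq_lintegral, mul_left_comm, ← lintegral_const_mul]
    · congr 1
      refine lintegral_congr fun t => ?_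
      have : {q : ℝ × ℝ | |q.1 - q.2| ≤ h}.indicator (1 : ℝ × ℝ → ℝ≥0∞) (u, t) =
          {q : ℝ × ℝ | |q.1 - q.2| ≤ h}.indicator 1 (t, u) := by
        simp only [indicator, mem_ofPred_eq, abs_sub_comm u t]
        rfl
      rw [this]
      ring
    · exact ((measurable_window h).comp (by fun_prop)).mul hψ
  simp only [e1, e2]
  rw [lintegral_const_mul, lintegral_const_mul, lintegral_lintegral_swap hm.aemeasurable]
  · exact hm.lintegral_prod_left'
  · exact hm.lintegral_prod_right'

theorem winAvg_le_of_near (hh : 0 < h) {t u : ℝ} (htu : |u - t| ≤ h) :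
    winAvg h φ t ≤ 2 * winAvg (2 * h) φ u := by
  rw [winAvg, winAvg, ← mul_assoc]
  refine mul_le_mul' (le_of_eq ?_) (lintegral_mono_set (Icc_subset_Icc ?_ ?_))
  · rw [show (2 : ℝ≥0∞) = ENNReal.ofReal 2 by simp, ← ENNReal.ofReal_mul zero_le_two]
    congr 1
    field_simp
  · linarith [(abs_le.1 htu).2]
  · linarith [(abs_le.1 htu).1]

theorem winAvg_le_of_forall_le (hh : 0 < h) {t : ℝ} {c : ℝ≥0∞} (hc : ∀ u, |t - u| ≤ h → φ u ≤ c) :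
    winAvg h φ t ≤ 2 * c := by
  have h1 : ∫⁻ u in Icc (t - h) (t + h), φ u ≤ c * ENNReal.ofReal (2 * h) := by
    refine (setLIntegral_mono' measurableSet_Icc (g := fun _ => c) fun u hu => hc u ?_).trans ?_
    · rw [abs_le]
      constructor <;> linarith [hu.1, hu.2]
    · rw [setLIntegral_const, Real.volume_Icc, show t + h - (t - h) = 2 * h by ring]
  calc winAvg h φ t ≤ ENNReal.ofReal h⁻¹ * (c * ENNReal.ofReal (2 * h)) := by
        rw [winAvg]; gcongr
    _ = (ENNReal.ofReal h⁻¹ * ENNReal.ofReal (2 * h)) * c := by ring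
    _ = 2 * c := by
        rw [← ENNReal.ofReal_mul (by positivity), show h⁻¹ * (2 * h) = 2 by field_simp]
        simp

theorem winAvg_rpow_le (hh : 0 < h) (hφ : Measurable φ) {q : ℝ} (hq : 1 ≤ q) (t : ℝ) :
    winAvg h φ t ^ q ≤ 2 ^ (q - 1) * winAvg h (fun u => φ u ^ q) t := by
  rcases eq_or_lt_of_le hq with rfl | hq1
  · simp
  have hq0 : 0 < q := by linarith
  have hpq := Real.HolderConjugate.conjExponent hq1
  have h1 := ENNReal.lintegral_mul_le_Lp_mul_Lq (volume.restrict (Icc (t - h) (t + h))) hpq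
    hφ.aemeasurable (aemeasurable_const (b := (1 : ℝ≥0∞)))
  simp only [Pi.mul_apply, mul_one, ENNReal.one_rpow] at h1
  rw [setLIntegral_one, Real.volume_Icc, show t + h - (t - h) = 2 * h by ring] at h1
  have h2 := ENNReal.rpow_le_rpow h1 hq0.le
  rw [ENNReal.mul_rpow_of_nonneg _ _ hq0.le, ← ENNReal.rpow_mul, one_div_mul_cancel hq0.ne',
    ENNReal.rpow_one, ← ENNReal.rpow_mul, Real.conjExponent,
    show 1 / (q / (q - 1)) * q = q - 1 by field_simp] at h2
  rw [winAvg, ENNReal.mul_rpow_of_nonneg _ _ hq0.le]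
  have h3 : ENNReal.ofReal h⁻¹ ^ q * ENNReal.ofReal (2 * h) ^ (q - 1) =
      2 ^ (q - 1) * ENNReal.ofReal h⁻¹ := by
    rw [show (2 : ℝ≥0∞) = ENNReal.ofReal 2 by simp,
      ENNReal.ofReal_rpow_of_pos (by positivity), ENNReal.ofReal_rpow_of_pos (by positivity),
      ENNReal.ofReal_rpow_of_pos (by positivity), ← ENNReal.ofReal_mul (by positivity),
      ← ENNReal.ofReal_mul (by positivity), Real.mul_rpow (by positivity) (by positivity)]
    congr 1
    have : h⁻¹ ^ q = h⁻¹ * (h ^ (q - 1))⁻¹ := by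
      rw [Real.inv_rpow hh.le, ← mul_inv, ← Real.rpow_one_add' hh.le (by linarith)]
      congr 2
      ring
    rw [this]
    have := (Real.rpow_pos_of_pos hh (q - 1)).ne'
    field_simp
  calc ENNReal.ofReal h⁻¹ ^ q * (∫⁻ u in Icc (t - h) (t + h), φ u) ^ q
      ≤ ENNReal.ofReal h⁻¹ ^ q * ((∫⁻ u in Icc (t - h) (t + h), φ u ^ q) *
        ENNReal.ofReal (2 * h) ^ (q - 1)) := by gcongr
    _ = (ENNReal.ofReal h⁻¹ ^ q * ENNReal.ofReal (2 * h) ^ (q - 1)) *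
        ∫⁻ u in Icc (t - h) (t + h), φ u ^ q := by ring
    _ = _ := by rw [h3, winAvg, mul_assoc]

theorem lintegral_winAvg_rpow_le (hh : 0 < h) (hφ : Measurable φ) {r : ℝ} (hr : 1 ≤ r) :
    ∫⁻ t, winAvg h φ t ^ r ≤ 2 ^ r * ∫⁻ t, φ t ^ r := by
  calc ∫⁻ t, winAvg h φ t ^ r ≤ ∫⁻ t, 2 ^ (r - 1) * winAvg h (fun u => φ u ^ r) t :=
        lintegral_mono fun t => winAvg_rpow_le hh hφ hr t
    _ = 2 ^ (r - 1) * ∫⁻ t, winAvg h (fun u => φ u ^ r) t * 1 := by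
        rw [lintegral_const_mul _ (measurable_winAvg (hφ.pow_const r))]
        simp only [mul_one]
    _ = 2 ^ (r - 1) * ∫⁻ t, φ t ^ r * winAvg h (fun _ => 1) t := by
        rw [lintegral_winAvg_mul (hφ.pow_const r) measurable_const]
    _ ≤ 2 ^ (r - 1) * ∫⁻ t, φ t ^ r * (2 * 1) := by
        gcongr with t
        exact winAvg_le_of_forall_le hh fun _ _ => le_rfl
    _ = _ := by
        rw [lintegral_mul_const _ (hφ.pow_const r), mul_one, mul_comm (∫⁻ t, φ t ^ r), ← mul_assoc]
        congr 1
        conv_lhs => rw [← ENNReal.rpow_one 2, ← ENNReal.rpow_mul, one_mul]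
        rw [← ENNReal.rpow_add _ _ two_ne_zero ENNReal.ofNat_ne_top]
        ring_nf

theorem ennreal_add_rpow_le (x y : ℝ≥0∞) {r : ℝ} (hr : 1 ≤ r) :
    (x + y) ^ r ≤ x ^ r + ENNReal.ofReal r * (y * (x + y) ^ (r - 1)) := by
  have hr0 : 0 < r := by linarith
  have hr1 : 0 ≤ r - 1 := by linarith
  rcases eq_or_ne x ∞ with rfl | hx
  · simp [hr0]
  rcases eq_or_ne y ∞ with rfl | hy
  · rw [ENNReal.top_mul, ENNReal.mul_top]
    · simp
    · simpa using hr0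
    · rw [add_top]
      rcases hr1.eq_or_lt with h | h
      · rw [← h]; simp
      · rw [ENNReal.top_rpow_of_pos h]; simp
  lift x to NNReal using hx
  lift y to NNReal using hy
  rw [← ENNReal.coe_add, ← ENNReal.coe_rpow_of_nonneg _ hr0.le, ← ENNReal.coe_rpow_of_nonneg _ hr0.le,
    ← ENNReal.coe_rpow_of_nonneg _ hr1, ENNReal.ofReal, ← ENNReal.coe_mul, ← ENNReal.coe_mul,
    ← ENNReal.coe_add, ENNReal.coe_le_coe, ← NNReal.coe_le_coe]
  push_cast
  rw [Real.coe_toNNReal r hr0.le]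
  rcases (add_nonneg x.2 y.2).eq_or_lt with h | h
  · have h0 : (x : ℝ) + y = 0 := h.symm
    rw [h0, Real.zero_rpow hr0.ne']
    positivity
  · set z : ℝ := (x : ℝ) + y with hz
    have hz0 : 0 < z := h
    have h1 := one_add_mul_self_le_rpow_one_add (s := -(y / z)) (by
      rw [neg_le_neg_iff, div_le_one hz0]
      exact le_add_of_nonneg_left x.2) hr
    have h2 : 1 + -((y : ℝ) / z) = x / z := by
      field_simp
      rw [hz]; ring
    rw [h2, Real.div_rpow (NNReal.coe_nonneg x) hz0.le, le_div_iff₀ (Real.rpow_pos_of_pos hz0 r)] at h1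
    have h3 : z ^ r = z * z ^ (r - 1) := by
      rw [← Real.rpow_one_add' hz0.le (by linarith)]; ring_nf
    have h4 : (1 + r * -((y : ℝ) / z)) * z ^ r = z ^ r - r * (y * z ^ (r - 1)) := by
      rw [h3]; field_simp; ring
    linarith

/-- Summation by parts for powers: `(∑ aᵢ)^r ≤ r ∑ᵢ aᵢ (∑_{j ≥ i} aⱼ)^{r-1}`. -/
theorem sum_rpow_le_sum_mul_tail (a : ℤ → ℝ≥0∞) (s : Finset ℤ) {r : ℝ} (hr : 1 ≤ r) :
    (∑ i ∈ s, a i) ^ r ≤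
      ENNReal.ofReal r * ∑ i ∈ s, a i * (∑ j ∈ s with i ≤ j, a j) ^ (r - 1) := by
  induction s using Finset.induction_on_min with
  | empty => simp [show 0 < r by linarith]
  | insert m s hm ih =>
    have hms : m ∉ s := fun h => lt_irrefl _ (hm m h)
    rw [Finset.sum_insert hms, Finset.sum_insert hms, mul_add, add_comm (a m)]
    refine (ennreal_add_rpow_le _ (a m) hr).trans ?_
    rw [add_comm]
    refine add_le_add (le_of_eq ?_) (ih.trans (le_of_eq ?_))
    · rw [Finset.filter_true_of_mem, Finset.sum_insert hms, add_comm (a m)]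
      intro j hj
      rcases Finset.mem_insert.1 hj with rfl | hj
      · exact le_rfl
      · exact (hm j hj).le
    · congr 1
      refine Finset.sum_congr rfl fun i hi => ?_
      rw [Finset.filter_insert, if_neg (not_le.2 (hm i hi))]

/-- One step of the estimate of `lintegral_sum_winAvg_rpow_le`: the mean values at a coarser
scale do not change much within a window, so they may be moved to the other side of the window. -/
theorem lintegral_sum_winAvg_rpow_step {l : ℤ → ℝ} (hl : ∀ i, 0 < l i) (hmono : Monotone l)
    (s : Finset ℤ) {ψ : ℤ → ℝ → ℝ≥0∞} (hψ : ∀ i, Measurable (ψ i)) {r : ℝ} (hr : 1 ≤ r) :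
    ∫⁻ t, (∑ i ∈ s, winAvg (l i) (ψ i) t) ^ r ≤ ENNReal.ofReal r * 2 ^ r *
      ∫⁻ t, (∑ i ∈ s, ψ i t) * (∑ i ∈ s, winAvg (2 * l i) (ψ i) t) ^ (r - 1) := by
  have hr1 : 0 ≤ r - 1 := by linarith
  have hm : ∀ i, Measurable (winAvg (l i) (ψ i)) := fun i => measurable_winAvg (hψ i)
  have hm2 : Measurable fun t => (∑ i ∈ s, winAvg (2 * l i) (ψ i) t) ^ (r - 1) :=
    (Finset.measurable_fun_sum s fun i _ => measurable_winAvg (hψ i)).pow_const _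
  have hmt : ∀ i, Measurable fun t => (∑ j ∈ s with i ≤ j, winAvg (l j) (ψ j) t) ^ (r - 1) :=
    fun i => (Finset.measurable_fun_sum _ fun j _ => hm j).pow_const _
  have h2 : (2 : ℝ≥0∞) * 2 ^ (r - 1) = 2 ^ r := by
    conv_lhs => rw [← ENNReal.rpow_one 2, ← ENNReal.rpow_mul, one_mul]
    rw [← ENNReal.rpow_add _ _ two_ne_zero ENNReal.ofNat_ne_top]
    ring_nf
  calc ∫⁻ t, (∑ i ∈ s, winAvg (l i) (ψ i) t) ^ r
      ≤ ∫⁻ t, ENNReal.ofReal r * ∑ i ∈ s, winAvg (l i) (ψ i) t *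
          (∑ j ∈ s with i ≤ j, winAvg (l j) (ψ j) t) ^ (r - 1) :=
        lintegral_mono fun t => sum_rpow_le_sum_mul_tail (fun i => winAvg (l i) (ψ i) t) s hr
    _ = ENNReal.ofReal r * ∑ i ∈ s, ∫⁻ t, ψ i t *
          winAvg (l i) (fun t => (∑ j ∈ s with i ≤ j, winAvg (l j) (ψ j) t) ^ (r - 1)) t := by
        rw [lintegral_const_mul, lintegral_finsetSum]
        · congr 1
          exact Finset.sum_congr rfl fun i _ => lintegral_winAvg_mul (hψ i) (hmt i)
        · exact fun i _ => (hm i).mul (hmt i)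
        · exact Finset.measurable_fun_sum s fun i _ => (hm i).mul (hmt i)
    _ ≤ ENNReal.ofReal r * ∑ i ∈ s, ∫⁻ t, ψ i t *
          (2 * (2 * ∑ i ∈ s, winAvg (2 * l i) (ψ i) t) ^ (r - 1)) := by
        gcongr with i hi t
        refine winAvg_le_of_forall_le (hl i) fun u hu => ENNReal.rpow_le_rpow ?_ hr1
        calc ∑ j ∈ s with i ≤ j, winAvg (l j) (ψ j) u
            ≤ ∑ j ∈ s with i ≤ j, 2 * winAvg (2 * l j) (ψ j) t :=
              Finset.sum_le_sum fun j hj => winAvg_le_of_near (hl j)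
                (hu.trans (hmono (Finset.mem_filter.1 hj).2))
          _ ≤ ∑ j ∈ s, 2 * winAvg (2 * l j) (ψ j) t :=
              Finset.sum_le_sum_of_subset (Finset.filter_subset _ _)
          _ = _ := by rw [Finset.mul_sum]
    _ = _ := by
        rw [← lintegral_finsetSum, mul_assoc]
        · congr 1
          rw [← lintegral_const_mul]
          · refine lintegral_congr fun t => ?_
            rw [← Finset.sum_mul, ENNReal.mul_rpow_of_nonneg _ _ hr1, ← mul_assoc 2, h2]
            ring
          · exact (Finset.measurable_fun_sum s fun i _ => hψ i).mul hm2
        · refine fun i _ => (hψ i).mul (Measurable.const_mul (Measurable.pow_const ?_ _) _)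
          exact Measurable.const_mul (Finset.measurable_fun_sum s fun i _ =>
            measurable_winAvg (hψ i)) _

theorem lintegral_mul_rpow_le {F G : ℝ → ℝ≥0∞} (hF : Measurable F) (hG : Measurable G) {r : ℝ}
    (hr : 1 ≤ r) : ∫⁻ t, F t * G t ^ (r - 1) ≤
      (∫⁻ t, F t ^ r) ^ (1 / r) * (∫⁻ t, G t ^ r) ^ (1 - 1 / r) := by
  rcases eq_or_lt_of_le hr with rfl | hr1
  · simp
  have hr0 : r ≠ 0 := by linarith
  have hr2 : r - 1 ≠ 0 := by linarith
  have h1 := ENNReal.lintegral_mul_le_Lp_mul_Lq volume (Real.HolderConjugate.conjExponent hr1)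
    hF.aemeasurable (hG.pow_const (r - 1)).aemeasurable
  simp only [Pi.mul_apply, ← ENNReal.rpow_mul, Real.conjExponent] at h1
  rwa [show (r - 1) * (r / (r - 1)) = r by field_simp,
    show 1 / (r / (r - 1)) = 1 - 1 / r by field_simp] at h1

/-- If `L ≤ c S^{1/r} L^{1 - 1/r}` and `L` is finite, then `L ≤ c^r S`. -/
theorem le_rpow_mul_of_le {L S c : ℝ≥0∞} (hL : L ≠ ∞) {r : ℝ} (hr : 1 ≤ r)
    (h : L ≤ c * (S ^ (1 / r) * L ^ (1 - 1 / r))) : L ≤ c ^ r * S := by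
  have hr0 : 0 < r := by linarith
  rcases eq_or_ne L 0 with rfl | hL0
  · exact zero_le
  have h1 : L ^ (1 - 1 / r) ≠ 0 := by
    simp [ENNReal.rpow_eq_zero_iff, hL0, hL]
  have h2 : L ^ (1 - 1 / r) ≠ ∞ := ENNReal.rpow_ne_top_of_nonneg (by
    rw [sub_nonneg, div_le_one hr0]; exact hr) hL
  have h3 : L = L ^ (1 / r) * L ^ (1 - 1 / r) := by
    rw [← ENNReal.rpow_add _ _ hL0 hL, add_sub_cancel, ENNReal.rpow_one]
  rw [← mul_assoc] at h
  conv_lhs at h => rw [h3]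
  rw [ENNReal.mul_le_mul_iff_left h1 h2] at h
  have h4 := ENNReal.rpow_le_rpow h hr0.le
  rwa [← ENNReal.rpow_mul, ENNReal.mul_rpow_of_nonneg _ _ hr0.le, ← ENNReal.rpow_mul,
    one_div_mul_cancel hr0.ne', ENNReal.rpow_one, ENNReal.rpow_one] at h4

/-- Window averages at increasing scales are bounded in `L^r(ℓ^1)`, `1 ≤ r < ∞`. The supremum
over all dilations of the scales is finite and satisfies a self-improving inequality. -/
theorem lintegral_sum_winAvg_rpow_le {l : ℤ → ℝ} (hl : ∀ i, 0 < l i) (hmono : Monotone l)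
    (s : Finset ℤ) {ψ : ℤ → ℝ → ℝ≥0∞} (hψ : ∀ i, Measurable (ψ i)) {r : ℝ} (hr : 1 ≤ r) :
    ∫⁻ t, (∑ i ∈ s, winAvg (l i) (ψ i) t) ^ r ≤
      (ENNReal.ofReal r * 2 ^ r) ^ r * ∫⁻ t, (∑ i ∈ s, ψ i t) ^ r := by
  have hr0 : 0 < r := by linarith
  set S := ∫⁻ t, (∑ i ∈ s, ψ i t) ^ r with hS
  rcases eq_or_ne S ∞ with hS1 | hS1
  · rw [hS1, ENNReal.mul_top]
    · exact le_top
    · rw [← pos_iff_ne_zero]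
      exact ENNReal.rpow_pos (ENNReal.mul_pos (by simpa using hr0)
        (ENNReal.rpow_pos two_pos ENNReal.ofNat_ne_top).ne') (by finiteness)
  -- `J k` is the left-hand side for the dilated scales `2^k l`. The step estimate bounds `J k`
  -- through `J (k + 1)`, so that the supremum, finite by `hJ`, satisfies an inequality with itself.
  let J : ℕ → ℝ≥0∞ := fun k => ∫⁻ t, (∑ i ∈ s, winAvg (2 ^ k * l i) (ψ i) t) ^ r
  have hk : ∀ (k : ℕ) i, 0 < 2 ^ k * l i := fun k i => mul_pos (by positivity) (hl i)
  have hJ : ∀ k, J k ≤ (s.card : ℝ≥0∞) ^ (r - 1) * ∑ i ∈ s, 2 ^ r * S := by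
    intro k
    calc J k ≤ ∫⁻ t, (s.card : ℝ≥0∞) ^ (r - 1) * ∑ i ∈ s, winAvg (2 ^ k * l i) (ψ i) t ^ r :=
          lintegral_mono fun t => ENNReal.rpow_sum_le_const_mul_sum_rpow s _ hr
      _ = (s.card : ℝ≥0∞) ^ (r - 1) * ∑ i ∈ s, ∫⁻ t, winAvg (2 ^ k * l i) (ψ i) t ^ r := by
          rw [lintegral_const_mul, lintegral_finsetSum]
          · exact fun i _ => (measurable_winAvg (hψ i)).pow_const _
          · exact Finset.measurable_fun_sum s fun i _ => (measurable_winAvg (hψ i)).pow_const _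
      _ ≤ _ := by
          gcongr with i hi
          refine (lintegral_winAvg_rpow_le (hk k i) (hψ i) hr).trans ?_
          refine mul_le_mul_right (lintegral_mono fun t => ENNReal.rpow_le_rpow ?_ hr0.le) _
          exact Finset.single_le_sum (f := fun i => ψ i t) (fun _ _ => zero_le) hi
  have hfin : ⨆ k, J k ≠ ∞ := ne_top_of_le_ne_top (ENNReal.mul_ne_top
    (ENNReal.rpow_ne_top_of_nonneg (by linarith) (by simp))
    (ENNReal.sum_ne_top.2 fun i _ => ENNReal.mul_ne_top (by finiteness) hS1)) (iSup_le hJ)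
  have hstep : ⨆ k, J k ≤ (ENNReal.ofReal r * 2 ^ r) *
      (S ^ (1 / r) * (⨆ k, J k) ^ (1 - 1 / r)) := by
    refine iSup_le fun k => ?_
    refine (lintegral_sum_winAvg_rpow_step (hk k)
      (fun i j hij => mul_le_mul_of_nonneg_left (hmono hij) (by positivity)) s hψ hr).trans ?_
    gcongr
    refine (lintegral_mul_rpow_le (Finset.measurable_fun_sum s fun i _ => hψ i)
      (Finset.measurable_fun_sum s fun i _ => measurable_winAvg (hψ i)) hr).trans ?_
    have h1 : 0 ≤ 1 - 1 / r := by rw [sub_nonneg, div_le_one hr0]; exact hr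
    gcongr
    refine le_trans (le_of_eq ?_) (le_iSup J (k + 1))
    refine lintegral_congr fun t => ?_
    simp only [pow_succ', mul_assoc]
  refine le_trans ?_ (le_rpow_mul_of_le hfin hr hstep)
  refine le_trans (le_of_eq ?_) (le_iSup J 0)
  simp only [J, pow_zero, one_mul]

end Averages

section MixedNorm

open Filter Topology

variable {l : ℤ → ℝ} {φ : ℤ → ℝ → ℝ≥0∞}

theorem lintegral_sum_winAvg_rpow_le_of_le {p q : ℝ} (hq : 1 ≤ q) (hqp : q ≤ p)
    (hl : ∀ i, 0 < l i) (hmono : Monotone l) (s : Finset ℤ) (hφ : ∀ i, Measurable (φ i)) :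
    ∫⁻ t, (∑ i ∈ s, winAvg (l i) (φ i) t ^ q) ^ (p / q) ≤
      ((2 ^ (q - 1)) ^ (p / q) * (ENNReal.ofReal (p / q) * 2 ^ (p / q)) ^ (p / q)) *
        ∫⁻ t, (∑ i ∈ s, φ i t ^ q) ^ (p / q) := by
  have hq0 : 0 < q := by linarith
  have hr : 1 ≤ p / q := by rwa [one_le_div hq0]
  have hm : ∀ i, Measurable fun t => φ i t ^ q := fun i => (hφ i).pow_const q
  calc ∫⁻ t, (∑ i ∈ s, winAvg (l i) (φ i) t ^ q) ^ (p / q)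
      ≤ ∫⁻ t, (∑ i ∈ s, 2 ^ (q - 1) * winAvg (l i) (fun t => φ i t ^ q) t) ^ (p / q) := by
        gcongr with t i hi
        exact winAvg_rpow_le (hl i) (hφ i) hq t
    _ = (2 ^ (q - 1)) ^ (p / q) *
          ∫⁻ t, (∑ i ∈ s, winAvg (l i) (fun t => φ i t ^ q) t) ^ (p / q) := by
        rw [← lintegral_const_mul]
        · refine lintegral_congr fun t => ?_
          rw [← Finset.mul_sum, ENNReal.mul_rpow_of_nonneg _ _ (by linarith)]
        · exact (Finset.measurable_fun_sum s fun i _ => measurable_winAvg (hm i)).pow_const _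
    _ ≤ _ := by
        rw [mul_assoc]
        gcongr
        exact lintegral_sum_winAvg_rpow_le hl hmono s hm hr

/-- A mixed-norm Hölder inequality. -/
theorem lintegral_sum_mul_le {p q p' q' : ℝ} (hp : p.HolderConjugate p')
    (hq : q.HolderConjugate q') (s : Finset ℤ) {ψ : ℤ → ℝ → ℝ≥0∞} (hφ : ∀ i, Measurable (φ i))
    (hψ : ∀ i, Measurable (ψ i)) : ∫⁻ t, ∑ i ∈ s, φ i t * ψ i t ≤
      (∫⁻ t, (∑ i ∈ s, φ i t ^ q) ^ (p / q)) ^ (1 / p) *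
        (∫⁻ t, (∑ i ∈ s, ψ i t ^ q') ^ (p' / q')) ^ (1 / p') := by
  refine (lintegral_mono fun t => ENNReal.inner_le_Lp_mul_Lq s (fun i => φ i t) (fun i => ψ i t)
    hq).trans ?_
  have h := ENNReal.lintegral_mul_le_Lp_mul_Lq volume hp
    (f := fun t => (∑ i ∈ s, φ i t ^ q) ^ (1 / q)) (g := fun t => (∑ i ∈ s, ψ i t ^ q') ^ (1 / q'))
    ((Finset.measurable_fun_sum s fun i _ => (hφ i).pow_const q).pow_const _).aemeasurable
    ((Finset.measurable_fun_sum s fun i _ => (hψ i).pow_const q').pow_const _).aemeasurable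
  simpa only [Pi.mul_apply, ← ENNReal.rpow_mul, one_div_mul_eq_div] using h

theorem lintegral_sum_winAvg_rpow_ne_top {p q : ℝ} (hp : 1 ≤ p) (hq : 1 ≤ q)
    (hl : ∀ i, 0 < l i) (hmono : Monotone l) (s : Finset ℤ) (hφ : ∀ i, Measurable (φ i))
    (hfin : ∫⁻ t, (∑ i ∈ s, φ i t ^ q) ^ (p / q) ≠ ∞) :
    ∫⁻ t, (∑ i ∈ s, winAvg (l i) (φ i) t ^ q) ^ (p / q) ≠ ∞ := by
  have hp0 : 0 < p := by linarith
  have hq0 : 0 < q := by linarith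
  have key : ∀ a : ℤ → ℝ≥0∞, (∑ i ∈ s, a i ^ q) ^ (p / q) ≤
      (s.card : ℝ≥0∞) ^ (p / q) * (∑ i ∈ s, a i) ^ p := by
    intro a
    calc (∑ i ∈ s, a i ^ q) ^ (p / q) ≤ (∑ i ∈ s, (∑ j ∈ s, a j) ^ q) ^ (p / q) := by
          gcongr with i hi
          exact Finset.single_le_sum (f := a) (fun _ _ => zero_le) hi
      _ = _ := by
          rw [Finset.sum_const, nsmul_eq_mul, ENNReal.mul_rpow_of_nonneg _ _ (by positivity),
            ← ENNReal.rpow_mul, mul_div_cancel₀ _ hq0.ne']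
  have key' : ∀ a : ℤ → ℝ≥0∞, (∑ i ∈ s, a i) ^ p ≤
      (s.card : ℝ≥0∞) ^ p * (∑ i ∈ s, a i ^ q) ^ (p / q) := by
    intro a
    calc (∑ i ∈ s, a i) ^ p ≤ (∑ i ∈ s, (∑ j ∈ s, a j ^ q) ^ (1 / q)) ^ p := by
          gcongr with i hi
          rw [one_div, ENNReal.le_rpow_inv_iff hq0]
          exact Finset.single_le_sum (f := fun i => a i ^ q) (fun _ _ => zero_le) hi
      _ = _ := by
          rw [Finset.sum_const, nsmul_eq_mul, ENNReal.mul_rpow_of_nonneg _ _ hp0.le,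
            ← ENNReal.rpow_mul, one_div_mul_eq_div]
  refine ne_top_of_le_ne_top ?_ (lintegral_mono fun t => key _)
  have hm : Measurable fun t => (∑ i ∈ s, winAvg (l i) (φ i) t) ^ p :=
    (Finset.measurable_fun_sum s fun i _ => measurable_winAvg (hφ i)).pow_const _
  rw [lintegral_const_mul _ hm]
  refine ENNReal.mul_ne_top (ENNReal.rpow_ne_top_of_nonneg (by positivity) (by simp)) ?_
  refine ne_top_of_le_ne_top (ENNReal.mul_ne_top (by finiteness) ?_)
    (lintegral_sum_winAvg_rpow_le hl hmono s hφ hp)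
  refine ne_top_of_le_ne_top ?_ (lintegral_mono fun t => key' _)
  rw [lintegral_const_mul _ ((Finset.measurable_fun_sum s fun i _ => (hφ i).pow_const q).pow_const _)]
  exact ENNReal.mul_ne_top (by finiteness) hfin

/-- Window averages at increasing scales are bounded in `L^p(ℓ^q)`, `1 < p, q < ∞`. For `q ≤ p`
this reduces to `L^{p/q}(ℓ^1)`; the case `p < q` follows by duality. -/
theorem exists_sum_winAvg_bound {p q : ℝ} (hp : 1 < p) (hq : 1 < q) :
    ∃ κ : ℝ≥0∞, κ ≠ ∞ ∧ ∀ (l : ℤ → ℝ), (∀ i, 0 < l i) → Monotone l → ∀ (s : Finset ℤ)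
      (φ : ℤ → ℝ → ℝ≥0∞), (∀ i, Measurable (φ i)) →
        ∫⁻ t, (∑ i ∈ s, winAvg (l i) (φ i) t ^ q) ^ (p / q) ≤
          κ * ∫⁻ t, (∑ i ∈ s, φ i t ^ q) ^ (p / q) := by
  have hp0 : 0 < p := by linarith
  have hq0 : 0 < q := by linarith
  rcases le_or_gt q p with hqp | hpq
  · refine ⟨_, ?_, fun l hl hmono s φ hφ =>
      lintegral_sum_winAvg_rpow_le_of_le hq.le hqp hl hmono s hφ⟩
    have : 0 < p / q := by positivity
    finiteness
  have hcp := Real.HolderConjugate.conjExponent hp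
  have hcq := Real.HolderConjugate.conjExponent hq
  set p' := Real.conjExponent p with hp'
  set q' := Real.conjExponent q with hq'
  have hqp' : q' ≤ p' := by
    rw [hq', hp', Real.conjExponent, Real.conjExponent, div_le_div_iff₀ (by linarith) (by linarith)]
    nlinarith
  have hp'0 : 0 < p' := hcp.symm.pos
  have hq'0 : 0 < q' := hcq.symm.pos
  set κ : ℝ≥0∞ := (2 ^ (q' - 1)) ^ (p' / q') * (ENNReal.ofReal (p' / q') * 2 ^ (p' / q')) ^ (p' / q')
    with hκ
  have hκt : κ ≠ ∞ := by
    have : 0 < p' / q' := by positivity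
    finiteness
  refine ⟨(κ ^ (1 / p')) ^ p + 1, by finiteness, fun l hl hmono s φ hφ => ?_⟩
  set S := ∫⁻ t, (∑ i ∈ s, φ i t ^ q) ^ (p / q) with hS
  rcases eq_or_ne S ∞ with hSt | hSt
  · rw [hSt, ENNReal.mul_top (by simp)]
    exact le_top
  set w : ℤ → ℝ → ℝ≥0∞ := fun i => winAvg (l i) (φ i) with hw
  have hwm : ∀ i, Measurable (w i) := fun i => measurable_winAvg (hφ i)
  set F : ℝ → ℝ≥0∞ := fun t => ∑ i ∈ s, w i t ^ q with hF
  have hFm : Measurable F := Finset.measurable_fun_sum s fun i _ => (hwm i).pow_const q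
  set J := ∫⁻ t, F t ^ (p / q) with hJ
  have hJt : J ≠ ∞ := lintegral_sum_winAvg_rpow_ne_top hp.le hq.le hl hmono s hφ hSt
  have hFt : ∀ᵐ t, F t ≠ ∞ := by
    filter_upwards [ae_lt_top (hFm.pow_const (p / q)) hJt] with t ht h
    rw [h, ENNReal.top_rpow_of_pos (by positivity)] at ht
    exact lt_irrefl _ ht
  -- The function dual to the averages: `∑ w g = F^{p/q}`, and `g` has norm `J^{1/p'}` in
  -- `L^{p'}(ℓ^{q'})`.
  set g : ℤ → ℝ → ℝ≥0∞ := fun i t => w i t ^ (q - 1) * F t ^ (p / q - 1) with hg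
  have hgm : ∀ i, Measurable (g i) := fun i => ((hwm i).pow_const _).mul (hFm.pow_const _)
  have h1 : J ≤ ∫⁻ t, ∑ i ∈ s, w i t * g i t := by
    refine lintegral_mono_ae ?_
    filter_upwards [hFt] with t ht
    rcases eq_or_ne (F t) 0 with h0 | h0
    · rw [h0, ENNReal.zero_rpow_of_pos (by positivity)]
      exact zero_le
    have e1 : ∀ i, w i t * g i t = w i t ^ q * F t ^ (p / q - 1) := fun i => by
      rw [hg, ← mul_assoc]
      congr 1
      conv_rhs => rw [← add_sub_cancel 1 q]
      rw [ENNReal.rpow_add_of_nonneg _ _ zero_le_one (by linarith), ENNReal.rpow_one]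
    simp only [e1, ← Finset.sum_mul]
    refine le_of_eq ?_
    change _ = F t * F t ^ (p / q - 1)
    conv_rhs => rw [← ENNReal.rpow_one (F t), ← ENNReal.rpow_mul, one_mul]
    rw [← ENNReal.rpow_add _ _ h0 ht]
    ring_nf
  have h2 : ∫⁻ t, (∑ i ∈ s, g i t ^ q') ^ (p' / q') ≤ J := by
    refine lintegral_mono_ae ?_
    filter_upwards [hFt] with t ht
    have hqq : (q - 1) * q' = q := by
      rw [hq', Real.conjExponent]
      field_simp [(by linarith : q - 1 ≠ 0)]
    have e2 : ∑ i ∈ s, g i t ^ q' = F t * F t ^ ((p / q - 1) * q') := by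
      rw [hF, Finset.sum_mul]
      refine Finset.sum_congr rfl fun i hi => ?_
      rw [hg, ENNReal.mul_rpow_of_nonneg _ _ hq'0.le, ← ENNReal.rpow_mul, ← ENNReal.rpow_mul, hqq]
    rw [e2]
    rcases eq_or_ne (F t) 0 with h0 | h0
    · rw [h0, zero_mul, ENNReal.zero_rpow_of_pos (by positivity)]
      exact zero_le
    refine le_of_eq ?_
    conv_lhs => rw [← ENNReal.rpow_one (F t), ← ENNReal.rpow_mul, one_mul]
    rw [← ENNReal.rpow_add _ _ h0 ht, ← ENNReal.rpow_mul]
    congr 1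
    have h3 : p - 1 ≠ 0 := by linarith
    have h4 : q - 1 ≠ 0 := by linarith
    rw [hq', hp', Real.conjExponent, Real.conjExponent]
    field_simp
    ring
  have h3 : J ≤ κ ^ (1 / p') * (S ^ (1 / p) * J ^ (1 - 1 / p)) := by
    calc J ≤ ∫⁻ t, ∑ i ∈ s, w i t * g i t := h1
      _ = ∫⁻ t, ∑ i ∈ s, φ i t * winAvg (l i) (g i) t := by
          rw [lintegral_finsetSum (f := fun i t => w i t * g i t) s fun i _ => (hwm i).mul (hgm i),
            lintegral_finsetSum (f := fun i t => φ i t * winAvg (l i) (g i) t) s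
              fun i _ => (hφ i).mul (measurable_winAvg (hgm i))]
          exact Finset.sum_congr rfl fun i _ => lintegral_winAvg_mul (hφ i) (hgm i)
      _ ≤ S ^ (1 / p) *
          (∫⁻ t, (∑ i ∈ s, winAvg (l i) (g i) t ^ q') ^ (p' / q')) ^ (1 / p') :=
          lintegral_sum_mul_le hcp hcq s hφ fun i => measurable_winAvg (hgm i)
      _ ≤ S ^ (1 / p) * (κ * J) ^ (1 / p') := by
          gcongr
          refine (lintegral_sum_winAvg_rpow_le_of_le hcq.symm.lt.le hqp' hl hmono s hgm).trans ?_
          gcongr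
      _ = _ := by
          have h4 : 1 / p' = 1 - 1 / p := by
            rw [one_div, one_div, eq_sub_iff_add_eq']
            exact hcp.inv_add_inv_eq_one
          rw [ENNReal.mul_rpow_of_nonneg _ _ (by positivity), h4]
          ring
  refine (le_rpow_mul_of_le hJt hp.le h3).trans ?_
  gcongr
  exact le_self_add

theorem tsum_rpow_eq_iSup (a : ℤ → ℝ≥0∞) {r : ℝ} (hr : 0 < r) :
    (∑' i, a i) ^ r = ⨆ n : ℕ, (∑ i ∈ Finset.Icc (-(n : ℤ)) n, a i) ^ r := by
  rw [ENNReal.tsum_eq_iSup_sum' (fun n : ℕ => Finset.Icc (-(n : ℤ)) n) fun t => ?_]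
  · exact (ENNReal.orderIsoRpow r hr).map_iSup _
  · obtain ⟨N, hN⟩ := (t.image Int.natAbs).exists_le
    refine ⟨N, fun i hi => ?_⟩
    have := hN _ (Finset.mem_image_of_mem _ hi)
    rw [Finset.mem_Icc]
    omega

/-- The window averages over `|u - t| ≤ 2^i` are bounded in `L^p(ℓ^q(ℤ))`. -/
theorem exists_tsum_winAvg_bound {p q : ℝ} (hp : 1 < p) (hq : 1 < q) :
    ∃ κ : ℝ≥0∞, κ ≠ ∞ ∧ ∀ φ : ℤ → ℝ → ℝ≥0∞, (∀ i, Measurable (φ i)) →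
      ∫⁻ t, (∑' i, winAvg (2 ^ i) (φ i) t ^ q) ^ (p / q) ≤
        κ * ∫⁻ t, (∑' i, φ i t ^ q) ^ (p / q) := by
  obtain ⟨κ, hκ, h⟩ := exists_sum_winAvg_bound hp hq
  have hr : 0 < p / q := div_pos (by linarith) (by linarith)
  refine ⟨κ, hκ, fun φ hφ => ?_⟩
  simp only [tsum_rpow_eq_iSup _ hr]
  rw [lintegral_iSup]
  · refine iSup_le fun n => (h (fun i => 2 ^ i) (fun i => by positivity)
      (zpow_right_mono₀ one_le_two) _ φ hφ).trans ?_
    gcongr with t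
    exact le_iSup (fun n : ℕ => (∑ i ∈ Finset.Icc (-(n : ℤ)) n, φ i t ^ q) ^ (p / q)) n
  · exact fun n => (Finset.measurable_fun_sum _ fun i _ =>
      (measurable_winAvg (hφ i)).pow_const q).pow_const _
  · intro m n hmn t
    refine ENNReal.rpow_le_rpow (Finset.sum_le_sum_of_subset (Finset.Icc_subset_Icc ?_ ?_)) hr.le
    · exact neg_le_neg (by exact_mod_cast hmn)
    · exact_mod_cast hmn

end MixedNorm

/-! ### Real interpolation spaces -/

section RealSpaces

open Filter Topology

theorem iUnion_Ico_two_zpow : ⋃ j : ℤ, Ico ((2 : ℝ) ^ j) (2 ^ (j + 1)) = Ioi 0 := by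
  ext t
  simp only [mem_iUnion, mem_Ioi]
  exact ⟨fun ⟨j, hj⟩ => (by positivity : (0 : ℝ) < 2 ^ j).trans_le hj.1,
    fun ht => exists_mem_Ico_zpow ht one_lt_two⟩

theorem lintegral_haarMeasure (f : ℝ → ℝ≥0∞) : ∫⁻ t, f t ∂BanachCouple.haarMeasure =
    ∑' j : ℤ, ∫⁻ t in Ico ((2 : ℝ) ^ j) (2 ^ (j + 1)), f t ∂BanachCouple.haarMeasure := by
  rw [← lintegral_iUnion (fun j => measurableSet_Ico), iUnion_Ico_two_zpow]
  · congr 1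
    rw [BanachCouple.haarMeasure, restrict_withDensity measurableSet_Ioi,
      Measure.restrict_restrict measurableSet_Ioi, inter_self]
  · exact (zpow_right_mono₀ (one_le_two (α := ℝ))).pairwise_disjoint_on_Ico_succ

theorem haarMeasure_Ico_le (j : ℤ) :
    BanachCouple.haarMeasure (Ico ((2 : ℝ) ^ j) (2 ^ (j + 1))) ≤ 1 := by
  have h2 : (0 : ℝ) < 2 ^ j := by positivity
  rw [BanachCouple.haarMeasure, withDensity_apply _ measurableSet_Ico]
  calc ∫⁻ t in Ico ((2 : ℝ) ^ j) (2 ^ (j + 1)), ENNReal.ofReal t⁻¹ ∂volume.restrict (Ioi 0)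
      ≤ ∫⁻ t in Ico ((2 : ℝ) ^ j) (2 ^ (j + 1)), ENNReal.ofReal t⁻¹ :=
        lintegral_mono' (Measure.restrict_mono_measure Measure.restrict_le_self _) le_rfl
    _ ≤ ∫⁻ t in Ico ((2 : ℝ) ^ j) (2 ^ (j + 1)), ENNReal.ofReal (2 ^ j)⁻¹ :=
        setLIntegral_mono' measurableSet_Ico fun t ht =>
          ENNReal.ofReal_le_ofReal (inv_anti₀ h2 ht.1)
    _ = 1 := by
        rw [setLIntegral_const, Real.volume_Ico, ← ENNReal.ofReal_mul (by positivity),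
          zpow_add_one₀ two_ne_zero, show ((2 : ℝ) ^ j)⁻¹ * (2 ^ j * 2 - 2 ^ j) = 1 by
            field_simp; norm_num, ENNReal.ofReal_one]

theorem one_le_haarMeasure_Ico (j : ℤ) :
    1 ≤ 2 * BanachCouple.haarMeasure (Ico ((2 : ℝ) ^ j) (2 ^ (j + 1))) := by
  have h2 : (0 : ℝ) < 2 ^ j := by positivity
  rw [BanachCouple.haarMeasure, withDensity_apply _ measurableSet_Ico,
    Measure.restrict_restrict measurableSet_Ico,
    inter_eq_left.2 fun t ht => mem_Ioi.2 (h2.trans_le ht.1)]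
  calc (1 : ℝ≥0∞) = 2 * ∫⁻ t in Ico ((2 : ℝ) ^ j) (2 ^ (j + 1)), ENNReal.ofReal (2 ^ (j + 1))⁻¹ := by
        rw [setLIntegral_const, Real.volume_Ico, ← ENNReal.ofReal_mul (by positivity),
          zpow_add_one₀ two_ne_zero, show ((2 : ℝ) ^ j * 2)⁻¹ * (2 ^ j * 2 - 2 ^ j) = 2⁻¹ by
            field_simp; norm_num, ENNReal.ofReal_inv_of_pos two_pos, ENNReal.ofReal_ofNat,
          ENNReal.mul_inv_cancel two_ne_zero ENNReal.ofNat_ne_top]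
    _ ≤ _ := by
        gcongr 2 * ?_
        exact setLIntegral_mono' measurableSet_Ico fun t ht =>
          ENNReal.ofReal_le_ofReal (inv_anti₀ (h2.trans_le ht.1) ht.2.le)

theorem lintegral_haarMeasure_le {f : ℝ → ℝ≥0∞} {a : ℤ → ℝ≥0∞}
    (h : ∀ j : ℤ, ∀ t ∈ Ico ((2 : ℝ) ^ j) (2 ^ (j + 1)), f t ≤ a j) :
    ∫⁻ t, f t ∂BanachCouple.haarMeasure ≤ ∑' j, a j := by
  rw [lintegral_haarMeasure]
  refine ENNReal.tsum_le_tsum fun j => ?_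
  refine (setLIntegral_mono' measurableSet_Ico (h j)).trans ?_
  rw [setLIntegral_const]
  exact mul_le_of_le_one_right' (haarMeasure_Ico_le j)

theorem tsum_le_lintegral_haarMeasure {f : ℝ → ℝ≥0∞} {a : ℤ → ℝ≥0∞}
    (h : ∀ j : ℤ, ∀ t ∈ Ico ((2 : ℝ) ^ j) (2 ^ (j + 1)), a j ≤ f t) :
    ∑' j, a j ≤ 2 * ∫⁻ t, f t ∂BanachCouple.haarMeasure := by
  rw [lintegral_haarMeasure, ← ENNReal.tsum_mul_left]
  refine ENNReal.tsum_le_tsum fun j => ?_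
  calc a j = a j * 1 := (mul_one _).symm
    _ ≤ a j * (2 * BanachCouple.haarMeasure (Ico ((2 : ℝ) ^ j) (2 ^ (j + 1)))) := by
        gcongr
        exact one_le_haarMeasure_Ico j
    _ = 2 * ∫⁻ _ in Ico ((2 : ℝ) ^ j) (2 ^ (j + 1)), a j ∂BanachCouple.haarMeasure := by
        rw [setLIntegral_const]; ring
    _ ≤ _ := by
        gcongr 2 * ?_
        exact setLIntegral_mono' measurableSet_Ico (h j)

/-- The weight `2^{-θ j}`. -/
def dyWeight (θ : ℝ) (j : ℤ) : ℝ≥0∞ := ENNReal.ofReal ((2 : ℝ) ^ (-(θ * j)))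

theorem dyWeight_add (θ : ℝ) (i j : ℤ) : dyWeight θ (i + j) = dyWeight θ i * dyWeight θ j := by
  rw [dyWeight, dyWeight, dyWeight, ← ENNReal.ofReal_mul (by positivity),
    ← Real.rpow_add two_pos]
  congr 2
  push_cast
  ring

theorem dyWeight_ne_top (θ : ℝ) (j : ℤ) : dyWeight θ j ≠ ∞ := ENNReal.ofReal_ne_top

theorem dyWeight_zero (θ : ℝ) : dyWeight θ 0 = 1 := by simp [dyWeight]

theorem dyWeight_le_two_mul {θ : ℝ} (hθ : θ ≤ 1) (j : ℤ) :
    dyWeight θ j ≤ 2 * dyWeight θ (j + 1) := by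
  rw [dyWeight, dyWeight, show (2 : ℝ≥0∞) = ENNReal.ofReal 2 by simp,
    ← ENNReal.ofReal_mul zero_le_two]
  refine ENNReal.ofReal_le_ofReal ?_
  conv_rhs => rw [← Real.rpow_one 2, ← Real.rpow_mul zero_le_two, one_mul]
  rw [← Real.rpow_add two_pos]
  refine Real.rpow_le_rpow_of_exponent_le one_le_two ?_
  push_cast
  linarith

theorem rpow_neg_le_dyWeight {θ : ℝ} (hθ : 0 ≤ θ) {j : ℤ} {t : ℝ}
    (ht : t ∈ Ico ((2 : ℝ) ^ j) (2 ^ (j + 1))) : ENNReal.ofReal (t ^ (-θ)) ≤ dyWeight θ j := by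
  refine ENNReal.ofReal_le_ofReal ?_
  rw [show -(θ * j) = j * (-θ) by ring, Real.rpow_mul zero_le_two, Real.rpow_intCast]
  exact Real.rpow_le_rpow_of_nonpos (by positivity) ht.1 (by linarith)

theorem dyWeight_le_rpow_neg {θ : ℝ} (hθ : 0 ≤ θ) {j : ℤ} {t : ℝ}
    (ht : t ∈ Ico ((2 : ℝ) ^ j) (2 ^ (j + 1))) : dyWeight θ (j + 1) ≤ ENNReal.ofReal (t ^ (-θ)) := by
  refine ENNReal.ofReal_le_ofReal ?_
  rw [show -(θ * (j + 1 : ℤ)) = (j + 1 : ℤ) * (-θ) by ring, Real.rpow_mul zero_le_two,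
    Real.rpow_intCast]
  exact Real.rpow_le_rpow_of_nonpos ((by positivity : (0 : ℝ) < 2 ^ j).trans_le ht.1) ht.2.le
    (by linarith)

/-- The kernel `2^{-θ j} min(1, 2^j)`. -/
def dyKernel (θ : ℝ) (j : ℤ) : ℝ≥0∞ := dyWeight θ j * min 1 (ENNReal.ofReal (2 ^ j))

theorem tsum_dyKernel_ne_top {θ : ℝ} (hθ : θ ∈ Ioo (0 : ℝ) 1) : ∑' j, dyKernel θ j ≠ ∞ := by
  have key : ∀ j, dyKernel θ j = ENNReal.ofReal ((2 : ℝ) ^ (-(θ * j)) * min 1 (2 ^ j)) := by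
    intro j
    rw [dyKernel, dyWeight, ENNReal.ofReal_mul (by positivity), ENNReal.ofReal_min,
      ENNReal.ofReal_one]
  simp only [key]
  refine Summable.tsum_ofReal_ne_top (Summable.of_nat_of_neg ?_ ?_)
  · refine Summable.of_nonneg_of_le (fun n => by positivity) (fun n => ?_)
      (summable_geometric_of_lt_one (r := (2 : ℝ) ^ (-θ)) (by positivity)
        (Real.rpow_lt_one_of_one_lt_of_neg one_lt_two (by linarith [hθ.1])))
    rw [← Real.rpow_natCast, ← Real.rpow_mul zero_le_two]
    refine (mul_le_of_le_one_right (by positivity) (min_le_left _ _)).trans (le_of_eq ?_)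
    push_cast
    ring_nf
  · refine Summable.of_nonneg_of_le (fun n => by positivity) (fun n => ?_)
      (summable_geometric_of_lt_one (r := (2 : ℝ) ^ (-(1 - θ))) (by positivity)
        (Real.rpow_lt_one_of_one_lt_of_neg one_lt_two (by linarith [hθ.2])))
    rw [← Real.rpow_natCast, ← Real.rpow_mul zero_le_two]
    refine (mul_le_mul_of_nonneg_left (min_le_right _ _) (by positivity)).trans (le_of_eq ?_)
    rw [← Real.rpow_intCast, ← Real.rpow_add two_pos]
    push_cast
    ring_nf

/-- Young's inequality for sequences. -/
theorem tsum_convolution_rpow_le (m a : ℤ → ℝ≥0∞) {q : ℝ} (hq : 1 < q) :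
    ∑' j, (∑' i, m (j - i) * a i) ^ q ≤ (∑' l, m l) ^ q * ∑' i, a i ^ q := by
  have hq0 : 0 < q := by linarith
  have hc := Real.HolderConjugate.conjExponent hq
  set B := ∑' l, m l with hB
  have hshift : ∀ j, ∑' i, m (j - i) = B := fun j => (Equiv.subLeft j).tsum_eq m
  have hshift' : ∀ i, ∑' j, m (j - i) = B := fun i => (Equiv.subRight i).tsum_eq m
  -- Hölder's inequality with the weight `m (j - i)`, whose total mass is `B`.
  have h1 : ∀ j, (∑' i, m (j - i) * a i) ^ q ≤ B ^ (q - 1) * ∑' i, m (j - i) * a i ^ q := by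
    intro j
    have h2 := ENNReal.lintegral_mul_le_Lp_mul_Lq (Measure.count : Measure ℤ) hc.symm
      (f := fun i => m (j - i) ^ (1 / Real.conjExponent q)) (g := fun i => m (j - i) ^ (1 / q) * a i)
      (measurable_of_countable _).aemeasurable (measurable_of_countable _).aemeasurable
    simp only [lintegral_count, Pi.mul_apply] at h2
    have e1 : ∀ i, m (j - i) ^ (1 / Real.conjExponent q) * (m (j - i) ^ (1 / q) * a i) =
        m (j - i) * a i := fun i => by
      rw [← mul_assoc, ← ENNReal.rpow_add_of_nonneg _ _ (one_div_nonneg.2 hc.symm.nonneg)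
        (by positivity), one_div, one_div, hc.symm.inv_add_inv_eq_one, ENNReal.rpow_one]
    have e2 : ∀ i, (m (j - i) ^ (1 / Real.conjExponent q)) ^ Real.conjExponent q = m (j - i) :=
      fun i => by rw [← ENNReal.rpow_mul, one_div_mul_cancel hc.symm.ne_zero, ENNReal.rpow_one]
    have e3 : ∀ i, (m (j - i) ^ (1 / q) * a i) ^ q = m (j - i) * a i ^ q := fun i => by
      rw [ENNReal.mul_rpow_of_nonneg _ _ hq0.le, ← ENNReal.rpow_mul, one_div_mul_cancel hq0.ne',
        ENNReal.rpow_one]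
    simp only [e1, e2, e3, hshift] at h2
    have h3 := ENNReal.rpow_le_rpow h2 hq0.le
    rwa [ENNReal.mul_rpow_of_nonneg _ _ hq0.le, ← ENNReal.rpow_mul, ← ENNReal.rpow_mul,
      one_div_mul_cancel hq0.ne', ENNReal.rpow_one, Real.conjExponent,
      show 1 / (q / (q - 1)) * q = q - 1 by field_simp] at h3
  calc ∑' j, (∑' i, m (j - i) * a i) ^ q
      ≤ ∑' j, B ^ (q - 1) * ∑' i, m (j - i) * a i ^ q := ENNReal.tsum_le_tsum h1
    _ = B ^ (q - 1) * ∑' i, ∑' j, m (j - i) * a i ^ q := by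
        rw [ENNReal.tsum_mul_left, ENNReal.tsum_comm]
    _ = B ^ (q - 1) * (B * ∑' i, a i ^ q) := by
        simp only [ENNReal.tsum_mul_right, hshift', ENNReal.tsum_mul_left]
    _ = _ := by
        rw [← mul_assoc]
        congr 1
        conv_rhs => rw [← sub_add_cancel q 1]
        rw [ENNReal.rpow_add_of_nonneg _ _ (by linarith) zero_le_one, ENNReal.rpow_one]

end RealSpaces

/-! ### The couple `(X, D_A)` and its real interpolation spaces -/

section DomainRealSpace

open Filter Topology

variable {X : Type u} [NormedAddCommGroup X] [NormedSpace ℂ X] [CompleteSpace X]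
  {A : X →ₗ.[ℂ] X} (hA : A.IsClosed)

/-- The `K`-functional of the couple `(X, D_A)`. -/
def domK (t : ℝ) (x : X) : ℝ≥0∞ := (domainCouple A hA).K t x

theorem domK_le {t : ℝ} {x : X} (y : X) (d : graphSpace A) (h : y + domFst A d = x) :
    domK hA t x ≤ ‖y‖ₑ + ENNReal.ofReal t * ‖d‖ₑ :=
  BanachCouple.K_le (C := domainCouple A hA) y d h

theorem domK_le_enorm (t : ℝ) (x : X) : domK hA t x ≤ ‖x‖ₑ := by
  have h : ‖(0 : graphSpace A)‖ₑ = 0 := enorm_zero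
  have h1 := domK_le hA (t := t) x 0 (by rw [map_zero, add_zero])
  rwa [h, mul_zero, add_zero] at h1

theorem domK_domFst_le (t : ℝ) (d : graphSpace A) :
    domK hA t (domFst A d) ≤ ENNReal.ofReal t * ‖d‖ₑ :=
  (domK_le hA 0 d (by simp)).trans (by simp)

theorem domK_add_le (t : ℝ) (x y : X) : domK hA t (x + y) ≤ domK hA t x + domK hA t y :=
  (domainCouple A hA).K_add_le t x y

theorem domK_mono (x : X) : Monotone fun t => domK hA t x := (domainCouple A hA).K_mono x

theorem le_mul_domK {t : ℝ} {x : X} {b c : ℝ≥0∞} (hb : b ≠ ∞)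
    (h : ∀ y d, y + domFst A d = x → c ≤ b * (‖y‖ₑ + ENNReal.ofReal t * ‖d‖ₑ)) :
    c ≤ b * domK hA t x := by
  rcases eq_or_ne b 0 with rfl | hb0
  · simpa using h x 0 (by simp)
  change c ≤ b * ⨅ (y : X) (d : graphSpace A) (_ : y + domFst A d = x), _
  simp only [ENNReal.mul_iInf_of_ne hb0 hb]
  exact le_iInf fun y => le_iInf fun d => le_iInf fun e => h y d e

theorem enorm_domFst_le (d : graphSpace A) : ‖domFst A d‖ₑ ≤ ‖d‖ₑ := by
  rw [← ofReal_norm, ← ofReal_norm]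
  exact ENNReal.ofReal_le_ofReal (norm_domFst_le d)

theorem enorm_le_domK_one (x : X) : ‖x‖ₑ ≤ domK hA 1 x := by
  rw [← one_mul (domK hA 1 x)]
  refine le_mul_domK hA ENNReal.one_ne_top fun y d h => ?_
  rw [one_mul, ENNReal.ofReal_one, one_mul, ← h]
  exact (enorm_add_le _ _).trans (add_le_add_right (enorm_domFst_le d) _)

theorem domK_map_le {M : ℝ} {L : X →L[ℂ] X} {L' : graphSpace A → graphSpace A}
    (hL : ∀ x, ‖L x‖ ≤ M * ‖x‖) (hL' : ∀ d, ‖L' d‖ ≤ M * ‖d‖)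
    (h : ∀ d, domFst A (L' d) = L (domFst A d)) (t : ℝ) (x : X) :
    domK hA t (L x) ≤ ENNReal.ofReal M * domK hA t x := by
  refine le_mul_domK hA ENNReal.ofReal_ne_top fun y d hyd => ?_
  refine (domK_le hA (L y) (L' d) (by rw [h, ← map_add, hyd])).trans ?_
  have h1 : ‖L y‖ₑ ≤ ENNReal.ofReal M * ‖y‖ₑ := by
    rw [← ofReal_norm, ← ofReal_norm, ← ENNReal.ofReal_mul' (norm_nonneg _)]
    exact ENNReal.ofReal_le_ofReal (hL y)
  have h2 : ‖L' d‖ₑ ≤ ENNReal.ofReal M * ‖d‖ₑ := by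
    rw [← ofReal_norm, ← ofReal_norm, ← ENNReal.ofReal_mul' (norm_nonneg _)]
    exact ENNReal.ofReal_le_ofReal (hL' d)
  calc ‖L y‖ₑ + ENNReal.ofReal t * ‖L' d‖ₑ
      ≤ ENNReal.ofReal M * ‖y‖ₑ + ENNReal.ofReal t * (ENNReal.ofReal M * ‖d‖ₑ) := by gcongr
    _ = _ := by ring

theorem continuous_domK (t : ℝ) : Continuous (domK hA t) := by
  rw [continuous_iff_continuousAt]
  intro x
  have h1 : Tendsto (fun y => ‖y - x‖ₑ) (𝓝 x) (𝓝 0) := by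
    have : Continuous fun y : X => ‖y - x‖ₑ := by fun_prop
    simpa using this.tendsto x
  have hfin : domK hA t x ≠ ∞ := ne_top_of_le_ne_top (by simp) (domK_le_enorm hA t x)
  refine ENNReal.tendsto_nhds hfin |>.2 fun ε hε => ?_
  filter_upwards [h1.eventually (ge_mem_nhds hε)] with y hy
  constructor
  · rw [tsub_le_iff_right]
    calc domK hA t x = domK hA t (y + (x - y)) := by rw [add_sub_cancel]
      _ ≤ domK hA t y + ‖x - y‖ₑ := (domK_add_le hA t _ _).trans
          (add_le_add_right (domK_le_enorm hA t _) _)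
      _ ≤ _ := by
          rw [← enorm_neg, neg_sub]
          gcongr
  · calc domK hA t y = domK hA t (x + (y - x)) := by rw [add_sub_cancel]
      _ ≤ domK hA t x + ‖y - x‖ₑ := (domK_add_le hA t _ _).trans
          (add_le_add_right (domK_le_enorm hA t _) _)
      _ ≤ _ := by gcongr

variable {θ q : ℝ} (hθ : θ ∈ Ioo (0 : ℝ) 1) (hq : 1 ≤ q)

theorem realNorm_rpow (x : X) : ((domainCouple A hA).realNorm θ q hq).toFun x ^ q =
    ∫⁻ t, (ENNReal.ofReal (t ^ (-θ)) * domK hA t x) ^ q ∂BanachCouple.haarMeasure := by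
  change (_ ^ (1 / q)) ^ q = _
  rw [← ENNReal.rpow_mul, one_div_mul_cancel (by linarith), ENNReal.rpow_one]
  rfl

include hθ

theorem realNorm_rpow_le (x : X) : ((domainCouple A hA).realNorm θ q hq).toFun x ^ q ≤
    2 ^ q * ∑' j : ℤ, (dyWeight θ j * domK hA (2 ^ j) x) ^ q := by
  have hq0 : 0 < q := by linarith
  rw [realNorm_rpow]
  calc _ ≤ ∑' j : ℤ, (2 * (dyWeight θ (j + 1) * domK hA (2 ^ (j + 1)) x)) ^ q := by
        refine lintegral_haarMeasure_le fun j t ht => ENNReal.rpow_le_rpow ?_ hq0.le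
        rw [← mul_assoc]
        exact mul_le_mul' ((rpow_neg_le_dyWeight hθ.1.le ht).trans (dyWeight_le_two_mul hθ.2.le j))
          (domK_mono hA x ht.2.le)
    _ = _ := by
        simp only [ENNReal.mul_rpow_of_nonneg 2 _ hq0.le, ENNReal.tsum_mul_left]
        congr 1
        exact (Equiv.addRight (1 : ℤ)).tsum_eq fun j => (dyWeight θ j * domK hA (2 ^ j) x) ^ q

theorem tsum_le_realNorm_rpow (x : X) :
    ∑' j : ℤ, (dyWeight θ j * domK hA (2 ^ j) x) ^ q ≤
      2 * 2 ^ q * ((domainCouple A hA).realNorm θ q hq).toFun x ^ q := by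
  have hq0 : 0 < q := by linarith
  have hm : Measurable fun t : ℝ => (ENNReal.ofReal (t ^ (-θ)) * domK hA t x) ^ q :=
    (((measurable_id.pow_const (-θ)).ennreal_ofReal).mul (domK_mono hA x).measurable).pow_const q
  rw [realNorm_rpow, mul_assoc, ← lintegral_const_mul _ hm]
  refine tsum_le_lintegral_haarMeasure fun j t ht => ?_
  rw [← ENNReal.mul_rpow_of_nonneg _ _ hq0.le, ← mul_assoc]
  refine ENNReal.rpow_le_rpow (mul_le_mul' ?_ (domK_mono hA x ht.1)) hq0.le
  refine (dyWeight_le_two_mul hθ.2.le j).trans ?_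
  gcongr
  exact dyWeight_le_rpow_neg hθ.1.le ht

theorem enorm_le_realNorm (x : X) :
    ‖x‖ₑ ≤ 4 * ((domainCouple A hA).realNorm θ q hq).toFun x := by
  have hq0 : 0 < q := by linarith
  rw [← ENNReal.rpow_le_rpow_iff hq0, ENNReal.mul_rpow_of_nonneg _ _ hq0.le]
  calc ‖x‖ₑ ^ q ≤ (dyWeight θ 0 * domK hA (2 ^ (0 : ℤ)) x) ^ q := by
        rw [dyWeight_zero, one_mul, zpow_zero]
        gcongr
        exact enorm_le_domK_one hA x
    _ ≤ ∑' j : ℤ, (dyWeight θ j * domK hA (2 ^ j) x) ^ q :=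
        ENNReal.le_tsum (f := fun j : ℤ => (dyWeight θ j * domK hA (2 ^ j) x) ^ q) 0
    _ ≤ 2 * 2 ^ q * ((domainCouple A hA).realNorm θ q hq).toFun x ^ q :=
        tsum_le_realNorm_rpow hA hθ hq x
    _ ≤ _ := by
        gcongr
        rw [show (4 : ℝ≥0∞) = 2 * 2 by norm_num, ENNReal.mul_rpow_of_nonneg _ _ hq0.le]
        gcongr
        conv_lhs => rw [← ENNReal.rpow_one 2]
        exact ENNReal.rpow_le_rpow_of_exponent_le one_le_two hq

theorem enorm_realSpace (x : (domainCouple A hA).RealSpace θ q hq) :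
    ‖x‖ₑ = ((domainCouple A hA).realNorm θ q hq).toFun
      (((domainCouple A hA).realNorm θ q hq).incl x) := by
  rw [← ofReal_norm, ExtNorm.norm_def, ENNReal.ofReal_toReal (ExtNorm.lt_top _ x).ne]

/-- The inclusion of `(X, D_A)_{θ,q}` in `X`. -/
def realIncl : (domainCouple A hA).RealSpace θ q hq →L[ℂ] X :=
  (show (domainCouple A hA).RealSpace θ q hq →ₗ[ℂ] X from
    ((domainCouple A hA).realNorm θ q hq).incl).mkContinuous 4 fun x => by
    have h := enorm_le_realNorm hA hθ hq (((domainCouple A hA).realNorm θ q hq).incl x)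
    rw [← enorm_realSpace hA hθ hq x] at h
    have h2 := ENNReal.toReal_mono (by finiteness) h
    rw [ENNReal.toReal_mul, toReal_enorm, toReal_enorm] at h2
    simpa using h2

theorem realIncl_injective : Function.Injective (realIncl hA hθ hq) :=
  ((domainCouple A hA).realNorm θ q hq).incl_injective

theorem enorm_eq_realNorm (x : (domainCouple A hA).RealSpace θ q hq) :
    ‖x‖ₑ = ((domainCouple A hA).realNorm θ q hq).toFun (realIncl hA hθ hq x) :=
  enorm_realSpace hA hθ hq x

omit hθ in
/-- The norm of the real method is lower semicontinuous on `X`. -/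
theorem realNorm_le_liminf {y : ℕ → X} {x : X} (h : Tendsto y atTop (𝓝 x)) {c : ℝ≥0∞}
    (hc : ∀ᶠ n in atTop, ((domainCouple A hA).realNorm θ q hq).toFun (y n) ≤ c) :
    ((domainCouple A hA).realNorm θ q hq).toFun x ≤ c := by
  have hq0 : 0 < q := by linarith
  rw [← ENNReal.rpow_le_rpow_iff hq0, realNorm_rpow]
  have hm : ∀ x, Measurable fun t : ℝ => (ENNReal.ofReal (t ^ (-θ)) * domK hA t x) ^ q := fun x =>
    (((measurable_id.pow_const (-θ)).ennreal_ofReal).mul (domK_mono hA x).measurable).pow_const q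
  have hlim : ∀ t : ℝ, (ENNReal.ofReal (t ^ (-θ)) * domK hA t x) ^ q =
      liminf (fun n => (ENNReal.ofReal (t ^ (-θ)) * domK hA t (y n)) ^ q) atTop := fun t => by
    refine (Tendsto.liminf_eq (Tendsto.ennrpow_const q ?_)).symm
    exact ENNReal.Tendsto.const_mul (((continuous_domK hA t).tendsto x).comp h)
      (Or.inr ENNReal.ofReal_ne_top)
  simp only [hlim]
  refine (lintegral_liminf_le fun n => hm (y n)).trans ?_
  refine liminf_le_of_frequently_le' (Eventually.frequently ?_)
  filter_upwards [hc] with n hn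
  rw [← realNorm_rpow hA hq]
  gcongr

theorem completeSpace_realSpace : CompleteSpace ((domainCouple A hA).RealSpace θ q hq) := by
  refine Metric.complete_of_cauchySeq_tendsto fun x hx => ?_
  obtain ⟨y, hy⟩ := cauchySeq_tendsto_of_complete
    (hx.map (realIncl hA hθ hq).uniformContinuous : CauchySeq (realIncl hA hθ hq ∘ x))
  have key : ∀ ε : ℝ, 0 < ε → ∃ n₀, ∀ n ≥ n₀,
      ((domainCouple A hA).realNorm θ q hq).toFun (y - realIncl hA hθ hq (x n)) ≤
        ENNReal.ofReal ε := by
    intro ε hε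
    obtain ⟨n₀, hn₀⟩ := Metric.cauchySeq_iff.1 hx ε hε
    refine ⟨n₀, fun n hn => ?_⟩
    refine realNorm_le_liminf hA hq (hy.sub_const (realIncl hA hθ hq (x n))) ?_
    filter_upwards [eventually_ge_atTop n₀] with m hm
    have h1 : realIncl hA hθ hq (x m) - realIncl hA hθ hq (x n) = realIncl hA hθ hq (x m - x n) :=
      (map_sub _ _ _).symm
    rw [h1, ← enorm_eq_realNorm, ← ofReal_norm, ← dist_eq_norm]
    exact ENNReal.ofReal_le_ofReal (hn₀ m hm n hn).le
  obtain ⟨n₁, hn₁⟩ := key 1 one_pos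
  let z : (domainCouple A hA).RealSpace θ q hq := ⟨y, by
    have h1 : y = (y - realIncl hA hθ hq (x n₁)) + realIncl hA hθ hq (x n₁) := by abel
    rw [h1]
    refine ((domainCouple A hA).realNorm θ q hq).finite.add_mem ?_ (x n₁).2
    exact (hn₁ n₁ le_rfl).trans_lt ENNReal.ofReal_lt_top⟩
  have hz : realIncl hA hθ hq z = y := rfl
  refine ⟨z, Metric.tendsto_atTop.2 fun ε hε => ?_⟩
  obtain ⟨n₀, hn₀⟩ := key (ε / 2) (by positivity)
  refine ⟨n₀, fun n hn => ?_⟩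
  have h2 := hn₀ n hn
  rw [← hz, ← map_sub, ← enorm_eq_realNorm] at h2
  rw [dist_comm, dist_eq_norm]
  have h3 := ENNReal.toReal_mono ENNReal.ofReal_ne_top h2
  rw [toReal_enorm, ENNReal.toReal_ofReal (by positivity)] at h3
  linarith

/-- The inclusion of `D_A` in `(X, D_A)_{θ,q}`. -/
theorem exists_domToReal (hq1 : 1 < q) :
    ∃ j : graphSpace A →L[ℂ] (domainCouple A hA).RealSpace θ q hq,
      ∀ d, realIncl hA hθ hq (j d) = domFst A d := by
  have hq0 : 0 < q := by linarith
  set κ : ℝ≥0∞ := 2 * ∑' j, dyKernel θ j with hκ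
  have hκt : κ ≠ ∞ := ENNReal.mul_ne_top ENNReal.ofNat_ne_top (tsum_dyKernel_ne_top hθ)
  have hb : ∀ d, ((domainCouple A hA).realNorm θ q hq).toFun (domFst A d) ≤ κ * ‖d‖ₑ := by
    intro d
    rw [← ENNReal.rpow_le_rpow_iff hq0]
    have h1 : ∀ j : ℤ, dyWeight θ j * domK hA (2 ^ j) (domFst A d) ≤ dyKernel θ j * ‖d‖ₑ := by
      intro j
      rw [dyKernel, mul_assoc]
      gcongr
      rw [min_mul_of_nonneg _ _ zero_le, one_mul]
      exact le_min ((domK_le_enorm hA _ _).trans (enorm_domFst_le d)) (domK_domFst_le hA _ d)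
    have h2 : ∑' j, dyKernel θ j ^ q ≤ (∑' j, dyKernel θ j) ^ q := by
      have h3 := tsum_convolution_rpow_le (dyKernel θ) (Pi.single 0 1) hq1
      have h4 : ∀ j, ∑' i, dyKernel θ (j - i) * (Pi.single 0 1 : ℤ → ℝ≥0∞) i = dyKernel θ j := by
        intro j
        rw [tsum_eq_single 0 fun i hi => by rw [Pi.single_eq_of_ne hi, mul_zero]]
        simp
      have h5 : ∑' i, (Pi.single 0 1 : ℤ → ℝ≥0∞) i ^ q = 1 := by
        rw [tsum_eq_single 0 fun i hi => by
          rw [Pi.single_eq_of_ne hi, ENNReal.zero_rpow_of_pos hq0]]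
        simp
      simpa only [h4, h5, mul_one] using h3
    calc _ ≤ 2 ^ q * ∑' j : ℤ, (dyWeight θ j * domK hA (2 ^ j) (domFst A d)) ^ q :=
          realNorm_rpow_le hA hθ hq _
      _ ≤ 2 ^ q * ∑' j : ℤ, (dyKernel θ j * ‖d‖ₑ) ^ q := by
          exact mul_le_mul_right (ENNReal.tsum_le_tsum fun j =>
            ENNReal.rpow_le_rpow (h1 j) hq0.le) _
      _ ≤ 2 ^ q * ((∑' j, dyKernel θ j) ^ q * ‖d‖ₑ ^ q) := by
          simp only [ENNReal.mul_rpow_of_nonneg _ _ hq0.le, ENNReal.tsum_mul_right]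
          gcongr
      _ = _ := by
          rw [hκ, ENNReal.mul_rpow_of_nonneg _ _ hq0.le, ENNReal.mul_rpow_of_nonneg _ _ hq0.le,
            mul_assoc]
  let j : graphSpace A →ₗ[ℂ] (domainCouple A hA).RealSpace θ q hq :=
    { toFun := fun d => ⟨domFst A d, (hb d).trans_lt (by finiteness)⟩
      map_add' := fun d d' => realIncl_injective hA hθ hq (map_add (domFst A) d d')
      map_smul' := fun c d => realIncl_injective hA hθ hq (map_smul (domFst A) c d) }
  have hj : ∀ d, realIncl hA hθ hq (j d) = domFst A d := fun d => rfl
  refine ⟨j.mkContinuous κ.toReal fun d => ?_, hj⟩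
  have h6 := hb d
  rw [← hj, ← enorm_eq_realNorm] at h6
  have h7 := ENNReal.toReal_mono (by finiteness) h6
  rwa [ENNReal.toReal_mul, toReal_enorm, toReal_enorm] at h7

end DomainRealSpace

/-! ### The semigroup and the `K`-functional -/

section KFunctionalEstimates

open Filter Topology

variable {X : Type u} [NormedAddCommGroup X] [NormedSpace ℂ X] [CompleteSpace X]
  {A : X →ₗ.[ℂ] X} (hA : A.IsClosed) {T S : ℝ → X →L[ℂ] X} {M : ℝ}

theorem enorm_le_ofReal_mul {E F : Type*} [SeminormedAddCommGroup E] [SeminormedAddCommGroup F]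
    {x : E} {y : F} {c : ℝ} (hc : 0 ≤ c) (h : ‖x‖ ≤ c * ‖y‖) : ‖x‖ₑ ≤ ENNReal.ofReal c * ‖y‖ₑ := by
  rw [← ofReal_norm, ← ofReal_norm, ← ENNReal.ofReal_mul hc]
  exact ENNReal.ofReal_le_ofReal h

namespace IsAnalyticPair

variable (hT : IsAnalyticPair A T S M)
include hT

theorem apply_add {s t : ℝ} (hs : 0 < s) (ht : 0 < t) (x : X) : S (s + t) x = S s (T t x) := by
  have h1 := hT.graph_mem (s + t) x (add_pos hs ht)
  rw [hT.map_add s t x hs ht] at h1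
  exact A.mem_graph_snd_inj h1 (hT.graph_mem s (T t x) hs) rfl

theorem apply_add' {s t : ℝ} (hs : 0 < s) (ht : 0 < t) (x : X) : S (s + t) x = T s (S t x) := by
  rw [hT.apply_add hs ht, hT.comm _ _ (hT.graph_mem t x ht) s hs]

theorem comp_eq_of_lt {a b a' b' : ℝ} (ha' : 0 < a') (hb : 0 < b) (h : a + b = a' + b')
    (haa : a' < a) (x : X) : S a (S b x) = S a' (S b' x) := by
  have he : 0 < a - a' := sub_pos.2 haa
  rw [show b' = (a - a') + b by linarith, hT.apply_add' he hb, ← hT.apply_add ha' he]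
  congr 3
  ring

theorem enorm_apply_le (hM : 0 ≤ M) {s : ℝ} (hs : 0 < s) (x : X) :
    ‖S s x‖ₑ ≤ ENNReal.ofReal (M / s) * domK hA s x := by
  refine le_mul_domK hA ENNReal.ofReal_ne_top fun y d h => ?_
  rw [← h, _root_.map_add, mul_add]
  refine (enorm_add_le _ _).trans (add_le_add ?_ ?_)
  · exact enorm_le_ofReal_mul (by positivity) ((S s).le_of_opNorm_le (hT.bound' s hs) y)
  · rw [← mul_assoc, ← ENNReal.ofReal_mul (by positivity), div_mul_cancel₀ _ hs.ne',
      hT.comm _ _ (mem_graph_dom d) s hs]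
    refine enorm_le_ofReal_mul hM ?_
    refine ((T s).le_of_opNorm_le (hT.bound s hs) _).trans ?_
    gcongr
    exact norm_domSnd_le d

/-- The composite depends only on the sum `s` of the two times, which may thus be balanced. -/
theorem enorm_comp_le (hM : 0 ≤ M) {r s : ℝ} (hr : 0 < r) (hrs : r < s) (x : X) :
    ‖S (r / 2) (S (s - r / 2) x)‖ₑ ≤ ENNReal.ofReal (4 * M ^ 2 / s ^ 2) * domK hA s x := by
  have hs : 0 < s := hr.trans hrs
  rw [← hT.comp_eq_of_lt (a := s / 2) (b := s / 2) (by positivity) (by positivity) (by ring)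
    (by linarith) x]
  calc ‖S (s / 2) (S (s / 2) x)‖ₑ ≤ ENNReal.ofReal (M / (s / 2)) * ‖S (s / 2) x‖ₑ :=
        enorm_le_ofReal_mul (by positivity)
          ((S _).le_of_opNorm_le (hT.bound' _ (by positivity)) _)
    _ ≤ ENNReal.ofReal (M / (s / 2)) * (ENNReal.ofReal (M / (s / 2)) * domK hA s x) := by
        gcongr
        refine (hT.enorm_apply_le hA hM (by positivity) x).trans ?_
        gcongr
        exact domK_mono hA x (by linarith)
    _ = _ := by
        rw [← mul_assoc, ← ENNReal.ofReal_mul (by positivity)]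
        congr 2
        field_simp
        ring

theorem enorm_apply_sub_le (hM : 0 ≤ M) {s : ℝ} (hs : 0 < s) (x : X) :
    ‖T s x - x‖ₑ ≤ ENNReal.ofReal (M + 1) * domK hA s x := by
  refine le_mul_domK hA ENNReal.ofReal_ne_top fun y d h => ?_
  have h1 : T s x - x = (T s y - y) + (T s (domFst A d) - domFst A d) := by
    rw [← h, _root_.map_add]; abel
  rw [h1, mul_add]
  refine (enorm_add_le _ _).trans (add_le_add ?_ ?_)
  · refine enorm_le_ofReal_mul (by positivity) ((norm_sub_le _ _).trans ?_)
    rw [add_mul, one_mul]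
    gcongr
    exact (T s).le_of_opNorm_le (hT.bound s hs) y
  · rw [← mul_assoc, ← ENNReal.ofReal_mul (by positivity)]
    refine enorm_le_ofReal_mul (by positivity) ?_
    rw [hT.integral_eq _ _ (mem_graph_dom d) s hs, sub_sub_cancel_left, norm_neg]
    have h2 : ∀ u ∈ Ioc 0 s, ‖T u (domSnd A d)‖ ≤ M * ‖d‖ := fun u hu => by
      refine ((T u).le_of_opNorm_le (hT.bound u hu.1) _).trans ?_
      gcongr
      exact norm_domSnd_le d
    refine (norm_setIntegral_le_of_norm_le_const (by simp) h2).trans ?_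
    rw [Measure.real, Real.volume_Ioc, sub_zero, ENNReal.toReal_ofReal hs.le]
    nlinarith [mul_nonneg hs.le (norm_nonneg d)]

/-- `x - T(t) x = ∫_0^t A T(s) x ds` for the vectors `x` of a real interpolation space. -/
theorem sub_apply_eq_integral (hM : 0 ≤ M) {x : X} {t : ℝ} (ht : 0 < t)
    (hx : Tendsto (fun s => domK hA s x) (𝓝[>] 0) (𝓝 0))
    (hS : IntegrableOn (fun s => S s x) (Ioc 0 t)) : x - T t x = ∫ s in Ioc 0 t, S s x := by
  have h1 : ∀ e ∈ Ioo 0 t, T e x - T t x = ∫ s in e..t, S s x := by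
    intro e he
    have h2 := hT.integral_eq _ _ (hT.graph_mem e x he.1) (t - e) (sub_pos.2 he.2)
    rw [← hT.map_add _ _ _ (sub_pos.2 he.2) he.1, sub_add_cancel] at h2
    rw [h2, sub_sub_cancel]
    have h3 : ∫ s in Ioc 0 (t - e), T s (S e x) = ∫ s in Ioc 0 (t - e), S (s + e) x :=
      setIntegral_congr_fun measurableSet_Ioc fun s hs => (hT.apply_add' hs.1 he.1 x).symm
    rw [h3, ← intervalIntegral.integral_of_le (sub_pos.2 he.2).le,
      intervalIntegral.integral_comp_add_right (fun s => S s x), zero_add, sub_add_cancel]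
  have h4 : Tendsto (fun e => T e x - T t x) (𝓝[>] 0) (𝓝 (x - T t x)) := by
    refine Tendsto.sub_const ?_ _
    rw [tendsto_iff_norm_sub_tendsto_zero]
    have h5 : Tendsto (fun e => ‖T e x - x‖ₑ) (𝓝[>] 0) (𝓝 0) := by
      have h6 := ENNReal.Tendsto.const_mul (a := ENNReal.ofReal (M + 1)) hx
        (Or.inr ENNReal.ofReal_ne_top)
      rw [mul_zero] at h6
      refine tendsto_of_tendsto_of_tendsto_of_le_of_le' tendsto_const_nhds h6
        (.of_forall fun _ => zero_le) ?_
      filter_upwards [self_mem_nhdsWithin] with e he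
      exact hT.enorm_apply_sub_le hA hM he x
    have h7 := (ENNReal.tendsto_toReal ENNReal.zero_ne_top).comp h5
    simpa [Function.comp_def] using h7
  have h8 : Tendsto (fun e => ∫ s in e..t, S s x) (𝓝[>] 0) (𝓝 (∫ s in 0..t, S s x)) := by
    have h9 : IntervalIntegrable (fun s => S s x) volume 0 t :=
      (intervalIntegrable_iff_integrableOn_Ioc_of_le ht.le).2 hS
    have h10 := intervalIntegral.continuousOn_primitive_interval_left
      ((intervalIntegrable_iff_integrableOn_Icc_of_le ht.le).1 h9 |> fun h =>
        by rwa [uIcc_of_le ht.le] : IntegrableOn (fun s => S s x) (uIcc 0 t))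
    have h11 := (h10 0 left_mem_uIcc).tendsto
    refine h11.mono_left ?_
    rw [uIcc_of_le ht.le, nhdsWithin_Icc_eq_nhdsGE ht]
    exact nhdsWithin_mono _ Ioi_subset_Ici_self
  rw [← intervalIntegral.integral_of_le ht.le]
  refine tendsto_nhds_unique (h4.congr' ?_) h8
  filter_upwards [Ioo_mem_nhdsGT ht] with e he
  exact h1 e he

/-- The `K`-functional of `∫ A T(s) F(s) ds`: the integral is split at `s = r`, and the part over
`s > r` belongs to `D_A`. -/
theorem domK_integral_le (hM : 0 ≤ M) {F : ℝ → X} {r : ℝ} (hr : 0 < r) (hr1 : r ≤ 1)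
    (hF : IntegrableOn (fun s => S s (F s)) (Ioi 0))
    (hF' : IntegrableOn (fun s => S (r / 2) (S (s - r / 2) (F s))) (Ioi r)) :
    domK hA r (∫ s in Ioi 0, S s (F s)) ≤ ENNReal.ofReal r * ‖∫ s in Ioi 0, S s (F s)‖ₑ +
      ENNReal.ofReal (2 * M + 4 * M ^ 2) *
        ∫⁻ s in Ioi 0, ENNReal.ofReal (s⁻¹ * min 1 (r / s)) * domK hA s (F s) := by
  set g := ∫ s in Ioi 0, S s (F s) with hg
  set y := ∫ s in Ioc 0 r, S s (F s) with hy
  set z := ∫ s in Ioi r, S s (F s) with hz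
  set w := ∫ s in Ioi r, S (r / 2) (S (s - r / 2) (F s)) with hw
  -- The part `y` over `s ≤ r` goes to `X` and the part `z` over `s > r` to `D_A`; `w = A z` because
  -- `S(s) = T(r/2) S(s - r/2)`.
  have hsplit : y + z = g := by
    rw [hg, ← Ioc_union_Ioi_eq_Ioi hr.le, setIntegral_union (Ioc_disjoint_Ioi le_rfl)
      measurableSet_Ioi (hF.mono_set Ioc_subset_Ioi_self) (hF.mono_set (Ioi_subset_Ioi hr.le))]
  have hzw : (z, w) ∈ A.graph := by
    refine integral_mem_graph hA (hF.mono_set (Ioi_subset_Ioi hr.le)) hF'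
      (ae_restrict_of_forall_mem measurableSet_Ioi fun s hs => ?_)
    have h1 := hT.graph_mem (r / 2) (S (s - r / 2) (F s)) (by positivity)
    rwa [← hT.apply_add' (by positivity) (by linarith [mem_Ioi.1 hs]), add_sub_cancel] at h1
  have hd : ‖domMk hzw‖ₑ ≤ ‖g‖ₑ + ‖y‖ₑ + ‖w‖ₑ := by
    have h1 : ‖domMk hzw‖ₑ = ‖z‖ₑ + ‖w‖ₑ := by
      rw [← ofReal_norm, norm_dom, domFst_mk, domSnd_mk,
        ENNReal.ofReal_add (norm_nonneg _) (norm_nonneg _), ofReal_norm, ofReal_norm]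
    rw [h1, ← hsplit]
    gcongr
    calc ‖z‖ₑ = ‖(y + z) - y‖ₑ := by rw [add_sub_cancel_left]
      _ ≤ _ := enorm_sub_le
  set φ : ℝ → ℝ≥0∞ := fun s => ENNReal.ofReal (s⁻¹ * min 1 (r / s)) * domK hA s (F s) with hφ
  have hyb : ‖y‖ₑ ≤ ENNReal.ofReal M * ∫⁻ s in Ioc 0 r, φ s := by
    rw [← lintegral_const_mul' _ _ ENNReal.ofReal_ne_top]
    refine (enorm_integral_le_lintegral_enorm _).trans
      (setLIntegral_mono' measurableSet_Ioc fun s hs => ?_)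
    refine (hT.enorm_apply_le hA hM hs.1 _).trans (le_of_eq ?_)
    rw [hφ, ← mul_assoc, ← ENNReal.ofReal_mul hM, min_eq_left ((one_le_div hs.1).2 hs.2), mul_one,
      div_eq_mul_inv]
  have hwb : ENNReal.ofReal r * ‖w‖ₑ ≤ ENNReal.ofReal (4 * M ^ 2) * ∫⁻ s in Ioi r, φ s := by
    rw [← lintegral_const_mul' _ _ ENNReal.ofReal_ne_top]
    refine (mul_le_mul_right (enorm_integral_le_lintegral_enorm _) _).trans ?_
    rw [← lintegral_const_mul' _ _ ENNReal.ofReal_ne_top]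
    refine setLIntegral_mono' measurableSet_Ioi fun s hs => ?_
    have hs0 : 0 < s := hr.trans hs
    refine (mul_le_mul_right (hT.enorm_comp_le hA hM hr hs _) _).trans (le_of_eq ?_)
    rw [hφ, ← mul_assoc, ← mul_assoc, ← ENNReal.ofReal_mul hr.le,
      ← ENNReal.ofReal_mul (by positivity), min_eq_right ((div_le_one hs0).2 (le_of_lt hs))]
    congr 2
    field_simp
  -- Here `r ≤ 1` is used: the term `r ‖y‖` from the graph norm is absorbed by `‖y‖`.
  have hr' : ENNReal.ofReal r ≤ 1 := by simpa using hr1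
  calc domK hA r g ≤ ‖y‖ₑ + ENNReal.ofReal r * ‖domMk hzw‖ₑ := domK_le hA y (domMk hzw) hsplit
    _ ≤ ‖y‖ₑ + ENNReal.ofReal r * (‖g‖ₑ + ‖y‖ₑ + ‖w‖ₑ) := by gcongr
    _ = ENNReal.ofReal r * ‖g‖ₑ + (‖y‖ₑ + ENNReal.ofReal r * ‖y‖ₑ) + ENNReal.ofReal r * ‖w‖ₑ := by
        ring
    _ ≤ ENNReal.ofReal r * ‖g‖ₑ + (‖y‖ₑ + 1 * ‖y‖ₑ) + ENNReal.ofReal r * ‖w‖ₑ := by gcongr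
    _ ≤ ENNReal.ofReal r * ‖g‖ₑ + (ENNReal.ofReal (2 * M) * ∫⁻ s in Ioi 0, φ s) +
          ENNReal.ofReal (4 * M ^ 2) * ∫⁻ s in Ioi 0, φ s := by
        refine add_le_add (add_le_add_right ?_ _) (hwb.trans ?_)
        · rw [one_mul, ← two_mul, ENNReal.ofReal_mul zero_le_two, ENNReal.ofReal_ofNat, mul_assoc]
          gcongr 2 * ?_
          refine hyb.trans ?_
          gcongr
          exact Ioc_subset_Ioi_self
        · gcongr
    _ = _ := by
        rw [add_assoc, ← add_mul, ← ENNReal.ofReal_add (by positivity) (by positivity)]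

end IsAnalyticPair

end KFunctionalEstimates

/-! ### The response to a step function as a convolution -/

section ResponseAsIntegral

open Filter Topology

variable {X : Type u} [NormedAddCommGroup X] [NormedSpace ℂ X] [CompleteSpace X]
  {A : X →ₗ.[ℂ] X} (hA : A.IsClosed) {T S : ℝ → X →L[ℂ] X} {M : ℝ}

/-- The convolution of an operator family with a dyadic step function. -/
theorem integrableOn_conv_dyStep {R : ℝ → X →L[ℂ] X} {a : ℝ} {c : (ℕ × ℕ) →₀ X}
    (h : ∀ q ∈ c.support, ∀ α β, IntegrableOn (fun s => R s (c q)) (Ioi a ∩ Ico α β)) (t : ℝ) :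
    IntegrableOn (fun s => R s (dyStep c (t - s))) (Ioi a) ∧
      ∫ s in Ioi a, R s (dyStep c (t - s)) = c.sum fun q x =>
        ∫ s in Ioi a ∩ Ico (t - (q.2 + 1) * dyMesh q.1) (t - q.2 * dyMesh q.1), R s x := by
  have hterm : ∀ (q : ℕ × ℕ) (x : X) (s : ℝ),
      R s ((cell (dyMesh q.1) q.2).indicator (fun _ => x) (t - s)) =
        (Ico (t - (q.2 + 1) * dyMesh q.1) (t - q.2 * dyMesh q.1)).indicator (fun s => R s x) s := by
    intro q x s
    have hiff : t - s ∈ cell (dyMesh q.1) q.2 ↔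
        s ∈ Ico (t - (q.2 + 1) * dyMesh q.1) (t - q.2 * dyMesh q.1) := by
      simp only [cell, mem_Ioc, mem_Ico]
      constructor <;> rintro ⟨h1, h2⟩ <;> constructor <;> linarith
    by_cases hs : t - s ∈ cell (dyMesh q.1) q.2
    · rw [indicator_of_mem hs, indicator_of_mem (hiff.1 hs)]
    · rw [indicator_of_notMem hs, indicator_of_notMem (fun h => hs (hiff.2 h)), map_zero]
  have hsum : (fun s => R s (dyStep c (t - s))) = fun s => ∑ q ∈ c.support,
      (Ico (t - (q.2 + 1) * dyMesh q.1) (t - q.2 * dyMesh q.1)).indicator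
        (fun s => R s (c q)) s := by
    ext s
    rw [dyStep, Finsupp.sum, map_sum]
    exact Finset.sum_congr rfl fun q _ => hterm q (c q) s
  have hint : ∀ q ∈ c.support, IntegrableOn
      ((Ico (t - (q.2 + 1) * dyMesh q.1) (t - q.2 * dyMesh q.1)).indicator
        (fun s => R s (c q))) (Ioi a) := fun q hq => by
    rw [integrableOn_indicator_iff measurableSet_Ico, inter_comm]
    exact h q hq _ _
  rw [hsum]
  refine ⟨integrable_finsetSum _ hint, ?_⟩
  rw [integral_finsetSum _ hint, Finsupp.sum]
  refine Finset.sum_congr rfl fun q _ => ?_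
  rw [setIntegral_indicator measurableSet_Ico]

/-- The dyadic decomposition of the kernel of `domK_integral_le`. -/
theorem lintegral_conv_domK_le {f : ℝ → X} (j : ℤ) (t : ℝ) :
    ∫⁻ s in Ioi 0, ENNReal.ofReal (s⁻¹ * min 1 (2 ^ j / s)) * domK hA s (f (t - s)) ≤
      4 * ∑' i : ℤ, min 1 (ENNReal.ofReal (2 ^ (j - i))) *
        winAvg (2 ^ i) (fun u => domK hA (2 ^ i) (f u)) t := by
  have hpos : ∀ i : ℤ, (0 : ℝ) < 2 ^ i := fun i => by positivity
  rw [← iUnion_Ico_two_zpow]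
  refine (lintegral_iUnion_le _ _).trans ?_
  rw [← (Equiv.addRight (1 : ℤ)).tsum_eq fun i : ℤ => min 1 (ENNReal.ofReal (2 ^ (j - i))) *
        winAvg (2 ^ i) (fun u => domK hA (2 ^ i) (f u)) t, ← ENNReal.tsum_mul_left]
  refine ENNReal.tsum_le_tsum fun i => ?_
  rw [Equiv.coe_addRight, winAvg]
  set h : ℝ := 2 ^ (i + 1) with hh
  have hi : h = 2 * 2 ^ i := by rw [hh, zpow_add_one₀ two_ne_zero, mul_comm]
  have hker : ∀ s ∈ Ico ((2 : ℝ) ^ i) h, ENNReal.ofReal (s⁻¹ * min 1 (2 ^ j / s)) ≤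
      4 * (min 1 (ENNReal.ofReal (2 ^ (j - (i + 1)))) * ENNReal.ofReal h⁻¹) := by
    intro s hs
    have hs0 : 0 < s := (hpos i).trans_le hs.1
    rw [← ENNReal.ofReal_one, ← ENNReal.ofReal_min, ← ENNReal.ofReal_mul (by positivity),
      show (4 : ℝ≥0∞) = ENNReal.ofReal 4 by simp, ← ENNReal.ofReal_mul (by norm_num)]
    refine ENNReal.ofReal_le_ofReal ?_
    have e1 : s⁻¹ ≤ 2 * h⁻¹ := by
      rw [hi, mul_inv, ← mul_assoc, mul_inv_cancel₀ two_ne_zero, one_mul]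
      exact inv_anti₀ (hpos i) hs.1
    have e2 : min 1 (2 ^ j / s) ≤ 2 * min 1 (2 ^ (j - (i + 1))) := by
      have e3 : (2 : ℝ) ^ j / s ≤ 2 * 2 ^ (j - (i + 1)) := by
        rw [zpow_sub₀ two_ne_zero, ← hh, div_eq_mul_inv, div_eq_mul_inv]
        calc (2 : ℝ) ^ j * s⁻¹ ≤ 2 ^ j * (2 * h⁻¹) := by gcongr
          _ = _ := by ring
      rw [mul_min_of_nonneg _ _ zero_le_two]
      exact min_le_min (by norm_num) e3
    calc s⁻¹ * min 1 (2 ^ j / s) ≤ (2 * h⁻¹) * (2 * min 1 (2 ^ (j - (i + 1)))) := by gcongr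
      _ = _ := by ring
  have hshift : ∫⁻ s in Ico ((2 : ℝ) ^ i) h, domK hA h (f (t - s)) ≤
      ∫⁻ u in Icc (t - h) (t + h), domK hA h (f u) := by
    rw [← lintegral_indicator measurableSet_Ico, ← lintegral_indicator measurableSet_Icc,
      ← lintegral_sub_left_eq_self (fun u => (Icc (t - h) (t + h)).indicator
        (fun u => domK hA h (f u)) u) t]
    refine lintegral_mono fun s => ?_
    by_cases hs : s ∈ Ico ((2 : ℝ) ^ i) h
    · have : t - s ∈ Icc (t - h) (t + h) :=
        ⟨by linarith [hs.2], by linarith [hs.1, hpos i, hs.2]⟩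
      rw [indicator_of_mem hs, indicator_of_mem this]
    · rw [indicator_of_notMem hs]
      exact zero_le
  calc ∫⁻ s in Ico ((2 : ℝ) ^ i) h,
        ENNReal.ofReal (s⁻¹ * min 1 (2 ^ j / s)) * domK hA s (f (t - s))
      ≤ ∫⁻ s in Ico ((2 : ℝ) ^ i) h, 4 * (min 1 (ENNReal.ofReal (2 ^ (j - (i + 1)))) *
          ENNReal.ofReal h⁻¹) * domK hA h (f (t - s)) :=
        setLIntegral_mono' measurableSet_Ico fun s hs =>
          mul_le_mul' (hker s hs) (domK_mono hA _ hs.2.le)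
    _ ≤ 4 * (min 1 (ENNReal.ofReal (2 ^ (j - (i + 1)))) * ENNReal.ofReal h⁻¹) *
          ∫⁻ u in Icc (t - h) (t + h), domK hA h (f u) := by
        rw [lintegral_const_mul' _ _ (ENNReal.mul_ne_top ENNReal.ofNat_ne_top (ENNReal.mul_ne_top
          (ne_top_of_le_ne_top ENNReal.one_ne_top (min_le_left _ _)) ENNReal.ofReal_ne_top))]
        gcongr
    _ = _ := by ring

namespace IsAnalyticPair

variable (hT : IsAnalyticPair A T S M)
include hT

theorem integrableOn_comp {r : ℝ} (hM : 0 ≤ M) (hr : 0 < r) (x : X) (α β : ℝ) :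
    IntegrableOn (fun s => S (r / 2) (S (s - r / 2) x)) (Ioi r ∩ Ico α β) := by
  have hc : ContinuousOn (fun s => S (r / 2) (S (s - r / 2) x)) (Ioi r) :=
    (S (r / 2)).continuous.comp_continuousOn ((hT.continuousOn x).comp (by fun_prop)
      fun s hs => by have := mem_Ioi.1 hs; simp only [mem_Ioi]; linarith)
  refine IntegrableOn.of_bound (C := ‖S (r / 2)‖ * (M / (r / 2) * ‖x‖))
    ((measure_mono inter_subset_right).trans_lt (by simp))
    ((hc.mono inter_subset_left).aestronglyMeasurable (measurableSet_Ioi.inter measurableSet_Ico))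
    (ae_restrict_of_forall_mem (measurableSet_Ioi.inter measurableSet_Ico) fun s hs => ?_)
  have hs1 : r < s := hs.1
  refine (S (r / 2)).le_opNorm_of_le (((S _).le_of_opNorm_le (hT.bound' _ (by linarith)) x).trans ?_)
  gcongr
  linarith

/-- The response to a step function is its convolution with `A T(s)`. -/
theorem dyResp_eq_integral {c : (ℕ × ℕ) →₀ X}
    (hS : ∀ q ∈ c.support, ∀ t, IntegrableOn (fun s => S s (c q)) (Ioc 0 t))
    (hI : ∀ q ∈ c.support, ∀ t, 0 < t → c q - T t (c q) = ∫ s in Ioc 0 t, S s (c q)) (t : ℝ) :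
    IntegrableOn (fun s => S s (dyStep c (t - s))) (Ioi 0) ∧
      dyResp (fun t => (T t : X →ₗ[ℂ] X)) c t = ∫ s in Ioi 0, S s (dyStep c (t - s)) := by
  have h1 := integrableOn_conv_dyStep (R := S) (a := 0) (c := c) (fun q hq α β =>
    (hS q hq β).mono_set fun s hs => ⟨hs.1, hs.2.2.le⟩) t
  refine ⟨h1.1, ?_⟩
  rw [h1.2, dyResp]
  refine Finsupp.sum_congr fun q hq => ?_
  have hstep : ∀ r, stepResp (fun t => (T t : X →ₗ[ℂ] X)) (c q) r = ∫ s in Ioc 0 r, S s (c q) := by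
    intro r
    rw [stepResp]
    split_ifs with hr
    · exact hI q hq r hr
    · rw [Ioc_eq_empty hr, Measure.restrict_empty, integral_zero_measure]
  have hle : t - (q.2 + 1) * dyMesh q.1 ≤ t - q.2 * dyMesh q.1 := by
    have := dyMesh_pos q.1
    nlinarith
  rw [hstep, hstep, ← setIntegral_sdiff measurableSet_Ioc (hS q hq _) (Ioc_subset_Ioc_right hle)]
  refine setIntegral_congr_set ?_
  have hset : Ioc 0 (t - q.2 * dyMesh q.1) \ Ioc 0 (t - (q.2 + 1) * dyMesh q.1) =
      Ioi 0 ∩ Ioc (t - (q.2 + 1) * dyMesh q.1) (t - q.2 * dyMesh q.1) := by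
    ext s
    simp only [Set.mem_sdiff, mem_Ioc, mem_inter_iff, mem_Ioi, not_and, not_le]
    exact ⟨fun h => ⟨h.1.1, h.2 h.1.1, h.1.2⟩, fun h => ⟨⟨h.1, h.2.2⟩, fun _ => h.2.1⟩⟩
  rw [hset]
  exact (ae_eq_refl (Ioi (0 : ℝ))).inter Ico_ae_eq_Ioc.symm

end IsAnalyticPair

variable {θ q : ℝ} (hθ : θ ∈ Ioo (0 : ℝ) 1) (hq : 1 ≤ q)
include hθ

/-- `K(s, x) = O(s^θ)` on `(X, D_A)_{θ,q}`. -/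
theorem exists_domK_le_rpow {x : X}
    (hx : ((domainCouple A hA).realNorm θ q hq).toFun x ≠ ∞) :
    ∃ B : ℝ, 0 ≤ B ∧ ∀ s, 0 < s → domK hA s x ≤ ENNReal.ofReal (B * s ^ θ) := by
  have hq0 : 0 < q := by linarith
  set b : ℝ≥0∞ := (2 * 2 ^ q * ((domainCouple A hA).realNorm θ q hq).toFun x ^ q) ^ q⁻¹ with hb
  have hbt : b ≠ ∞ := by
    rw [hb]
    have h2 : ((domainCouple A hA).realNorm θ q hq).toFun x ^ q ≠ ∞ :=
      ENNReal.rpow_ne_top_of_nonneg hq0.le hx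
    have h3 : (2 : ℝ≥0∞) ^ q ≠ ∞ := ENNReal.rpow_ne_top_of_nonneg hq0.le ENNReal.ofNat_ne_top
    exact ENNReal.rpow_ne_top_of_nonneg (by positivity) (by finiteness)
  have h1 : ∀ j : ℤ, dyWeight θ j * domK hA (2 ^ j) x ≤ b := fun j => by
    rw [hb, ENNReal.le_rpow_inv_iff hq0]
    exact (ENNReal.le_tsum (f := fun j : ℤ => (dyWeight θ j * domK hA (2 ^ j) x) ^ q) j).trans
      (tsum_le_realNorm_rpow hA hθ hq x)
  refine ⟨2 * b.toReal, by positivity, fun s hs => ?_⟩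
  obtain ⟨j, hj⟩ := exists_mem_Ico_zpow hs one_lt_two
  calc domK hA s x = ENNReal.ofReal (s ^ θ) * (ENNReal.ofReal (s ^ (-θ)) * domK hA s x) := by
        rw [← mul_assoc, ← ENNReal.ofReal_mul (by positivity), ← Real.rpow_add hs, add_neg_cancel,
          Real.rpow_zero, ENNReal.ofReal_one, one_mul]
    _ ≤ ENNReal.ofReal (s ^ θ) * (2 * dyWeight θ (j + 1) * domK hA (2 ^ (j + 1)) x) := by
        gcongr
        · exact (rpow_neg_le_dyWeight hθ.1.le hj).trans (dyWeight_le_two_mul hθ.2.le j)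
        · exact domK_mono hA x hj.2.le
    _ ≤ ENNReal.ofReal (s ^ θ) * (2 * b) := by
        rw [mul_assoc]
        gcongr
        exact h1 (j + 1)
    _ = _ := by
        rw [mul_comm, ENNReal.ofReal_mul (by positivity), ENNReal.ofReal_mul zero_le_two,
          ENNReal.ofReal_ofNat, ENNReal.ofReal_toReal hbt]

theorem tendsto_domK_zero {x : X} (hx : ((domainCouple A hA).realNorm θ q hq).toFun x ≠ ∞) :
    Tendsto (fun s => domK hA s x) (𝓝[>] 0) (𝓝 0) := by
  obtain ⟨B, hB, h⟩ := exists_domK_le_rpow hA hθ hq hx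
  have h1 : Tendsto (fun s : ℝ => ENNReal.ofReal (B * s ^ θ)) (𝓝[>] 0) (𝓝 0) := by
    have h2 : Tendsto (fun s : ℝ => B * s ^ θ) (𝓝[>] 0) (𝓝 (B * 0 ^ θ)) :=
      ((Real.continuousAt_rpow_const 0 θ (Or.inr hθ.1.le)).tendsto.const_mul B).mono_left
        nhdsWithin_le_nhds
    rw [Real.zero_rpow hθ.1.ne', mul_zero] at h2
    simpa using ENNReal.tendsto_ofReal h2
  refine tendsto_of_tendsto_of_tendsto_of_le_of_le' tendsto_const_nhds h1
    (.of_forall fun _ => zero_le) ?_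
  filter_upwards [self_mem_nhdsWithin] with s hs
  exact h s hs

theorem IsAnalyticPair.integrableOn_of_realNorm (hT : IsAnalyticPair A T S M) (hM : 0 ≤ M) {x : X}
    (hx : ((domainCouple A hA).realNorm θ q hq).toFun x ≠ ∞) (t : ℝ) :
    IntegrableOn (fun s => S s x) (Ioc 0 t) := by
  obtain ⟨B, hB, h⟩ := exists_domK_le_rpow hA hθ hq hx
  have h1 : IntegrableOn (fun s : ℝ => M * B * s ^ (θ - 1)) (Ioc 0 t) := by
    rcases le_total t 0 with ht | ht
    · simp [Ioc_eq_empty ht.not_gt]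
    · exact ((intervalIntegrable_iff_integrableOn_Ioc_of_le ht).1
        (intervalIntegral.intervalIntegrable_rpow' (by linarith [hθ.1]))).const_mul _
  refine h1.mono' (((hT.continuousOn x).mono Ioc_subset_Ioi_self).aestronglyMeasurable
    measurableSet_Ioc) (ae_restrict_of_forall_mem measurableSet_Ioc fun s hs => ?_)
  have hs0 : 0 < s := hs.1
  have h2 : ‖S s x‖ₑ ≤ ENNReal.ofReal (M * B * s ^ (θ - 1)) := by
    refine (hT.enorm_apply_le hA hM hs0 x).trans ?_
    refine (mul_le_mul_right (h s hs0) _).trans (le_of_eq ?_)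
    rw [← ENNReal.ofReal_mul (by positivity), Real.rpow_sub_one hs0.ne']
    congr 1
    ring
  rw [← ofReal_norm] at h2
  exact (ENNReal.ofReal_le_ofReal_iff (by positivity)).1 h2

end ResponseAsIntegral

/-! ### Maximal regularity in real interpolation spaces -/

section RealMaxReg

open Filter Topology

variable {X : Type u} [NormedAddCommGroup X] [NormedSpace ℂ X] [CompleteSpace X]
  {A : X →ₗ.[ℂ] X} (hA : A.IsClosed) {T S : ℝ → X →L[ℂ] X} {M : ℝ}

theorem winAvg_const_mul {w : ℝ≥0∞} (hw : w ≠ ∞) (h : ℝ) (φ : ℝ → ℝ≥0∞) (t : ℝ) :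
    winAvg h (fun u => w * φ u) t = w * winAvg h φ t := by
  rw [winAvg, lintegral_const_mul' _ _ hw, winAvg]
  ring

theorem ennreal_add_rpow_le_two_rpow_mul (x y : ℝ≥0∞) {r : ℝ} (hr : 0 ≤ r) :
    (x + y) ^ r ≤ 2 ^ r * (x ^ r + y ^ r) := by
  have h1 : x + y ≤ 2 * max x y := by
    rw [two_mul]
    exact add_le_add (le_max_left _ _) (le_max_right _ _)
  refine (ENNReal.rpow_le_rpow h1 hr).trans ?_
  rw [ENNReal.mul_rpow_of_nonneg _ _ hr]
  gcongr
  rcases le_total x y with h | h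
  · rw [max_eq_right h]; exact le_add_self
  · rw [max_eq_left h]; exact le_self_add

variable {θ q : ℝ}

/-- The discretized pointwise estimate for the response `g` to the step function `f`: the weighted
`K`-functional of `g(t)` is a discrete convolution of window averages of that of `f`. -/
theorem IsAnalyticPair.dyWeight_mul_domK_le (hT : IsAnalyticPair A T S M) (hM : 0 ≤ M) (hq : 1 ≤ q)
    {c : (ℕ × ℕ) →₀ X}
    (hc : ∀ k ∈ c.support, ((domainCouple A hA).realNorm θ q hq).toFun (c k) ≠ ∞)
    (hθ : θ ∈ Ioo (0 : ℝ) 1) (j : ℤ) (t : ℝ) :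
    dyWeight θ j * domK hA (2 ^ j) (dyResp (fun t => (T t : X →ₗ[ℂ] X)) c t) ≤
      ∑' i : ℤ, dyKernel θ (j - i) *
        (4 * ENNReal.ofReal (2 * M + 4 * M ^ 2) *
            winAvg (2 ^ i) (fun u => dyWeight θ i * domK hA (2 ^ i) (dyStep c u)) t +
          (Pi.single 0 ‖dyResp (fun t => (T t : X →ₗ[ℂ] X)) c t‖ₑ : ℤ → ℝ≥0∞) i) := by
  set g := dyResp (fun t => (T t : X →ₗ[ℂ] X)) c t with hg
  set κ := 4 * ENNReal.ofReal (2 * M + 4 * M ^ 2) with hκ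
  simp only [mul_add, ENNReal.tsum_add]
  have hsingle : ∑' i : ℤ, dyKernel θ (j - i) * (Pi.single 0 ‖g‖ₑ : ℤ → ℝ≥0∞) i =
      dyKernel θ j * ‖g‖ₑ := by
    rw [tsum_eq_single 0 fun i hi => by rw [Pi.single_eq_of_ne hi, mul_zero], sub_zero,
      Pi.single_eq_same]
  rw [hsingle]
  rcases le_total 0 j with hj | hj
  -- For `2^j ≥ 1` the `K`-functional is at most the norm of `X`, which is the term `i = 0`.
  · refine le_add_of_nonneg_of_le zero_le ?_
    have h1 : (1 : ℝ) ≤ 2 ^ j := one_le_zpow₀ one_le_two hj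
    rw [dyKernel, min_eq_left (by simpa using h1), mul_one]
    gcongr
    exact domK_le_enorm hA _ _
  · have h1 : (2 : ℝ) ^ j ≤ 1 := zpow_le_one_of_nonpos₀ one_le_two hj
    have hS : ∀ k ∈ c.support, ∀ t, IntegrableOn (fun s => S s (c k)) (Ioc 0 t) := fun k hk t =>
      hT.integrableOn_of_realNorm hA hθ hq hM (hc k hk) t
    have hI := hT.dyResp_eq_integral hS (fun k hk t ht =>
      hT.sub_apply_eq_integral hA hM ht (tendsto_domK_zero hA hθ hq (hc k hk)) (hS k hk t)) t
    have h2 := hT.domK_integral_le hA hM (F := fun s => dyStep c (t - s)) (r := 2 ^ j)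
      (by positivity) h1 hI.1
      (integrableOn_conv_dyStep (R := fun s => (S (2 ^ j / 2)).comp (S (s - 2 ^ j / 2)))
        (fun k _ α β => hT.integrableOn_comp hM (by positivity) (c k) α β) t).1
    rw [← hI.2, ← hg] at h2
    have h3 := lintegral_conv_domK_le hA (f := dyStep c) j t
    calc dyWeight θ j * domK hA (2 ^ j) g
        ≤ dyWeight θ j * (ENNReal.ofReal (2 ^ j) * ‖g‖ₑ + ENNReal.ofReal (2 * M + 4 * M ^ 2) *
          (4 * ∑' i : ℤ, min 1 (ENNReal.ofReal (2 ^ (j - i))) *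
            winAvg (2 ^ i) (fun u => domK hA (2 ^ i) (dyStep c u)) t)) := by
          gcongr
          exact h2.trans (by gcongr)
      _ = ∑' i : ℤ, dyWeight θ j * (κ * (min 1 (ENNReal.ofReal (2 ^ (j - i))) *
            winAvg (2 ^ i) (fun u => domK hA (2 ^ i) (dyStep c u)) t)) + dyKernel θ j * ‖g‖ₑ := by
          rw [ENNReal.tsum_mul_left, ENNReal.tsum_mul_left, dyKernel, min_eq_right (by simpa using h1),
            hκ]
          ring
      _ = _ := by
          congr 1
          refine tsum_congr fun i => ?_
          rw [winAvg_const_mul (dyWeight_ne_top θ i), dyKernel,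
            show dyWeight θ j = dyWeight θ (j - i) * dyWeight θ i by
              rw [← dyWeight_add, sub_add_cancel]]
          ring

/-- The real interpolation norm of the response, by Young's inequality for the discrete
convolution. -/
theorem IsAnalyticPair.exists_realNorm_dyResp_rpow_le (hT : IsAnalyticPair A T S M) (hM : 0 ≤ M)
    (hθ : θ ∈ Ioo (0 : ℝ) 1) (hq : 1 < q) {p : ℝ} (hp : 0 < p) :
    ∃ κ : ℝ≥0∞, κ ≠ ∞ ∧ ∀ c : (ℕ × ℕ) →₀ X,
      (∀ k ∈ c.support, ((domainCouple A hA).realNorm θ q hq.le).toFun (c k) ≠ ∞) → ∀ t : ℝ,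
      ((domainCouple A hA).realNorm θ q hq.le).toFun (dyResp (fun t => (T t : X →ₗ[ℂ] X)) c t) ^ p ≤
        κ * ((∑' i : ℤ, winAvg (2 ^ i)
            (fun u => dyWeight θ i * domK hA (2 ^ i) (dyStep c u)) t ^ q) ^ (p / q) +
          ‖dyResp (fun t => (T t : X →ₗ[ℂ] X)) c t‖ₑ ^ p) := by
  have hq0 : 0 < q := by linarith
  have hpq : 0 < p / q := by positivity
  set m := ∑' l, dyKernel θ l with hm
  have hmt : m ≠ ∞ := tsum_dyKernel_ne_top hθ
  set C : ℝ≥0∞ := 1 + 4 * ENNReal.ofReal (2 * M + 4 * M ^ 2) with hC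
  have hCt : C ≠ ∞ := by finiteness
  set D : ℝ≥0∞ := 2 ^ q * (m ^ q * (2 ^ q * C ^ q)) with hD
  have hDt : D ≠ ∞ := by
    have h2 : (2 : ℝ≥0∞) ^ q ≠ ∞ := ENNReal.rpow_ne_top_of_nonneg hq0.le ENNReal.ofNat_ne_top
    have h3 : m ^ q ≠ ∞ := ENNReal.rpow_ne_top_of_nonneg hq0.le hmt
    have h4 : C ^ q ≠ ∞ := ENNReal.rpow_ne_top_of_nonneg hq0.le hCt
    finiteness
  refine ⟨D ^ (p / q) * 2 ^ (p / q), ENNReal.mul_ne_top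
    (ENNReal.rpow_ne_top_of_nonneg hpq.le hDt)
    (ENNReal.rpow_ne_top_of_nonneg hpq.le ENNReal.ofNat_ne_top), fun c hc t => ?_⟩
  set g := dyResp (fun t => (T t : X →ₗ[ℂ] X)) c t with hg
  set W : ℤ → ℝ≥0∞ := fun i => winAvg (2 ^ i)
    (fun u => dyWeight θ i * domK hA (2 ^ i) (dyStep c u)) t with hW
  set N := ((domainCouple A hA).realNorm θ q hq.le).toFun g with hN
  set b : ℤ → ℝ≥0∞ := fun i => 4 * ENNReal.ofReal (2 * M + 4 * M ^ 2) * W i +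
    (Pi.single 0 ‖g‖ₑ : ℤ → ℝ≥0∞) i with hb
  have hbq : ∀ i, b i ^ q ≤ 2 ^ q * C ^ q * (W i ^ q + (Pi.single 0 (‖g‖ₑ ^ q) : ℤ → ℝ≥0∞) i) := by
    intro i
    have h1 : b i ≤ C * (W i + (Pi.single 0 ‖g‖ₑ : ℤ → ℝ≥0∞) i) := by
      rw [hb, hC, mul_add]
      refine add_le_add (mul_le_mul_left le_add_self _) ?_
      rw [add_mul, one_mul]
      exact le_self_add
    have h2 : (Pi.single 0 ‖g‖ₑ : ℤ → ℝ≥0∞) i ^ q = (Pi.single 0 (‖g‖ₑ ^ q) : ℤ → ℝ≥0∞) i := by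
      rcases eq_or_ne i 0 with rfl | hi
      · simp
      · rw [Pi.single_eq_of_ne hi, Pi.single_eq_of_ne hi, ENNReal.zero_rpow_of_pos hq0]
    refine (ENNReal.rpow_le_rpow h1 hq0.le).trans ?_
    rw [ENNReal.mul_rpow_of_nonneg _ _ hq0.le, ← h2, mul_comm (2 ^ q) (C ^ q), mul_assoc]
    gcongr
    exact ennreal_add_rpow_le_two_rpow_mul _ _ hq0.le
  have hNq : N ^ q ≤ D * (∑' i, W i ^ q + ‖g‖ₑ ^ q) := by
    calc N ^ q ≤ 2 ^ q * ∑' j : ℤ, (dyWeight θ j * domK hA (2 ^ j) g) ^ q :=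
          realNorm_rpow_le hA hθ hq.le g
      _ ≤ 2 ^ q * ∑' j : ℤ, (∑' i, dyKernel θ (j - i) * b i) ^ q := by
          refine mul_le_mul_right (ENNReal.tsum_le_tsum fun j =>
            ENNReal.rpow_le_rpow ?_ hq0.le) _
          exact hT.dyWeight_mul_domK_le hA hM hq.le hc hθ j t
      _ ≤ 2 ^ q * (m ^ q * ∑' i, b i ^ q) := by
          gcongr
          exact tsum_convolution_rpow_le (dyKernel θ) b hq
      _ ≤ 2 ^ q * (m ^ q * ∑' i, 2 ^ q * C ^ q *
            (W i ^ q + (Pi.single 0 (‖g‖ₑ ^ q) : ℤ → ℝ≥0∞) i)) :=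
          mul_le_mul_right (mul_le_mul_right (ENNReal.tsum_le_tsum hbq) _) _
      _ = _ := by
          rw [ENNReal.tsum_mul_left, ENNReal.tsum_add, tsum_pi_single, hD]
          ring
  calc N ^ p = (N ^ q) ^ (p / q) := by rw [← ENNReal.rpow_mul, mul_div_cancel₀ _ hq0.ne']
    _ ≤ (D * (∑' i, W i ^ q + ‖g‖ₑ ^ q)) ^ (p / q) := ENNReal.rpow_le_rpow hNq hpq.le
    _ ≤ D ^ (p / q) * (2 ^ (p / q) * ((∑' i, W i ^ q) ^ (p / q) + (‖g‖ₑ ^ q) ^ (p / q))) := by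
        rw [ENNReal.mul_rpow_of_nonneg _ _ hpq.le]
        gcongr
        exact ennreal_add_rpow_le_two_rpow_mul _ _ hpq.le
    _ = _ := by
        rw [← ENNReal.rpow_mul ‖g‖ₑ, mul_div_cancel₀ _ hq0.ne', mul_assoc]

theorem dyStep_of_nonpos {E : Type*} [NormedAddCommGroup E] (c : (ℕ × ℕ) →₀ E) {t : ℝ}
    (ht : t ≤ 0) : dyStep c t = 0 := by
  rw [dyStep]
  refine Finset.sum_eq_zero fun q _ => indicator_of_notMem (fun h => ?_) _
  have h1 : (0 : ℝ) ≤ q.2 * dyMesh q.1 := mul_nonneg (Nat.cast_nonneg _) (dyMesh_pos _).le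
  linarith [h.1]

end RealMaxReg

section RealMaxReg

open Filter Topology

variable {X : Type u} [NormedAddCommGroup X] [NormedSpace ℂ X] [CompleteSpace X]
  {A : X →ₗ.[ℂ] X} {p : ℝ≥0∞} [Fact (1 ≤ p)]

theorem eLpNorm_le_of_lintegral_rpow_le {α E F : Type*} [MeasurableSpace α] {μ : Measure α}
    [NormedAddCommGroup E] [NormedAddCommGroup F] {f : α → E} {g : α → F} {p : ℝ≥0∞}
    (hp0 : p ≠ 0) (hp : p ≠ ∞) {κ : ℝ≥0∞} (hκ : κ ≠ ∞)
    (h : ∫⁻ t, ‖f t‖ₑ ^ p.toReal ∂μ ≤ κ * ∫⁻ t, ‖g t‖ₑ ^ p.toReal ∂μ) :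
    eLpNorm f p μ ≤ ENNReal.ofReal (κ ^ (1 / p.toReal)).toReal * eLpNorm g p μ := by
  rw [eLpNorm_eq_lintegral_rpow_enorm_toReal hp0 hp, eLpNorm_eq_lintegral_rpow_enorm_toReal hp0 hp,
    ENNReal.ofReal_toReal (ENNReal.rpow_ne_top_of_nonneg (by positivity) hκ),
    ← ENNReal.mul_rpow_of_nonneg _ _ (by positivity)]
  exact ENNReal.rpow_le_rpow h (by positivity)

/-- The `L^p` estimate of the responses in `(X, D_A)_{θ,q}`. -/
theorem HasLpMaxReg.exists_lintegral_realNorm_dyResp_le (hA : HasLpMaxReg A p ∞) (hp1 : 1 < p)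
    (hp : p ≠ ∞) {T S : ℝ → X →L[ℂ] X} {M : ℝ} (hM : 0 ≤ M) (hT : IsAnalyticPair A T S M) {θ q : ℝ}
    (hθ : θ ∈ Ioo (0 : ℝ) 1) (hq : 1 < q) :
    ∃ κ : ℝ≥0∞, κ ≠ ∞ ∧ ∀ d : (ℕ × ℕ) →₀ X,
      (∀ k ∈ d.support, ((domainCouple A hA.1).realNorm θ q hq.le).toFun (d k) ≠ ∞) →
      ∫⁻ t in Ioi 0, ((domainCouple A hA.1).realNorm θ q hq.le).toFun
          (dyResp (fun t => (T t : X →ₗ[ℂ] X)) d t) ^ p.toReal ≤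
        κ * ∫⁻ t in Ioi 0, ((domainCouple A hA.1).realNorm θ q hq.le).toFun
          (dyStep d t) ^ p.toReal := by
  have hq0 : 0 < q := by linarith
  have hr1 : 1 < p.toReal := by
    rw [← ENNReal.toReal_one]
    exact (ENNReal.toReal_lt_toReal ENNReal.one_ne_top hp).2 hp1
  have hp0 : p ≠ 0 := (zero_lt_one.trans hp1).ne'
  set r := p.toReal with hr
  have hr0 : 0 < r := by linarith
  have hrq : 0 < r / q := by positivity
  obtain ⟨k, hk, hK⟩ : ∃ k : ℝ≥0∞, k ≠ ∞ ∧ ∀ d : (ℕ × ℕ) →₀ X,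
      eLpNorm (dyResp (fun t => (T t : X →ₗ[ℂ] X)) d) p (volume.restrict (Ioi 0)) ≤
        k * eLpNorm (dyStep d) p (volume.restrict (Ioi 0)) := by
    obtain ⟨K, hK⟩ := hA.exists_extendsResp_top hT
    refine ⟨ENNReal.ofReal ‖K‖, ENNReal.ofReal_ne_top, fun d => ?_⟩
    have h := hK.eLpNorm_le hp d
    generalize ENNReal.ofReal ‖K‖ = a at h ⊢
    rwa [timeMeasure_top] at h
  obtain ⟨κ₀, hκ₀, hwin⟩ := exists_tsum_winAvg_bound hr1 hq
  obtain ⟨κ₁, hκ₁, hpt⟩ := hT.exists_realNorm_dyResp_rpow_le hA.1 hM hθ hq hr0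
  have h2 : (2 * 2 ^ q : ℝ≥0∞) ^ (r / q) ≠ ∞ := by
    have : (2 : ℝ≥0∞) ^ q ≠ ∞ := ENNReal.rpow_ne_top_of_nonneg hq0.le ENNReal.ofNat_ne_top
    exact ENNReal.rpow_ne_top_of_nonneg hrq.le (by finiteness)
  have h4 : (4 : ℝ≥0∞) ^ r ≠ ∞ := ENNReal.rpow_ne_top_of_nonneg hr0.le ENNReal.ofNat_ne_top
  refine ⟨κ₁ * (κ₀ * (2 * 2 ^ q) ^ (r / q) + k ^ r * 4 ^ r), ?_, fun d hd => ?_⟩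
  · have h3 : k ^ r ≠ ∞ := ENNReal.rpow_ne_top_of_nonneg hr0.le hk
    finiteness
  set N := ((domainCouple A hA.1).realNorm θ q hq.le).toFun with hN
  set φ : ℤ → ℝ → ℝ≥0∞ := fun i u => dyWeight θ i * domK hA.1 (2 ^ i) (dyStep d u) with hφ
  have hφm : ∀ i, Measurable (φ i) := fun i =>
    ((continuous_domK hA.1 (2 ^ i)).comp_stronglyMeasurable
      (stronglyMeasurable_dyStep d)).measurable.const_mul _
  have hWm : Measurable fun t => (∑' i : ℤ, winAvg (2 ^ i) (φ i) t ^ q) ^ (r / q) :=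
    (Measurable.tsum fun i => (measurable_winAvg (hφm i)).pow_const q).pow_const _
  have hnorm : ∀ u, (∑' i, φ i u ^ q) ^ (r / q) ≤ (2 * 2 ^ q) ^ (r / q) * N (dyStep d u) ^ r := by
    intro u
    refine (ENNReal.rpow_le_rpow (tsum_le_realNorm_rpow hA.1 hθ hq.le _) hrq.le).trans
      (le_of_eq ?_)
    rw [ENNReal.mul_rpow_of_nonneg _ _ hrq.le, ← ENNReal.rpow_mul, mul_div_cancel₀ _ hq0.ne']
  have hwhole : ∫⁻ u, N (dyStep d u) ^ r = ∫⁻ u in Ioi 0, N (dyStep d u) ^ r := by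
    rw [← lintegral_indicator measurableSet_Ioi]
    refine lintegral_congr fun u => ?_
    by_cases hu : u ∈ Ioi (0 : ℝ)
    · rw [indicator_of_mem hu]
    · rw [indicator_of_notMem hu, dyStep_of_nonpos d (not_lt.1 hu), hN, ExtNorm.map_zero,
        ENNReal.zero_rpow_of_pos hr0]
  have hW : ∫⁻ t in Ioi 0, (∑' i : ℤ, winAvg (2 ^ i) (φ i) t ^ q) ^ (r / q) ≤
      κ₀ * (2 * 2 ^ q) ^ (r / q) * ∫⁻ t in Ioi 0, N (dyStep d t) ^ r := by
    refine (setLIntegral_le_lintegral _ _).trans ((hwin φ hφm).trans ?_)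
    rw [mul_assoc, ← hwhole, ← lintegral_const_mul' _ _ h2]
    gcongr with u
    exact hnorm u
  have hG : ∫⁻ t in Ioi 0, ‖dyResp (fun t => (T t : X →ₗ[ℂ] X)) d t‖ₑ ^ r ≤
      k ^ r * 4 ^ r * ∫⁻ t in Ioi 0, N (dyStep d t) ^ r := by
    have h1 := hK d
    rw [eLpNorm_eq_lintegral_rpow_enorm_toReal hp0 hp,
      eLpNorm_eq_lintegral_rpow_enorm_toReal hp0 hp, ← ENNReal.rpow_le_rpow_iff hr0,
      ENNReal.mul_rpow_of_nonneg _ _ hr0.le, ← ENNReal.rpow_mul, ← ENNReal.rpow_mul, ← hr,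
      one_div_mul_cancel hr0.ne', ENNReal.rpow_one, ENNReal.rpow_one] at h1
    refine h1.trans ?_
    rw [mul_assoc, ← lintegral_const_mul' (4 ^ r) _ h4]
    gcongr with t
    rw [← ENNReal.mul_rpow_of_nonneg _ _ hr0.le]
    exact ENNReal.rpow_le_rpow (enorm_le_realNorm hA.1 hθ hq.le _) hr0.le
  calc ∫⁻ t in Ioi 0, N (dyResp (fun t => (T t : X →ₗ[ℂ] X)) d t) ^ r
      ≤ ∫⁻ t in Ioi 0, κ₁ * ((∑' i : ℤ, winAvg (2 ^ i) (φ i) t ^ q) ^ (r / q) +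
          ‖dyResp (fun t => (T t : X →ₗ[ℂ] X)) d t‖ₑ ^ r) := lintegral_mono fun t => hpt d hd t
    _ = κ₁ * ((∫⁻ t in Ioi 0, (∑' i : ℤ, winAvg (2 ^ i) (φ i) t ^ q) ^ (r / q)) +
          ∫⁻ t in Ioi 0, ‖dyResp (fun t => (T t : X →ₗ[ℂ] X)) d t‖ₑ ^ r) := by
        rw [lintegral_const_mul' _ _ hκ₁, lintegral_add_left hWm]
    _ ≤ κ₁ * (κ₀ * (2 * 2 ^ q) ^ (r / q) * (∫⁻ t in Ioi 0, N (dyStep d t) ^ r) +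
          k ^ r * 4 ^ r * ∫⁻ t in Ioi 0, N (dyStep d t) ^ r) := by gcongr
    _ = _ := by ring

theorem IsAnalyticPair.realNorm_apply_le {T S : ℝ → X →L[ℂ] X} {M : ℝ}
    (hT : IsAnalyticPair A T S M) (hA : A.IsClosed) {θ q : ℝ} (hq : 1 ≤ q) {t : ℝ} (ht : 0 < t)
    (x : X) : ((domainCouple A hA).realNorm θ q hq).toFun (T t x) ≤
      ENNReal.ofReal M * ((domainCouple A hA).realNorm θ q hq).toFun x := by
  have hq0 : 0 < q := by linarith
  rw [← ENNReal.rpow_le_rpow_iff hq0, ENNReal.mul_rpow_of_nonneg _ _ hq0.le,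
    realNorm_rpow, realNorm_rpow, ← lintegral_const_mul' _ _
      (ENNReal.rpow_ne_top_of_nonneg hq0.le ENNReal.ofReal_ne_top)]
  refine lintegral_mono fun s => ?_
  rw [← ENNReal.mul_rpow_of_nonneg _ _ hq0.le]
  refine ENNReal.rpow_le_rpow ?_ hq0.le
  rw [mul_left_comm]
  gcongr
  exact domK_map_le hA (fun x => (T t).le_of_opNorm_le (hT.bound t ht) x)
    (L' := fun d => hT.toDom t (domFst A d)) (fun d => hT.norm_toDom_domFst_le ht d)
    (fun d => hT.domFst_toDom ht _) s x

/-- Maximal regularity passes to the part of `A` in a space `E` between `D_A` and `X`, normed by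
the extended norm `N` of `X`, provided that `N` is compatible with the semigroup and with the
responses. -/
theorem HasLpMaxReg.part_of_extNorm (hA : HasLpMaxReg A p ∞) (hp : p ≠ ∞) {T S : ℝ → X →L[ℂ] X}
    {M : ℝ} (hM : 0 ≤ M) (hT : IsAnalyticPair A T S M) {E : Type u} [NormedAddCommGroup E]
    [NormedSpace ℂ E] [CompleteSpace E] {ι : E →L[ℂ] X} (hι : Function.Injective ι)
    (j : graphSpace A →L[ℂ] E) (hj : ∀ d, ι (j d) = domFst A d) {N : X → ℝ≥0∞}
    (hN : ∀ x, ‖x‖ₑ = N (ι x))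
    (hTN : ∀ t, 0 < t → ∀ x, N (T t x) ≤ ENNReal.ofReal M * N x) {κ : ℝ≥0∞} (hκ : κ ≠ ∞)
    (h : ∀ d : (ℕ × ℕ) →₀ X, (∀ k ∈ d.support, N (d k) ≠ ∞) →
      ∫⁻ t in Ioi 0, N (dyResp (fun t => (T t : X →ₗ[ℂ] X)) d t) ^ p.toReal ≤
        κ * ∫⁻ t in Ioi 0, N (dyStep d t) ^ p.toReal) :
    HasLpMaxReg (MaxReg.part A (ι : E →ₗ[ℂ] X)) p ∞ := by
  have hbound : ∀ t, 0 < t → ∀ x, ‖j (hT.toDom t (ι x))‖ ≤ M * ‖x‖ := by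
    intro t ht x
    have h1 : ‖j (hT.toDom t (ι x))‖ₑ ≤ ENNReal.ofReal M * ‖x‖ₑ := by
      rw [hN, hN, hj, hT.domFst_toDom ht]
      exact hTN t ht _
    have h2 := ENNReal.toReal_mono (by finiteness) h1
    rwa [ENNReal.toReal_mul, toReal_enorm, toReal_enorm, ENNReal.toReal_ofReal hM] at h2
  refine hasLpMaxReg_of_bound hp (isClosed_part hA.1 hι) ((hA.strongUnique ∞).part hι)
    (hT.solFamily hι j hj hbound) (κ := (κ ^ (1 / p.toReal)).toReal) fun c => ?_
  have hp1 : (1 : ℝ≥0∞) ≤ p := Fact.out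
  rw [timeMeasure_top]
  refine eLpNorm_le_of_lintegral_rpow_le (zero_lt_one.trans_le hp1).ne' hp hκ ?_
  have h1 := h (c.mapRange ι (map_zero ι)) fun k _ => by
    rw [Finsupp.mapRange_apply, ← hN]
    exact enorm_ne_top
  have h2 : ∀ t, dyResp (fun t => (T t : X →ₗ[ℂ] X)) (c.mapRange ι (map_zero ι)) t =
      ι (dyResp (fun t => ((j.comp (hT.toDom t)).comp ι : E →ₗ[ℂ] E)) c t) :=
    map_dyResp ι (fun t ht x => (hj _).trans (hT.domFst_toDom ht _)) c
  simp only [map_dyStep, h2, ← hN] at h1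
  exact h1

/-- Maximal regularity on `(0,∞)` passes to the part of `A` in `(X, D_A)_{θ,q}`. -/
theorem HasLpMaxReg.part_real (hA : HasLpMaxReg A p ∞) (hp1 : 1 < p) (hp : p ≠ ∞) {θ q : ℝ}
    (hθ : θ ∈ Ioo (0 : ℝ) 1) (hq : 1 < q) :
    HasLpMaxReg (MaxReg.part A ((domainCouple A hA.1).realNorm θ q hq.le).incl) p ∞ := by
  have hE := completeSpace_realSpace hA.1 hθ hq.le
  obtain ⟨j, hj⟩ := exists_domToReal hA.1 hθ hq.le hq
  obtain ⟨T, S, M, hM, hT⟩ := hA.exists_analyticPair hp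
  obtain ⟨κ, hκ, h⟩ := hA.exists_lintegral_realNorm_dyResp_le hp1 hp hM hT hθ hq
  have key := hA.part_of_extNorm (N := ((domainCouple A hA.1).realNorm θ q hq.le).toFun) hp hM hT
    (realIncl_injective hA.1 hθ hq.le) j hj (enorm_eq_realNorm hA.1 hθ hq.le)
    (fun t ht x => hT.realNorm_apply_le hA.1 hq.le ht x) hκ h
  exact key

end RealMaxReg

end MaxReg

end

open MaxReg in
theorem theorem4p2 (p : ℝ≥0∞) [Fact (1 ≤ p)] (hp : p ≠ ∞) :
    (∀ (C : BanachCouple.{u}) (A₀ : C.X₀ →ₗ.[ℂ] C.X₀) (A₁ : C.X₁ →ₗ.[ℂ] C.X₁)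
        (T₀ : ℝ → C.X₀ →L[ℂ] C.X₀) (T₁ : ℝ → C.X₁ →L[ℂ] C.X₁),
      IsNegGenerator A₀ T₀ → IsBoundedHolomorphic T₀ →
      IsNegGenerator A₁ T₁ → IsBoundedHolomorphic T₁ →
      (∀ (a : C.X₀) (b : C.X₁), C.ι₀ a = C.ι₁ b →
        ∀ t : ℝ, 0 < t → C.ι₀ (T₀ t a) = C.ι₁ (T₁ t b)) →
      C.ConsistentOps A₀ A₁ →
      ∀ τ : ℝ≥0∞, 0 < τ → HasLpMaxReg A₀ p τ → HasLpMaxReg A₁ p τ →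
      ∀ F : InterpolationFunctor.{u}, F.SplitsLp p C →
        HasLpMaxReg (part (C.sumOp A₀ A₁) (F.inclZ C)) p τ) ∧
    (∀ (X : Type u) [NormedAddCommGroup X] [NormedSpace ℂ X] [CompleteSpace X]
        (A : X →ₗ.[ℂ] X) (hA : A.IsClosed), HasLpMaxReg A p ∞ →
      (∀ F : InterpolationFunctor.{u}, F.SplitsLp p (domainCouple A hA) →
        HasLpMaxReg (part A (F.inclZ (domainCouple A hA))) p ∞) ∧
      (∀ (θ : ℝ) (hθ : θ ∈ Ioo (0 : ℝ) 1),
        HasLpMaxReg (part A ((domainCouple A hA).complexNorm θ hθ).incl) p ∞) ∧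
      (1 < p → ∀ θ ∈ Ioo (0 : ℝ) 1, ∀ (q : ℝ) (hq : 1 < q),
        HasLpMaxReg (part A ((domainCouple A hA).realNorm θ q hq.le).incl) p ∞)) := by
  exact ⟨fun C A₀ A₁ T₀ T₁ g₀ b₀ g₁ b₁ hT hA τ _ m₀ m₁ F hF =>
    hasLpMaxReg_part_sumOp hp g₀ b₀ g₁ b₁ hT hA m₀ m₁ hF, fun X _ _ _ A hA hm =>
    ⟨fun F hF => hm.part_functor hp hF, fun θ hθ => hm.part_complex hp hθ, fun hp1 θ hθ q hq =>
      hm.part_real hp1 hp hθ hq⟩⟩
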